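/- Let $n$ be a positive integer. The affine symmetric group $\widetilde{S}_n$ consists of the bijections $w:\mathbb{Z}\to\mathbb{Z}$ with $w(x+n)=w(x)+n$ for all $x$ and $\sum_{i=1}^n w(i)=\binom{n+1}{2}$. For $n\ge 2$ and $i\in\mathbb{Z}/n$, the simple transposition $s_i$ exchanges $x$ and $x+1$ for all $x\equiv i \pmod n$ and fixes all other integers (for $n=1$ the group is trivial and there are no generators). A reduced word of $w$ is a word $i_1\cdots i_\ell$ over $\mathbb{Z}/n$ of minimal length with $s_{i_1}\cdots s_{i_\ell}=w$. Two reduced words of $w$ are commutation equivalent if they differ by a sequence of exchanges of adjacent letters $i,j$ with $j\not\equiv i,\,i\pm1$. The directed braid graph $\mathcal{G}(w)$ has the commutation classes of reduced words of $w$ as vertices, with an edge $c\to d$ if some $a\in c$ and $b\in d$ differ by replacing consecutive letters $i(i+1)i$ of $a$ by $(i+1)i(i+1)$. For $k\ge 2$ let $\binom{\mathbb{Z}}{k}_n$ be the set of classes $[x_1,\dots,x_k]$, $x_1<\dots<x_k$, of $k$-subsets of $\mathbb{Z}$ with elements pairwise distinct modulo $n$, up to simultaneous translation by multiples of $n$.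 For $X=[x_1,\dots,x_{k+1}]$ let $X_i\in\binom{\mathbb{Z}}{k}_n$ be obtained by deleting $x_i$. The packet of $X$ is $P(X)=\{X_1,\dots,X_{k+1}\}$; its lex order is $(X_{k+1},\dots,X_1)$ and its antilex order is $(X_1,\dots,X_{k+1})$. A prefix of $P(X)$ is a (possibly empty) subset $\{X_{k+1},X_k,\dots,X_{m+1}\}$, and a suffix is a (possibly empty) subset $\{X_m,\dots,X_1\}$. Put $$\mathrm{Inv}_k(w)=\Bigl\{[x_1,\dots,x_k]\in\tbinom{\mathbb{Z}}{k}_n : w^{-1}(x_1)>\dots>w^{-1}(x_k)\Bigr\}.$$ A $(k+1)$-quasi-inversion is an $X\in\binom{\mathbb{Z}}{k+1}_n$ for which all but exactly one of the pairs $[x_i,x_j]$, $i<j$, are in $\mathrm{Inv}_2(w)$. The permanent poset $\mathcal{P}_w(n,k)$ is $\mathrm{Inv}_k(w)$ with the reflexive transitive closure of the following relations between its elements: (1) if $X$ is a $(k+1)$-quasi-inversion with $P(X)\cap\mathrm{Inv}_k(w)=\{X_i,X_{i+1}\}$, then $X_i<X_{i+1}$ if $k-i$ is odd and $X_{i+1}<X_i$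 if $k-i$ is even; (2) for $0\le i<k$ and $v_i=(0,\dots,0,n,\dots,n)$ with $i$ entries $0$ and $k-i$ entries $n$, $X\le X+v_i$ if $k-i$ is odd and $X+v_i\le X$ if $k-i$ is even. The set $\mathcal{A}_w(n,k)$ of $k$-admissible orders consists of the total orders $\rho$ of $\mathrm{Inv}_k(w)$ that are linear extensions of $\mathcal{P}_w(n,k)$ and restrict to the lex or the antilex order on $P(X)$ for every $X\in\mathrm{Inv}_{k+1}(w)$. The reversal set $\mathrm{Rev}(\rho)$ is the set of the $X\in\mathrm{Inv}_{k+1}(w)$ such that $\rho$ restricts to the antilex order on $P(X)$. Commutation equivalence $\sim_w$ of total orders of $\mathrm{Inv}_k(w)$ is generated by the exchange of two adjacent elements that are incomparable in $\mathcal{P}_w(n,k)$ and do not lie in a common packet. A lex-to-antilex packet flip replaces a consecutive block of a total order that is the lex order of $P(X)$, where $X\in\mathrm{Inv}_{k+1}(w)$, by the antilex order. On $\mathcal{B}_w(n,k)=\mathcal{A}_w(n,k)/{\sim_w}$ one has $[\rho]\le[\sigma]$ if $\sigma$ can be obtained from $\rho$ by a sequence of commutations and lex-to-antilex packet flips. The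 poset $\mathcal{C}_w(n,k)$ consists of the consistent subsets of $\mathrm{Inv}_k(w)$, that is, the lower order ideals $R$ of $\mathcal{P}_w(n,k)$ such that $P(X)\cap R$ is a prefix or a suffix of $P(X)$ for all $X\in\mathrm{Inv}_{k+1}(w)$; its partial order is generated by the inclusions $R\subset S$ with $|S\setminus R|=1$. The reflection order of a reduced word $i_1\cdots i_\ell$ of $w$ is the sequence $\rho_1,\dots,\rho_\ell$ with $\rho_j=[w^{(j)}(i_j),w^{(j)}(i_j+1)]$ and $w^{(j)}=s_{i_1}\cdots s_{i_{j-1}}$. The reflection orders of $w$ are those of its reduced words. **Theorem.** For every positive integer $n$ and every $w\in\widetilde{S}_n$ the following hold. (a) There are bijections between the maximal chains of $\mathcal{C}_w(n,2)$, the reduced words of $w$, the reflection orders of $w$, and $\mathcal{A}_w(n,2)$. They are the natural ones: a reduced word corresponds to its reflection order, a reflection order is itself the corresponding element of $\mathcal{A}_w(n,2)$, and the maximal chain corresponding to $(\rho_1,\dots,\rho_\ell)\in\mathcal{A}_w(n,2)$ is $\emptyset\subset\{\rho_1\}\subset\{\rho_1,\rho_2\}\subset\dots\subset\{\rho_1,\dots,\rho_\ell\}$.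 (b) The relation $\le$ on $\mathcal{B}_w(n,2)$ is a partial order, and $[\rho]\mapsto\mathrm{Rev}(\rho)$ is a poset isomorphism $\mathcal{B}_w(n,2)\cong\mathcal{C}_w(n,3)$. This poset is ranked, the rank of an element being the cardinality of its reversal set. It has a unique minimal element and a unique maximal element, which are a minimum and a maximum, with reversal sets $\emptyset$ and $\mathrm{Inv}_3(w)$ respectively. (c) The Hasse diagram of $\mathcal{B}_w(n,2)$, with edges directed upwards, is isomorphic to $\mathcal{G}(w)$ as a directed graph, by the map induced by the bijection of (a) between $\mathcal{A}_w(n,2)$ and the reduced words of $w$. Moreover $\mathrm{Inv}_3(w)$ is finite, and the diameter of $\mathcal{G}(w)$ as an undirected graph equals $|\mathrm{Inv}_3(w)|$. -/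

import Mathlib

namespace AffineBruhat

/-! ### Affine permutations and words -/

/-- `w` is an element of the affine symmetric group on `n` letters: a bijection of `ℤ` with
`w (x + n) = w x + n` for all `x` and `w 1 + ⋯ + w n = 1 + ⋯ + n`. The group operation is the
composition of permutations of `ℤ`. -/
structure IsAffinePerm (n : ℕ) (w : Equiv.Perm ℤ) : Prop where
  periodic : ∀ x : ℤ, w (x + n) = w x + n
  sum_window : ∑ i ∈ Finset.Icc 1 n, w (i : ℤ) = ((n + 1).choose 2 : ℤ)

/-- The function underlying the simple transposition `s_i`, for a residue `i` modulo `n`. For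
`n = 1` the affine symmetric group is trivial and has no simple transposition; there the function
is the identity, which never occurs in a reduced word. -/
def simpleFun (n : ℕ) (i : ZMod n) (x : ℤ) : ℤ :=
  if n = 1 then x
  else if (x : ZMod n) = i then x + 1
  else if (x : ZMod n) = i + 1 then x - 1
  else x

theorem simpleFun_involutive (n : ℕ) (i : ZMod n) : Function.Involutive (simpleFun n i) := by
  intro x
  by_cases hn : n = 1
  · simp [simpleFun, hn]
  · have h1 : (1 : ZMod n) ≠ 0 := by
      have : Nontrivial (ZMod n) := ZMod.nontrivial_iff.mpr hn
      exact one_ne_zero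
    by_cases hx : (x : ZMod n) = i
    · simp [simpleFun, hn, hx, h1]
    · by_cases hy : (x : ZMod n) = i + 1
      · simp [simpleFun, hn, hy, h1]
      · simp [simpleFun, hn, hx, hy]

/-- The simple transposition `s_i`: it exchanges `x` and `x + 1` for all `x ≡ i` modulo `n` and
fixes all other integers. -/
def simpleTransposition (n : ℕ) (i : ZMod n) : Equiv.Perm ℤ :=
  (simpleFun_involutive n i).toPerm

/-- The product `s_{i_1} ⋯ s_{i_l}` of a word `i_1 ⋯ i_l`. -/
def wordProd (n : ℕ) (l : List (ZMod n)) : Equiv.Perm ℤ :=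
  (l.map (simpleTransposition n)).prod

/-- `l` is a reduced word for `w`: its product is `w`, and no shorter word has this product. -/
def IsReducedWord (n : ℕ) (w : Equiv.Perm ℤ) (l : List (ZMod n)) : Prop :=
  wordProd n l = w ∧ ∀ l' : List (ZMod n), wordProd n l' = w → l.length ≤ l'.length

/-- The set of reduced words for `w`. -/
def ReducedWord (n : ℕ) (w : Equiv.Perm ℤ) : Type :=
  {l : List (ZMod n) // IsReducedWord n w l}

/-- A commutation: `⋯ i j ⋯` becomes `⋯ j i ⋯` where `j` is none of `i`, `i + 1`, `i - 1`. -/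
def WordCommStep (n : ℕ) (a b : List (ZMod n)) : Prop :=
  ∃ (l₁ l₂ : List (ZMod n)) (i j : ZMod n), j ≠ i ∧ j ≠ i + 1 ∧ j ≠ i - 1 ∧
    a = l₁ ++ [i, j] ++ l₂ ∧ b = l₁ ++ [j, i] ++ l₂

/-- A directed braid: `⋯ i (i+1) i ⋯` becomes `⋯ (i+1) i (i+1) ⋯`. -/
def BraidStep (n : ℕ) (a b : List (ZMod n)) : Prop :=
  ∃ (l₁ l₂ : List (ZMod n)) (i : ZMod n),
    a = l₁ ++ [i, i + 1, i] ++ l₂ ∧ b = l₁ ++ [i + 1, i, i + 1] ++ l₂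

/-- Commutation equivalence of reduced words for `w`. -/
def wordSetoid (n : ℕ) (w : Equiv.Perm ℤ) : Setoid (ReducedWord n w) :=
  (Relation.EqvGen.setoid (WordCommStep n)).comap Subtype.val

/-- The commutation classes of reduced words for `w`. -/
def WordClass (n : ℕ) (w : Equiv.Perm ℤ) : Type :=
  Quotient (wordSetoid n w)

/-- The commutation class of a reduced word. -/
def wordClass {n : ℕ} {w : Equiv.Perm ℤ} (a : ReducedWord n w) : WordClass n w :=
  Quotient.mk (wordSetoid n w) a

/-- The directed braid graph `G(w)` on the commutation classes of reduced words for `w`. -/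
def braidGraph (n : ℕ) (w : Equiv.Perm ℤ) : Digraph (WordClass n w) where
  Adj c d := ∃ a b : ReducedWord n w, wordClass a = c ∧ wordClass b = d ∧ BraidStep n a.1 b.1

/-! ### Subsets of `ℤ` up to translation, packets and inversions -/

/-- The `k`-element subsets of `ℤ` whose elements are distinct modulo `n`, listed in increasing
order. -/
def Tuple (n k : ℕ) : Type :=
  {x : Fin k → ℤ // StrictMono x ∧ ∀ i j, i ≠ j → ¬ x i ≡ x j [ZMOD n]}

/-- Simultaneous translation by a multiple of `n`. -/
def tupleSetoid (n k : ℕ) : Setoid (Tuple n k) where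
  r x y := ∃ m : ℤ, ∀ i, x.1 i = y.1 i + m * n
  iseqv :=
    { refl := fun _ => ⟨0, by simp⟩
      symm := by
        rintro x y ⟨m, h⟩
        exact ⟨-m, fun i => by rw [h i]; ring⟩
      trans := by
        rintro x y z ⟨m, h⟩ ⟨m', h'⟩
        exact ⟨m + m', fun i => by rw [h i, h' i]; ring⟩ }

/-- For `k ≥ 2`, the set of classes `[x_1, …, x_k]` of `k`-element subsets of `ℤ` with elements
distinct modulo `n`, under translation by multiples of `n`. -/
def AffSet (n k : ℕ) : Type :=
  Quotient (tupleSetoid n k)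

/-- The class of a tuple. -/
def AffSet.mk {n k : ℕ} (x : Tuple n k) : AffSet n k :=
  Quotient.mk (tupleSetoid n k) x

/-- Deletion of the entry with (zero-based) index `i` of a tuple. -/
def Tuple.del {n k : ℕ} (i : Fin (k + 1)) (x : Tuple n (k + 1)) : Tuple n k :=
  ⟨fun j => x.1 (i.succAbove j), fun _ _ h => x.2.1 (Fin.strictMono_succAbove i h),
    fun _ _ h => x.2.2 _ _ (fun e => h (Fin.succAbove_right_injective e))⟩

/-- For `X = [x_1, …, x_{k+1}]`, the class `X_{i+1}` obtained by deleting `x_{i+1}`; here `i`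
is zero-based. -/
def AffSet.del {n k : ℕ} (X : AffSet n (k + 1)) (i : Fin (k + 1)) : AffSet n k :=
  Quotient.map (sa := tupleSetoid n (k + 1)) (sb := tupleSetoid n k) (Tuple.del i)
    (fun _ _ ⟨m, h⟩ => ⟨m, fun j => h (i.succAbove j)⟩) X

/-- Addition of the vector `(0, …, 0, n, …, n)` with `i` entries `0` to a tuple. -/
def Tuple.shift {n k : ℕ} (i : Fin k) (x : Tuple n k) : Tuple n k :=
  ⟨fun j => x.1 j + if j < i then 0 else (n : ℤ),
    by
      intro a b hab
      have h := x.2.1 hab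
      dsimp only
      split_ifs with h1 h2 h2
      · omega
      · omega
      · exact absurd (hab.trans h2) h1
      · omega,
    by
      intro a b hab h
      apply x.2.2 a b hab
      have key : ∀ j, (x.1 j + if j < i then 0 else (n : ℤ)) ≡ x.1 j [ZMOD n] := by
        intro j
        split_ifs
        · simp
        · simp
      exact (key a).symm.trans (h.trans (key b))⟩

/-- The class `X + (0, …, 0, n, …, n)` with `i` entries `0` in the vector. -/
def AffSet.shift {n k : ℕ} (X : AffSet n k) (i : Fin k) : AffSet n k :=
  Quotient.map (sa := tupleSetoid n k) (sb := tupleSetoid n k) (Tuple.shift i)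
    (fun x y ⟨m, h⟩ => ⟨m, fun j => by
      have := h j
      simp only [Tuple.shift]
      rw [this]
      ring⟩) X

/-- The packet `P(X) = {X_1, …, X_{k+1}}`. -/
def packet {n k : ℕ} (X : AffSet n (k + 1)) : Set (AffSet n k) :=
  Set.range X.del

/-- The antilexicographic order `(X_1, X_2, …, X_{k+1})` on the packet of `X`. -/
def antilexPacket {n k : ℕ} (X : AffSet n (k + 1)) : List (AffSet n k) :=
  List.ofFn X.del

/-- The lexicographic order `(X_{k+1}, X_k, …, X_1)` on the packet of `X`. -/
def lexPacket {n k : ℕ} (X : AffSet n (k + 1)) : List (AffSet n k) :=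
  (antilexPacket X).reverse

/-- `S` is a (possibly empty) prefix `{X_{k+1}, X_k, …, X_{m+1}}` of the packet of `X`. -/
def IsPacketPrefix {n k : ℕ} (X : AffSet n (k + 1)) (S : Set (AffSet n k)) : Prop :=
  ∃ m : ℕ, S = {Y | ∃ i : Fin (k + 1), m ≤ (i : ℕ) ∧ X.del i = Y}

/-- `S` is a (possibly empty) suffix `{X_m, …, X_2, X_1}` of the packet of `X`. -/
def IsPacketSuffix {n k : ℕ} (X : AffSet n (k + 1)) (S : Set (AffSet n k)) : Prop :=
  ∃ m : ℕ, S = {Y | ∃ i : Fin (k + 1), (i : ℕ) < m ∧ X.del i = Y}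

/-- The `k`-inversion set of `w`: the classes `[x_1, …, x_k]` with
`w⁻¹(x_1) > ⋯ > w⁻¹(x_k)`. -/
def InvSet (n : ℕ) (w : Equiv.Perm ℤ) (k : ℕ) : Set (AffSet n k) :=
  {X | ∃ x : Tuple n k, AffSet.mk x = X ∧ StrictAnti fun i => w.symm (x.1 i)}

/-- `X = [x_1, …, x_k]` is a `k`-quasi-inversion for `w`: all but exactly one of the pairs
`[x_i, x_j]`, `i < j`, are inversions of `w`. -/
def IsQuasiInv (n : ℕ) (w : Equiv.Perm ℤ) {k : ℕ} (X : AffSet n k) : Prop :=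
  ∃ x : Tuple n k, AffSet.mk x = X ∧
    ∃! p : Fin k × Fin k, p.1 < p.2 ∧ ¬ w.symm (x.1 p.2) < w.symm (x.1 p.1)

/-! ### The permanent poset -/

/-- The quasi-inversion relations: if `X` is a `(k+1)`-quasi-inversion with
`P(X) ∩ Inv_k(w) = {X_i, X_{i+1}}`, then `X_i < X_{i+1}` if `k - i` is odd and `X_{i+1} < X_i` if
`k - i` is even. In the code `i` is zero-based, so that `X_i` is `X.del i.castSucc`. -/
def QuasiRel (n : ℕ) (w : Equiv.Perm ℤ) {k : ℕ} (A B : AffSet n k) : Prop :=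
  ∃ X : AffSet n (k + 1), IsQuasiInv n w X ∧ ∃ i : Fin k,
    packet X ∩ InvSet n w k = {X.del i.castSucc, X.del i.succ} ∧
    ((Odd (k - (i + 1 : ℕ)) ∧ A = X.del i.castSucc ∧ B = X.del i.succ) ∨
      (Even (k - (i + 1 : ℕ)) ∧ A = X.del i.succ ∧ B = X.del i.castSucc))

/-- The congruence relations: with `v_i = (0, …, 0, n, …, n)` having `i` entries `0`,
`0 ≤ i < k`, one has `X ≤ X + v_i` if `k - i` is odd and `X + v_i ≤ X` if `k - i` is even. -/
def CongrRel {n k : ℕ} (A B : AffSet n k) : Prop :=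
  ∃ i : Fin k, (Odd (k - (i : ℕ)) ∧ B = A.shift i) ∨ (Even (k - (i : ℕ)) ∧ A = B.shift i)

/-- The order relation of the permanent poset on `Inv_k(w)`: the reflexive transitive closure of
the quasi-inversion and congruence relations between elements of `Inv_k(w)`. -/
def PermLE (n : ℕ) (w : Equiv.Perm ℤ) {k : ℕ} : AffSet n k → AffSet n k → Prop :=
  Relation.ReflTransGen fun A B =>
    A ∈ InvSet n w k ∧ B ∈ InvSet n w k ∧ (QuasiRel n w A B ∨ CongrRel A B)

/-! ### Admissible orders, reversal sets and reflection orders -/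

/-- The list `ρ` is an admissible order for `w` (where `k ≥ 2`): a total order on `Inv_k(w)`,
written as the list of its elements, which is a linear extension of the permanent poset and
whose restriction to the packet of any `(k+1)`-inversion is the lex or the antilex order. -/
structure IsAdmissible (n : ℕ) (w : Equiv.Perm ℤ) {k : ℕ} (ρ : List (AffSet n k)) : Prop where
  nodup : ρ.Nodup
  mem_iff : ∀ X, X ∈ ρ ↔ X ∈ InvSet n w k
  linear_extension : ∀ X Y, X ≠ Y → PermLE n w X Y → List.Sublist [X, Y] ρ
  packets : ∀ X ∈ InvSet n w (k + 1), List.Sublist (lexPacket X) ρ ∨ List.Sublist (antilexPacket X) ρ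

/-- The set `A_w(n,k)` of `k`-admissible orders for `w`. -/
def Adm (n : ℕ) (w : Equiv.Perm ℤ) (k : ℕ) : Type :=
  {ρ : List (AffSet n k) // IsAdmissible n w ρ}

/-- The reversal set: the `(k+1)`-inversions whose packets appear in antilex order. -/
def Rev (n : ℕ) (w : Equiv.Perm ℤ) {k : ℕ} (ρ : List (AffSet n k)) : Set (AffSet n (k + 1)) :=
  {X | X ∈ InvSet n w (k + 1) ∧ List.Sublist (antilexPacket X) ρ}

/-- The pairs `(u w^{(j)}(i_j), u w^{(j)}(i_j + 1))`, where `w^{(j)} = s_{i_1} ⋯ s_{i_{j-1}}`, for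
a word `i_1 ⋯ i_l`; the residues `i_j` are represented by the integers `0, …, n - 1`. -/
def reflPairs (n : ℕ) : Equiv.Perm ℤ → List (ZMod n) → List (ℤ × ℤ)
  | _, [] => []
  | u, i :: l => (u (i.cast : ℤ), u ((i.cast : ℤ) + 1)) :: reflPairs n (u * simpleTransposition n i) l

/-- `ρ` lists the classes `[w^{(j)}(i_j), w^{(j)}(i_j + 1)]` that belong to the word `l`. -/
def IsReflOrderOf (n : ℕ) (l : List (ZMod n)) (ρ : List (AffSet n 2)) : Prop :=
  List.Forall₂ (fun X p => ∃ x : Tuple n 2, AffSet.mk x = X ∧ x.1 0 = p.1 ∧ x.1 1 = p.2)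
    ρ (reflPairs n 1 l)

/-- The set of reflection orders of `w`. -/
def ReflOrder (n : ℕ) (w : Equiv.Perm ℤ) : Type :=
  {ρ : List (AffSet n 2) // ∃ l, IsReducedWord n w l ∧ IsReflOrderOf n l ρ}

/-! ### The higher Bruhat orders -/

/-- `X` and `Y` commute with respect to `w`: they are incomparable in the permanent poset and do
not lie in a common packet. -/
def Commutes (n : ℕ) (w : Equiv.Perm ℤ) {k : ℕ} (X Y : AffSet n k) : Prop :=
  ¬ PermLE n w X Y ∧ ¬ PermLE n w Y X ∧
    ¬ ∃ Z : AffSet n (k + 1), X ∈ packet Z ∧ Y ∈ packet Z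

/-- Exchange of two adjacent elements that commute with respect to `w`. -/
def CommStep (n : ℕ) (w : Equiv.Perm ℤ) {k : ℕ} (ρ σ : List (AffSet n k)) : Prop :=
  ∃ (l₁ l₂ : List (AffSet n k)) (X Y : AffSet n k), Commutes n w X Y ∧
    ρ = l₁ ++ [X, Y] ++ l₂ ∧ σ = l₁ ++ [Y, X] ++ l₂

/-- A lex-to-antilex packet flip. -/
def FlipStep (n : ℕ) (w : Equiv.Perm ℤ) {k : ℕ} (ρ σ : List (AffSet n k)) : Prop :=
  ∃ (l₁ l₂ : List (AffSet n k)) (X : AffSet n (k + 1)), X ∈ InvSet n w (k + 1) ∧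
    ρ = l₁ ++ lexPacket X ++ l₂ ∧ σ = l₁ ++ antilexPacket X ++ l₂

/-- Commutation equivalence of admissible orders. -/
def admSetoid (n : ℕ) (w : Equiv.Perm ℤ) (k : ℕ) : Setoid (Adm n w k) :=
  (Relation.EqvGen.setoid (CommStep n w (k := k))).comap Subtype.val

/-- The underlying set `A_w(n,k)/∼` of the higher Bruhat order `B_w(n,k)`. -/
def HigherBruhat (n : ℕ) (w : Equiv.Perm ℤ) (k : ℕ) : Type :=
  Quotient (admSetoid n w k)

/-- The commutation class of an admissible order. -/
def admClass {n : ℕ} {w : Equiv.Perm ℤ} {k : ℕ} (ρ : Adm n w k) : HigherBruhat n w k :=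
  Quotient.mk (admSetoid n w k) ρ

theorem CommStep.symm {n : ℕ} {w : Equiv.Perm ℤ} {k : ℕ} {ρ σ : List (AffSet n k)}
    (h : CommStep n w ρ σ) : CommStep n w σ ρ := by
  obtain ⟨l₁, l₂, X, Y, ⟨h1, h2, h3⟩, rfl, rfl⟩ := h
  exact ⟨l₁, l₂, Y, X, ⟨h2, h1, fun ⟨Z, a, b⟩ => h3 ⟨Z, b, a⟩⟩, rfl, rfl⟩

theorem reflTransGen_of_eqvGen {n : ℕ} {w : Equiv.Perm ℤ} {k : ℕ} {ρ σ : List (AffSet n k)}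
    (h : Relation.EqvGen (CommStep n w) ρ σ) :
    Relation.ReflTransGen (fun a b => CommStep n w a b ∨ FlipStep n w a b) ρ σ := by
  suffices H : Relation.ReflTransGen (fun a b => CommStep n w a b ∨ FlipStep n w a b) ρ σ ∧
      Relation.ReflTransGen (fun a b => CommStep n w a b ∨ FlipStep n w a b) σ ρ from H.1
  induction h with
  | rel a b h => exact ⟨.single (.inl h), .single (.inl h.symm)⟩
  | refl a => exact ⟨.refl, .refl⟩
  | symm a b _ ih => exact ⟨ih.2, ih.1⟩
  | trans a b c _ _ ih₁ ih₂ => exact ⟨ih₁.1.trans ih₂.1, ih₂.2.trans ih₁.2⟩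

/-- The order of `B_w(n,k)`: `[ρ] ≤ [σ]` if `σ` can be obtained from `ρ` by a sequence of
commutations and lex-to-antilex packet flips. -/
instance (n : ℕ) (w : Equiv.Perm ℤ) (k : ℕ) : Preorder (HigherBruhat n w k) where
  le b c := ∃ ρ σ : Adm n w k, admClass ρ = b ∧ admClass σ = c ∧
    Relation.ReflTransGen (fun a b => CommStep n w a b ∨ FlipStep n w a b) ρ.1 σ.1
  le_refl b := by
    induction b using Quotient.inductionOn with
    | _ ρ => exact ⟨ρ, ρ, rfl, rfl, .refl⟩
  le_trans := by
    rintro a b c ⟨ρ, σ, rfl, rfl, h⟩ ⟨σ', τ, h', rfl, h''⟩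
    have e : Relation.EqvGen (CommStep n w) σ'.1 σ.1 := Quotient.exact h'
    have e' : Relation.EqvGen (CommStep n w) σ.1 σ'.1 := .symm _ _ e
    exact ⟨ρ, τ, rfl, rfl, h.trans ((reflTransGen_of_eqvGen e').trans h'')⟩

/-! ### Consistent sets -/

/-- `R` is consistent with respect to `w`: a lower order ideal of the permanent poset on
`Inv_k(w)` that meets the packet of every `(k+1)`-inversion in a prefix or a suffix. -/
structure IsConsistent (n : ℕ) (w : Equiv.Perm ℤ) {k : ℕ} (R : Set (AffSet n k)) : Prop where
  subset : R ⊆ InvSet n w k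
  ideal : ∀ X Y, Y ∈ R → PermLE n w X Y → X ∈ R
  packets : ∀ X ∈ InvSet n w (k + 1),
    IsPacketPrefix X (packet X ∩ R) ∨ IsPacketSuffix X (packet X ∩ R)

/-- The underlying set of `C_w(n,k)`: the consistent subsets of `Inv_k(w)`. -/
def Consistent (n : ℕ) (w : Equiv.Perm ℤ) (k : ℕ) : Type :=
  {R : Set (AffSet n k) // IsConsistent n w R}

theorem subset_of_steps {n : ℕ} {w : Equiv.Perm ℤ} {k : ℕ} {R S : Consistent n w k}
    (h : Relation.ReflTransGen
      (fun R S : Consistent n w k => ∃ X, X ∉ R.1 ∧ S.1 = insert X R.1) R S) : R.1 ⊆ S.1 := by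
  induction h with
  | refl => exact subset_rfl
  | tail _ h ih =>
    obtain ⟨X, _, h⟩ := h
    rw [h]
    exact ih.trans (Set.subset_insert _ _)

/-- The order of `C_w(n,k)`, generated by single step inclusion. -/
instance (n : ℕ) (w : Equiv.Perm ℤ) (k : ℕ) : PartialOrder (Consistent n w k) where
  le := Relation.ReflTransGen
    (fun R S : Consistent n w k => ∃ X, X ∉ R.1 ∧ S.1 = insert X R.1)
  le_refl _ := .refl
  le_trans _ _ _ := .trans
  le_antisymm _ _ h h' := Subtype.ext (subset_antisymm (subset_of_steps h) (subset_of_steps h'))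

/-- The Hasse diagram of a (pre)ordered set as a directed graph, with an edge from each element
to every element that covers it. -/
def hasseDigraph (P : Type) [Preorder P] : Digraph P where
  Adj a b := a ⋖ b

end AffineBruhat

open AffineBruhat

namespace AffineBruhat

/-! ### The affine symmetric group -/

/-! Regard `w` as an arrangement of lines labelled by the integers, in which two lines cross exactly
when their labels form an inversion. A reduced word sweeps this arrangement: each letter performs
one translation class of crossings, and `time` records the step. Two facts about three lines carry
the proof: the crossing of the two outer lines falls between the other two crossings
(`Asc.time_between`), and crossings that share a line happen at different times (`Asc.time_ne`). A
pair that never crosses receives the length of the word as its time, so it acts like a crossing at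
infinity; the quasi-inversion and congruence relations of the permanent poset encode exactly this.

Over the integers, consistency becomes biconvexity for pairs (`isConsistent_two_iff`) and the
structure `TripleCons` for triples (`isConsistent_three_iff`). A biconvex set of inversions of `w`
is reached by inverting one adjacent pair after the other (`PairCons.exists_ascent`), hence it is
the inversion set of a prefix of a reduced word. So reduced words, reflection orders, admissible
orders and maximal chains of consistent sets of pairs carry the same data.

The reversed triples of a word are consistent (`Asc.tripleCons`). Conversely, a consistent set of
triples prescribes a strict total order of the crossings on every line (`TripleCons.before_trans`).
Some crossing is last on both of its lines; it sits at adjacent positions and can be undone, and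
induction produces a word with the prescribed reversed triples (`TripleCons.exists_word`). Two words
for `w` with the same reversed triples are commutation equivalent, since the last crossing of one
can be commuted to the end of the other (`Asc.eqvGen_of_revP`). Commutation classes are therefore
the consistent sets of triples, and a braid move adds one element.

For the order, braid moves are needed in prescribed directions (`Asc.exists_braid`). Among the
triples on which a word disagrees with a target set, take a triangle whose first and last crossings
are closest in time. No fourth line cuts it (`FourLines.noCut`), so commutations contract it to
three consecutive letters, and a braid move reverses it. This argument needs the disagreement to be
confined to triples through one fixed pair. That holds when the target has one element more; for the
targets "no triple" and "all inverted triples" one passes to the shortest prefix that disagrees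
(`Asc.hasBraid_const`). Hence every consistent set lies on a chain of single insertions from the
empty set to the full one. Minimum, maximum and rank follow, and the diameter is found by joining
two classes through the minimum or the maximum. -/

theorem map_add_mul {n : ℕ} {f : ℤ → ℤ} (hf : ∀ x, f (x + n) = f x + n) (x m : ℤ) :
    f (x + m * n) = f x + m * n := by
  induction m using Int.induction_on with
  | zero => simp
  | succ k ih =>
    have := hf (x + k * n)
    rw [ih] at this
    rw [show x + ((k : ℤ) + 1) * n = x + k * n + n by ring, this]
    ring
  | pred k ih =>
    have := hf (x + (-(k : ℤ) - 1) * n)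
    rw [show x + (-(k : ℤ) - 1) * n + n = x + -(k : ℤ) * n by ring, ih] at this
    linarith

/-- A permutation of `ℤ` that commutes with the translation by `n`. -/
def Periodic (n : ℕ) (u : Equiv.Perm ℤ) : Prop := ∀ x : ℤ, u (x + n) = u x + n

theorem Periodic.apply {n : ℕ} {u : Equiv.Perm ℤ} (hu : Periodic n u) (x m : ℤ) :
    u (x + m * n) = u x + m * n :=
  map_add_mul hu x m

theorem Periodic.symm {n : ℕ} {u : Equiv.Perm ℤ} (hu : Periodic n u) : Periodic n u.symm := by
  intro x
  rw [Equiv.symm_apply_eq, hu, Equiv.apply_symm_apply]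

theorem Periodic.symm_apply {n : ℕ} {u : Equiv.Perm ℤ} (hu : Periodic n u) (x m : ℤ) :
    u.symm (x + m * n) = u.symm x + m * n :=
  map_add_mul hu.symm x m

theorem Periodic.mul {n : ℕ} {u v : Equiv.Perm ℤ} (hu : Periodic n u) (hv : Periodic n v) :
    Periodic n (u * v) := by
  intro x
  rw [Equiv.Perm.mul_apply, hv, hu, Equiv.Perm.mul_apply]

theorem Periodic.one (n : ℕ) : Periodic n 1 := fun _ => rfl

theorem simple_apply (n : ℕ) (i : ZMod n) (x : ℤ) :
    simpleTransposition n i x = simpleFun n i x := rfl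

theorem simple_periodic (n : ℕ) (i : ZMod n) : Periodic n (simpleTransposition n i) := by
  intro x
  simp only [simple_apply, simpleFun]
  push_cast
  simp only [CharP.cast_eq_zero, add_zero]
  split_ifs <;> ring

theorem simple_mul_self (n : ℕ) (i : ZMod n) :
    simpleTransposition n i * simpleTransposition n i = 1 := by
  ext x
  exact simpleFun_involutive n i x

theorem simple_simple (n : ℕ) (i : ZMod n) (x : ℤ) :
    simpleTransposition n i (simpleTransposition n i x) = x :=
  simpleFun_involutive n i x

theorem mul_simple_symm_apply (n : ℕ) (i : ZMod n) (u : Equiv.Perm ℤ) (x : ℤ) :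
    (u * simpleTransposition n i).symm x = simpleTransposition n i (u.symm x) := rfl

theorem simple_of_eq {n : ℕ} (hn : n ≠ 1) {i : ZMod n} {x : ℤ} (hx : (x : ZMod n) = i) :
    simpleTransposition n i x = x + 1 := by
  simp [simple_apply, simpleFun, hn, hx]

theorem simple_of_eq_add_one {n : ℕ} (hn : n ≠ 1) {i : ZMod n} {x : ℤ}
    (hx : (x : ZMod n) = i + 1) : simpleTransposition n i x = x - 1 := by
  have : Nontrivial (ZMod n) := ZMod.nontrivial_iff.mpr hn
  simp [simple_apply, simpleFun, hn, hx]

theorem simple_of_ne {n : ℕ} {i : ZMod n} {x : ℤ} (hx : (x : ZMod n) ≠ i)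
    (hx' : (x : ZMod n) ≠ i + 1) : simpleTransposition n i x = x := by
  simp [simple_apply, simpleFun, hx, hx']

theorem simple_le (n : ℕ) (i : ZMod n) (x : ℤ) : simpleTransposition n i x ≤ x + 1 := by
  rw [simple_apply, simpleFun]
  split_ifs <;> omega

theorem le_simple (n : ℕ) (i : ZMod n) (x : ℤ) : x - 1 ≤ simpleTransposition n i x := by
  rw [simple_apply, simpleFun]
  split_ifs <;> omega

/-- A simple transposition moves every integer by at most one, so it can only reverse neighbours,
and the excluded neighbours are exactly the ones that it exchanges. -/
theorem simple_lt_simple {n : ℕ} (i : ZMod n) {x y : ℤ} (h : x < y)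
    (h' : ¬ (y = x + 1 ∧ (x : ZMod n) = i)) :
    simpleTransposition n i x < simpleTransposition n i y := by
  have h1 := simple_le n i x
  have h2 := le_simple n i y
  have h3 : simpleTransposition n i x ≠ simpleTransposition n i y := by
    simp only [ne_eq, EmbeddingLike.apply_eq_iff_eq]
    omega
  rcases eq_or_ne y (x + 1) with rfl | h4
  · have hx : (x : ZMod n) ≠ i := fun e => h' ⟨rfl, e⟩
    have hy : ((x + 1 : ℤ) : ZMod n) ≠ i + 1 := by
      push_cast
      simpa using hx
    have h5 : simpleTransposition n i x ≤ x := by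
      rw [simple_apply, simpleFun]
      split_ifs <;> omega
    have h6 : x + 1 ≤ simpleTransposition n i (x + 1) := by
      rw [simple_apply, simpleFun]
      split_ifs <;> omega
    omega
  · omega

theorem simple_injective {n : ℕ} (hn : n ≠ 1) {i j : ZMod n}
    (h : simpleTransposition n i = simpleTransposition n j) : i = j := by
  obtain ⟨a, rfl⟩ := ZMod.intCast_surjective i
  have h1 := simple_of_eq hn (x := a) rfl
  rw [h, simple_apply, simpleFun, if_neg hn] at h1
  split_ifs at h1 with h2 h3
  · exact h2
  · omega
  · omega

theorem wordProd_nil (n : ℕ) : wordProd n [] = 1 := rfl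

theorem wordProd_append (n : ℕ) (l l' : List (ZMod n)) :
    wordProd n (l ++ l') = wordProd n l * wordProd n l' := by
  simp [wordProd]

theorem wordProd_cons (n : ℕ) (i : ZMod n) (l : List (ZMod n)) :
    wordProd n (i :: l) = simpleTransposition n i * wordProd n l := by
  simp [wordProd]

theorem wordProd_singleton (n : ℕ) (i : ZMod n) :
    wordProd n [i] = simpleTransposition n i := by
  simp [wordProd]

theorem wordProd_periodic (n : ℕ) (l : List (ZMod n)) : Periodic n (wordProd n l) := by
  induction l with
  | nil => exact Periodic.one n
  | cons i l ih => exact wordProd_cons n i l ▸ (simple_periodic n i).mul ih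

/-- A periodic permutation permutes the residues modulo `n`, so reducing its values on the window
back into the window only reorders the summands. -/
theorem sum_periodic_comp {n : ℕ} {f : ℤ → ℤ} (hf : ∀ x, f (x + n) = f x) {v : Equiv.Perm ℤ}
    (hv : Periodic n v) :
    ∑ i ∈ Finset.Icc 1 n, f (v (i : ℤ)) = ∑ i ∈ Finset.Icc 1 n, f (i : ℤ) := by
  have hf' : ∀ x m : ℤ, f (x + m * n) = f x := by
    intro x m
    -- Adding the identity turns an invariant function into an equivariant one.
    have := map_add_mul (f := fun y => f y + y) (n := n) (fun y => by simp only [hf]; ring) x m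
    linarith
  rcases Nat.eq_zero_or_pos n with rfl | hn
  · simp
  -- The shifts by one select the representative in `1, …, n` instead of `0, …, n - 1`.
  let g : ℕ → ℕ := fun i => ((v (i : ℤ) - 1) % n).toNat + 1
  have hn' : (n : ℤ) ≠ 0 := by omega
  have hg : ∀ i : ℕ, v (i : ℤ) = (g i : ℤ) + (v (i : ℤ) - 1) / n * n := by
    intro i
    have h1 := Int.emod_nonneg (v (i : ℤ) - 1) hn'
    have h2 := Int.emod_add_mul_ediv (v (i : ℤ) - 1) n
    have h3 : ((g i : ℕ) : ℤ) = (v (i : ℤ) - 1) % n + 1 := by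
      simp only [g]
      push_cast
      rw [Int.toNat_of_nonneg h1]
    rw [h3]
    linarith
  have hmaps : Set.MapsTo g (Finset.Icc 1 n) (Finset.Icc 1 n) := by
    intro i _
    have h1 := Int.emod_nonneg (v (i : ℤ) - 1) hn'
    have h2 := Int.emod_lt_of_pos (v (i : ℤ) - 1) (show (0 : ℤ) < n by omega)
    simp only [Finset.coe_Icc, Set.mem_Icc, g]
    omega
  have hinj : Set.InjOn g (Finset.Icc 1 n) := by
    intro i hi j hj hij
    have h1 := hg i
    have h2 := hg j
    rw [← hij] at h2
    have h3 : v (i : ℤ) = v ((j : ℤ) + ((v (i : ℤ) - 1) / n - (v (j : ℤ) - 1) / n) * n) := by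
      rw [hv.apply]
      linarith
    have h4 := v.injective h3
    simp only [Finset.coe_Icc, Set.mem_Icc] at hi hj
    set m := (v (i : ℤ) - 1) / n - (v (j : ℤ) - 1) / n
    have h5 : m = 0 := by
      by_contra hm
      rcases lt_or_gt_of_ne hm with hm | hm
      · nlinarith
      · nlinarith
    rw [h5] at h4
    omega
  refine Finset.sum_nbij g hmaps hinj (Finset.surjOn_of_injOn_of_card_le g hmaps hinj le_rfl) ?_
  intro i _
  rw [hg i, hf']

theorem sum_Icc_cast (n : ℕ) : ∑ i ∈ Finset.Icc 1 n, ((i : ℤ)) = ((n + 1).choose 2 : ℤ) := by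
  have h := Finset.sum_range_id_mul_two (n + 1)
  have h1 : ∑ i ∈ Finset.range (n + 1), i = ∑ i ∈ Finset.Icc 1 n, i := by
    rw [Finset.range_eq_Ico, Finset.sum_eq_sum_Ico_succ_bot (by omega)]
    simp
    rfl
  rw [h1] at h
  rw [Nat.choose_two_right, show (n + 1) * (n + 1 - 1) / 2 = ∑ i ∈ Finset.Icc 1 n, i by omega]
  push_cast
  ring

/-- The normalisation says that the total displacement over a window vanishes. In this form it is
additive under composition. -/
theorem isAffinePerm_iff {n : ℕ} {w : Equiv.Perm ℤ} :
    IsAffinePerm n w ↔ Periodic n w ∧ ∑ i ∈ Finset.Icc 1 n, (w (i : ℤ) - i) = 0 := by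
  rw [Finset.sum_sub_distrib, sum_Icc_cast, sub_eq_zero]
  exact ⟨fun h => ⟨h.periodic, h.sum_window⟩, fun ⟨h, h'⟩ => ⟨h, h'⟩⟩

theorem sum_window_sub {n : ℕ} {w : Equiv.Perm ℤ} (hw : IsAffinePerm n w) :
    ∑ i ∈ Finset.Icc 1 n, (w (i : ℤ) - i) = 0 :=
  (isAffinePerm_iff.mp hw).2

theorem IsAffinePerm.one (n : ℕ) : IsAffinePerm n 1 :=
  isAffinePerm_iff.mpr ⟨Periodic.one n, by simp⟩

/-- The displacement of `u` is a periodic function, so its sum over the image of the window under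
`v` equals its sum over the window. -/
theorem sum_mul_sub {n : ℕ} {u v : Equiv.Perm ℤ} (hu : Periodic n u) (hv : Periodic n v) :
    ∑ i ∈ Finset.Icc 1 n, ((u * v) (i : ℤ) - i) =
      ∑ i ∈ Finset.Icc 1 n, (u (i : ℤ) - i) + ∑ i ∈ Finset.Icc 1 n, (v (i : ℤ) - i) := by
  rw [← sum_periodic_comp (f := fun x => u x - x) (fun x => by rw [hu]; ring) hv,
    ← Finset.sum_add_distrib]
  exact Finset.sum_congr rfl fun i _ => by rw [Equiv.Perm.mul_apply]; ring

theorem IsAffinePerm.mul {n : ℕ} {u v : Equiv.Perm ℤ} (hu : IsAffinePerm n u)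
    (hv : IsAffinePerm n v) : IsAffinePerm n (u * v) := by
  rw [isAffinePerm_iff] at hu hv ⊢
  exact ⟨hu.1.mul hv.1, by rw [sum_mul_sub hu.1 hv.1, hu.2, hv.2, add_zero]⟩

/-- The displacement is additive and the transposition is an involution, so twice its displacement
is zero. -/
theorem isAffinePerm_simple (n : ℕ) (i : ZMod n) : IsAffinePerm n (simpleTransposition n i) := by
  have h := sum_mul_sub (simple_periodic n i) (simple_periodic n i)
  rw [simple_mul_self] at h
  simp only [Equiv.Perm.coe_one, id_eq, sub_self, Finset.sum_const_zero] at h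
  exact isAffinePerm_iff.mpr ⟨simple_periodic n i, by linarith⟩

theorem isAffinePerm_wordProd (n : ℕ) (l : List (ZMod n)) : IsAffinePerm n (wordProd n l) := by
  induction l with
  | nil => exact IsAffinePerm.one n
  | cons i l ih => exact wordProd_cons n i l ▸ (isAffinePerm_simple n i).mul ih

theorem IsAffinePerm.per {n : ℕ} {w : Equiv.Perm ℤ} (hw : IsAffinePerm n w) : Periodic n w :=
  hw.periodic

/-! ### Inversions -/

/-- The pair `x < y` is an inversion of `u`. -/
def Invd (u : Equiv.Perm ℤ) (x y : ℤ) : Prop := x < y ∧ u.symm y < u.symm x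

theorem Invd.trans {u : Equiv.Perm ℤ} {x y z : ℤ} (h : Invd u x y) (h' : Invd u y z) :
    Invd u x z :=
  ⟨h.1.trans h'.1, h'.2.trans h.2⟩

theorem Invd.split {u : Equiv.Perm ℤ} {x y z : ℤ} (h : Invd u x z) (hxy : x < y) (hyz : y < z) :
    Invd u x y ∨ Invd u y z := by
  have := h.2
  rcases lt_or_ge (u.symm y) (u.symm x) with h1 | h1
  · exact .inl ⟨hxy, h1⟩
  · exact .inr ⟨hyz, by omega⟩

theorem invd_translate {n : ℕ} {u : Equiv.Perm ℤ} (hu : Periodic n u) (x y m : ℤ) :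
    Invd u (x + m * n) (y + m * n) ↔ Invd u x y := by
  simp only [Invd, hu.symm_apply]
  constructor <;> rintro ⟨h, h'⟩ <;> constructor <;> linarith

theorem not_invd_add {n : ℕ} {u : Equiv.Perm ℤ} (hu : Periodic n u) (x m : ℤ) :
    ¬ Invd u x (x + m * n) := by
  simp only [Invd, hu.symm_apply]
  intro h
  linarith [h.1, h.2]

theorem Invd.not_modEq {n : ℕ} {u : Equiv.Perm ℤ} (hu : Periodic n u) {x y : ℤ}
    (h : Invd u x y) : ¬ x ≡ y [ZMOD n] := by
  intro e
  obtain ⟨m, hm⟩ := e.dvd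
  have : y = x + m * n := by linarith
  exact not_invd_add hu x m (this ▸ h)

theorem not_invd_one (x y : ℤ) : ¬ Invd 1 x y := fun h => by
  have h1 := h.1
  have h2 : y < x := h.2
  omega

/-- Multiplication on the right exchanges the entries at the positions `a` and `a + 1` and their
translates. All other pairs keep their relative positions, so one translation class of inversions is
gained. -/
theorem invd_mul_simple {n : ℕ} (hn : n ≠ 1) {u : Equiv.Perm ℤ} (hu : Periodic n u) {i : ZMod n}
    {a : ℤ} (ha : (a : ZMod n) = i) (h : u a < u (a + 1)) (x y : ℤ) :
    Invd (u * simpleTransposition n i) x y ↔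
      Invd u x y ∨ ∃ m : ℤ, x = u a + m * n ∧ y = u (a + 1) + m * n := by
  simp only [Invd, mul_simple_symm_apply]
  constructor
  · rintro ⟨hxy, h1⟩
    by_cases h2 : u.symm y < u.symm x
    · exact .inl ⟨hxy, h2⟩
    · have h3 : u.symm x ≠ u.symm y := by
        simp only [ne_eq, EmbeddingLike.apply_eq_iff_eq]
        omega
      by_cases h4 : u.symm y = u.symm x + 1 ∧ (u.symm x : ZMod n) = i
      · right
        obtain ⟨h4, h5⟩ := h4
        rw [← ha, ZMod.intCast_eq_intCast_iff] at h5
        obtain ⟨m, hm⟩ := h5.symm.dvd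
        refine ⟨m, ?_, ?_⟩
        · rw [← hu.apply, ← Equiv.symm_apply_eq]
          linarith
        · rw [← hu.apply, ← Equiv.symm_apply_eq]
          linarith
      · have := simple_lt_simple i (show u.symm x < u.symm y by omega) h4
        omega
  · rintro (⟨hxy, h1⟩ | ⟨m, rfl, rfl⟩)
    · refine ⟨hxy, simple_lt_simple i h1 ?_⟩
      rintro ⟨h2, h3⟩
      rw [← ha, ZMod.intCast_eq_intCast_iff] at h3
      obtain ⟨m, hm⟩ := h3.symm.dvd
      have h4 : u.symm y = a + m * n := by linarith
      have h5 : u.symm x = (a + 1) + m * n := by linarith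
      rw [Equiv.symm_apply_eq, hu.apply] at h4 h5
      omega
    · refine ⟨by linarith, ?_⟩
      rw [hu.symm_apply, hu.symm_apply, Equiv.symm_apply_apply, Equiv.symm_apply_apply,
        (simple_periodic n i).apply, (simple_periodic n i).apply, simple_of_eq hn ha,
        simple_of_eq_add_one hn (by push_cast; rw [ha])]
      linarith

/-- Equal inversions make `v⁻¹ u` an increasing bijection of the integers, hence a translation. The
normalisation of `u` and `v` forces the translation to be trivial. -/
theorem perm_eq_of_invd_iff {n : ℕ} (hn : 0 < n) {u v : Equiv.Perm ℤ} (hu : IsAffinePerm n u)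
    (hv : IsAffinePerm n v) (h : ∀ x y, Invd u x y ↔ Invd v x y) : u = v := by
  have hmono : StrictMono (fun x => v.symm (u x)) := by
    intro x y hxy
    have h1 : u x ≠ u y := by simp; omega
    have h2 : v.symm (u x) ≠ v.symm (u y) := by simp; omega
    rcases lt_or_gt_of_ne h1 with h3 | h3
    · by_contra h4
      have h5 : Invd v (u x) (u y) := ⟨h3, by simp only at h4; omega⟩
      rw [← h] at h5
      have := h5.2
      simp at this
      omega
    · have h5 : Invd u (u y) (u x) := ⟨h3, by simpa using hxy⟩
      rw [h] at h5
      exact h5.2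
  have hmono' : StrictMono (fun x => u.symm (v x)) := by
    intro x y hxy
    by_contra h1
    have h2 := hmono.monotone (not_lt.mp h1)
    simp at h2
    omega
  -- An increasing bijection with increasing inverse cannot skip a value.
  have hsucc : ∀ x, v.symm (u (x + 1)) = v.symm (u x) + 1 := by
    intro x
    have h1 : v.symm (u x) < v.symm (u (x + 1)) := hmono (by omega)
    by_contra h2
    have h3 := hmono' (show v.symm (u x) < v.symm (u x) + 1 by omega)
    have h4 := hmono' (show v.symm (u x) + 1 < v.symm (u (x + 1)) by omega)
    simp at h3 h4
    omega
  have hc : ∀ x, v.symm (u x) = x + v.symm (u 0) := by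
    intro x
    have := map_add_mul (n := 1) (f := fun x => v.symm (u x)) (by simpa using hsucc) 0 x
    simp at this
    linarith
  have hc' : ∀ x, u x = v (x + v.symm (u 0)) := by
    intro x
    rw [← hc, Equiv.apply_symm_apply]
  set c := v.symm (u 0)
  have h1 := sum_window_sub hu
  have h2 := sum_window_sub hv
  have hper : Periodic n (Equiv.addRight c) := fun x => by simp; ring
  have h3 := sum_mul_sub hv.per hper
  have h4 : v * Equiv.addRight c = u := by
    ext x
    rw [Equiv.Perm.mul_apply, hc']
    rfl
  rw [h4, h1, h2] at h3
  simp at h3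
  have h5 : c = 0 := by omega
  ext x
  rw [hc', h5, add_zero]

/-! ### Ascending words -/

/-- Multiplication of `u` on the right by the letters of the word increases the length in each
step. -/
def Asc (n : ℕ) : Equiv.Perm ℤ → List (ZMod n) → Prop
  | _, [] => True
  | u, i :: l => (n ≠ 1 ∧ u (i.cast : ℤ) < u ((i.cast : ℤ) + 1)) ∧
      Asc n (u * simpleTransposition n i) l

theorem asc_append {n : ℕ} {u : Equiv.Perm ℤ} {l l' : List (ZMod n)} :
    Asc n u (l ++ l') ↔ Asc n u l ∧ Asc n (u * wordProd n l) l' := by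
  induction l generalizing u with
  | nil => simp [Asc, wordProd_nil]
  | cons i l ih => simp only [List.cons_append, Asc, ih, wordProd_cons, mul_assoc, and_assoc]

theorem asc_singleton {n : ℕ} {u : Equiv.Perm ℤ} {i : ZMod n} :
    Asc n u [i] ↔ n ≠ 1 ∧ u (i.cast : ℤ) < u ((i.cast : ℤ) + 1) := by
  simp [Asc]

theorem lt_of_intCast_eq {n : ℕ} {u : Equiv.Perm ℤ} (hu : Periodic n u) {a b : ℤ}
    (h : (a : ZMod n) = b) : u a < u (a + 1) ↔ u b < u (b + 1) := by
  rw [ZMod.intCast_eq_intCast_iff] at h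
  obtain ⟨m, hm⟩ := h.dvd
  have h1 : b = a + m * n := by linarith
  rw [h1, show a + m * n + 1 = a + 1 + m * n by ring, hu.apply, hu.apply]
  constructor <;> intro h <;> linarith

theorem intCast_cast' {n : ℕ} (i : ZMod n) : ((i.cast : ℤ) : ZMod n) = i :=
  ZMod.intCast_zmod_cast i

/-- The product of the first `j` letters of a word. -/
def prefixProd (n : ℕ) (l : List (ZMod n)) (j : ℕ) : Equiv.Perm ℤ := wordProd n (l.take j)

theorem prefixProd_length (n : ℕ) (l : List (ZMod n)) :
    prefixProd n l l.length = wordProd n l := by simp [prefixProd]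

theorem prefixProd_zero (n : ℕ) (l : List (ZMod n)) : prefixProd n l 0 = 1 := by
  simp [prefixProd, wordProd]

theorem prefixProd_succ {n : ℕ} {l : List (ZMod n)} {j : ℕ} (hj : j < l.length) :
    prefixProd n l (j + 1) = prefixProd n l j * simpleTransposition n l[j] := by
  rw [prefixProd, List.take_succ_eq_append_getElem hj, wordProd_append, wordProd_singleton]
  rfl

theorem prefixProd_append_left {n : ℕ} {l l' : List (ZMod n)} {j : ℕ} (hj : j ≤ l.length) :
    prefixProd n (l ++ l') j = prefixProd n l j := by
  rw [prefixProd, List.take_append_of_le_length hj]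
  rfl

theorem prefixProd_append_right (n : ℕ) (l l' : List (ZMod n)) (j : ℕ) :
    prefixProd n (l ++ l') (l.length + j) = wordProd n l * prefixProd n l' j := by
  rw [prefixProd, List.take_length_add_append, wordProd_append]
  rfl

theorem prefixProd_periodic (n : ℕ) (l : List (ZMod n)) (j : ℕ) : Periodic n (prefixProd n l j) :=
  wordProd_periodic n _

theorem Asc.step {n : ℕ} {l : List (ZMod n)} (h : Asc n 1 l) {j : ℕ} (hj : j < l.length) :
    n ≠ 1 ∧ prefixProd n l j (l[j].cast : ℤ) < prefixProd n l j ((l[j].cast : ℤ) + 1) := by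
  have e : l.take j ++ ([l[j]] ++ l.drop (j + 1)) = l := by simp
  rw [← e, asc_append, asc_append, asc_singleton, one_mul] at h
  exact h.2.1

theorem Asc.invd_succ {n : ℕ} {l : List (ZMod n)} (h : Asc n 1 l) {j : ℕ} (hj : j < l.length)
    (x y : ℤ) : Invd (prefixProd n l (j + 1)) x y ↔ Invd (prefixProd n l j) x y ∨
      ∃ m : ℤ, x = prefixProd n l j (l[j].cast : ℤ) + m * n ∧
        y = prefixProd n l j ((l[j].cast : ℤ) + 1) + m * n := by
  rw [prefixProd_succ hj]
  exact invd_mul_simple (h.step hj).1 (prefixProd_periodic n l j) (intCast_cast' _) (h.step hj).2 x y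

theorem Asc.invd_mono {n : ℕ} {l : List (ZMod n)} (h : Asc n 1 l) {j k : ℕ} (hjk : j ≤ k)
    (hk : k ≤ l.length) {x y : ℤ} (hx : Invd (prefixProd n l j) x y) :
    Invd (prefixProd n l k) x y := by
  induction k, hjk using Nat.le_induction with
  | base => exact hx
  | succ k _ ih => exact (h.invd_succ (by omega) x y).mpr (.inl (ih (by omega)))

open Classical in
/-- The (zero-based) step in which the pair `x < y` becomes inverted, and the length of the word
if this never happens. -/
noncomputable def time (n : ℕ) (l : List (ZMod n)) (x y : ℤ) : ℕ :=
  -- In an ascending word inversions only accumulate, so the steps after which the pair is still not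
  -- inverted form an initial segment. Counting them gives the step sought, with the length as
  -- default value.
  ((Finset.range l.length).filter fun j => ¬ Invd (prefixProd n l (j + 1)) x y).card

theorem time_le (n : ℕ) (l : List (ZMod n)) (x y : ℤ) : time n l x y ≤ l.length := by
  classical
  exact (Finset.card_filter_le _ _).trans (Finset.card_range _).le

/-- This translates comparisons of a time with a threshold into inversions of a prefix. Properties
of inversions such as transitivity thereby become inequalities between times. -/
theorem Asc.time_lt_iff {n : ℕ} {l : List (ZMod n)} (h : Asc n 1 l) {j : ℕ} (hj : j ≤ l.length)
    (x y : ℤ) : time n l x y < j ↔ Invd (prefixProd n l j) x y := by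
  classical
  have ht : time n l x y =
      ((Finset.range l.length).filter fun j => ¬ Invd (prefixProd n l (j + 1)) x y).card := by
    simp only [time]
  constructor
  · intro h1
    by_contra h2
    have h3 : Finset.range j ⊆
        (Finset.range l.length).filter fun j => ¬ Invd (prefixProd n l (j + 1)) x y := by
      intro k hk
      simp only [Finset.mem_range, Finset.mem_filter] at hk ⊢
      exact ⟨by omega, fun h3 => h2 (h.invd_mono (by omega) hj h3)⟩
    have h4 := Finset.card_le_card h3
    rw [Finset.card_range] at h4
    omega
  · intro h1
    have hj0 : j ≠ 0 := by
      rintro rfl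
      rw [prefixProd_zero] at h1
      exact not_invd_one _ _ h1
    have h3 : ((Finset.range l.length).filter fun j => ¬ Invd (prefixProd n l (j + 1)) x y) ⊆
        Finset.range (j - 1) := by
      intro k hk
      simp only [Finset.mem_range, Finset.mem_filter] at hk ⊢
      by_contra h4
      exact hk.2 (h.invd_mono (by omega) (by omega) h1)
    have h4 := Finset.card_le_card h3
    rw [Finset.card_range] at h4
    omega

theorem Asc.time_lt_length {n : ℕ} {l : List (ZMod n)} (h : Asc n 1 l) (x y : ℤ) :
    time n l x y < l.length ↔ Invd (wordProd n l) x y := by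
  rw [h.time_lt_iff le_rfl, prefixProd_length]

theorem Asc.time_eq_iff {n : ℕ} {l : List (ZMod n)} (h : Asc n 1 l) {j : ℕ} (hj : j < l.length)
    (x y : ℤ) : time n l x y = j ↔ ∃ m : ℤ, x = prefixProd n l j (l[j].cast : ℤ) + m * n ∧
        y = prefixProd n l j ((l[j].cast : ℤ) + 1) + m * n := by
  have h1 := h.time_lt_iff (show j + 1 ≤ l.length by omega) x y
  have h2 := h.time_lt_iff hj.le x y
  rw [h.invd_succ hj] at h1
  constructor
  · intro h3
    rcases h1.mp (by omega) with h4 | h4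
    · have := h2.mpr h4
      omega
    · exact h4
  · intro h3
    have h4 := h1.mpr (.inr h3)
    have h5 : ¬ time n l x y < j := by
      rw [h2]
      obtain ⟨m, rfl, rfl⟩ := h3
      rw [invd_translate (prefixProd_periodic n l j)]
      intro h6
      have := h6.2
      simp at this
    omega

/-- The pair inverted in step `j` has adjacent positions, and its position determines the
letter. -/
theorem Asc.position {n : ℕ} {l : List (ZMod n)} (h : Asc n 1 l) {j : ℕ} (hj : j < l.length)
    {x y : ℤ} (hx : time n l x y = j) :
    (((prefixProd n l j).symm x : ℤ) : ZMod n) = l[j] ∧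
      (prefixProd n l j).symm y = (prefixProd n l j).symm x + 1 := by
  obtain ⟨m, rfl, rfl⟩ := (h.time_eq_iff hj x y).mp hx
  have hp := prefixProd_periodic n l j
  rw [hp.symm_apply, hp.symm_apply, Equiv.symm_apply_apply, Equiv.symm_apply_apply]
  constructor
  · simp
  · ring

theorem time_translate {n : ℕ} {l : List (ZMod n)} (x y m : ℤ) :
    time n l (x + m * n) (y + m * n) = time n l x y := by
  classical
  unfold time
  congr 1
  ext j
  simp only [Finset.mem_filter, invd_translate (prefixProd_periodic n l _)]

/-- Each step inverts one translation class, so an inverted pair is determined by its time up to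
translation. -/
theorem Asc.exists_translate {n : ℕ} {l : List (ZMod n)} (h : Asc n 1 l) {x y x' y' : ℤ}
    (h1 : time n l x y = time n l x' y') (h2 : time n l x y < l.length) :
    ∃ m : ℤ, x' = x + m * n ∧ y' = y + m * n := by
  obtain ⟨m, h3, h4⟩ := (h.time_eq_iff h2 x y).mp rfl
  obtain ⟨m', h5, h6⟩ := (h.time_eq_iff h2 x' y').mp h1.symm
  exact ⟨m' - m, by rw [h3, h5]; ring, by rw [h4, h6]; ring⟩

theorem Asc.lt_of_time {n : ℕ} {l : List (ZMod n)} (h : Asc n 1 l) {x y : ℤ}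
    (h1 : time n l x y < l.length) : x < y :=
  ((h.time_lt_length x y).mp h1).1

/-- The time of the middle pair of a triple lies between the times of the two other pairs. -/
theorem Asc.time_between {n : ℕ} {l : List (ZMod n)} (h : Asc n 1 l) {x y z : ℤ} (hxy : x < y)
    (hyz : y < z) :
    (time n l x y ≤ time n l x z ∧ time n l x z ≤ time n l y z) ∨
      (time n l y z ≤ time n l x z ∧ time n l x z ≤ time n l x y) := by
  have h1 := time_le n l x y
  have h2 := time_le n l x z
  have h3 := time_le n l y z
  -- Transitivity of inversions bounds the middle time by the larger of the other two; splitting, in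
  -- `h5`, bounds it below by the smaller.
  have h4 : ∀ k ≤ l.length, time n l x y < k → time n l y z < k → time n l x z < k := by
    intro k hk
    simp only [h.time_lt_iff hk]
    exact Invd.trans
  have h5 : ∀ k ≤ l.length, time n l x z < k → time n l x y < k ∨ time n l y z < k := by
    intro k hk
    simp only [h.time_lt_iff hk]
    exact fun h => h.split hxy hyz
  have h6 := h4 (time n l x z) h2
  have h7 : time n l x z + 1 ≤ l.length → _ := h5 (time n l x z + 1)
  omega

/-- Two distinct pairs with a common entry have different times. -/
theorem Asc.time_ne {n : ℕ} {l : List (ZMod n)} (h : Asc n 1 l) {x y z : ℤ} (hxy : x < y)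
    (hyz : y < z) :
    (time n l x y = time n l x z → time n l x y = l.length) ∧
      (time n l y z = time n l x z → time n l x z = l.length) ∧
      (time n l x y = time n l y z → time n l x y = l.length) := by
  refine ⟨fun e => ?_, fun e => ?_, fun e => ?_⟩
  all_goals
    by_contra hne
    have hlt := lt_of_le_of_ne (time_le n l _ _) hne
  · obtain ⟨m, h1, h2⟩ := h.exists_translate e hlt
    omega
  · obtain ⟨m, h1, h2⟩ := h.exists_translate e.symm hlt
    omega
  · obtain ⟨m, h1, h2⟩ := h.exists_translate e hlt
    -- Here `y` would be a translate of `x`, and congruent entries are never inverted.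
    have h3 := (h.time_lt_length x y).mp hlt
    rw [h1] at h3
    exact not_invd_add (wordProd_periodic n l) x m h3

/-- The prefix has the same inversions at each of its steps, so passing to it truncates all times at
its length. -/
theorem Asc.time_append {n : ℕ} {l l' : List (ZMod n)} (h : Asc n 1 (l ++ l')) (x y : ℤ) :
    time n l x y = min (time n (l ++ l') x y) l.length := by
  have h' := (asc_append.mp h).1
  have h1 := time_le n l x y
  have h2 : ∀ k ≤ l.length, time n l x y < k ↔ time n (l ++ l') x y < k := by
    intro k hk
    rw [h.time_lt_iff (by simp; omega), h'.time_lt_iff hk, prefixProd_append_left hk]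
  have h3 := h2 (time n l x y)
  have h4 := h2 l.length le_rfl
  have h5 := h2 (time n l x y + 1)
  omega

/-- Replacing a factor of a word by a word of the same length with the same product changes the
times only within that factor. -/
theorem Asc.time_window {n : ℕ} {l₁ l₂ m m' : List (ZMod n)} (h : Asc n 1 (l₁ ++ m ++ l₂))
    (h' : Asc n 1 (l₁ ++ m' ++ l₂)) (hlen : m.length = m'.length)
    (hprod : wordProd n m = wordProd n m') (x y : ℤ) :
    time n (l₁ ++ m' ++ l₂) x y = time n (l₁ ++ m ++ l₂) x y ∨
      (l₁.length ≤ time n (l₁ ++ m ++ l₂) x y ∧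
        time n (l₁ ++ m ++ l₂) x y < l₁.length + m.length ∧
        l₁.length ≤ time n (l₁ ++ m' ++ l₂) x y ∧
        time n (l₁ ++ m' ++ l₂) x y < l₁.length + m.length) := by
  have h1 := time_le n (l₁ ++ m ++ l₂) x y
  have h2 := time_le n (l₁ ++ m' ++ l₂) x y
  -- A threshold outside the factor is tested on a product that is the same for both words.
  have h3 : ∀ k ≤ (l₁ ++ m ++ l₂).length, (k ≤ l₁.length ∨ l₁.length + m.length ≤ k) →
      (time n (l₁ ++ m ++ l₂) x y < k ↔ time n (l₁ ++ m' ++ l₂) x y < k) := by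
    intro k hk hk'
    rw [h.time_lt_iff hk, h'.time_lt_iff (by simp at hk ⊢; omega)]
    rcases hk' with hk' | hk'
    · rw [List.append_assoc, List.append_assoc, prefixProd_append_left hk',
        prefixProd_append_left hk']
    · obtain ⟨j, rfl⟩ := Nat.exists_eq_add_of_le hk'
      have e1 : l₁.length + m.length + j = (l₁ ++ m).length + j := by simp
      have e2 : l₁.length + m.length + j = (l₁ ++ m').length + j := by simp [hlen]
      conv_lhs => rw [e1, prefixProd_append_right]
      conv_rhs => rw [e2, prefixProd_append_right]
      rw [wordProd_append, wordProd_append, hprod]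
  simp only [List.length_append] at h1 h2 h3
  set t := time n (l₁ ++ m ++ l₂) x y
  set t' := time n (l₁ ++ m' ++ l₂) x y
  have h4 := h3 t
  have h5 := h3 t'
  have h6 := h3 (t + 1)
  have h7 := h3 (t' + 1)
  have h8 := h3 l₁.length
  have h9 := h3 (l₁.length + m.length)
  omega

end AffineBruhat

namespace AffineBruhat

/-! ### Triples -/

/-- Consistency of a translation invariant set of increasing triples of integers with respect to
`w`. Congruent entries are covered by the cases with a pair that is not inverted. -/
structure TripleCons (n : ℕ) (w : Equiv.Perm ℤ) (R : ℤ → ℤ → ℤ → Prop) : Prop where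
  subset : ∀ {a b c}, R a b c → Invd w a b ∧ Invd w b c
  translate : ∀ {a b c} (m : ℤ), R a b c → R (a + m * n) (b + m * n) (c + m * n)
  full : ∀ {a b c d}, Invd w a b → Invd w b c → Invd w c d →
    ((R b c d → R a c d) ∧ (R a c d → R a b d) ∧ (R a b d → R a b c)) ∨
      ((R a b c → R a b d) ∧ (R a b d → R a c d) ∧ (R a c d → R b c d))
  first : ∀ {a b c d}, a < b → ¬ Invd w a b → Invd w a c → Invd w b c → Invd w c d →
    R b c d → R a c d
  middle : ∀ {a b c d}, b < c → ¬ Invd w b c → Invd w a b → Invd w a c → Invd w b d → Invd w c d →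
    R a b d → R a c d
  last : ∀ {a b c d}, c < d → ¬ Invd w c d → Invd w a b → Invd w b c → Invd w b d →
    R a b d → R a b c

/-- The triple `a < b < c` of inverted pairs is reversed by the word. -/
def RevP (n : ℕ) (l : List (ZMod n)) (a b c : ℤ) : Prop :=
  a < b ∧ b < c ∧ time n l b c < time n l a b ∧ time n l a b < l.length

/-- The middle crossing of each of the four triples lies between the other two. With the convention
that an uncrossed pair has the length as its time, each condition is then a statement of linear
arithmetic about six times. -/
theorem Asc.tripleCons {n : ℕ} {l : List (ZMod n)} (h : Asc n 1 l) :
    TripleCons n (wordProd n l) (RevP n l) where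
  subset := by
    intro a b c ⟨_, _, h3, h4⟩
    rw [← h.time_lt_length, ← h.time_lt_length]
    omega
  translate := by
    intro a b c m ⟨h1, h2, h3, h4⟩
    refine ⟨by omega, by omega, ?_⟩
    simp only [time_translate]
    exact ⟨h3, h4⟩
  full := by
    intro a b c d hab hbc hcd
    have l1 := hab.1
    have l2 := hbc.1
    have l3 := hcd.1
    rw [← h.time_lt_length] at hab hbc hcd
    have b1 := h.time_between l1 l2
    have b2 := h.time_between l1 (l2.trans l3)
    have b3 := h.time_between (l1.trans l2) l3
    have b4 := h.time_between l2 l3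
    have d1 := h.time_ne l1 l2
    have d2 := h.time_ne l1 (l2.trans l3)
    have d3 := h.time_ne (l1.trans l2) l3
    have d4 := h.time_ne l2 l3
    simp only [RevP]
    omega
  first := by
    intro a b c d l1 hab hac hbc hcd
    have l2 := hbc.1
    have l3 := hcd.1
    rw [← h.time_lt_length] at hab hbc hac hcd
    have b1 := h.time_between l1 l2
    have b2 := h.time_between l1 (l2.trans l3)
    have b3 := h.time_between (l1.trans l2) l3
    have b4 := h.time_between l2 l3
    simp only [RevP]
    omega
  middle := by
    intro a b c d l2 hbc hab hac hbd hcd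
    have l1 := hab.1
    have l3 := hcd.1
    rw [← h.time_lt_length] at hab hbc hac hcd hbd
    have b1 := h.time_between l1 l2
    have b2 := h.time_between l1 (l2.trans l3)
    have b3 := h.time_between (l1.trans l2) l3
    have b4 := h.time_between l2 l3
    simp only [RevP]
    omega
  last := by
    intro a b c d l3 hcd hab hbc hbd
    have l1 := hab.1
    have l2 := hbc.1
    rw [← h.time_lt_length] at hab hbc hcd hbd
    have b1 := h.time_between l1 l2
    have b2 := h.time_between l1 (l2.trans l3)
    have b3 := h.time_between (l1.trans l2) l3
    have b4 := h.time_between l2 l3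
    simp only [RevP]
    omega

/-! ### The order of the crossings on a line -/

/-- The pair `x`, `y` is inverted, in either order. -/
def Crosses (w : Equiv.Perm ℤ) (x y : ℤ) : Prop := Invd w x y ∨ Invd w y x

/-- The triple `a < b < c` is antilexicographically ordered. -/
def Anti (w : Equiv.Perm ℤ) (R : ℤ → ℤ → ℤ → Prop) (a b c : ℤ) : Prop :=
  -- If only `a b` is not inverted, its crossing counts as being at infinity, which puts `b c`
  -- before `a c`. If only `b c` is not inverted, the triple counts as lexicographic.
  R a b c ∨ (¬ Invd w a b ∧ Invd w a c ∧ Invd w b c)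

/-- The triple consisting of `y` and `u < v` is antilexicographically ordered. -/
def AntiAt (w : Equiv.Perm ℤ) (R : ℤ → ℤ → ℤ → Prop) (y u v : ℤ) : Prop :=
  (y < u ∧ Anti w R y u v) ∨ (u < y ∧ y < v ∧ Anti w R u y v) ∨ (v < y ∧ Anti w R u v y)

/-- On the line `y`, the crossing with `u` comes before the crossing with `v`. -/
def Before (w : Equiv.Perm ℤ) (R : ℤ → ℤ → ℤ → Prop) (y u v : ℤ) : Prop :=
  Crosses w y u ∧ Crosses w y v ∧
    ((u < v ∧ ¬ AntiAt w R y u v) ∨ (v < u ∧ AntiAt w R y v u))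

theorem crosses_ne {w : Equiv.Perm ℤ} {x y : ℤ} (h : Crosses w x y) : x ≠ y := by
  rintro rfl
  rcases h with h | h <;> exact absurd h.1 (lt_irrefl _)

section

variable {n : ℕ} {w : Equiv.Perm ℤ} {R : ℤ → ℤ → ℤ → Prop}

/-- These two implications exclude cycles among three crossings on the line `y`. For each of the
four places of `y` among `u < v < z` they follow from the consistency conditions on the four triples
of these lines. -/
theorem TripleCons.not_alternating (hR : TripleCons n w R) {y u v z : ℤ} (huv : u < v)
    (hvz : v < z) (hu : Crosses w y u) (hv : Crosses w y v) (hz : Crosses w y z) :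
    (AntiAt w R y u v → AntiAt w R y v z → AntiAt w R y u z) ∧
      (AntiAt w R y u z → AntiAt w R y u v ∨ AntiAt w R y v z) := by
  -- All constraints on four lines are collected as propositional facts, so that each of the four
  -- cases below becomes a finite check.
  have key : ∀ a b c d : ℤ, a < b → b < c → c < d →
      (Invd w a b → Invd w b c → Invd w a c) ∧ (Invd w a b → Invd w b d → Invd w a d) ∧
      (Invd w a c → Invd w c d → Invd w a d) ∧ (Invd w b c → Invd w c d → Invd w b d) ∧
      (Invd w a c → Invd w a b ∨ Invd w b c) ∧ (Invd w a d → Invd w a b ∨ Invd w b d) ∧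
      (Invd w a d → Invd w a c ∨ Invd w c d) ∧ (Invd w b d → Invd w b c ∨ Invd w c d) ∧
      (R a b c → Invd w a b ∧ Invd w b c) ∧ (R a b d → Invd w a b ∧ Invd w b d) ∧
      (R a c d → Invd w a c ∧ Invd w c d) ∧ (R b c d → Invd w b c ∧ Invd w c d) ∧
      (Invd w a b → Invd w b c → Invd w c d →
        ((R b c d → R a c d) ∧ (R a c d → R a b d) ∧ (R a b d → R a b c)) ∨
        ((R a b c → R a b d) ∧ (R a b d → R a c d) ∧ (R a c d → R b c d))) ∧
      (¬ Invd w a b → Invd w a c → Invd w b c → Invd w c d → R b c d → R a c d) ∧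
      (¬ Invd w b c → Invd w a b → Invd w a c → Invd w b d → Invd w c d → R a b d → R a c d) ∧
      (¬ Invd w c d → Invd w a b → Invd w b c → Invd w b d → R a b d → R a b c) := by
    intro a b c d h1 h2 h3
    exact ⟨Invd.trans, Invd.trans, Invd.trans, Invd.trans, fun h => h.split h1 h2,
      fun h => h.split h1 (h2.trans h3), fun h => h.split (h1.trans h2) h3, fun h => h.split h2 h3,
      hR.subset, hR.subset, hR.subset, hR.subset, hR.full, hR.first h1, hR.middle h2, hR.last h3⟩
  have hlt : ∀ {x y : ℤ}, Invd w x y → x < y := fun h => h.1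
  have n1 := crosses_ne hu
  have n2 := crosses_ne hv
  have n3 := crosses_ne hz
  simp only [AntiAt, Anti]
  rcases lt_or_gt_of_ne n1 with h1 | h1
  · have k := key _ _ _ _ h1 huv hvz
    have c1 : ¬ Invd w u y := fun h => by have := h.1; omega
    have c2 : ¬ Invd w v y := fun h => by have := h.1; omega
    have c3 : ¬ Invd w z y := fun h => by have := h.1; omega
    simp only [Crosses, c1, c2, c3, or_false] at hu hv hz
    simp only [h1, h1.trans huv, (h1.trans huv).trans hvz, not_lt_of_gt h1,
      not_lt_of_gt (h1.trans huv), not_lt_of_gt ((h1.trans huv).trans hvz), true_and, false_and,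
      or_false, hu, hv, hz, not_true_eq_false] at k ⊢
    clear n1 n2 n3 hR key
    grind
  rcases lt_or_gt_of_ne n2 with h2 | h2
  · have k := key _ _ _ _ h1 h2 hvz
    have c1 : ¬ Invd w y u := fun h => by have := h.1; omega
    have c2 : ¬ Invd w v y := fun h => by have := h.1; omega
    have c3 : ¬ Invd w z y := fun h => by have := h.1; omega
    simp only [Crosses, c1, c2, c3, or_false, false_or] at hu hv hz
    simp only [h1, h2, h2.trans hvz, not_lt_of_gt h1,
      not_lt_of_gt h2, not_lt_of_gt (h2.trans hvz), true_and, false_and,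
      or_false, hu, hv, hz, not_true_eq_false, false_or] at k ⊢
    clear n1 n2 n3 hR key
    grind
  rcases lt_or_gt_of_ne n3 with h3 | h3
  · have k := key _ _ _ _ huv h2 h3
    have c1 : ¬ Invd w y u := fun h => by have := h.1; omega
    have c2 : ¬ Invd w y v := fun h => by have := h.1; omega
    have c3 : ¬ Invd w z y := fun h => by have := h.1; omega
    simp only [Crosses, c1, c2, c3, or_false, false_or] at hu hv hz
    simp only [h1, h2, h3, not_lt_of_gt h1,
      not_lt_of_gt h2, not_lt_of_gt h3, true_and, false_and,
      or_false, hu, hv, hz, not_true_eq_false, false_or] at k ⊢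
    clear n1 n2 n3 hR key
    grind
  · have k := key _ _ _ _ huv hvz h3
    have c1 : ¬ Invd w y u := fun h => by have := h.1; omega
    have c2 : ¬ Invd w y v := fun h => by have := h.1; omega
    have c3 : ¬ Invd w y z := fun h => by have := h.1; omega
    simp only [Crosses, c1, c2, c3, false_or] at hu hv hz
    simp only [h1, h2, h3, not_lt_of_gt h1,
      not_lt_of_gt h2, not_lt_of_gt h3, true_and, false_and,
      or_false, hu, hv, hz, not_true_eq_false, false_or] at k ⊢
    clear n1 n2 n3 hR key
    grind

theorem TripleCons.before_trans (hR : TripleCons n w R) {y u v z : ℤ} (h : Before w R y u v)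
    (h' : Before w R y v z) : Before w R y u z := by
  obtain ⟨hu, hv, h1⟩ := h
  obtain ⟨_, hz, h2⟩ := h'
  refine ⟨hu, hz, ?_⟩
  rcases h1 with ⟨l1, a1⟩ | ⟨l1, a1⟩ <;> rcases h2 with ⟨l2, a2⟩ | ⟨l2, a2⟩
  · have := hR.not_alternating l1 l2 hu hv hz
    exact .inl ⟨l1.trans l2, by grind⟩
  · rcases lt_trichotomy u z with l3 | rfl | l3
    · have := hR.not_alternating l3 l2 hu hz hv
      exact .inl ⟨l3, by grind⟩
    · contradiction
    · have := hR.not_alternating l3 l1 hz hu hv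
      exact .inr ⟨l3, by grind⟩
  · rcases lt_trichotomy u z with l3 | rfl | l3
    · have := hR.not_alternating l1 l3 hv hu hz
      exact .inl ⟨l3, by grind⟩
    · contradiction
    · have := hR.not_alternating l2 l3 hv hz hu
      exact .inr ⟨l3, by grind⟩
  · have := hR.not_alternating l2 l1 hz hv hu
    exact .inr ⟨l2.trans l1, by grind⟩

theorem before_total {y u v : ℤ} (hu : Crosses w y u) (hv : Crosses w y v) (huv : u ≠ v) :
    Before w R y u v ∨ Before w R y v u := by
  rcases lt_or_gt_of_ne huv with h | h <;> simp only [Before, hu, hv, h, true_and] <;> grind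

theorem not_before_self {y u : ℤ} : ¬ Before w R y u u := by
  simp [Before]

theorem exists_last_of_finite {α : Type*} {s : Set α} (hs : s.Finite) (hne : s.Nonempty)
    {r : α → α → Prop} (htrans : ∀ a b c, r a b → r b c → r a c) (hirr : ∀ a, ¬ r a a) :
    ∃ a ∈ s, ∀ b ∈ s, ¬ r a b := by
  let t : α → α → Prop := fun a b => r b a
  have : IsStrictOrder α t :=
    { irrefl := hirr, trans := fun a b c h h' => htrans _ _ _ h' h }
  have hwf : s.WellFoundedOn t := hs.wellFoundedOn
  rw [Set.wellFoundedOn_iff_no_descending_seq] at hwf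
  by_contra! hcon
  have : ∀ a : s, ∃ b : s, r a b := fun a => by
    obtain ⟨b, hb, h⟩ := hcon a.1 a.2
    exact ⟨⟨b, hb⟩, h⟩
  choose f hf using this
  obtain ⟨a, ha⟩ := hne
  have hstep : ∀ k : ℕ, t ((f^[k + 1] ⟨a, ha⟩ : s) : α) ((f^[k] ⟨a, ha⟩ : s) : α) := by
    intro k
    rw [Function.iterate_succ_apply']
    exact hf _
  exact hwf (RelEmbedding.natGT (fun k => ((f^[k] ⟨a, ha⟩ : s) : α)) hstep)
    (by intro k; exact (f^[k] ⟨a, ha⟩ : s).2)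

/-- The displacement is periodic, so its absolute value is bounded by the sum of its absolute values
over one period. -/
theorem Periodic.exists_bound (hn : 0 < n) {u : Equiv.Perm ℤ} (hu : Periodic n u) :
    ∃ B : ℤ, ∀ x, |u x - x| ≤ B := by
  refine ⟨∑ i ∈ Finset.range n, |u (i : ℤ) - i|, fun x => ?_⟩
  have h1 := Int.emod_nonneg x (show (n : ℤ) ≠ 0 by omega)
  have h2 := Int.emod_lt_of_pos x (show (0 : ℤ) < n by omega)
  have h3 : x = x % n + x / n * n := by
    have := Int.emod_add_mul_ediv x n
    linarith
  have h4 : |u x - x| = |u ((x % n).toNat : ℤ) - ((x % n).toNat : ℤ)| := by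
    rw [Int.toNat_of_nonneg h1]
    conv_lhs => rw [h3, hu.apply]
    congr 1
    ring
  rw [h4]
  exact Finset.single_le_sum (f := fun i : ℕ => |u (i : ℤ) - i|) (fun i _ => abs_nonneg _)
    (by simp; omega)

theorem Periodic.exists_invd_bound (hn : 0 < n) (hw : Periodic n w) :
    ∃ B : ℤ, ∀ x y, Invd w x y → y < x + B := by
  obtain ⟨B, hB⟩ := hw.symm.exists_bound hn
  -- The inverse of `w` moves each of the two entries by at most `B`, so it cannot reverse entries
  -- at distance `2 * B` or more.
  refine ⟨2 * B, fun x y h => ?_⟩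
  have h1 := abs_le.mp (hB x)
  have h2 := abs_le.mp (hB y)
  have := h.2
  omega

theorem Periodic.finite_crosses (hn : 0 < n) (hw : Periodic n w) (y : ℤ) :
    {u | Crosses w y u}.Finite := by
  obtain ⟨B, hB⟩ := hw.exists_invd_bound hn
  refine (Set.finite_Icc (y - B) (y + B)).subset ?_
  rintro u (h | h)
  · have := hB _ _ h
    have := h.1
    simp only [Set.mem_Icc]
    omega
  · have := hB _ _ h
    have := h.1
    simp only [Set.mem_Icc]
    omega

theorem TripleCons.exists_last (hR : TripleCons n w R) (hn : 0 < n) (hw : Periodic n w) {y z : ℤ}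
    (h : Crosses w y z) : ∃ u, Crosses w y u ∧ ∀ v, ¬ Before w R y u v := by
  obtain ⟨u, hu, h1⟩ := exists_last_of_finite (hw.finite_crosses hn y) ⟨z, h⟩
    (r := Before w R y) (fun _ _ _ => hR.before_trans) (fun _ => not_before_self)
  exact ⟨u, hu, fun v hv => h1 v hv.2.1 hv⟩

/-- There is a pair whose crossing is the last one on both of its lines. -/
theorem TripleCons.exists_last_both (hR : TripleCons n w R) (hn : 0 < n) (hw : Periodic n w)
    (hne : ∃ x y, Invd w x y) :
    ∃ y z, Crosses w y z ∧ (∀ v, ¬ Before w R y z v) ∧ ∀ v, ¬ Before w R z y v := by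
  let S : Set (ℤ × ℤ) := {q | Crosses w q.1 q.2 ∧ ∀ v, ¬ Before w R q.1 q.2 v}
  have hS : S.Nonempty := by
    obtain ⟨x, y, h⟩ := hne
    obtain ⟨u, hu⟩ := hR.exists_last hn hw (.inl h : Crosses w x y)
    exact ⟨(x, u), hu⟩
  -- Among the lines `y` with last crossing `z`, choose one for which the positions of `y` and `z`
  -- in `w` are closest. If the last crossing on `z` were with another line `v`, then in every
  -- arrangement of the three lines compatible with `h1` and `h3` the position of `v` would be
  -- nearer to that of `z` than the position of `y` is, against minimality.
  obtain ⟨⟨y, z⟩, ⟨hyz, hlast⟩, hmin⟩ :=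
    (measure fun q : ℤ × ℤ => (w.symm q.1 - w.symm q.2).natAbs).wf.has_min S hS
  simp only at hyz hlast
  refine ⟨y, z, hyz, hlast, ?_⟩
  by_contra! hcon
  obtain ⟨v₀, hv₀⟩ := hcon
  obtain ⟨v, hzv, hv⟩ := hR.exists_last hn hw hyz.symm
  have hvy : v ≠ y := by
    rintro rfl
    exact hv _ hv₀
  have h1 : Before w R z y v :=
    (before_total hyz.symm hzv hvy.symm).resolve_right (hv y)
  have h2 := hmin (z, v) ⟨hzv, hv⟩
  have h3 : Crosses w y v → Before w R y v z := fun h =>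
    (before_total h hyz (crosses_ne hzv).symm).resolve_right (hlast v)
  have hd1 : w.symm y ≠ w.symm v := by simpa using hvy.symm
  have hd2 : w.symm y ≠ w.symm z := by simpa using crosses_ne hyz
  have hd3 : w.symm z ≠ w.symm v := by simpa using crosses_ne hzv
  have n1 := crosses_ne hyz
  have n2 := crosses_ne hzv
  have hsub : ∀ {a b c}, R a b c → Invd w a b ∧ Invd w b c := hR.subset
  simp only [WellFoundedRelation.rel, InvImage] at h2
  simp only [Before, AntiAt, Anti] at h1 h3
  simp only [Crosses] at hyz hzv h1 h3
  have e : ∀ a b, Invd w a b ↔ a < b ∧ w.symm b < w.symm a := fun _ _ => Iff.rfl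
  have s1 := @hsub y z v
  have s2 := @hsub y v z
  have s3 := @hsub z y v
  have s4 := @hsub z v y
  have s5 := @hsub v y z
  have s6 := @hsub v z y
  simp only [e] at *
  generalize w.symm y = p at *
  generalize w.symm z = q at *
  generalize w.symm v = r at *
  clear hsub e hv₀ hv hlast hmin hn hw hR
  rcases lt_or_gt_of_ne n1 with l1 | l1 <;> rcases lt_or_gt_of_ne n2 with l2 | l2 <;>
    rcases lt_or_gt_of_ne hvy with l3 | l3 <;>
    grind

end

end AffineBruhat

/-! ### Words with a prescribed consistent set of reversed triples -/

namespace AffineBruhat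

section

variable {n : ℕ} {w : Equiv.Perm ℤ} {R : ℤ → ℤ → ℤ → Prop}

/-- There is a pair of values with adjacent positions that can be inverted last. -/
theorem TripleCons.exists_last_pair (hR : TripleCons n w R) (hn : 0 < n) (hw : Periodic n w)
    (hne : ∃ x y, Invd w x y) :
    ∃ x y, Invd w x y ∧ w.symm x = w.symm y + 1 ∧ (∀ z, Invd w y z → R x y z) ∧
      ∀ z, Invd w z x → ¬ R z x y := by
  have main : ∀ x y, Invd w x y → (∀ v, ¬ Before w R x y v) → (∀ v, ¬ Before w R y x v) →
      ∃ x y, Invd w x y ∧ w.symm x = w.symm y + 1 ∧ (∀ z, Invd w y z → R x y z) ∧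
        ∀ z, Invd w z x → ¬ R z x y := by
    intro x y hxy hx hy
    refine ⟨x, y, hxy, ?_, fun z hz => ?_, fun z hz => ?_⟩
    · obtain ⟨h1, h2⟩ := hxy
      by_contra h3
      -- A line at the position right after `y` would cross `x` or `y`. Wherever its value lies
      -- relative to `x < y`, one of these crossings would come after the crossing of `x` and `y`.
      obtain ⟨v, hv⟩ : ∃ v, w.symm v = w.symm y + 1 := ⟨w (w.symm y + 1), by simp⟩
      have n1 : v ≠ x := by
        rintro rfl
        exact h3 hv
      have n2 : v ≠ y := by
        rintro rfl
        omega
      have hx := hx v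
      have hy := hy v
      have s1 := @hR.subset x y v
      have s2 := @hR.subset x v y
      have s3 := @hR.subset v x y
      simp only [Before, AntiAt, Anti, Crosses, Invd] at hx hy s1 s2 s3
      rw [hv] at hx hy s1 s2 s3
      generalize w.symm x = p at *
      generalize w.symm y = q at *
      clear hR hw hne hv
      rcases lt_or_gt_of_ne n1 with l1 | l1 <;> rcases lt_or_gt_of_ne n2 with l2 | l2 <;> grind
    · by_contra h
      have h1 := hxy.1
      have h2 := hz.1
      refine hy z ⟨.inr hxy, .inl hz, .inl ⟨h1.trans h2, ?_⟩⟩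
      rintro (h3 | ⟨_, _, h3⟩ | h3)
      · omega
      · exact h3.elim h fun h4 => h4.1 hxy
      · omega
    · intro h
      have h1 := hxy.1
      have h2 := hz.1
      exact hx z ⟨.inl hxy, .inr hz, .inr ⟨h2.trans h1, .inr (.inl ⟨h2, h1, .inl h⟩)⟩⟩
  obtain ⟨y, z, h | h, h1, h2⟩ := hR.exists_last_both hn hw hne
  · exact main _ _ h h1 h2
  · exact main _ _ h h2 h1

/-- A pair inverted in `w` but not in `u` is a translate of `x y`. By `h1` and `h2` all triples that
begin with it belong to `R` and none that end with it does. Hence the conditions for `u` at such a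
pair are instances of `full` for `w`. -/
theorem TripleCons.of_mul_simple (hR : TripleCons n w R) {u : Equiv.Perm ℤ} {x y : ℤ}
    (hw : Periodic n w)
    (hu : ∀ a b, Invd w a b ↔ Invd u a b ∨ ∃ m : ℤ, a = x + m * n ∧ b = y + m * n)
    (hup : Periodic n u)
    (h1 : ∀ z, Invd w y z → R x y z) (h2 : ∀ z, Invd w z x → ¬ R z x y) :
    TripleCons n u fun a b c => R a b c ∧ Invd u a b ∧ Invd u b c := by
  have hq : ∀ a b c, ¬ Invd u a b → Invd w a b → Invd w b c → R a b c := by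
    intro a b c h3 h4 h5
    obtain ⟨m, rfl, rfl⟩ := ((hu a b).mp h4).resolve_left h3
    have e : c = (c + (-m) * n) + m * n := by ring
    rw [e] at h5 ⊢
    rw [invd_translate hw] at h5
    exact hR.translate m (h1 _ h5)
  have hq' : ∀ a b c, ¬ Invd u b c → Invd w b c → Invd w a b → ¬ R a b c := by
    intro a b c h3 h4 h5 h6
    obtain ⟨m, rfl, rfl⟩ := ((hu b c).mp h4).resolve_left h3
    have h7 := hR.translate (-m) h6
    rw [← invd_translate hw _ _ (-m)] at h5
    rw [show x + m * n + -m * n = x by ring] at h5 h7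
    rw [show y + m * n + -m * n = y by ring] at h7
    exact h2 _ h5 h7
  have huw : ∀ {a b}, Invd u a b → Invd w a b := fun h => (hu _ _).mpr (.inl h)
  refine ⟨fun h => h.2, ?_, ?_, ?_, ?_, ?_⟩
  · intro a b c m h
    simp only [invd_translate hup]
    exact ⟨hR.translate m h.1, h.2⟩
  · intro a b c d hab hbc hcd
    have := hR.full (huw hab) (huw hbc) (huw hcd)
    have h3 := hab.trans hbc
    have h4 := hbc.trans hcd
    simp only [hab, hbc, hcd, h3, h4, and_true]
    exact this
  · intro a b c d hl hab hac hbc hcd ⟨h, _⟩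
    refine ⟨?_, hac, hcd⟩
    by_cases h3 : Invd w a b
    · have := hR.full h3 (huw hbc) (huw hcd)
      have h4 := hq a b c hab h3 (huw hbc)
      have h5 := hq a b d hab h3 (huw (hbc.trans hcd))
      tauto
    · exact hR.first hl h3 (huw hac) (huw hbc) (huw hcd) h
  · intro a b c d hl hbc hab hac hbd hcd ⟨h, _⟩
    refine ⟨?_, hac, hcd⟩
    by_cases h3 : Invd w b c
    · have := hR.full (huw hab) h3 (huw hcd)
      have h4 := hq b c d hbc h3 (huw hcd)
      have h5 := hq' a b c hbc h3 (huw hab)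
      tauto
    · exact hR.middle hl h3 (huw hab) (huw hac) (huw hbd) (huw hcd) h
  · intro a b c d hl hcd hab hbc hbd ⟨h, _⟩
    refine ⟨?_, hab, hbc⟩
    by_cases h3 : Invd w c d
    · have := hR.full (huw hab) (huw hbc) h3
      have h4 := hq' a c d hcd h3 (huw (hab.trans hbc))
      have h5 := hq' b c d hcd h3 (huw hbc)
      tauto
    · exact hR.last hl h3 (huw hab) (huw hbc) (huw hbd) h

/-- The crossing made by the last letter is later than all others, so the newly reversed triples are
those that begin with it and whose last two lines have already crossed. -/
theorem Asc.revP_append_singleton {l : List (ZMod n)} {j : ZMod n} (h : Asc n 1 (l ++ [j]))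
    (a b c : ℤ) : RevP n (l ++ [j]) a b c ↔ RevP n l a b c ∨
      (time n (l ++ [j]) a b = l.length ∧ time n (l ++ [j]) b c < l.length) := by
  have h1 := h.time_append a b
  have h2 := h.time_append b c
  have h3 := @Asc.lt_of_time n _ h a b
  have h4 := @Asc.lt_of_time n _ h b c
  simp only [RevP, List.length_append, List.length_singleton] at *
  omega

/-- Counting the inversions with first entry in a window counts the translation classes of
inversions. This is the measure for the construction of words. -/
theorem Periodic.finite_windowInv (hn : 0 < n) (hw : Periodic n w) :
    {q : ℤ × ℤ | (0 ≤ q.1 ∧ q.1 < n) ∧ Invd w q.1 q.2}.Finite := by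
  obtain ⟨B, hB⟩ := hw.exists_invd_bound hn
  refine ((Set.finite_Ico (0 : ℤ) n).prod (Set.finite_Ico (0 : ℤ) (n + B))).subset ?_
  rintro ⟨x, y⟩ ⟨⟨h1, h2⟩, h3⟩
  have h4 := h3.1
  have h5 := hB _ _ h3
  simp only [Set.mem_prod, Set.mem_Ico] at *
  omega

/-- Existence of a word with a given consistent set of reversed triples. -/
theorem TripleCons.exists_word (hn : 0 < n) (hw : IsAffinePerm n w) (hR : TripleCons n w R) :
    ∃ l, Asc n 1 l ∧ wordProd n l = w ∧ ∀ a b c, RevP n l a b c ↔ R a b c := by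
  induction hN : {q : ℤ × ℤ | (0 ≤ q.1 ∧ q.1 < n) ∧ Invd w q.1 q.2}.ncard
    using Nat.strong_induction_on generalizing w R with
  | _ N ih =>
  subst hN
  by_cases hne : ∃ x y, Invd w x y
  -- The values `y` and `x` stand at the positions `a` and `a + 1` of `w`. Exchanging them undoes
  -- the crossing that is to be the last one.
  · obtain ⟨x, y, hxy, hpos, h1, h2⟩ := hR.exists_last_pair hn hw.per hne
    have hn1 : n ≠ 1 := by
      rintro rfl
      exact hxy.not_modEq hw.per (by simpa using Int.modEq_one)
    set a := w.symm y
    set j : ZMod n := (a : ZMod n)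
    set u := w * simpleTransposition n j
    have hua : u a = x := by
      simp only [u, Equiv.Perm.mul_apply]
      rw [simple_of_eq hn1 rfl, ← hpos, Equiv.apply_symm_apply]
    have hua' : u (a + 1) = y := by
      simp only [u, Equiv.Perm.mul_apply]
      rw [simple_of_eq_add_one hn1 (by push_cast; rfl), add_sub_cancel_right,
        Equiv.apply_symm_apply]
    have hwu : w = u * simpleTransposition n j := by
      simp only [u, mul_assoc, simple_mul_self, mul_one]
    have hu : IsAffinePerm n u := hw.mul (isAffinePerm_simple n j)
    have hlt : u a < u (a + 1) := by rw [hua, hua']; exact hxy.1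
    have hstep : ∀ p q, Invd w p q ↔ Invd u p q ∨ ∃ m : ℤ, p = x + m * n ∧ q = y + m * n := by
      intro p q
      conv_lhs => rw [hwu]
      rw [invd_mul_simple hn1 hu.per rfl hlt, hua, hua']
    have hR' := hR.of_mul_simple hw.per hstep hu.per h1 h2
    have hux : ¬ Invd u x y := by
      intro h
      have := h.2
      rw [← hua, ← hua'] at this
      simp at this
    obtain ⟨l, hl, hprod, hrev⟩ := ih _ (by
      refine Set.ncard_lt_ncard ?_ (hw.per.finite_windowInv hn)
      -- The translate of `x y` whose first entry lies in the window is counted for `w` and not for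
      -- `u`.
      refine ⟨fun q hq => ⟨hq.1, (hstep _ _).mpr (.inl hq.2)⟩, fun hsub => ?_⟩
      have e1 := Int.emod_nonneg x (show (n : ℤ) ≠ 0 by omega)
      have e2 := Int.emod_lt_of_pos x (show (0 : ℤ) < n by omega)
      have e3 : x % n = x + (-(x / n)) * n := by
        have := Int.emod_add_mul_ediv x n
        linarith
      have h3 : (x % n, y + (-(x / n)) * n) ∈
          {q : ℤ × ℤ | (0 ≤ q.1 ∧ q.1 < n) ∧ Invd w q.1 q.2} := by
        refine ⟨⟨e1, e2⟩, ?_⟩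
        rw [e3, invd_translate hw.per]
        exact hxy
      have h4 := (hsub h3).2
      rw [e3, invd_translate hu.per] at h4
      exact hux h4) hu hR' rfl
    have hasc : Asc n 1 (l ++ [j]) := by
      refine asc_append.mpr ⟨hl, asc_singleton.mpr ⟨hn1, ?_⟩⟩
      rw [one_mul, hprod, lt_of_intCast_eq hu.per (intCast_cast' j)]
      exact hlt
    have hprod' : wordProd n (l ++ [j]) = w := by
      rw [wordProd_append, hprod, wordProd_singleton, hwu]
    refine ⟨l ++ [j], hasc, hprod', fun p q r => ?_⟩
    rw [hasc.revP_append_singleton, hrev]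
    have t1 := fun p q => hasc.time_lt_length p q
    have t2 := fun p q => hl.time_lt_length p q
    have t3 := fun p q => hasc.time_append p q
    rw [hprod'] at t1
    rw [hprod] at t2
    simp only [List.length_append, List.length_singleton] at t1
    have t4 : ∀ p q, time n (l ++ [j]) p q = l.length ↔ Invd w p q ∧ ¬ Invd u p q := by
      intro p q
      rw [← t1, ← t2, t3]
      omega
    have t5 : ∀ p q, time n (l ++ [j]) p q < l.length ↔ Invd u p q := by
      intro p q
      rw [← t2, t3]
      omega
    rw [t4, t5]
    constructor
    · rintro (h | ⟨⟨h3, h4⟩, h5⟩)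
      · exact h.1
      · obtain ⟨m, rfl, rfl⟩ := ((hstep _ _).mp h3).resolve_left h4
        have h6 : Invd w (y + m * n) r := (hstep _ _).mpr (.inl h5)
        have e : r = (r + (-m) * n) + m * n := by ring
        rw [e] at h6 ⊢
        rw [invd_translate hw.per] at h6
        exact hR.translate m (h1 _ h6)
    · intro h
      have h3 := hR.subset h
      by_cases h5 : Invd u q r
      · by_cases h4 : Invd u p q
        · exact .inl ⟨h, h4, h5⟩
        · exact .inr ⟨⟨h3.1, h4⟩, h5⟩
      · exfalso
        obtain ⟨m, rfl, rfl⟩ := ((hstep _ _).mp h3.2).resolve_left h5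
        have h7 := hR.translate (-m) h
        have h8 := h3.1
        rw [← invd_translate hw.per _ _ (-m)] at h8
        rw [show x + m * n + -m * n = x by ring] at h7 h8
        rw [show y + m * n + -m * n = y by ring] at h7
        exact h2 _ h8 h7
  · have hw1 : w = 1 := by
      refine perm_eq_of_invd_iff hn hw (IsAffinePerm.one n) fun x y => ?_
      exact ⟨fun h => (hne ⟨x, y, h⟩).elim, fun h => (not_invd_one _ _ h).elim⟩
    refine ⟨[], trivial, by rw [hw1, wordProd_nil], fun a b c => ⟨fun h => ?_, fun h => ?_⟩⟩
    · exact absurd h.2.2.2 (by simp)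
    · exact (hne ⟨a, b, (hR.subset h).1⟩).elim

end

end AffineBruhat

namespace AffineBruhat

section

variable {n : ℕ}

theorem one_ne_zero_zmod (hn : n ≠ 1) : (1 : ZMod n) ≠ 0 := by
  have : Nontrivial (ZMod n) := ZMod.nontrivial_iff.mpr hn
  exact one_ne_zero

theorem asc_cons_iff {u : Equiv.Perm ℤ} (hu : Periodic n u) {i : ZMod n} {p : ℤ}
    (hp : (p : ZMod n) = i) {l : List (ZMod n)} :
    Asc n u (i :: l) ↔ (n ≠ 1 ∧ u p < u (p + 1)) ∧ Asc n (u * simpleTransposition n i) l := by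
  rw [Asc, lt_of_intCast_eq hu (show ((i.cast : ℤ) : ZMod n) = p by rw [intCast_cast', hp])]

/-- The time of the pair inverted by a given letter. -/
theorem Asc.time_of_split {l₁ l₂ : List (ZMod n)} {i : ZMod n} (h : Asc n 1 (l₁ ++ i :: l₂))
    {p : ℤ} (hp : (p : ZMod n) = i) :
    time n (l₁ ++ i :: l₂) (wordProd n l₁ p) (wordProd n l₁ (p + 1)) = l₁.length := by
  have hlt : l₁.length < (l₁ ++ i :: l₂).length := by simp
  rw [h.time_eq_iff hlt]
  have h1 : prefixProd n (l₁ ++ i :: l₂) l₁.length = wordProd n l₁ := by simp [prefixProd]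
  have h2 : (l₁ ++ i :: l₂)[l₁.length] = i := by simp
  rw [h1, h2]
  have h3 : ((i.cast : ℤ) : ZMod n) = p := by rw [intCast_cast', hp]
  rw [ZMod.intCast_eq_intCast_iff] at h3
  obtain ⟨m, hm⟩ := h3.dvd
  refine ⟨m, ?_, ?_⟩ <;> rw [← (wordProd_periodic n l₁).apply] <;> congr 1 <;> linarith

/-! ### Commutations -/

theorem simple_mul_comm (hn : n ≠ 1) {i j : ZMod n} (h1 : j ≠ i) (h2 : j ≠ i + 1)
    (h3 : j ≠ i - 1) : simpleTransposition n i * simpleTransposition n j =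
      simpleTransposition n j * simpleTransposition n i := by
  have h4 : j + 1 ≠ i := fun e => h3 (by rw [← e]; ring)
  have h5 : j + 1 ≠ i + 1 := fun e => h1 (by simpa using e)
  ext x
  simp only [Equiv.Perm.mul_apply]
  by_cases e1 : (x : ZMod n) = i
  · have e2 : ((x + 1 : ℤ) : ZMod n) = i + 1 := by push_cast; rw [e1]
    rw [simple_of_ne (x := x) (i := j) (by rw [e1]; exact h1.symm) (by rw [e1]; exact h4.symm),
      simple_of_eq hn e1,
      simple_of_ne (x := x + 1) (by rw [e2]; exact h2.symm) (by rw [e2]; exact h5.symm)]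
  by_cases e2 : (x : ZMod n) = i + 1
  · have e3 : ((x - 1 : ℤ) : ZMod n) = i := by push_cast; rw [e2]; ring
    rw [simple_of_ne (x := x) (i := j) (by rw [e2]; exact h2.symm) (by rw [e2]; exact h5.symm),
      simple_of_eq_add_one hn e2,
      simple_of_ne (x := x - 1) (by rw [e3]; exact h1.symm) (by rw [e3]; exact h4.symm)]
  rw [simple_of_ne e1 e2]
  by_cases e3 : (x : ZMod n) = j
  · have e4 : ((x + 1 : ℤ) : ZMod n) = j + 1 := by push_cast; rw [e3]
    rw [simple_of_eq hn e3, simple_of_ne (by rw [e4]; exact h4) (by rw [e4]; exact h5)]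
  by_cases e4 : (x : ZMod n) = j + 1
  · have e5 : ((x - 1 : ℤ) : ZMod n) = j := by push_cast; rw [e4]; ring
    rw [simple_of_eq_add_one hn e4, simple_of_ne (by rw [e5]; exact h1) (by rw [e5]; exact h2)]
  rw [simple_of_ne e3 e4, simple_of_ne e1 e2]

theorem asc_pair_comm {u : Equiv.Perm ℤ} (hu : Periodic n u) {i j : ZMod n} (h1 : j ≠ i)
    (h2 : j ≠ i + 1) (h3 : j ≠ i - 1) (h : Asc n u [i, j]) : Asc n u [j, i] := by
  have h4 : j + 1 ≠ i := fun e => h3 (by rw [← e]; ring)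
  have h5 : j + 1 ≠ i + 1 := fun e => h1 (by simpa using e)
  obtain ⟨p, rfl⟩ := ZMod.intCast_surjective i
  obtain ⟨q, rfl⟩ := ZMod.intCast_surjective j
  rw [asc_cons_iff hu rfl, asc_cons_iff (hu.mul (simple_periodic n _)) rfl] at h ⊢
  simp only [Equiv.Perm.mul_apply] at h ⊢
  rw [simple_of_ne h1 h2, simple_of_ne (by push_cast; exact h4) (by push_cast; exact h5)] at h
  rw [simple_of_ne h1.symm (Ne.symm h4), simple_of_ne (by push_cast; exact h2.symm)
    (by push_cast; exact h5.symm)]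
  tauto

theorem Asc.ne_one {l : List (ZMod n)} (h : Asc n 1 l) (hl : l ≠ []) : n ≠ 1 := by
  cases l with
  | nil => exact absurd rfl hl
  | cons i l => exact h.1.1

/-- The effect of a commutation on an ascending word. -/
theorem Asc.comm {l₁ l₂ : List (ZMod n)} {i j : ZMod n} (h : Asc n 1 (l₁ ++ [i, j] ++ l₂))
    (h1 : j ≠ i) (h2 : j ≠ i + 1) (h3 : j ≠ i - 1) :
    Asc n 1 (l₁ ++ [j, i] ++ l₂) ∧ wordProd n (l₁ ++ [j, i] ++ l₂) = wordProd n (l₁ ++ [i, j] ++ l₂)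
      ∧ ∀ a b, time n (l₁ ++ [j, i] ++ l₂) a b =
        if time n (l₁ ++ [i, j] ++ l₂) a b = l₁.length then l₁.length + 1
        else if time n (l₁ ++ [i, j] ++ l₂) a b = l₁.length + 1 then l₁.length
        else time n (l₁ ++ [i, j] ++ l₂) a b := by
  have hn := h.ne_one (by simp)
  have hprod : wordProd n [j, i] = wordProd n [i, j] := by
    simp only [wordProd_cons, wordProd_nil, mul_one]
    exact (simple_mul_comm hn h1 h2 h3).symm
  have h' : Asc n 1 (l₁ ++ [j, i] ++ l₂) := by
    rw [asc_append, asc_append] at h ⊢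
    refine ⟨⟨h.1.1, asc_pair_comm (by simpa using wordProd_periodic n l₁) h1 h2 h3 h.1.2⟩, ?_⟩
    rw [wordProd_append, hprod, ← wordProd_append]
    exact h.2
  refine ⟨h', by simp only [wordProd_append, hprod], ?_⟩
  obtain ⟨p, hp⟩ := ZMod.intCast_surjective i
  obtain ⟨q, hq⟩ := ZMod.intCast_surjective j
  have hw := fun a b => h.time_window h' rfl hprod.symm a b
  have e1 : l₁ ++ [i, j] ++ l₂ = l₁ ++ i :: (j :: l₂) := by simp
  have e2 : l₁ ++ [j, i] ++ l₂ = l₁ ++ j :: (i :: l₂) := by simp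
  have e3 : l₁ ++ [i, j] ++ l₂ = (l₁ ++ [i]) ++ j :: l₂ := by simp
  have h4 : j + 1 ≠ i := fun e => h3 (by rw [← e]; ring)
  have h5 : j + 1 ≠ i + 1 := fun e => h1 (by simpa using e)
  have t1 := (e1 ▸ h).time_of_split hp
  have t2 := (e2 ▸ h').time_of_split hq
  have t3 := (e3 ▸ h).time_of_split hq
  rw [wordProd_append, wordProd_singleton] at t3
  simp only [Equiv.Perm.mul_apply] at t3
  -- The transposition of `i` fixes the positions `q` and `q + 1`, so the letter `j` inverts the
  -- same pair in both words.
  rw [simple_of_ne (by rw [hq]; exact h1) (by rw [hq]; exact h2),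
    simple_of_ne (by push_cast; rw [hq]; exact h4) (by push_cast; rw [hq]; exact h5)] at t3
  rw [← e1] at t1
  rw [← e2] at t2
  rw [← e3] at t3
  simp only [List.length_append, List.length_cons, List.length_nil] at *
  have hlen : ∀ a b, time n (l₁ ++ [i, j] ++ l₂) a b = l₁.length + 1 →
      time n (l₁ ++ [j, i] ++ l₂) a b = l₁.length := by
    intro a b hab
    obtain ⟨m, rfl, rfl⟩ := h.exists_translate (t3.trans hab.symm) (by rw [t3]; simp)
    rw [time_translate, t2]
  intro a b
  have hw1 := hw a b
  have hlen1 := hlen a b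
  have hinj : time n (l₁ ++ [j, i] ++ l₂) a b = l₁.length →
      time n (l₁ ++ [i, j] ++ l₂) a b = l₁.length + 1 := by
    intro hab
    obtain ⟨m, rfl, rfl⟩ := h'.exists_translate (t2.trans hab.symm) (by rw [t2]; simp)
    rw [time_translate, t3]
  split_ifs <;> omega

theorem list_split_two {α : Type*} {l : List α} {k : ℕ} (hk : k + 1 < l.length) :
    l = l.take k ++ [l[k], l[k + 1]] ++ l.drop (k + 2) := by
  conv_lhs => rw [← List.take_append_drop k l]
  rw [List.drop_eq_getElem_cons (by omega), List.drop_eq_getElem_cons (by omega)]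
  simp

/-- Exchange of consecutive pairs without a common line. -/
theorem Asc.exists_swap {l : List (ZMod n)} (h : Asc n 1 l) {k : ℕ} (hk : k + 1 < l.length)
    {x y : ℤ} (hx : time n l x y = k)
    (hdis : ∀ z, time n l x z ≠ k + 1 ∧ time n l z x ≠ k + 1 ∧ time n l y z ≠ k + 1 ∧
      time n l z y ≠ k + 1) :
    ∃ l', WordCommStep n l l' ∧ Asc n 1 l' ∧ wordProd n l' = wordProd n l ∧
      l'.length = l.length ∧
      ∀ a b, time n l' a b = if time n l a b = k then k + 1
        else if time n l a b = k + 1 then k else time n l a b := by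
  have hn := h.ne_one (by rintro rfl; simp at hk)
  have hk' : k < l.length := by omega
  obtain ⟨p1, p2⟩ := h.position hk' hx
  set u := prefixProd n l k
  set i := l[k]
  set j := l[k + 1]
  have hu : Periodic n u := prefixProd_periodic n l k
  set p := u.symm x
  have hxp : x = u p := by simp [p]
  have hyp : y = u (p + 1) := by rw [← p2]; simp
  have hus : prefixProd n l (k + 1) = u * simpleTransposition n i := prefixProd_succ hk'
  obtain ⟨q, hq⟩ := ZMod.intCast_surjective j
  have t' : time n l ((u * simpleTransposition n i) q) ((u * simpleTransposition n i) (q + 1)) =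
      k + 1 := by
    have e : l = l.take (k + 1) ++ j :: l.drop (k + 2) := by
      rw [← List.drop_eq_getElem_cons, List.take_append_drop]
    have h' := h
    rw [e] at h'
    have := h'.time_of_split hq
    rw [← e, List.length_take] at this
    rw [← hus]
    simp only [prefixProd]
    omega
  have hne : ∀ r : ℤ, (r : ZMod n) = p ∨ (r : ZMod n) = ((p + 1 : ℤ) : ZMod n) → ∀ z,
      time n l (u r) z ≠ k + 1 ∧ time n l z (u r) ≠ k + 1 := by
    intro r hr z
    rcases hr with hr | hr <;> rw [ZMod.intCast_eq_intCast_iff] at hr <;>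
      obtain ⟨m, hm⟩ := hr.symm.dvd
    · have e : u r = x + m * n := by
        rw [hxp, ← hu.apply]
        congr 1
        linarith
      have := hdis (z + (-m) * n)
      rw [← time_translate x _ m, ← time_translate _ x m] at this
      rw [show z + -m * n + m * n = z by ring, ← e] at this
      exact ⟨this.1, this.2.1⟩
    · have e : u r = y + m * n := by
        rw [hyp, ← hu.apply]
        congr 1
        linarith
      have := hdis (z + (-m) * n)
      rw [← time_translate y _ m, ← time_translate _ y m] at this
      rw [show z + -m * n + m * n = z by ring, ← e] at this
      exact ⟨this.2.2.1, this.2.2.2⟩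
  simp only [Equiv.Perm.mul_apply] at t'
  -- If the next letter were `i`, `i + 1` or `i - 1`, the pair that it inverts would contain a
  -- translate of `x` or of `y`, which `hne` forbids.
  have h1 : j ≠ i := by
    intro e
    rw [simple_of_eq hn (hq.trans e)] at t'
    refine (hne (q + 1) (.inr ?_) _).1 t'
    push_cast
    rw [hq, e, p1]
  have h2 : j ≠ i + 1 := by
    intro e
    rw [simple_of_eq_add_one hn (hq.trans e)] at t'
    refine (hne (q - 1) (.inl ?_) _).1 t'
    push_cast
    rw [hq, e, p1]
    ring
  have h3 : j ≠ i - 1 := by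
    intro e
    rw [simple_of_eq hn (x := q + 1) (by push_cast; rw [hq, e]; ring)] at t'
    refine (hne (q + 1 + 1) (.inr ?_) _).2 t'
    push_cast
    rw [hq, e, p1]
    ring
  have hl := list_split_two hk
  have h' := h
  rw [hl] at h'
  obtain ⟨c1, c2, c3⟩ := h'.comm h1 h2 h3
  rw [← hl] at c2 c3
  have hlen : (l.take k).length = k := by simp; omega
  rw [hlen] at c3
  refine ⟨_, ⟨_, _, _, _, h1, h2, h3, hl, rfl⟩, c1, c2, ?_, c3⟩
  simp
  omega

/-! ### Braids -/

theorem two_ne_zero_zmod (hn : 3 ≤ n) : (2 : ZMod n) ≠ 0 := by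
  intro h
  have h1 : ((2 : ℕ) : ZMod n) = 0 := by exact_mod_cast h
  rw [ZMod.natCast_eq_zero_iff] at h1
  have := Nat.le_of_dvd (by norm_num) h1
  omega

/-- The values of a simple transposition on four consecutive positions. -/
theorem simple_values (hn : 3 ≤ n) {i : ZMod n} {p : ℤ} (hp : (p : ZMod n) = i) :
    simpleTransposition n i p = p + 1 ∧ simpleTransposition n i (p + 1) = p ∧
      simpleTransposition n i (p + 2) = p + 2 ∧ simpleTransposition n (i + 1) p = p ∧
      simpleTransposition n (i + 1) (p + 1) = p + 2 ∧
      simpleTransposition n (i + 1) (p + 2) = p + 1 := by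
  have h1 := one_ne_zero_zmod (show n ≠ 1 by omega)
  have h2 := two_ne_zero_zmod hn
  have hn1 : n ≠ 1 := by omega
  refine ⟨simple_of_eq hn1 hp, ?_, ?_, ?_, ?_, ?_⟩
  · rw [simple_of_eq_add_one hn1 (by push_cast; rw [hp])]
    ring
  · refine simple_of_ne ?_ ?_ <;> push_cast <;> rw [hp]
    · simpa using h2
    · simp only [ne_eq, add_right_inj]
      exact fun e => h1 (by linear_combination e)
  · refine simple_of_ne ?_ ?_ <;> rw [hp]
    · simpa using h1
    · rw [add_assoc, one_add_one_eq_two]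
      simpa using h2
  · rw [simple_of_eq hn1 (by push_cast; rw [hp])]
    ring
  · rw [simple_of_eq_add_one hn1 (by push_cast; rw [hp]; ring)]
    ring

/-- Only positions congruent to `i`, `i + 1`, `i + 2` are moved. These residues are distinct because
`n` is at least three, and both sides exchange the outer two. -/
theorem simple_braid (hn : 3 ≤ n) (i : ZMod n) :
    wordProd n [i, i + 1, i] = wordProd n [i + 1, i, i + 1] := by
  simp only [wordProd_cons, wordProd_nil, mul_one]
  ext x
  simp only [Equiv.Perm.mul_apply]
  by_cases e1 : (x : ZMod n) = i
  · obtain ⟨v1, v2, v3, v4, v5, v6⟩ := simple_values hn e1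
    rw [v1, v5, v3, v4, v1, v5]
  by_cases e2 : (x : ZMod n) = i + 1
  · have e : ((x - 1 : ℤ) : ZMod n) = i := by push_cast; rw [e2]; ring
    obtain ⟨v1, v2, v3, v4, v5, v6⟩ := simple_values hn e
    rw [sub_add_cancel] at v1 v2 v5
    rw [show x - 1 + 2 = x + 1 by ring] at v3 v5 v6
    rw [v2, v4, v1, v5, v3, v6, sub_add_cancel]
  by_cases e3 : (x : ZMod n) = i + 2
  · have e : ((x - 2 : ℤ) : ZMod n) = i := by push_cast; rw [e3]; ring
    obtain ⟨v1, v2, v3, v4, v5, v6⟩ := simple_values hn e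
    rw [show x - 2 + 2 = x by ring] at v3 v5 v6
    rw [v3, v6, v2, v4]
  have e4 : (x : ZMod n) ≠ i + 1 + 1 := by rwa [add_assoc, one_add_one_eq_two]
  rw [simple_of_ne e1 e2, simple_of_ne e2 e4, simple_of_ne e1 e2, simple_of_ne e2 e4]

/-- Both words completely reverse the entries at three consecutive positions, so each step is an
ascent exactly when these entries are increasing at the start. -/
theorem asc_braid_iff (hn : 3 ≤ n) {u : Equiv.Perm ℤ} (hu : Periodic n u) {i : ZMod n} {p : ℤ}
    (hp : (p : ZMod n) = i) :
    (Asc n u [i, i + 1, i] ↔ u p < u (p + 1) ∧ u (p + 1) < u (p + 2)) ∧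
      (Asc n u [i + 1, i, i + 1] ↔ u p < u (p + 1) ∧ u (p + 1) < u (p + 2)) := by
  have hn1 : n ≠ 1 := by omega
  obtain ⟨v1, v2, v3, v4, v5, v6⟩ := simple_values hn hp
  have hp' : ((p + 1 : ℤ) : ZMod n) = i + 1 := by push_cast; rw [hp]
  have s := simple_periodic n
  rw [asc_cons_iff hu hp, asc_cons_iff (hu.mul (s _)) hp',
    asc_cons_iff ((hu.mul (s _)).mul (s _)) hp, asc_cons_iff hu hp',
    asc_cons_iff (hu.mul (s _)) hp, asc_cons_iff ((hu.mul (s _)).mul (s _)) hp']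
  simp only [Equiv.Perm.mul_apply, Asc, and_true, show p + 1 + 1 = p + 2 by ring, v1, v2, v3, v4,
    v5, v6, ne_eq, hn1, not_false_eq_true, true_and]
  constructor <;> constructor <;> intro h <;> omega

/-- The effect of a braid move on an ascending word. -/
theorem Asc.braid_times (hn : 3 ≤ n) {l₁ l₂ : List (ZMod n)} {i : ZMod n}
    (h : Asc n 1 (l₁ ++ [i, i + 1, i] ++ l₂)) (h' : Asc n 1 (l₁ ++ [i + 1, i, i + 1] ++ l₂)) :
    ∃ x y z, time n (l₁ ++ [i, i + 1, i] ++ l₂) x y = l₁.length ∧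
      time n (l₁ ++ [i, i + 1, i] ++ l₂) x z = l₁.length + 1 ∧
      time n (l₁ ++ [i, i + 1, i] ++ l₂) y z = l₁.length + 2 ∧
      time n (l₁ ++ [i + 1, i, i + 1] ++ l₂) y z = l₁.length ∧
      time n (l₁ ++ [i + 1, i, i + 1] ++ l₂) x z = l₁.length + 1 ∧
      time n (l₁ ++ [i + 1, i, i + 1] ++ l₂) x y = l₁.length + 2 := by
  obtain ⟨p, hp⟩ := ZMod.intCast_surjective i
  have hp' : ((p + 1 : ℤ) : ZMod n) = i + 1 := by push_cast; rw [hp]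
  obtain ⟨v1, v2, v3, v4, v5, v6⟩ := simple_values hn hp
  have e1 : l₁ ++ [i, i + 1, i] ++ l₂ = l₁ ++ i :: ([i + 1, i] ++ l₂) := by simp
  have e2 : l₁ ++ [i, i + 1, i] ++ l₂ = (l₁ ++ [i]) ++ (i + 1) :: ([i] ++ l₂) := by simp
  have e3 : l₁ ++ [i, i + 1, i] ++ l₂ = (l₁ ++ [i, i + 1]) ++ i :: l₂ := by simp
  have e4 : l₁ ++ [i + 1, i, i + 1] ++ l₂ = l₁ ++ (i + 1) :: ([i, i + 1] ++ l₂) := by simp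
  have e5 : l₁ ++ [i + 1, i, i + 1] ++ l₂ = (l₁ ++ [i + 1]) ++ i :: ([i + 1] ++ l₂) := by simp
  have e6 : l₁ ++ [i + 1, i, i + 1] ++ l₂ = (l₁ ++ [i + 1, i]) ++ (i + 1) :: l₂ := by simp
  have t1 := (e1 ▸ h).time_of_split hp
  have t2 := (e2 ▸ h).time_of_split hp'
  have t3 := (e3 ▸ h).time_of_split hp
  have t4 := (e4 ▸ h').time_of_split hp'
  have t5 := (e5 ▸ h').time_of_split hp
  have t6 := (e6 ▸ h').time_of_split hp'
  rw [← e1] at t1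
  rw [← e2] at t2
  rw [← e3] at t3
  rw [← e4] at t4
  rw [← e5] at t5
  rw [← e6] at t6
  simp only [wordProd_append, wordProd_cons, wordProd_nil, mul_one, Equiv.Perm.mul_apply,
    show p + 1 + 1 = p + 2 by ring, v1, v2, v3, v4, v5, v6, List.length_append,
    List.length_cons, List.length_nil] at t1 t2 t3 t4 t5 t6
  exact ⟨_, _, _, t1, t2, t3, t4, t5, t6⟩

/-- A braid move exchanges the times of the first and third crossings of one triangle and keeps all
other times. Only this triangle and its translates have both of these crossings as their outer
pairs, so no other triple changes its order. -/
theorem Asc.revP_braid (hn : 3 ≤ n) {l₁ l₂ : List (ZMod n)} {i : ZMod n}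
    (h : Asc n 1 (l₁ ++ [i, i + 1, i] ++ l₂)) (h' : Asc n 1 (l₁ ++ [i + 1, i, i + 1] ++ l₂)) :
    ∃ x y z, time n (l₁ ++ [i, i + 1, i] ++ l₂) x y = l₁.length ∧
      time n (l₁ ++ [i, i + 1, i] ++ l₂) x z = l₁.length + 1 ∧
      time n (l₁ ++ [i, i + 1, i] ++ l₂) y z = l₁.length + 2 ∧
      ∀ a b c, RevP n (l₁ ++ [i + 1, i, i + 1] ++ l₂) a b c ↔
        RevP n (l₁ ++ [i, i + 1, i] ++ l₂) a b c ∨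
          ∃ m : ℤ, a = x + m * n ∧ b = y + m * n ∧ c = z + m * n := by
  obtain ⟨x, y, z, t1, t2, t3, t4, t5, t6⟩ := h.braid_times hn h'
  refine ⟨x, y, z, t1, t2, t3, fun a b c => ?_⟩
  have hw := fun a b => h.time_window h' rfl (simple_braid hn i) a b
  set l := l₁ ++ [i, i + 1, i] ++ l₂ with hl
  set l' := l₁ ++ [i + 1, i, i + 1] ++ l₂ with hl'
  have hlen : l'.length = l.length := by simp [l, l']
  have hk : l₁.length + 2 < l.length := by simp [l]
  set k := l₁.length
  simp only [List.length_cons, List.length_nil] at hw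
  have f1 : ∀ a b, time n l a b = k → time n l' a b = k + 2 := by
    intro a b hab
    obtain ⟨m, rfl, rfl⟩ := h.exists_translate (t1.trans hab.symm) (by omega)
    rw [time_translate, t6]
  have f2 : ∀ a b, time n l a b = k + 1 → time n l' a b = k + 1 := by
    intro a b hab
    obtain ⟨m, rfl, rfl⟩ := h.exists_translate (t2.trans hab.symm) (by omega)
    rw [time_translate, t5]
  have f3 : ∀ a b, time n l a b = k + 2 → time n l' a b = k := by
    intro a b hab
    obtain ⟨m, rfl, rfl⟩ := h.exists_translate (t3.trans hab.symm) (by omega)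
    rw [time_translate, t4]
  have hxy : x < y := h.lt_of_time (by omega)
  have hyz : y < z := h.lt_of_time (by omega)
  have hT : ∀ a b, (time n l a b = k ∧ time n l' a b = k + 2) ∨
      (time n l a b = k + 1 ∧ time n l' a b = k + 1) ∨
      (time n l a b = k + 2 ∧ time n l' a b = k) ∨
      ((time n l a b < k ∨ k + 2 < time n l a b) ∧ time n l' a b = time n l a b) := by
    intro a b
    by_cases c1 : time n l a b = k
    · exact .inl ⟨c1, f1 a b c1⟩
    by_cases c2 : time n l a b = k + 1
    · exact .inr (.inl ⟨c2, f2 a b c2⟩)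
    by_cases c3 : time n l a b = k + 2
    · exact .inr (.inr (.inl ⟨c3, f3 a b c3⟩))
    have c4 : time n l a b < k ∨ k + 2 < time n l a b := by
      clear hw f1 f2 f3
      omega
    refine .inr (.inr (.inr ⟨c4, (hw a b).resolve_right fun c5 => ?_⟩))
    clear hw f1 f2 f3
    omega
  clear_value k l l'
  constructor
  · rintro ⟨hab, hbc, h1, h2⟩
    by_cases h3 : time n l b c < time n l a b
    · left
      refine ⟨hab, hbc, h3, ?_⟩
      have := hT a b
      omega
    · right
      have b1 := h.time_between hab hbc
      have b2 := h.time_ne hab hbc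
      have w1 := hT a b
      have w2 := hT b c
      have h4 : time n l a b = k ∧ time n l b c = k + 2 := by omega
      obtain ⟨m, rfl, rfl⟩ := h.exists_translate (t1.trans h4.1.symm) (by omega)
      obtain ⟨m', h5, rfl⟩ := h.exists_translate (t3.trans h4.2.symm) (by omega)
      exact ⟨m, rfl, rfl, by linarith⟩
  · rintro (⟨hab, hbc, h1, h2⟩ | ⟨m, rfl, rfl, rfl⟩)
    · refine ⟨hab, hbc, ?_⟩
      have b1 := h.time_between hab hbc
      have b2 := h.time_ne hab hbc
      have w1 := hT a b
      have w2 := hT b c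
      by_cases h4 : time n l a b = k + 2 ∧ time n l b c = k
      -- Here `b` would be a translate of both `z` and `x`, although `x` and `z` cross and so are
      -- not congruent.
      · exfalso
        obtain ⟨m, h5, rfl⟩ := h.exists_translate (t3.trans h4.1.symm) (by omega)
        obtain ⟨m', h6, rfl⟩ := h.exists_translate (t1.trans h4.2.symm) (by omega)
        have h7 := (h.time_lt_length x z).mp (by omega)
        rw [show z = x + (m' - m) * n by linarith] at h7
        exact not_invd_add (wordProd_periodic n l) _ _ h7
      · clear hT hw f1 f2 f3
        rcases w1 with w1 | w1 | w1 | w1 <;> rcases w2 with w2 | w2 | w2 | w2 <;> omega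
    · refine ⟨by linarith, by linarith, ?_⟩
      simp only [time_translate]
      omega

theorem list_split_three {α : Type*} {l : List α} {k : ℕ} (hk : k + 2 < l.length) :
    l = l.take k ++ [l[k], l[k + 1], l[k + 2]] ++ l.drop (k + 3) := by
  conv_lhs => rw [← List.take_append_drop k l]
  rw [List.drop_eq_getElem_cons (by omega), List.drop_eq_getElem_cons (by omega),
    List.drop_eq_getElem_cons (by omega)]
  simp

theorem three_le_of (hn : 0 < n) {a b c : ℤ} (hab : ¬ a ≡ b [ZMOD n]) (hac : ¬ a ≡ c [ZMOD n])
    (hbc : ¬ b ≡ c [ZMOD n]) : 3 ≤ n := by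
  by_contra h
  have h1 : n = 1 ∨ n = 2 := by omega
  simp only [Int.ModEq] at *
  rcases h1 with rfl | rfl <;> omega

/-- Consecutive pairs in lexicographic order belong to a factor `i (i+1) i`. -/
theorem Asc.braid_of_lex (hn : 0 < n) {l : List (ZMod n)} (h : Asc n 1 l) {a b c : ℤ} {k : ℕ}
    (hk : k + 2 < l.length) (h1 : time n l a b = k) (h2 : time n l a c = k + 1)
    (h3 : time n l b c = k + 2) :
    3 ≤ n ∧ ∃ i, l = l.take k ++ [i, i + 1, i] ++ l.drop (k + 3) := by
  have hw := wordProd_periodic n l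
  have hn3 : 3 ≤ n := three_le_of hn
    (((h.time_lt_length a b).mp (by omega)).not_modEq hw)
    (((h.time_lt_length a c).mp (by omega)).not_modEq hw)
    (((h.time_lt_length b c).mp (by omega)).not_modEq hw)
  -- Each letter is the residue of the position of the smaller value of its pair. Following the
  -- positions of `a` and `b` through the three steps identifies the letters.
  obtain ⟨p1, p2⟩ := h.position (by omega) h1
  obtain ⟨p3, p4⟩ := h.position (by omega) h2
  obtain ⟨p5, p6⟩ := h.position hk h3
  rw [prefixProd_succ (show k + 1 < l.length by omega)] at p5
  rw [prefixProd_succ (show k < l.length by omega)] at p3 p5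
  simp only [mul_simple_symm_apply] at p3 p5
  obtain ⟨v1, v2, v3, v4, v5, v6⟩ := simple_values hn3 p1
  rw [v1] at p3
  have p3' : l[k + 1] = l[k] + 1 := by
    rw [← p3]
    push_cast
    rw [p1]
  rw [p2, v2, p3', v4, p1] at p5
  refine ⟨hn3, l[k], ?_⟩
  conv_lhs => rw [list_split_three hk]
  rw [p3', ← p5]

theorem Asc.braid_of_antilex (hn : 0 < n) {l : List (ZMod n)} (h : Asc n 1 l) {a b c : ℤ} {k : ℕ}
    (hk : k + 2 < l.length) (h1 : time n l b c = k) (h2 : time n l a c = k + 1)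
    (h3 : time n l a b = k + 2) :
    3 ≤ n ∧ ∃ i, l = l.take k ++ [i + 1, i, i + 1] ++ l.drop (k + 3) := by
  have hw := wordProd_periodic n l
  have hn3 : 3 ≤ n := three_le_of hn
    (((h.time_lt_length a b).mp (by omega)).not_modEq hw)
    (((h.time_lt_length a c).mp (by omega)).not_modEq hw)
    (((h.time_lt_length b c).mp (by omega)).not_modEq hw)
  obtain ⟨p1, p2⟩ := h.position (by omega) h1
  obtain ⟨p3, p4⟩ := h.position (by omega) h2
  obtain ⟨p5, p6⟩ := h.position hk h3
  rw [prefixProd_succ (show k + 1 < l.length by omega)] at p5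
  rw [prefixProd_succ (show k < l.length by omega)] at p3 p4 p5
  simp only [mul_simple_symm_apply] at p3 p4 p5
  have hn1 : n ≠ 1 := by omega
  rw [p2, simple_of_eq_add_one hn1 (by push_cast; rw [p1]), add_sub_cancel_right] at p4
  have p3' : l[k] = l[k + 1] + 1 := by
    rw [← p1, p4, ← p3]
    push_cast
    rfl
  rw [simple_of_eq hn1 p3] at p5
  push_cast at p5
  rw [p3] at p5
  refine ⟨hn3, l[k + 1], ?_⟩
  conv_lhs => rw [list_split_three hk]
  rw [p3', ← p5]

end

end AffineBruhat

/-! ### Triangles among four lines -/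

namespace AffineBruhat

/-- The combinatorial data of four lines, with the times `t` of their crossings, where `N` stands
for lines that do not cross, and a consistent set `r` of triples. -/
structure FourLines (N t12 t13 t14 t23 t24 t34 : ℕ) (r123 r124 r134 r234 : Prop) : Prop where
  le : t12 ≤ N ∧ t13 ≤ N ∧ t14 ≤ N ∧ t23 ≤ N ∧ t24 ≤ N ∧ t34 ≤ N
  b123 : (t12 ≤ t13 ∧ t13 ≤ t23) ∨ (t23 ≤ t13 ∧ t13 ≤ t12)
  b124 : (t12 ≤ t14 ∧ t14 ≤ t24) ∨ (t24 ≤ t14 ∧ t14 ≤ t12)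
  b134 : (t13 ≤ t14 ∧ t14 ≤ t34) ∨ (t34 ≤ t14 ∧ t14 ≤ t13)
  b234 : (t23 ≤ t24 ∧ t24 ≤ t34) ∨ (t34 ≤ t24 ∧ t24 ≤ t23)
  d123 : (t12 = t13 → t12 = N) ∧ (t23 = t13 → t13 = N)
  d124 : (t12 = t14 → t12 = N) ∧ (t24 = t14 → t14 = N)
  d134 : (t13 = t14 → t13 = N) ∧ (t34 = t14 → t14 = N)
  d234 : (t23 = t24 → t23 = N) ∧ (t34 = t24 → t24 = N)
  full : t12 < N → t23 < N → t34 < N →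
    ((r234 → r134) ∧ (r134 → r124) ∧ (r124 → r123)) ∨
      ((r123 → r124) ∧ (r124 → r134) ∧ (r134 → r234))
  first : t12 = N → t13 < N → t23 < N → t34 < N → r234 → r134
  middle : t23 = N → t12 < N → t13 < N → t24 < N → t34 < N → r124 → r134
  last : t34 = N → t12 < N → t23 < N → t24 < N → r124 → r123

/-- The triple of lines with crossing times `t12`, `t13`, `t23` belongs to the symmetric difference
of `r` and the set of reversed triples. -/
def InDiff (N t12 t23 : ℕ) (r : Prop) : Prop := t12 < N ∧ t23 < N ∧ ¬ (r ↔ t23 < t12)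

/-- No crossing with a fourth line, at times `s1`, `s2`, `s3`, cuts the triangle of three lines. -/
def NoCutAt (t12 t13 t23 s1 s2 s3 : ℕ) : Prop :=
  (t12 < t23 → ¬ (t12 < s1 ∧ s1 < t13) ∧ ¬ (t12 < s2 ∧ s2 < t13) ∧ ¬ (t13 < s2 ∧ s2 < t23) ∧
      ¬ (t13 < s3 ∧ s3 < t23)) ∧
    (t23 < t12 → ¬ (t23 < s2 ∧ s2 < t13) ∧ ¬ (t23 < s3 ∧ s3 < t13) ∧ ¬ (t13 < s1 ∧ s1 < t12) ∧
      ¬ (t13 < s2 ∧ s2 < t12))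

/-- The distance of two natural numbers. -/
def span (a b : ℕ) : ℕ := (a - b) + (b - a)

/-- Here `M` is to be the smallest span of a triangle on which `r` and the times disagree. A fourth
line that cut such a triangle would form further triangles with its sides, and minimality restricts
on which of them a disagreement can occur. The consistency of both `r` and the times on the four
triples, together with `hthree`, rules out what remains. -/
theorem FourLines.noCut {N t12 t13 t14 t23 t24 t34 : ℕ} {r123 r124 r134 r234 : Prop}
    (h : FourLines N t12 t13 t14 t23 t24 t34 r123 r124 r134 r234)
    (hthree : t12 < N → t23 < N → t34 < N →
      ¬ (InDiff N t12 t23 r123 ∧ InDiff N t12 t24 r124 ∧ InDiff N t13 t34 r134) ∧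
      ¬ (InDiff N t12 t23 r123 ∧ InDiff N t12 t24 r124 ∧ InDiff N t23 t34 r234) ∧
      ¬ (InDiff N t12 t23 r123 ∧ InDiff N t13 t34 r134 ∧ InDiff N t23 t34 r234) ∧
      ¬ (InDiff N t12 t24 r124 ∧ InDiff N t13 t34 r134 ∧ InDiff N t23 t34 r234)) {M : ℕ}
    (h123 : InDiff N t12 t23 r123 → M ≤ span t12 t23)
    (h124 : InDiff N t12 t24 r124 → M ≤ span t12 t24)
    (h134 : InDiff N t13 t34 r134 → M ≤ span t13 t34)
    (h234 : InDiff N t23 t34 r234 → M ≤ span t23 t34) :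
    (InDiff N t12 t23 r123 → M = span t12 t23 → NoCutAt t12 t13 t23 t14 t24 t34) ∧
    (InDiff N t12 t24 r124 → M = span t12 t24 → NoCutAt t12 t14 t24 t13 t23 t34) ∧
    (InDiff N t13 t34 r134 → M = span t13 t34 → NoCutAt t13 t14 t34 t12 t23 t24) ∧
    (InDiff N t23 t34 r234 → M = span t23 t34 → NoCutAt t23 t24 t34 t12 t13 t14) := by
  obtain ⟨hle, b1, b2, b3, b4, d1, d2, d3, d4, f, f1, f2, f3⟩ := h
  simp only [InDiff, NoCutAt, span] at *
  -- Each triple has one of two orders. Combinations that are impossible for the times alone are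
  -- removed by arithmetic, and only the others need consistency, minimality and `hthree`.
  refine ⟨?_, ?_, ?_, ?_⟩ <;> intro hX hM <;>
    refine ⟨fun ho => ⟨?_, ?_, ?_, ?_⟩, fun ho => ⟨?_, ?_, ?_, ?_⟩⟩ <;> rintro ⟨c1, c2⟩ <;>
    rcases b1 with b1 | b1 <;>
    try (exfalso; clear f f1 f2 f3 hthree h123 h124 h134 h234 hX hM; omega)
  all_goals
    rcases b2 with b2 | b2 <;>
      try (exfalso; clear f f1 f2 f3 hthree h123 h124 h134 h234 hX hM; omega)
  all_goals
    rcases b3 with b3 | b3 <;>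
      try (exfalso; clear f f1 f2 f3 hthree h123 h124 h134 h234 hX hM; omega)
  all_goals
    rcases b4 with b4 | b4 <;>
      try (exfalso; clear f f1 f2 f3 hthree h123 h124 h134 h234 hX hM; omega)
  all_goals grind (splits := 40)

end AffineBruhat

namespace AffineBruhat

section

variable {n : ℕ}

/-! ### Commutation classes and reversed triples -/

/-- In a triple whose outer pairs are both inverted, the crossing of its outer lines falls strictly
between the other two. The two times whose comparison decides the reversal are therefore never
consecutive. -/
theorem revP_of_swap {l l' : List (ZMod n)} (h : Asc n 1 l) (hlen : l'.length = l.length) {k : ℕ}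
    (hk : k + 1 < l.length)
    (ht : ∀ a b, time n l' a b = if time n l a b = k then k + 1
      else if time n l a b = k + 1 then k else time n l a b) (a b c : ℤ) :
    RevP n l' a b c ↔ RevP n l a b c := by
  simp only [RevP]
  refine and_congr_right fun hab => and_congr_right fun hbc => ?_
  have b1 := h.time_between hab hbc
  have b2 := h.time_ne hab hbc
  rw [ht, ht, hlen]
  split_ifs <;> omega

theorem Asc.of_commStep {l l' : List (ZMod n)} (h : Asc n 1 l) (hs : WordCommStep n l l') :
    Asc n 1 l' ∧ wordProd n l' = wordProd n l ∧ l'.length = l.length ∧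
      ∀ a b c, RevP n l' a b c ↔ RevP n l a b c := by
  obtain ⟨l₁, l₂, i, j, h1, h2, h3, rfl, rfl⟩ := hs
  obtain ⟨c1, c2, c3⟩ := h.comm h1 h2 h3
  have hlen : (l₁ ++ [j, i] ++ l₂).length = (l₁ ++ [i, j] ++ l₂).length := by simp
  exact ⟨c1, c2, hlen, revP_of_swap h hlen (by simp) c3⟩

theorem WordCommStep.symm {l l' : List (ZMod n)} (h : WordCommStep n l l') :
    WordCommStep n l' l := by
  obtain ⟨l₁, l₂, i, j, h1, h2, h3, rfl, rfl⟩ := h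
  refine ⟨l₁, l₂, j, i, h1.symm, fun e => h3 ?_, fun e => h2 ?_, rfl, rfl⟩
  · rw [e]; ring
  · rw [e]; ring

theorem Asc.of_eqvGen {l l' : List (ZMod n)} (hs : Relation.EqvGen (WordCommStep n) l l')
    (h : Asc n 1 l) :
    Asc n 1 l' ∧ wordProd n l' = wordProd n l ∧ l'.length = l.length ∧
      ∀ a b c, RevP n l' a b c ↔ RevP n l a b c := by
  -- The generated equivalence also runs backwards, so ascent is carried along as an equivalence
  -- rather than an implication.
  suffices H : ∀ l l', Relation.EqvGen (WordCommStep n) l l' → (Asc n 1 l ↔ Asc n 1 l') ∧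
      (Asc n 1 l → wordProd n l' = wordProd n l ∧ l'.length = l.length ∧
        ∀ a b c, RevP n l' a b c ↔ RevP n l a b c) by
    exact ⟨(H l l' hs).1.mp h, (H l l' hs).2 h⟩
  intro l l' hs
  induction hs with
  | rel a b hab => exact ⟨⟨fun h => (h.of_commStep hab).1, fun h => (h.of_commStep hab.symm).1⟩,
      fun h => (h.of_commStep hab).2⟩
  | refl a => exact ⟨Iff.rfl, fun _ => ⟨rfl, rfl, fun _ _ _ => Iff.rfl⟩⟩
  | symm a b _ ih =>
    refine ⟨ih.1.symm, fun h => ?_⟩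
    obtain ⟨h1, h2, h3⟩ := ih.2 (ih.1.mpr h)
    exact ⟨h1.symm, h2.symm, fun _ _ _ => (h3 _ _ _).symm⟩
  | trans a b c _ _ ih₁ ih₂ =>
    refine ⟨ih₁.1.trans ih₂.1, fun h => ?_⟩
    obtain ⟨h1, h2, h3⟩ := ih₁.2 h
    obtain ⟨h4, h5, h6⟩ := ih₂.2 (ih₁.1.mp h)
    exact ⟨h4.trans h1, h5.trans h2, fun _ _ _ => (h6 _ _ _).trans (h3 _ _ _)⟩

theorem eqvGen_append {l l' : List (ZMod n)} (hs : Relation.EqvGen (WordCommStep n) l l')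
    (m : List (ZMod n)) : Relation.EqvGen (WordCommStep n) (l ++ m) (l' ++ m) := by
  induction hs with
  | rel a b hab =>
    obtain ⟨l₁, l₂, i, j, h1, h2, h3, rfl, rfl⟩ := hab
    exact .rel _ _ ⟨l₁, l₂ ++ m, i, j, h1, h2, h3, by simp, by simp⟩
  | refl a => exact .refl _
  | symm a b _ ih => exact .symm _ _ ih
  | trans a b c _ _ ih₁ ih₂ => exact .trans _ _ _ ih₁ ih₂

/-- A pair that is inverted last in some word with the given reversed triples can be moved
to the end by commutations. -/
theorem Asc.exists_move_last {l : List (ZMod n)} (h : Asc n 1 l) {N : ℕ} (hN : l.length = N + 1)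
    {x y : ℤ} (hxy : time n l x y = N) (d k : ℕ) (hd : N = k + d) (l' : List (ZMod n))
    (h' : Asc n 1 l') (hprod : wordProd n l' = wordProd n l) (hlen : l'.length = l.length)
    (hrev : ∀ a b c, RevP n l' a b c ↔ RevP n l a b c) (hk : time n l' x y = k) :
    ∃ l'', Relation.EqvGen (WordCommStep n) l' l'' ∧ time n l'' x y = N := by
  induction d generalizing k l' with
  | zero => exact ⟨l', .refl _, by omega⟩
  | succ d ih =>
    have hltxy : x < y := h.lt_of_time (by omega)
    have hinv : ∀ a b, time n l' a b < N + 1 ↔ time n l a b < N + 1 := by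
      intro a b
      have h1 := h.time_lt_length a b
      have h2 := h'.time_lt_length a b
      rw [hprod] at h2
      rw [hlen] at h2
      rw [hN] at h1 h2
      exact h2.trans h1.symm
    have hself : ∀ a, time n l' a a ≠ k + 1 := by
      intro a ha
      have := h'.lt_of_time (x := a) (y := a) (by omega)
      omega
    -- In `l` the pair `x y` is inverted last of all, hence last among the inverted pairs of each
    -- triple containing it. Since the inverted pairs and the reversed triples agree, the same holds
    -- in `l'`, and no pair with a common line can follow it.
    have key : ∀ a b c : ℤ, a < b → b < c →
        ((x = a ∧ y = b) → time n l' a c ≠ k + 1 ∧ time n l' b c ≠ k + 1) ∧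
        ((x = a ∧ y = c) → time n l' a b ≠ k + 1 ∧ time n l' b c ≠ k + 1) ∧
        ((x = b ∧ y = c) → time n l' a b ≠ k + 1 ∧ time n l' a c ≠ k + 1) := by
      intro a b c hab hbc
      have b1 := h.time_between hab hbc
      have b2 := h.time_ne hab hbc
      have b3 := h'.time_between hab hbc
      have b4 := h'.time_ne hab hbc
      have b5 := hrev a b c
      have i1 := hinv a b
      have i2 := hinv a c
      have i3 := hinv b c
      have l1 := time_le n l a b
      have l2 := time_le n l a c
      have l3 := time_le n l b c
      have l4 := time_le n l' a b
      have l5 := time_le n l' a c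
      have l6 := time_le n l' b c
      simp only [RevP, hab, hbc, true_and, hN, hlen] at *
      refine ⟨?_, ?_, ?_⟩ <;> rintro ⟨rfl, rfl⟩ <;> constructor <;> intro he <;> omega
    obtain ⟨l₁, hs, hl₁, hp₁, hlen₁, ht₁⟩ := h'.exists_swap (k := k) (by omega) hk (by
      intro z
      have hgt : ∀ {a b : ℤ}, b ≤ a → time n l' a b ≠ k + 1 := by
        intro a b hab he
        have := h'.lt_of_time (x := a) (y := b) (by omega)
        omega
      rcases lt_trichotomy z x with h1 | rfl | h1
      · have := (key z x y h1 hltxy).2.2 ⟨rfl, rfl⟩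
        exact ⟨hgt h1.le, this.1, hgt (by omega), this.2⟩
      · exact ⟨hself _, hself _, hgt hltxy.le, by omega⟩
      rcases lt_trichotomy z y with h2 | rfl | h2
      · have := (key x z y h1 h2).2.1 ⟨rfl, rfl⟩
        exact ⟨this.1, hgt h1.le, hgt h2.le, this.2⟩
      · exact ⟨by omega, hgt hltxy.le, hself _, hself _⟩
      · have := (key x y z hltxy h2).1 ⟨rfl, rfl⟩
        exact ⟨this.1, hgt h1.le, this.2, hgt h2.le⟩)
    obtain ⟨l₂, hs₂, ht₂⟩ := ih (k + 1) (by omega) l₁ hl₁ (hp₁.trans hprod) (hlen₁.trans hlen)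
      (fun a b c => (revP_of_swap h' hlen₁ (by omega) ht₁ a b c).trans (hrev a b c))
      (by rw [ht₁, if_pos hk])
    exact ⟨l₂, .trans _ _ _ (.rel _ _ hs) hs₂, ht₂⟩

/-- Words for the same element with the same reversed triples are commutation equivalent. -/
theorem Asc.eqvGen_of_revP {l l' : List (ZMod n)} (h : Asc n 1 l) (h' : Asc n 1 l')
    (hprod : wordProd n l' = wordProd n l) (hlen : l'.length = l.length)
    (hrev : ∀ a b c, RevP n l' a b c ↔ RevP n l a b c) :
    Relation.EqvGen (WordCommStep n) l' l := by
  induction hN : l.length generalizing l l' with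
  | zero =>
    rw [hN] at hlen
    rw [List.length_eq_zero_iff] at hlen hN
    rw [hlen, hN]
    exact .refl _
  | succ N ih =>
    obtain ⟨m, i, rfl⟩ := List.eq_nil_or_concat' l |>.resolve_left (by rintro rfl; simp at hN)
    have hm : m.length = N := by simpa using hN
    obtain ⟨p, hp⟩ := ZMod.intCast_surjective i
    have hxy := h.time_of_split hp
    rw [hm] at hxy
    set x := wordProd n m p
    set y := wordProd n m (p + 1)
    have hk : time n l' x y < N + 1 := by
      have h1 := h.time_lt_length x y
      have h2 := h'.time_lt_length x y
      rw [hprod, hlen, ← h1, hN] at h2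
      omega
    obtain ⟨l₁, hs, ht⟩ := h.exists_move_last hN hxy (N - time n l' x y) (time n l' x y) (by omega)
      l' h' hprod hlen hrev rfl
    obtain ⟨g1, g2, g3, g4⟩ := Asc.of_eqvGen hs h'
    have hlen₁ : l₁.length = N + 1 := by rw [g3, hlen, hN]
    obtain ⟨m', j, rfl⟩ := List.eq_nil_or_concat' l₁ |>.resolve_left
      (by rintro rfl; simp at hlen₁)
    have hm' : m'.length = N := by simpa using hlen₁
    have q1 := (h.position (j := N) (by omega) hxy)
    have q2 := (g1.position (j := N) (by omega) ht)
    have hn : n ≠ 1 := h.ne_one (by simp)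
    have e1 : prefixProd n (m ++ [i]) N = wordProd n m := by
      rw [prefixProd_append_left hm.ge, ← hm, prefixProd_length]
    have e2 : prefixProd n (m' ++ [j]) N = wordProd n m' := by
      rw [prefixProd_append_left hm'.ge, ← hm', prefixProd_length]
    have e3 : (m ++ [i])[N] = i := by simp [← hm]
    have e4 : (m' ++ [j])[N] = j := by simp [← hm']
    rw [e1, e3] at q1
    rw [e2, e4] at q2
    have hw : wordProd n (m' ++ [j]) = wordProd n (m ++ [i]) := g2.trans hprod
    have s1 : (wordProd n (m ++ [i])).symm x = (wordProd n m).symm x + 1 := by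
      rw [wordProd_append, wordProd_singleton, mul_simple_symm_apply, simple_of_eq hn q1.1]
    have s2 : (wordProd n (m' ++ [j])).symm x = (wordProd n m').symm x + 1 := by
      rw [wordProd_append, wordProd_singleton, mul_simple_symm_apply, simple_of_eq hn q2.1]
    -- Both last letters are the residue of the position of `x` before the last step, which is one
    -- less than its position in the common product.
    have hij : j = i := by
      rw [hw, s1] at s2
      rw [← q1.1, ← q2.1]
      congr 1
      omega
    subst hij
    have hw' : wordProd n m' = wordProd n m := by
      rw [wordProd_append, wordProd_append] at hw
      exact mul_right_cancel hw
    have a1 := (asc_append.mp h).1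
    have a2 := (asc_append.mp g1).1
    have hrev' : ∀ a b c, RevP n m' a b c ↔ RevP n m a b c := by
      intro a b c
      have r1 := h.revP_append_singleton a b c
      have r2 := g1.revP_append_singleton a b c
      have r3 := (g4 a b c).trans (hrev a b c)
      have t1 := h.time_append a b
      have t2 := g1.time_append a b
      have t3 := a1.time_lt_length a b
      have t4 := a2.time_lt_length a b
      rw [hw', ← t3] at t4
      have u1 : RevP n m a b c → time n m a b < N := fun h => hm ▸ h.2.2.2
      have u2 : RevP n m' a b c → time n m' a b < N := fun h => hm' ▸ h.2.2.2
      rw [hm] at r1 t1 t4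
      rw [hm'] at r2 t2 t4
      constructor
      · intro h1
        rcases r1.mp (r3.mp (r2.mpr (.inl h1))) with h2 | h2
        · exact h2
        · have := u2 h1
          omega
      · intro h1
        rcases r2.mp (r3.mpr (r1.mpr (.inl h1))) with h2 | h2
        · exact h2
        · have := u1 h1
          omega
    exact .trans _ _ _ hs (eqvGen_append (ih a1 a2 hw' (by omega) hrev' hm) [j])

end

end AffineBruhat

/-! ### Contracting a triangle to a braid move -/

namespace AffineBruhat

section

variable {n : ℕ}

/-- The pair `p` commutes with everything between it and `q`, so it can be moved up to `q`; likewise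
`r` can be moved down to `q`. Each swap shortens the distance `d` by one. -/
theorem Asc.exists_tighten (d : ℕ) {l : List (ZMod n)} (h : Asc n 1 l) {p₁ p₂ q₁ q₂ r₁ r₂ : ℤ}
    (hd : time n l r₁ r₂ = time n l p₁ p₂ + d)
    (hLM : time n l p₁ p₂ < time n l q₁ q₂) (hMU : time n l q₁ q₂ < time n l r₁ r₂)
    (hU : time n l r₁ r₂ < l.length)
    (h1 : ∀ z v, time n l p₁ p₂ < v → v < time n l q₁ q₂ → time n l p₁ z ≠ v ∧ time n l z p₁ ≠ v ∧
      time n l p₂ z ≠ v ∧ time n l z p₂ ≠ v)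
    (h2 : ∀ z v, time n l q₁ q₂ < v → v < time n l r₁ r₂ → time n l r₁ z ≠ v ∧ time n l z r₁ ≠ v ∧
      time n l r₂ z ≠ v ∧ time n l z r₂ ≠ v) :
    ∃ l', Relation.EqvGen (WordCommStep n) l l' ∧ time n l' q₁ q₂ = time n l' p₁ p₂ + 1 ∧
      time n l' r₁ r₂ = time n l' p₁ p₂ + 2 ∧ time n l' p₁ p₂ + 2 < l'.length := by
  induction d using Nat.strong_induction_on generalizing l with
  | _ d ih =>
  by_cases c1 : time n l p₁ p₂ + 1 < time n l q₁ q₂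
  · obtain ⟨l', hs, hl', -, hlen, ht⟩ := h.exists_swap (k := time n l p₁ p₂) (by omega) rfl
      (fun z => h1 z _ (by omega) c1)
    have e1 : time n l' p₁ p₂ = time n l p₁ p₂ + 1 := by rw [ht, if_pos rfl]
    have e2 : time n l' q₁ q₂ = time n l q₁ q₂ := by
      rw [ht, if_neg (by omega), if_neg (by omega)]
    have e3 : time n l' r₁ r₂ = time n l r₁ r₂ := by
      rw [ht, if_neg (by omega), if_neg (by omega)]
    have e4 : ∀ a b v, time n l p₁ p₂ + 1 < v → time n l' a b = v → time n l a b = v := by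
      intro a b v hv hab
      rw [ht] at hab
      split_ifs at hab <;> omega
    obtain ⟨l'', hs', g⟩ := ih (d - 1) (by omega) hl' (by omega) (by omega) (by omega) (by omega)
      (by
        intro z v hv hv'
        have := h1 z v (by omega) (by omega)
        exact ⟨fun h => this.1 (e4 _ _ _ (by omega) h), fun h => this.2.1 (e4 _ _ _ (by omega) h),
          fun h => this.2.2.1 (e4 _ _ _ (by omega) h), fun h => this.2.2.2 (e4 _ _ _ (by omega) h)⟩)
      (by
        intro z v hv hv'
        have := h2 z v (by omega) (by omega)
        exact ⟨fun h => this.1 (e4 _ _ _ (by omega) h), fun h => this.2.1 (e4 _ _ _ (by omega) h),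
          fun h => this.2.2.1 (e4 _ _ _ (by omega) h), fun h => this.2.2.2 (e4 _ _ _ (by omega) h)⟩)
    exact ⟨l'', .trans _ _ _ (.rel _ _ hs) hs', g⟩
  by_cases c2 : time n l q₁ q₂ + 1 < time n l r₁ r₂
  · obtain ⟨k, hk⟩ : ∃ k, time n l r₁ r₂ = k + 1 := ⟨time n l r₁ r₂ - 1, by omega⟩
    have hkl : k < l.length := by omega
    obtain ⟨x, y, hxy⟩ : ∃ x y, time n l x y = k :=
      ⟨_, _, (h.time_eq_iff hkl _ _).mpr ⟨0, rfl, rfl⟩⟩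
    -- The swap lemma speaks of the lines of the earlier pair, while `h2` speaks of those of the
    -- later one. Since the pair at step `k + 1` is a translate of `r`, a line common to both can be
    -- moved from one description to the other.
    obtain ⟨l', hs, hl', -, hlen, ht⟩ := h.exists_swap (k := k) (by omega) hxy (by
      intro z
      have hT := fun {a b : ℤ} (e : time n l a b = k + 1) =>
        h.exists_translate (hk.trans e.symm) (by omega)
      refine ⟨fun e => ?_, fun e => ?_, fun e => ?_, fun e => ?_⟩ <;> obtain ⟨m, e1, e2⟩ := hT e
      · refine (h2 (y + (-m) * n) k (by omega) (by omega)).1 ?_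
        rw [← time_translate _ _ m, ← e1, show y + -m * n + m * n = y by ring, hxy]
      · refine (h2 (y + (-m) * n) k (by omega) (by omega)).2.2.1 ?_
        rw [← time_translate _ _ m, ← e2, show y + -m * n + m * n = y by ring, hxy]
      · refine (h2 (x + (-m) * n) k (by omega) (by omega)).2.1 ?_
        rw [← time_translate _ _ m, ← e1, show x + -m * n + m * n = x by ring, hxy]
      · refine (h2 (x + (-m) * n) k (by omega) (by omega)).2.2.2 ?_
        rw [← time_translate _ _ m, ← e2, show x + -m * n + m * n = x by ring, hxy])
    have e1 : time n l' p₁ p₂ = time n l p₁ p₂ := by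
      rw [ht, if_neg (by omega), if_neg (by omega)]
    have e2 : time n l' q₁ q₂ = time n l q₁ q₂ := by
      rw [ht, if_neg (by omega), if_neg (by omega)]
    have e3 : time n l' r₁ r₂ = k := by
      rw [ht, if_neg (by omega), if_pos hk]
    have e4 : ∀ a b v, v < k → time n l' a b = v → time n l a b = v := by
      intro a b v hv hab
      rw [ht] at hab
      split_ifs at hab <;> omega
    obtain ⟨l'', hs', g⟩ := ih (d - 1) (by omega) hl' (by omega) (by omega) (by omega) (by omega)
      (by
        intro z v hv hv'
        have := h1 z v (by omega) (by omega)
        exact ⟨fun h => this.1 (e4 _ _ _ (by omega) h), fun h => this.2.1 (e4 _ _ _ (by omega) h),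
          fun h => this.2.2.1 (e4 _ _ _ (by omega) h), fun h => this.2.2.2 (e4 _ _ _ (by omega) h)⟩)
      (by
        intro z v hv hv'
        have := h2 z v (by omega) (by omega)
        exact ⟨fun h => this.1 (e4 _ _ _ (by omega) h), fun h => this.2.1 (e4 _ _ _ (by omega) h),
          fun h => this.2.2.1 (e4 _ _ _ (by omega) h), fun h => this.2.2.2 (e4 _ _ _ (by omega) h)⟩)
    exact ⟨l'', .trans _ _ _ (.rel _ _ hs) hs', g⟩
  · exact ⟨l, .refl _, by omega, by omega, by omega⟩

/-- The triple `a < b < c` of inverted pairs belongs to the symmetric difference of `R` and the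
set of reversed triples of the word. -/
def Diff (n : ℕ) (l : List (ZMod n)) (R : ℤ → ℤ → ℤ → Prop) (a b c : ℤ) : Prop :=
  Invd (wordProd n l) a b ∧ Invd (wordProd n l) b c ∧ ¬ (R a b c ↔ RevP n l a b c)

/-- One of the three pairs of a triple is a translate of `q₁ < q₂`. -/
def ContainsPair (n : ℕ) (q₁ q₂ a b c : ℤ) : Prop :=
  (∃ m : ℤ, a = q₁ + m * n ∧ b = q₂ + m * n) ∨ (∃ m : ℤ, a = q₁ + m * n ∧ c = q₂ + m * n) ∨
    ∃ m : ℤ, b = q₁ + m * n ∧ c = q₂ + m * n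

theorem Asc.inDiff_iff {l : List (ZMod n)} (h : Asc n 1 l) {R : ℤ → ℤ → ℤ → Prop} {a b c : ℤ}
    (hab : a < b) (hbc : b < c) :
    InDiff l.length (time n l a b) (time n l b c) (R a b c) ↔ Diff n l R a b c := by
  simp only [InDiff, Diff, ← h.time_lt_length, RevP, hab, hbc, true_and]
  refine and_congr_right fun h1 => and_congr_right fun h2 => ?_
  simp [h1]

theorem Asc.fourLines {l : List (ZMod n)} (h : Asc n 1 l) {R : ℤ → ℤ → ℤ → Prop}
    (hR : TripleCons n (wordProd n l) R) {a b c d : ℤ} (hab : a < b) (hbc : b < c) (hcd : c < d) :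
    FourLines l.length (time n l a b) (time n l a c) (time n l a d) (time n l b c) (time n l b d)
      (time n l c d) (R a b c) (R a b d) (R a c d) (R b c d) where
  le := ⟨time_le .., time_le .., time_le .., time_le .., time_le .., time_le ..⟩
  b123 := h.time_between hab hbc
  b124 := h.time_between hab (hbc.trans hcd)
  b134 := h.time_between (hab.trans hbc) hcd
  b234 := h.time_between hbc hcd
  d123 := ⟨(h.time_ne hab hbc).1, (h.time_ne hab hbc).2.1⟩
  d124 := ⟨(h.time_ne hab (hbc.trans hcd)).1, (h.time_ne hab (hbc.trans hcd)).2.1⟩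
  d134 := ⟨(h.time_ne (hab.trans hbc) hcd).1, (h.time_ne (hab.trans hbc) hcd).2.1⟩
  d234 := ⟨(h.time_ne hbc hcd).1, (h.time_ne hbc hcd).2.1⟩
  full := by
    simp only [h.time_lt_length]
    exact hR.full
  first := by
    intro h1
    simp only [h.time_lt_length]
    exact hR.first hab (by rw [← h.time_lt_length]; omega)
  middle := by
    intro h1
    simp only [h.time_lt_length]
    exact hR.middle hbc (by rw [← h.time_lt_length]; omega)
  last := by
    intro h1
    simp only [h.time_lt_length]
    exact hR.last hcd (by rw [← h.time_lt_length]; omega)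

/-- The four entries are pairwise incongruent, so at most one pair formed from them is a translate
of `q₁ q₂`, and a pair lies in only two of the four triples. -/
theorem not_three_containsPair {w : Equiv.Perm ℤ} (hw : Periodic n w) {q₁ q₂ a b c d : ℤ}
    (hab : Invd w a b) (hbc : Invd w b c) (hcd : Invd w c d) :
    ¬ (ContainsPair n q₁ q₂ a b c ∧ ContainsPair n q₁ q₂ a b d ∧ ContainsPair n q₁ q₂ a c d) ∧
      ¬ (ContainsPair n q₁ q₂ a b c ∧ ContainsPair n q₁ q₂ a b d ∧ ContainsPair n q₁ q₂ b c d) ∧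
      ¬ (ContainsPair n q₁ q₂ a b c ∧ ContainsPair n q₁ q₂ a c d ∧ ContainsPair n q₁ q₂ b c d) ∧
      ¬ (ContainsPair n q₁ q₂ a b d ∧ ContainsPair n q₁ q₂ a c d ∧ ContainsPair n q₁ q₂ b c d) := by
  have h1 := hab.not_modEq hw
  have h2 := hbc.not_modEq hw
  have h3 := hcd.not_modEq hw
  have h4 := (hab.trans hbc).not_modEq hw
  have h5 := (hbc.trans hcd).not_modEq hw
  have h6 := (hab.trans (hbc.trans hcd)).not_modEq hw
  have hQ : ∀ x y x' y' : ℤ, (∃ m : ℤ, x = q₁ + m * n ∧ y = q₂ + m * n) →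
      (∃ m : ℤ, x' = q₁ + m * n ∧ y' = q₂ + m * n) → x ≡ x' [ZMOD n] ∧ y ≡ y' [ZMOD n] := by
    rintro x y x' y' ⟨m, rfl, rfl⟩ ⟨m', rfl, rfl⟩
    constructor <;> refine Int.modEq_iff_dvd.mpr ⟨m' - m, by ring⟩
  have hsymm : ∀ x y : ℤ, x ≡ y [ZMOD n] → y ≡ x [ZMOD n] := fun _ _ h => h.symm
  simp only [ContainsPair]
  generalize hP : (fun x y => ∃ m : ℤ, x = q₁ + m * n ∧ y = q₂ + m * n) = P at *
  have hP' : ∀ x y, (∃ m : ℤ, x = q₁ + m * n ∧ y = q₂ + m * n) = P x y := fun x y => by rw [← hP]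
  simp only [hP'] at *
  generalize hC : (fun x y => x ≡ y [ZMOD n]) = C at *
  have hC' : ∀ x y, (x ≡ y [ZMOD n]) = C x y := fun x y => by rw [← hC]
  simp only [hC'] at *
  clear hP hC hP' hC' hab hbc hcd
  have u1 := hQ a b a c
  have u2 := hQ a b a d
  have u3 := hQ a b b c
  have u4 := hQ a b b d
  have u5 := hQ a b c d
  have u6 := hQ a c a d
  have u7 := hQ a c b c
  have u8 := hQ a c b d
  have u9 := hQ a c c d
  have u10 := hQ a d b c
  have u11 := hQ a d b d
  have u12 := hQ a d c d
  have u13 := hQ b c b d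
  have u14 := hQ b c c d
  have u15 := hQ b d c d
  clear hQ
  have s1 := hsymm b a
  have s2 := hsymm c b
  have s3 := hsymm d c
  have s4 := hsymm c a
  have s5 := hsymm d b
  have s6 := hsymm d a
  clear hsymm
  grind

/-- A triple of minimal span in the difference is not cut by any line. -/
theorem Asc.noCut_of_minimal {l : List (ZMod n)} (h : Asc n 1 l) {R : ℤ → ℤ → ℤ → Prop}
    (hR : TripleCons n (wordProd n l) R) {q₁ q₂ : ℤ}
    (hq : ∀ a b c, Diff n l R a b c → ContainsPair n q₁ q₂ a b c) {a b c : ℤ}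
    (hX : Diff n l R a b c)
    (hmin : ∀ a' b' c', Diff n l R a' b' c' →
      span (time n l a b) (time n l b c) ≤ span (time n l a' b') (time n l b' c')) (z : ℤ)
    (hza : z ≠ a) (hzb : z ≠ b) (hzc : z ≠ c) :
    NoCutAt (time n l a b) (time n l a c) (time n l b c)
      (if a < z then time n l a z else time n l z a)
      (if b < z then time n l b z else time n l z b)
      (if c < z then time n l c z else time n l z c) := by
  have hthree : ∀ {a b c d : ℤ}, a < b → b < c → c < d →
      time n l a b < l.length → time n l b c < l.length → time n l c d < l.length →
      ¬ (InDiff l.length (time n l a b) (time n l b c) (R a b c) ∧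
          InDiff l.length (time n l a b) (time n l b d) (R a b d) ∧
          InDiff l.length (time n l a c) (time n l c d) (R a c d)) ∧
        ¬ (InDiff l.length (time n l a b) (time n l b c) (R a b c) ∧
          InDiff l.length (time n l a b) (time n l b d) (R a b d) ∧
          InDiff l.length (time n l b c) (time n l c d) (R b c d)) ∧
        ¬ (InDiff l.length (time n l a b) (time n l b c) (R a b c) ∧
          InDiff l.length (time n l a c) (time n l c d) (R a c d) ∧
          InDiff l.length (time n l b c) (time n l c d) (R b c d)) ∧
        ¬ (InDiff l.length (time n l a b) (time n l b d) (R a b d) ∧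
          InDiff l.length (time n l a c) (time n l c d) (R a c d) ∧
          InDiff l.length (time n l b c) (time n l c d) (R b c d)) := by
    intro a b c d hab hbc hcd h1 h2 h3
    rw [h.time_lt_length] at h1 h2 h3
    rw [h.inDiff_iff hab hbc, h.inDiff_iff hab (hbc.trans hcd), h.inDiff_iff (hab.trans hbc) hcd,
      h.inDiff_iff hbc hcd]
    obtain ⟨n1, n2, n3, n4⟩ := not_three_containsPair (wordProd_periodic n l) h1 h2 h3
      (q₁ := q₁) (q₂ := q₂)
    exact ⟨fun ⟨x, y, z⟩ => n1 ⟨hq _ _ _ x, hq _ _ _ y, hq _ _ _ z⟩,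
      fun ⟨x, y, z⟩ => n2 ⟨hq _ _ _ x, hq _ _ _ y, hq _ _ _ z⟩,
      fun ⟨x, y, z⟩ => n3 ⟨hq _ _ _ x, hq _ _ _ y, hq _ _ _ z⟩,
      fun ⟨x, y, z⟩ => n4 ⟨hq _ _ _ x, hq _ _ _ y, hq _ _ _ z⟩⟩
  have hM : ∀ {a' b' c' : ℤ}, a' < b' → b' < c' →
      InDiff l.length (time n l a' b') (time n l b' c') (R a' b' c') →
      span (time n l a b) (time n l b c) ≤ span (time n l a' b') (time n l b' c') :=
    fun h1 h2 h3 => hmin _ _ _ ((h.inDiff_iff h1 h2).mp h3)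
  have hab := hX.1.1
  have hbc := hX.2.1.1
  have hX' := (h.inDiff_iff hab hbc).mpr hX
  have main : ∀ {p q r s : ℤ} (hpq : p < q) (hqr : q < r) (hrs : r < s), _ :=
    fun {p q r s} hpq hqr hrs => (h.fourLines hR hpq hqr hrs).noCut
      (hthree hpq hqr hrs) (hM hpq hqr) (hM hpq (hqr.trans hrs)) (hM (hpq.trans hqr) hrs)
      (hM hqr hrs)
  rcases lt_or_gt_of_ne hza with h1 | h1
  · rw [if_neg (by omega), if_neg (by omega), if_neg (by omega)]
    exact (main h1 hab hbc).2.2.2 hX' rfl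
  rw [if_pos h1]
  rcases lt_or_gt_of_ne hzb with h2 | h2
  · rw [if_neg (by omega), if_neg (by omega)]
    exact (main h1 h2 hbc).2.2.1 hX' rfl
  rw [if_pos h2]
  rcases lt_or_gt_of_ne hzc with h3 | h3
  · rw [if_neg (by omega)]
    exact (main hab h2 h3).2.1 hX' rfl
  rw [if_pos h3]
  exact (main hab hbc h3).1 hX' rfl

/-- After commutations a single braid move can be applied to `l`, in a triple in which the reversed
triples of `l` differ from `R`. -/
def HasBraid (n : ℕ) (l : List (ZMod n)) (R : ℤ → ℤ → ℤ → Prop) : Prop :=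
  ∃ l₁ l₂ a b c, Relation.EqvGen (WordCommStep n) l l₁ ∧ Asc n 1 l₂ ∧
    wordProd n l₂ = wordProd n l ∧ l₂.length = l.length ∧ Diff n l R a b c ∧
    ((BraidStep n l₁ l₂ ∧ ∀ a' b' c', RevP n l₂ a' b' c' ↔ RevP n l a' b' c' ∨
        ∃ m : ℤ, a' = a + m * n ∧ b' = b + m * n ∧ c' = c + m * n) ∨
      (BraidStep n l₂ l₁ ∧ ∀ a' b' c', RevP n l a' b' c' ↔ RevP n l₂ a' b' c' ∨
        ∃ m : ℤ, a' = a + m * n ∧ b' = b + m * n ∧ c' = c + m * n))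

set_option maxHeartbeats 1000000 in
/-- If the reversed triples of a word differ from a consistent set only in triples that contain a
fixed pair, then the difference can be reduced by commutations and a single braid move. -/
theorem Asc.exists_braid (hn : 0 < n) {l : List (ZMod n)} (h : Asc n 1 l)
    {R : ℤ → ℤ → ℤ → Prop} (hR : TripleCons n (wordProd n l) R) {q₁ q₂ : ℤ}
    (hq : ∀ a b c, Diff n l R a b c → ContainsPair n q₁ q₂ a b c)
    (hne : ∃ a b c, Diff n l R a b c) :
    HasBraid n l R := by
  -- The triangle to be reversed is a triple of the difference whose first and last crossings are
  -- closest in time, so that no other line cuts it.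
  obtain ⟨⟨a, b, c⟩, hX, hmin⟩ := (measure fun t : ℤ × ℤ × ℤ =>
    span (time n l t.1 t.2.1) (time n l t.2.1 t.2.2)).wf.has_min
    {t | Diff n l R t.1 t.2.1 t.2.2} (let ⟨a, b, c, h⟩ := hne; ⟨(a, b, c), h⟩)
  have hX : Diff n l R a b c := hX
  have hmin : ∀ a' b' c', Diff n l R a' b' c' →
      span (time n l a b) (time n l b c) ≤ span (time n l a' b') (time n l b' c') :=
    fun a' b' c' h' => not_lt.mp (hmin (a', b', c') h')
  have hcut := h.noCut_of_minimal hR hq hX hmin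
  have hab := hX.1.1
  have hbc := hX.2.1.1
  have i1 := (h.time_lt_length a b).mpr hX.1
  have i2 := (h.time_lt_length b c).mpr hX.2.1
  have i3 := (h.time_lt_length a c).mpr (hX.1.trans hX.2.1)
  have hbt := h.time_between hab hbc
  have hne := h.time_ne hab hbc
  have hif : ∀ x y v, v < l.length → time n l x y = v ∨ time n l y x = v →
      (if x < y then time n l x y else time n l y x) = v := by
    rintro x y v hv (hxy | hxy)
    · rw [if_pos (h.lt_of_time (by omega)), hxy]
    · rw [if_neg (by have := h.lt_of_time (x := y) (y := x) (by omega); omega), hxy]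
  have hself : ∀ x, time n l x x = l.length := by
    intro x
    have h1 := time_le n l x x
    by_contra h2
    have := h.lt_of_time (x := x) (y := x) (by omega)
    omega
  have hrevn : ∀ {x y : ℤ}, y < x → time n l x y = l.length := by
    intro x y hxy
    have h1 := time_le n l x y
    by_contra h2
    have := h.lt_of_time (x := x) (y := y) (by omega)
    omega
  have rab := hrevn hab
  have rbc := hrevn hbc
  have rac := hrevn (hab.trans hbc)
  have sa := hself a
  have sb := hself b
  have sc := hself c
  -- Equal or wrongly ordered entries have the length as their time. Hence a crossing on a side of
  -- the triangle, at a time other than those of its corners on this side, involves a fourth line.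
  have hA : ∀ z v, v < l.length → v ≠ time n l a b → v ≠ time n l a c →
      time n l a z = v ∨ time n l z a = v → z ≠ a ∧ z ≠ b ∧ z ≠ c := by
    intro z v hv h1 h2 h3
    refine ⟨?_, ?_, ?_⟩ <;> rintro rfl <;> omega
  have hB : ∀ z v, v < l.length → v ≠ time n l a b → v ≠ time n l b c →
      time n l b z = v ∨ time n l z b = v → z ≠ a ∧ z ≠ b ∧ z ≠ c := by
    intro z v hv h1 h2 h3
    refine ⟨?_, ?_, ?_⟩ <;> rintro rfl <;> omega
  have hC : ∀ z v, v < l.length → v ≠ time n l a c → v ≠ time n l b c →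
      time n l c z = v ∨ time n l z c = v → z ≠ a ∧ z ≠ b ∧ z ≠ c := by
    intro z v hv h1 h2 h3
    refine ⟨?_, ?_, ?_⟩ <;> rintro rfl <;> omega
  by_cases hlex : time n l a b < time n l b c
  · have cA : ∀ z v, time n l a b < v → v < time n l a c →
        ¬ (time n l a z = v ∨ time n l z a = v) := by
      intro z v h1 h2 h3
      obtain ⟨n1, n2, n3⟩ := hA z v (by omega) (by omega) (by omega) h3
      have := ((hcut z n1 n2 n3).1 hlex).1
      rw [hif a z v (by omega) h3] at this
      exact this ⟨h1, h2⟩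
    have cB : ∀ z v, time n l a b < v → v < time n l a c →
        ¬ (time n l b z = v ∨ time n l z b = v) := by
      intro z v h1 h2 h3
      obtain ⟨n1, n2, n3⟩ := hB z v (by omega) (by omega) (by omega) h3
      have := ((hcut z n1 n2 n3).1 hlex).2.1
      rw [hif b z v (by omega) h3] at this
      exact this ⟨h1, h2⟩
    have cB' : ∀ z v, time n l a c < v → v < time n l b c →
        ¬ (time n l b z = v ∨ time n l z b = v) := by
      intro z v h1 h2 h3
      obtain ⟨n1, n2, n3⟩ := hB z v (by omega) (by omega) (by omega) h3
      have := ((hcut z n1 n2 n3).1 hlex).2.2.1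
      rw [hif b z v (by omega) h3] at this
      exact this ⟨h1, h2⟩
    have cC : ∀ z v, time n l a c < v → v < time n l b c →
        ¬ (time n l c z = v ∨ time n l z c = v) := by
      intro z v h1 h2 h3
      obtain ⟨n1, n2, n3⟩ := hC z v (by omega) (by omega) (by omega) h3
      have := ((hcut z n1 n2 n3).1 hlex).2.2.2
      rw [hif c z v (by omega) h3] at this
      exact this ⟨h1, h2⟩
    obtain ⟨l₁, hs, e1, e2, e3⟩ := h.exists_tighten (time n l b c - time n l a b)
      (p₁ := a) (p₂ := b) (q₁ := a) (q₂ := c) (r₁ := b) (r₂ := c) (by omega) (by omega)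
      (by omega) i2
      (fun z v h1 h2 => by
        have := cA z v h1 h2
        have := cB z v h1 h2
        tauto)
      (fun z v h1 h2 => by
        have := cB' z v h1 h2
        have := cC z v h1 h2
        tauto)
    obtain ⟨g1, g2, g3, g4⟩ := Asc.of_eqvGen hs h
    obtain ⟨hn3, i, hsplit⟩ := g1.braid_of_lex hn e3 rfl e1 e2
    generalize hm₁ : l₁.take (time n l₁ a b) = m₁ at hsplit
    generalize l₁.drop (time n l₁ a b + 3) = m₂ at hsplit
    have hm₁' : m₁.length = time n l₁ a b := by
      rw [← hm₁, List.length_take]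
      omega
    subst hsplit
    have g1' := g1
    rw [asc_append, asc_append] at g1'
    have hper : Periodic n (1 * wordProd n m₁) := by
      rw [one_mul]
      exact wordProd_periodic n m₁
    obtain ⟨p, hp⟩ := ZMod.intCast_surjective i
    have hiff := asc_braid_iff hn3 hper hp
    have hl₂ : Asc n 1 (m₁ ++ [i + 1, i, i + 1] ++ m₂) := by
      rw [asc_append, asc_append]
      refine ⟨⟨g1'.1.1, hiff.2.mpr (hiff.1.mp g1'.1.2)⟩, ?_⟩
      rw [wordProd_append, ← simple_braid hn3, ← wordProd_append]
      exact g1'.2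
    obtain ⟨x, y, z, t1, t2, t3, hrev⟩ := g1.revP_braid hn3 hl₂
    refine ⟨_, _, a, b, c, hs, hl₂, ?_, ?_, hX, .inl ⟨⟨m₁, m₂, i, rfl, rfl⟩, ?_⟩⟩
    · rw [← g2]
      simp only [wordProd_append, simple_braid hn3]
    · rw [← g3]
      simp
    · intro a' b' c'
      rw [hrev, g4]
      refine or_congr_right ?_
      -- The first and last crossings of the braid are those of `a b` and `b c` up to translation.
      -- The common entry forces both translations to agree, so the reversed triple is the chosen
      -- one.
      obtain ⟨μ, f1, f2⟩ := g1.exists_translate (t1.trans hm₁') (by omega)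
      obtain ⟨ν, f3, f4⟩ := g1.exists_translate (x := y) (y := z) (x' := b) (y' := c) (by omega) (by omega)
      have : μ * n = ν * n := by omega
      constructor
      · rintro ⟨m, rfl, rfl, rfl⟩
        exact ⟨m - μ, by linarith, by linarith, by linarith⟩
      · rintro ⟨m, rfl, rfl, rfl⟩
        exact ⟨m + μ, by linarith, by linarith, by linarith⟩
  · have hanti : time n l b c < time n l a b := by omega
    have cA : ∀ z v, time n l a c < v → v < time n l a b →
        ¬ (time n l a z = v ∨ time n l z a = v) := by
      intro z v h1 h2 h3
      obtain ⟨n1, n2, n3⟩ := hA z v (by omega) (by omega) (by omega) h3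
      have := ((hcut z n1 n2 n3).2 hanti).2.2.1
      rw [hif a z v (by omega) h3] at this
      exact this ⟨h1, h2⟩
    have cB : ∀ z v, time n l a c < v → v < time n l a b →
        ¬ (time n l b z = v ∨ time n l z b = v) := by
      intro z v h1 h2 h3
      obtain ⟨n1, n2, n3⟩ := hB z v (by omega) (by omega) (by omega) h3
      have := ((hcut z n1 n2 n3).2 hanti).2.2.2
      rw [hif b z v (by omega) h3] at this
      exact this ⟨h1, h2⟩
    have cB' : ∀ z v, time n l b c < v → v < time n l a c →
        ¬ (time n l b z = v ∨ time n l z b = v) := by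
      intro z v h1 h2 h3
      obtain ⟨n1, n2, n3⟩ := hB z v (by omega) (by omega) (by omega) h3
      have := ((hcut z n1 n2 n3).2 hanti).1
      rw [hif b z v (by omega) h3] at this
      exact this ⟨h1, h2⟩
    have cC : ∀ z v, time n l b c < v → v < time n l a c →
        ¬ (time n l c z = v ∨ time n l z c = v) := by
      intro z v h1 h2 h3
      obtain ⟨n1, n2, n3⟩ := hC z v (by omega) (by omega) (by omega) h3
      have := ((hcut z n1 n2 n3).2 hanti).2.1
      rw [hif c z v (by omega) h3] at this
      exact this ⟨h1, h2⟩
    obtain ⟨l₁, hs, e1, e2, e3⟩ := h.exists_tighten (time n l a b - time n l b c)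
      (p₁ := b) (p₂ := c) (q₁ := a) (q₂ := c) (r₁ := a) (r₂ := b) (by omega) (by omega)
      (by omega) i1
      (fun z v h1 h2 => by
        have := cB' z v h1 h2
        have := cC z v h1 h2
        tauto)
      (fun z v h1 h2 => by
        have := cA z v h1 h2
        have := cB z v h1 h2
        tauto)
    obtain ⟨g1, g2, g3, g4⟩ := Asc.of_eqvGen hs h
    obtain ⟨hn3, i, hsplit⟩ := g1.braid_of_antilex hn e3 rfl e1 e2
    generalize hm₁ : l₁.take (time n l₁ b c) = m₁ at hsplit
    generalize l₁.drop (time n l₁ b c + 3) = m₂ at hsplit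
    have hm₁' : m₁.length = time n l₁ b c := by
      rw [← hm₁, List.length_take]
      omega
    subst hsplit
    have g1' := g1
    rw [asc_append, asc_append] at g1'
    have hper : Periodic n (1 * wordProd n m₁) := by
      rw [one_mul]
      exact wordProd_periodic n m₁
    obtain ⟨p, hp⟩ := ZMod.intCast_surjective i
    have hiff := asc_braid_iff hn3 hper hp
    have hl₂ : Asc n 1 (m₁ ++ [i, i + 1, i] ++ m₂) := by
      rw [asc_append, asc_append]
      refine ⟨⟨g1'.1.1, hiff.1.mpr (hiff.2.mp g1'.1.2)⟩, ?_⟩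
      rw [wordProd_append, simple_braid hn3, ← wordProd_append]
      exact g1'.2
    -- Now the new word is the lexicographic one and the braid move leads back from it. The triple
    -- located by its crossings and the triple named by `revP_braid` are matched by comparing times.
    obtain ⟨x, y, z, t1, t2, t3, t4, t5, t6⟩ := hl₂.braid_times hn3 g1
    obtain ⟨x', y', z', t1', t2', t3', hrev⟩ := hl₂.revP_braid hn3 g1
    refine ⟨_, _, a, b, c, hs, hl₂, ?_, ?_, hX, .inr ⟨⟨m₁, m₂, i, rfl, rfl⟩, ?_⟩⟩
    · rw [← g2]
      simp only [wordProd_append, simple_braid hn3]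
    · rw [← g3]
      simp
    · intro a' b' c'
      rw [← g4, hrev]
      refine or_congr_right ?_
      have hlen : (m₁ ++ [i, i + 1, i] ++ m₂).length = (m₁ ++ [i + 1, i, i + 1] ++ m₂).length := by
        simp
      obtain ⟨α, k1, k2⟩ := hl₂.exists_translate (t1.trans t1'.symm) (by omega)
      obtain ⟨β, k3, k4⟩ := hl₂.exists_translate (t3.trans t3'.symm) (by omega)
      obtain ⟨μ, f1, f2⟩ := g1.exists_translate (t4.trans hm₁') (by omega)
      obtain ⟨ν, f3, f4⟩ := g1.exists_translate (x := x) (y := y) (x' := a) (y' := b) (by omega) (by omega)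
      have h1 : μ * n = ν * n := by omega
      have h2 : α * n = β * n := by omega
      constructor
      · rintro ⟨m, rfl, rfl, rfl⟩
        exact ⟨m + α - μ, by linarith, by linarith, by linarith⟩
      · rintro ⟨m, rfl, rfl, rfl⟩
        exact ⟨m + μ - α, by linarith, by linarith, by linarith⟩

end

end AffineBruhat

/-! ### Braid moves towards none or all of the inverted triples -/

namespace AffineBruhat

section

variable {n : ℕ}

/-- Moves inside the prefix keep its product, so the last letter performs the same crossing and
contributes the same reversed triples before and after the braid. -/
theorem HasBraid.append_singleton {l : List (ZMod n)} {j : ZMod n} (h : Asc n 1 (l ++ [j]))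
    {R R' : ℤ → ℤ → ℤ → Prop}
    (hRR : ∀ a b c, Invd (wordProd n l) a b → Invd (wordProd n l) b c → (R a b c ↔ R' a b c))
    (hb : HasBraid n l R') : HasBraid n (l ++ [j]) R := by
  have hl := (asc_append.mp h).1
  obtain ⟨l₁, l₂, a, b, c, h1, h2, h3, h4, h5, h6⟩ := hb
  have hasc : Asc n 1 (l₂ ++ [j]) := by
    rw [asc_append, h3]
    exact ⟨h2, (asc_append.mp h).2⟩
  have hprod : wordProd n (l₂ ++ [j]) = wordProd n (l ++ [j]) := by
    rw [wordProd_append, wordProd_append, h3]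
  have hlen : (l₂ ++ [j]).length = (l ++ [j]).length := by simp [h4]
  have hT : ∀ x y, Invd (wordProd n l) x y → time n (l ++ [j]) x y = time n l x y ∧
      Invd (wordProd n (l ++ [j])) x y := by
    intro x y hxy
    have i1 := (hl.time_lt_length x y).mpr hxy
    have i2 := h.time_append x y
    refine ⟨by omega, (h.time_lt_length x y).mp ?_⟩
    simp only [List.length_append, List.length_singleton]
    omega
  have hlast : ∀ x y, (time n (l₂ ++ [j]) x y < l₂.length ↔ time n (l ++ [j]) x y < l.length) ∧
      (time n (l₂ ++ [j]) x y = l₂.length ↔ time n (l ++ [j]) x y = l.length) := by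
    intro x y
    have i1 := hl.time_lt_length x y
    have i2 := h2.time_lt_length x y
    have i3 := h.time_lt_length x y
    have i4 := hasc.time_lt_length x y
    have i5 := h.time_append x y
    have i6 := hasc.time_append x y
    have i7 := time_le n l x y
    have i8 := time_le n l₂ x y
    have i9 := time_le n (l ++ [j]) x y
    have i10 := time_le n (l₂ ++ [j]) x y
    rw [h3, ← i1] at i2
    rw [hprod, ← i3] at i4
    simp only [List.length_append, List.length_singleton] at i3 i4 i9 i10
    omega
  have hrev : ∀ a b c, RevP n (l₂ ++ [j]) a b c ↔ RevP n l₂ a b c ∨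
      (time n (l ++ [j]) a b = l.length ∧ time n (l ++ [j]) b c < l.length) := by
    intro a b c
    rw [hasc.revP_append_singleton, (hlast a b).2, (hlast b c).1]
  refine ⟨l₁ ++ [j], l₂ ++ [j], a, b, c, eqvGen_append h1 _, hasc, hprod, hlen, ?_, ?_⟩
  · obtain ⟨d1, d2, d3⟩ := h5
    refine ⟨(hT _ _ d1).2, (hT _ _ d2).2, ?_⟩
    rw [hRR a b c d1 d2, h.revP_append_singleton, (hT _ _ d1).1]
    have := (hl.time_lt_length a b).mpr d1
    intro h7
    refine d3 (h7.trans (or_iff_left ?_))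
    omega
  · refine h6.imp ?_ ?_
    · rintro ⟨⟨m₁, m₂, i, rfl, rfl⟩, h8⟩
      refine ⟨⟨m₁, m₂ ++ [j], i, by simp, by simp⟩, fun a' b' c' => ?_⟩
      rw [hrev, h.revP_append_singleton, h8]
      exact or_right_comm
    · rintro ⟨⟨m₁, m₂, i, rfl, rfl⟩, h8⟩
      refine ⟨⟨m₁, m₂ ++ [j], i, by simp, by simp⟩, fun a' b' c' => ?_⟩
      rw [hrev, h.revP_append_singleton, h8]
      exact or_right_comm

/-- A word whose reversed triples are not all the inverted triples, or not none of them, admits a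
braid move in the direction of this goal. -/
theorem Asc.hasBraid_const (hn : 0 < n) (β : Prop) {l : List (ZMod n)} (h : Asc n 1 l)
    (hne : ∃ a b c, Diff n l
      (fun a b c => β ∧ Invd (wordProd n l) a b ∧ Invd (wordProd n l) b c) a b c) :
    HasBraid n l fun a b c => β ∧ Invd (wordProd n l) a b ∧ Invd (wordProd n l) b c := by
  induction l using List.reverseRecOn with
  | nil =>
    obtain ⟨a, b, c, h1, -⟩ := hne
    exact absurd h1 (not_invd_one a b)
  | append_singleton l j ih =>
    have hl := (asc_append.mp h).1
    have hT : ∀ x y, Invd (wordProd n l) x y → Invd (wordProd n (l ++ [j])) x y := by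
      intro x y hxy
      have i1 := (hl.time_lt_length x y).mpr hxy
      have i2 := h.time_append x y
      refine (h.time_lt_length x y).mp ?_
      simp only [List.length_append, List.length_singleton]
      omega
    -- If the prefix already disagrees with the target, the induction hypothesis gives a move there.
    -- Otherwise every disagreement involves the crossing made by the last letter.
    by_cases hd : ∃ a b c, Diff n l
        (fun a b c => β ∧ Invd (wordProd n l) a b ∧ Invd (wordProd n l) b c) a b c
    · refine (ih hl hd).append_singleton h fun a b c h1 h2 => ?_
      simp only [h1, h2, hT _ _ h1, hT _ _ h2]
    have hper := wordProd_periodic n (l ++ [j])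
    have hcons : TripleCons n (wordProd n (l ++ [j])) fun a b c =>
        β ∧ Invd (wordProd n (l ++ [j])) a b ∧ Invd (wordProd n (l ++ [j])) b c := by
      refine ⟨fun h => h.2, fun m h => ?_, fun h1 h2 h3 => ?_, ?_, ?_, ?_⟩
      · rwa [invd_translate hper, invd_translate hper]
      · have h4 := h1.trans h2
        have h5 := h2.trans h3
        left
        tauto
      · tauto
      · tauto
      · tauto
    -- The fixed pair required by `exists_braid` is the one inverted by the last letter.
    refine h.exists_braid hn hcons
      (q₁ := prefixProd n (l ++ [j]) l.length (j.cast : ℤ))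
      (q₂ := prefixProd n (l ++ [j]) l.length ((j.cast : ℤ) + 1)) ?_ hne
    rintro a b c ⟨d1, d2, d3⟩
    have key : ∀ x y, time n (l ++ [j]) x y = l.length →
        ∃ m : ℤ, x = prefixProd n (l ++ [j]) l.length (j.cast : ℤ) + m * n ∧
          y = prefixProd n (l ++ [j]) l.length ((j.cast : ℤ) + 1) + m * n := by
      intro x y hxy
      have := (h.time_eq_iff (j := l.length) (by simp) x y).mp hxy
      simpa using this
    have i1 := (h.time_lt_length a b).mpr d1
    have i2 := (h.time_lt_length b c).mpr d2
    have i3 := h.time_append a b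
    have i4 := h.time_append b c
    simp only [List.length_append, List.length_singleton] at i1 i2
    by_cases c1 : time n (l ++ [j]) a b = l.length
    · exact .inl (key _ _ c1)
    by_cases c2 : time n (l ++ [j]) b c = l.length
    · exact .inr (.inr (key _ _ c2))
    have e1 := (hl.time_lt_length a b).mp (by omega)
    have e2 := (hl.time_lt_length b c).mp (by omega)
    refine absurd ⟨a, b, c, e1, e2, ?_⟩ hd
    rw [h.revP_append_singleton] at d3
    simp only [e1, e2, d1, d2] at d3 ⊢
    intro h7
    exact d3 (h7.trans (or_iff_left (by omega)).symm)

end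

end AffineBruhat

namespace AffineBruhat

section

variable {n : ℕ} {k : ℕ} {w : Equiv.Perm ℤ}

/-! ### Classes of pairs and triples -/

theorem AffSet.exists_mk (X : AffSet n k) : ∃ t : Tuple n k, AffSet.mk t = X :=
  Quotient.exists_rep X

theorem AffSet.mk_eq_mk {s t : Tuple n k} :
    AffSet.mk s = AffSet.mk t ↔ ∃ m : ℤ, ∀ i, s.1 i = t.1 i + m * n :=
  Quotient.eq (r := tupleSetoid n k)

theorem AffSet.del_mk (t : Tuple n (k + 1)) (i : Fin (k + 1)) :
    (AffSet.mk t).del i = AffSet.mk (t.del i) := rfl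

theorem AffSet.shift_mk (t : Tuple n k) (i : Fin k) :
    (AffSet.mk t).shift i = AffSet.mk (t.shift i) := rfl

/-- If deleting two different entries gave translates of each other, comparing the entries at one
index would give two different entries of the tuple that are congruent. -/
theorem AffSet.del_injective (X : AffSet n (k + 1)) : Function.Injective X.del := by
  obtain ⟨t, rfl⟩ := X.exists_mk
  intro i j hij
  by_contra hne
  obtain ⟨m, h⟩ := AffSet.mk_eq_mk.mp hij
  obtain ⟨j', hj'⟩ := Fin.exists_succAbove_eq (Ne.symm hne)
  have h1 := h j'
  simp only [Tuple.del, hj'] at h1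
  refine t.2.2 j (j.succAbove j') (Fin.succAbove_ne j j').symm ?_
  rw [h1]
  exact (Int.modEq_iff_dvd.mpr ⟨-m, by ring⟩)

theorem mk_mem_invSet (hw : Periodic n w) {t : Tuple n k} :
    AffSet.mk t ∈ InvSet n w k ↔ StrictAnti fun i => w.symm (t.1 i) := by
  constructor
  · rintro ⟨s, h, hs⟩ i j hij
    obtain ⟨m, hm⟩ := AffSet.mk_eq_mk.mp h
    have := hs hij
    simp only [hm, hw.symm_apply] at this
    dsimp only
    omega
  · exact fun h => ⟨t, rfl, h⟩

/-- A prefix is a set of indices closed upwards, and closure can be tested on neighbouring indices.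
The threshold is the least index that occurs. -/
theorem isPacketPrefix_iff {X : AffSet n (k + 1)} {R : Set (AffSet n k)} :
    IsPacketPrefix X (packet X ∩ R) ↔ ∀ i : Fin k, X.del i.castSucc ∈ R → X.del i.succ ∈ R := by
  have key : ∀ m : ℕ, (packet X ∩ R = {Y | ∃ i : Fin (k + 1), m ≤ (i : ℕ) ∧ X.del i = Y}) ↔
      ∀ i, X.del i ∈ R ↔ m ≤ (i : ℕ) := by
    intro m
    constructor
    · intro h i
      have := Set.ext_iff.mp h (X.del i)
      simp only [packet, Set.mem_inter_iff, Set.mem_range_self, true_and, Set.mem_ofPred_eq] at this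
      rw [this]
      constructor
      · rintro ⟨j, h1, h2⟩
        rwa [← X.del_injective h2]
      · exact fun h => ⟨i, h, rfl⟩
    · intro h
      ext Y
      constructor
      · rintro ⟨⟨i, rfl⟩, h1⟩
        exact ⟨i, (h i).mp h1, rfl⟩
      · rintro ⟨i, h1, rfl⟩
        exact ⟨⟨i, rfl⟩, (h i).mpr h1⟩
  simp only [IsPacketPrefix, key]
  constructor
  · rintro ⟨m, h⟩ i
    rw [h, h]
    simp only [Fin.val_castSucc, Fin.val_succ]
    omega
  · intro h
    by_cases hex : ∃ i : ℕ, ∃ hi : i < k + 1, X.del ⟨i, hi⟩ ∈ R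
    · classical
      refine ⟨Nat.find hex, fun i => ⟨fun hi => Nat.find_min' hex ⟨i.2, hi⟩, fun hi => ?_⟩⟩
      obtain ⟨h1, h2⟩ := Nat.find_spec hex
      have : ∀ j : ℕ, Nat.find hex ≤ j → ∀ hj : j < k + 1, X.del ⟨j, hj⟩ ∈ R := by
        intro j hj
        induction j, hj using Nat.le_induction with
        | base => exact fun _ => h2
        | succ j hj ih => exact fun hj' => h ⟨j, by omega⟩ (ih (by omega))
      exact this i hi i.2
    · push Not at hex
      -- The threshold `k + 1` exceeds every index and stands for the empty prefix.
      refine ⟨k + 1, fun i => ⟨fun hi => absurd hi (hex i i.2), fun hi => ?_⟩⟩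
      have := i.2
      omega

/-- Suffixes of a packet are the complements of its prefixes. -/
theorem isPacketSuffix_iff {X : AffSet n (k + 1)} {R : Set (AffSet n k)} :
    IsPacketSuffix X (packet X ∩ R) ↔ ∀ i : Fin k, X.del i.succ ∈ R → X.del i.castSucc ∈ R := by
  have h1 : ∀ m : ℕ, (packet X ∩ R = {Y | ∃ i : Fin (k + 1), (i : ℕ) < m ∧ X.del i = Y}) ↔
      (packet X ∩ Rᶜ = {Y | ∃ i : Fin (k + 1), m ≤ (i : ℕ) ∧ X.del i = Y}) := by
    intro m
    have hinj : ∀ i (p : Fin (k + 1) → Prop), (∃ j, p j ∧ X.del j = X.del i) ↔ p i :=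
      fun i p => ⟨fun ⟨j, hj, e⟩ => X.del_injective e ▸ hj, fun h => ⟨i, h, rfl⟩⟩
    constructor <;> intro h <;> ext Y <;> (constructor <;> [rintro ⟨⟨i, rfl⟩, h2⟩; rintro ⟨i, h2, rfl⟩])
    all_goals
      have h3 := Set.ext_iff.mp h (X.del i)
      simp only [packet, Set.mem_inter_iff, Set.mem_range_self, true_and, Set.mem_ofPred_eq,
        hinj, Set.mem_compl_iff] at h2 h3 ⊢
      grind
  have h2 := isPacketPrefix_iff (X := X) (R := Rᶜ)
  have h3 : IsPacketSuffix X (packet X ∩ R) ↔ IsPacketPrefix X (packet X ∩ Rᶜ) :=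
    exists_congr h1
  rw [h3, h2]
  exact forall_congr' fun i => not_imp_not

/-- Being an ideal need only be tested on the generating relations, and the packet condition only on
neighbouring indices. -/
theorem isConsistent_iff {R : Set (AffSet n k)} : IsConsistent n w R ↔
    R ⊆ InvSet n w k ∧ (∀ A B, A ∈ InvSet n w k → B ∈ R → QuasiRel n w A B ∨ CongrRel A B → A ∈ R) ∧
    ∀ X ∈ InvSet n w (k + 1), (∀ i : Fin k, X.del i.castSucc ∈ R → X.del i.succ ∈ R) ∨
      ∀ i : Fin k, X.del i.succ ∈ R → X.del i.castSucc ∈ R := by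
  constructor
  · rintro ⟨h1, h2, h3⟩
    refine ⟨h1, fun A B hA hB h => h2 A B hB (.single ⟨hA, h1 hB, h⟩), fun X hX => ?_⟩
    rw [← isPacketPrefix_iff, ← isPacketSuffix_iff]
    exact h3 X hX
  · rintro ⟨h1, h2, h3⟩
    refine ⟨h1, fun A B hB h => ?_, fun X hX => ?_⟩
    · induction h using Relation.ReflTransGen.head_induction_on with
      | refl => exact hB
      | head h _ ih => exact h2 _ _ h.1 ih h.2.2
    · rw [isPacketPrefix_iff, isPacketSuffix_iff]
      exact h3 X hX

/-- The relation on integers that belongs to a set of classes of pairs. -/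
def PairRel (R : Set (AffSet n 2)) (x y : ℤ) : Prop :=
  ∃ t : Tuple n 2, t.1 = ![x, y] ∧ AffSet.mk t ∈ R

/-- The relation on integers that belongs to a set of classes of triples. -/
def TripleRel (R : Set (AffSet n 3)) (x y z : ℤ) : Prop :=
  ∃ t : Tuple n 3, t.1 = ![x, y, z] ∧ AffSet.mk t ∈ R

theorem Tuple.eq_pair (t : Tuple n 2) : t.1 = ![t.1 0, t.1 1] := by
  funext i
  fin_cases i <;> rfl

theorem Tuple.eq_triple (t : Tuple n 3) : t.1 = ![t.1 0, t.1 1, t.1 2] := by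
  funext i
  fin_cases i <;> rfl

theorem Tuple.eq_quad (t : Tuple n 4) : t.1 = ![t.1 0, t.1 1, t.1 2, t.1 3] := by
  funext i
  fin_cases i <;> rfl

theorem Tuple.exists_pair {x y : ℤ} (h : x < y) (h' : ¬ x ≡ y [ZMOD n]) :
    ∃ t : Tuple n 2, t.1 = ![x, y] := by
  refine ⟨⟨![x, y], ?_, ?_⟩, rfl⟩
  · intro i j hij
    fin_cases i <;> fin_cases j <;> simp_all
  · intro i j hij
    fin_cases i <;> fin_cases j <;> simp_all [Int.modEq_comm]

theorem Tuple.exists_triple {x y z : ℤ} (h1 : x < y) (h2 : y < z) (h3 : ¬ x ≡ y [ZMOD n])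
    (h4 : ¬ x ≡ z [ZMOD n]) (h5 : ¬ y ≡ z [ZMOD n]) :
    ∃ t : Tuple n 3, t.1 = ![x, y, z] := by
  refine ⟨⟨![x, y, z], ?_, ?_⟩, rfl⟩
  · have := h1.trans h2
    intro i j hij
    fin_cases i <;> fin_cases j <;> simp_all
  · intro i j hij
    fin_cases i <;> fin_cases j <;> simp_all [Int.modEq_comm]

theorem Tuple.exists_quad {a b c d : ℤ} (h1 : a < b) (h2 : b < c) (h3 : c < d)
    (h4 : ¬ a ≡ b [ZMOD n]) (h5 : ¬ a ≡ c [ZMOD n]) (h6 : ¬ a ≡ d [ZMOD n])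
    (h7 : ¬ b ≡ c [ZMOD n]) (h8 : ¬ b ≡ d [ZMOD n]) (h9 : ¬ c ≡ d [ZMOD n]) :
    ∃ t : Tuple n 4, t.1 = ![a, b, c, d] := by
  refine ⟨⟨![a, b, c, d], ?_, ?_⟩, rfl⟩
  · have := h1.trans h2
    have := h2.trans h3
    have := (h1.trans h2).trans h3
    intro i j hij
    fin_cases i <;> fin_cases j <;> simp_all
  · intro i j hij
    fin_cases i <;> fin_cases j <;> simp_all [Int.modEq_comm]

theorem pairRel_mk {R : Set (AffSet n 2)} {t : Tuple n 2} {x y : ℤ} (h : t.1 = ![x, y]) :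
    AffSet.mk t ∈ R ↔ PairRel R x y :=
  ⟨fun h' => ⟨t, h, h'⟩, fun ⟨s, h1, h2⟩ => (Subtype.ext (h1.trans h.symm) : s = t) ▸ h2⟩

theorem tripleRel_mk {R : Set (AffSet n 3)} {t : Tuple n 3} {x y z : ℤ} (h : t.1 = ![x, y, z]) :
    AffSet.mk t ∈ R ↔ TripleRel R x y z :=
  ⟨fun h' => ⟨t, h, h'⟩, fun ⟨s, h1, h2⟩ => (Subtype.ext (h1.trans h.symm) : s = t) ▸ h2⟩

theorem mk_pair_eq {s t : Tuple n 2} {x y x' y' : ℤ} (hs : s.1 = ![x, y]) (ht : t.1 = ![x', y']) :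
    AffSet.mk s = AffSet.mk t ↔ ∃ m : ℤ, x = x' + m * n ∧ y = y' + m * n := by
  rw [AffSet.mk_eq_mk, hs, ht]
  simp [Fin.forall_fin_two]

theorem mk_triple_eq {s t : Tuple n 3} {x y z x' y' z' : ℤ} (hs : s.1 = ![x, y, z])
    (ht : t.1 = ![x', y', z']) :
    AffSet.mk s = AffSet.mk t ↔
      ∃ m : ℤ, x = x' + m * n ∧ y = y' + m * n ∧ z = z' + m * n := by
  rw [AffSet.mk_eq_mk, hs, ht]
  refine exists_congr fun m => ⟨fun h => ⟨h 0, h 1, h 2⟩, fun h i => ?_⟩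
  fin_cases i
  exacts [h.1, h.2.1, h.2.2]

theorem modEq_translate {x y m : ℤ} : (x + m * n ≡ y + m * n [ZMOD n]) ↔ x ≡ y [ZMOD n] := by
  constructor
  · exact Int.ModEq.add_right_cancel' _
  · exact Int.ModEq.add_right _

theorem PairRel.lt {R : Set (AffSet n 2)} {x y : ℤ} (h : PairRel R x y) :
    x < y ∧ ¬ x ≡ y [ZMOD n] := by
  obtain ⟨t, ht, -⟩ := h
  have h1 := t.2.1 (show (0 : Fin 2) < 1 by decide)
  have h2 := t.2.2 0 1 (by decide)
  rw [ht] at h1 h2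
  exact ⟨h1, h2⟩

theorem TripleRel.lt {R : Set (AffSet n 3)} {x y z : ℤ} (h : TripleRel R x y z) :
    (x < y ∧ y < z) ∧ ¬ x ≡ y [ZMOD n] ∧ ¬ x ≡ z [ZMOD n] ∧ ¬ y ≡ z [ZMOD n] := by
  obtain ⟨t, ht, -⟩ := h
  have h1 := t.2.1 (show (0 : Fin 3) < 1 by decide)
  have h2 := t.2.1 (show (1 : Fin 3) < 2 by decide)
  have h3 := t.2.2 0 1 (by decide)
  have h4 := t.2.2 0 2 (by decide)
  have h5 := t.2.2 1 2 (by decide)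
  rw [ht] at h1 h2 h3 h4 h5
  exact ⟨⟨h1, h2⟩, h3, h4, h5⟩

theorem PairRel.translate {R : Set (AffSet n 2)} {x y : ℤ} (h : PairRel R x y) (m : ℤ) :
    PairRel R (x + m * n) (y + m * n) := by
  obtain ⟨h1, h2⟩ := h.lt
  obtain ⟨t, ht, h⟩ := h
  obtain ⟨s, hs⟩ := Tuple.exists_pair (n := n) (x := x + m * n) (y := y + m * n) (by omega)
    (by rwa [modEq_translate])
  refine ⟨s, hs, ?_⟩
  rwa [(mk_pair_eq hs ht).mpr ⟨m, rfl, rfl⟩]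

theorem TripleRel.translate {R : Set (AffSet n 3)} {x y z : ℤ} (h : TripleRel R x y z) (m : ℤ) :
    TripleRel R (x + m * n) (y + m * n) (z + m * n) := by
  obtain ⟨⟨h1, h1'⟩, h2, h3, h4⟩ := h.lt
  obtain ⟨t, ht, h⟩ := h
  obtain ⟨s, hs⟩ := Tuple.exists_triple (n := n) (x := x + m * n) (y := y + m * n)
    (z := z + m * n) (by omega) (by omega) (by rwa [modEq_translate]) (by rwa [modEq_translate])
    (by rwa [modEq_translate])
  refine ⟨s, hs, ?_⟩
  rwa [(mk_triple_eq hs ht).mpr ⟨m, rfl, rfl, rfl⟩]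

theorem pairRel_invSet (hw : Periodic n w) {x y : ℤ} :
    PairRel (InvSet n w 2) x y ↔ Invd w x y := by
  constructor
  · intro h
    obtain ⟨h1, -⟩ := h.lt
    obtain ⟨t, ht, h⟩ := h
    rw [mk_mem_invSet hw, ht] at h
    exact ⟨h1, h (show (0 : Fin 2) < 1 by decide)⟩
  · intro h
    obtain ⟨t, ht⟩ := Tuple.exists_pair h.1 (h.not_modEq hw)
    refine ⟨t, ht, ?_⟩
    rw [mk_mem_invSet hw, ht]
    intro i j hij
    have := h.2
    fin_cases i <;> fin_cases j <;> simp_all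

theorem tripleRel_invSet (hw : Periodic n w) {x y z : ℤ} :
    TripleRel (InvSet n w 3) x y z ↔ Invd w x y ∧ Invd w y z := by
  constructor
  · intro h
    obtain ⟨h1, -⟩ := h.lt
    obtain ⟨t, ht, h⟩ := h
    rw [mk_mem_invSet hw, ht] at h
    exact ⟨⟨h1.1, h (show (0 : Fin 3) < 1 by decide)⟩, h1.2, h (show (1 : Fin 3) < 2 by decide)⟩
  · rintro ⟨h1, h2⟩
    obtain ⟨t, ht⟩ := Tuple.exists_triple h1.1 h2.1 (h1.not_modEq hw)
      ((h1.trans h2).not_modEq hw) (h2.not_modEq hw)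
    refine ⟨t, ht, ?_⟩
    rw [mk_mem_invSet hw, ht]
    intro i j hij
    have := h1.2
    have := h2.2
    have := (h1.trans h2).2
    fin_cases i <;> fin_cases j <;> simp_all

theorem PairRel.mono {R S : Set (AffSet n 2)} (h : R ⊆ S) {x y : ℤ} (hx : PairRel R x y) :
    PairRel S x y :=
  hx.imp fun _ h' => ⟨h'.1, h h'.2⟩

theorem subset_iff_pairRel {R S : Set (AffSet n 2)} :
    R ⊆ S ↔ ∀ x y, PairRel R x y → PairRel S x y := by
  refine ⟨fun h x y => .mono h, fun h X hX => ?_⟩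
  obtain ⟨t, rfl⟩ := X.exists_mk
  rw [pairRel_mk t.eq_pair] at hX ⊢
  exact h _ _ hX

theorem eq_iff_pairRel {R S : Set (AffSet n 2)} :
    R = S ↔ ∀ x y, PairRel R x y ↔ PairRel S x y := by
  rw [subset_antisymm_iff, subset_iff_pairRel, subset_iff_pairRel]
  grind

theorem subset_iff_tripleRel {R S : Set (AffSet n 3)} :
    R ⊆ S ↔ ∀ x y z, TripleRel R x y z → TripleRel S x y z := by
  refine ⟨fun h x y z ⟨t, h1, h2⟩ => ⟨t, h1, h h2⟩, fun h X hX => ?_⟩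
  obtain ⟨t, rfl⟩ := X.exists_mk
  rw [tripleRel_mk t.eq_triple] at hX ⊢
  exact h _ _ _ hX

theorem eq_iff_tripleRel {R S : Set (AffSet n 3)} :
    R = S ↔ ∀ x y z, TripleRel R x y z ↔ TripleRel S x y z := by
  rw [subset_antisymm_iff, subset_iff_tripleRel, subset_iff_tripleRel]
  grind

theorem Tuple.del_triple {t : Tuple n 3} {a b c : ℤ} (h : t.1 = ![a, b, c]) :
    (t.del 0).1 = ![b, c] ∧ (t.del 1).1 = ![a, c] ∧ (t.del 2).1 = ![a, b] := by
  refine ⟨?_, ?_, ?_⟩ <;> (funext j; simp only [Tuple.del, h]; fin_cases j <;> rfl)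

theorem Tuple.del_quad {t : Tuple n 4} {a b c d : ℤ} (h : t.1 = ![a, b, c, d]) :
    (t.del 0).1 = ![b, c, d] ∧ (t.del 1).1 = ![a, c, d] ∧ (t.del 2).1 = ![a, b, d] ∧
      (t.del 3).1 = ![a, b, c] := by
  refine ⟨?_, ?_, ?_, ?_⟩ <;> (funext j; simp only [Tuple.del, h]; fin_cases j <;> rfl)

end

end AffineBruhat

namespace AffineBruhat

section

variable {n : ℕ} {k : ℕ} {w : Equiv.Perm ℤ}

/-! ### Consistent sets of pairs and triples -/

theorem packet_inter_eq_pair {X : AffSet n (k + 1)} {S : Set (AffSet n k)} {i j : Fin (k + 1)} :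
    packet X ∩ S = {X.del i, X.del j} ↔ ∀ l, X.del l ∈ S ↔ l = i ∨ l = j := by
  constructor
  · intro h l
    have := Set.ext_iff.mp h (X.del l)
    simpa [packet, X.del_injective.eq_iff] using this
  · intro h
    ext Y
    constructor
    · rintro ⟨⟨l, rfl⟩, hl⟩
      exact ((h l).mp hl).imp (congrArg _) (congrArg _)
    · rintro (rfl | rfl)
      · exact ⟨⟨i, rfl⟩, (h i).mpr (.inl rfl)⟩
      · exact ⟨⟨j, rfl⟩, (h j).mpr (.inr rfl)⟩

theorem invd_iff_of_lt {x y : ℤ} (h : x < y) : Invd w x y ↔ w.symm y < w.symm x :=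
  and_iff_right h

theorem Tuple.del_pair_mem (hw : Periodic n w) {t : Tuple n 3} {a b c : ℤ}
    (h : t.1 = ![a, b, c]) : (AffSet.mk (t.del 0) ∈ InvSet n w 2 ↔ Invd w b c) ∧
      (AffSet.mk (t.del 1) ∈ InvSet n w 2 ↔ Invd w a c) ∧
      (AffSet.mk (t.del 2) ∈ InvSet n w 2 ↔ Invd w a b) := by
  obtain ⟨h0, h1, h2⟩ := Tuple.del_triple h
  rw [pairRel_mk h0, pairRel_mk h1, pairRel_mk h2]
  simp only [pairRel_invSet hw, and_self]

theorem Tuple.del_triple_mem (hw : Periodic n w) {t : Tuple n 4} {a b c d : ℤ}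
    (h : t.1 = ![a, b, c, d]) :
    (AffSet.mk (t.del 0) ∈ InvSet n w 3 ↔ Invd w b c ∧ Invd w c d) ∧
      (AffSet.mk (t.del 1) ∈ InvSet n w 3 ↔ Invd w a c ∧ Invd w c d) ∧
      (AffSet.mk (t.del 2) ∈ InvSet n w 3 ↔ Invd w a b ∧ Invd w b d) ∧
      (AffSet.mk (t.del 3) ∈ InvSet n w 3 ↔ Invd w a b ∧ Invd w b c) := by
  obtain ⟨h0, h1, h2, h3⟩ := Tuple.del_quad h
  rw [tripleRel_mk h0, tripleRel_mk h1, tripleRel_mk h2, tripleRel_mk h3]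
  simp only [tripleRel_invSet hw, and_self]

theorem Tuple.lt_triple {t : Tuple n 3} {a b c : ℤ} (h : t.1 = ![a, b, c]) : a < b ∧ b < c := by
  have h1 := t.2.1 (show (0 : Fin 3) < 1 by decide)
  have h2 := t.2.1 (show (1 : Fin 3) < 2 by decide)
  rw [h] at h1 h2
  exact ⟨h1, h2⟩

theorem Tuple.lt_quad {t : Tuple n 4} {a b c d : ℤ} (h : t.1 = ![a, b, c, d]) :
    a < b ∧ b < c ∧ c < d := by
  have h1 := t.2.1 (show (0 : Fin 4) < 1 by decide)
  have h2 := t.2.1 (show (1 : Fin 4) < 2 by decide)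
  have h3 := t.2.1 (show (2 : Fin 4) < 3 by decide)
  rw [h] at h1 h2 h3
  exact ⟨h1, h2, h3⟩

/-- The missing crossing counts as the last one, and the middle crossing must lie between the other
two. This orders the two crossings that exist. -/
theorem Tuple.quasiRel_pair (hw : Periodic n w) {t : Tuple n 3} {a b c : ℤ}
    (h : t.1 = ![a, b, c]) :
    (¬ Invd w a b → Invd w a c → Invd w b c →
      QuasiRel n w (AffSet.mk (t.del 0)) (AffSet.mk (t.del 1))) ∧
    (¬ Invd w b c → Invd w a b → Invd w a c →
      QuasiRel n w (AffSet.mk (t.del 2)) (AffSet.mk (t.del 1))) := by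
  obtain ⟨m0, m1, m2⟩ := Tuple.del_pair_mem hw h
  obtain ⟨hab, hbc⟩ := Tuple.lt_triple h
  have hac := hab.trans hbc
  constructor
  · intro n1 i1 i2
    refine ⟨AffSet.mk t, ⟨t, rfl, (0, 1), ?_, ?_⟩, 0, ?_, .inl ⟨by decide, rfl, rfl⟩⟩
    · rw [invd_iff_of_lt hab] at n1
      simpa [h] using n1
    · rw [invd_iff_of_lt hac] at i1
      rw [invd_iff_of_lt hbc] at i2
      rintro ⟨i, j⟩ ⟨e1, e2⟩
      rw [h] at e2
      fin_cases i <;> fin_cases j <;> simp_all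
    · rw [packet_inter_eq_pair]
      intro l
      fin_cases l
      · simpa [AffSet.del_mk, m0] using i2
      · simpa [AffSet.del_mk, m1] using i1
      · simpa [AffSet.del_mk, m2] using n1
  · intro n1 i1 i2
    refine ⟨AffSet.mk t, ⟨t, rfl, (1, 2), ?_, ?_⟩, 1, ?_, .inr ⟨by decide, rfl, rfl⟩⟩
    · rw [invd_iff_of_lt hbc] at n1
      simpa [h] using n1
    · rw [invd_iff_of_lt hac] at i2
      rw [invd_iff_of_lt hab] at i1
      rintro ⟨i, j⟩ ⟨e1, e2⟩
      rw [h] at e2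
      fin_cases i <;> fin_cases j <;> simp_all
    · rw [packet_inter_eq_pair]
      intro l
      fin_cases l
      · simpa [AffSet.del_mk, m0] using n1
      · simpa [AffSet.del_mk, m1] using i2
      · simpa [AffSet.del_mk, m2] using i1

/-- By transitivity of inversions, a single uninverted pair among four entries joins neighbours. The
three cases are the sources of the fields `first`, `middle` and `last` of `TripleCons`. -/
theorem Tuple.quasiRel_triple (hw : Periodic n w) {t : Tuple n 4} {a b c d : ℤ}
    (h : t.1 = ![a, b, c, d]) :
    (¬ Invd w a b → Invd w a c → Invd w b c → Invd w c d →
      QuasiRel n w (AffSet.mk (t.del 1)) (AffSet.mk (t.del 0))) ∧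
    (¬ Invd w b c → Invd w a b → Invd w a c → Invd w b d → Invd w c d →
      QuasiRel n w (AffSet.mk (t.del 1)) (AffSet.mk (t.del 2))) ∧
    (¬ Invd w c d → Invd w a b → Invd w b c → Invd w b d →
      QuasiRel n w (AffSet.mk (t.del 3)) (AffSet.mk (t.del 2))) := by
  obtain ⟨m0, m1, m2, m3⟩ := Tuple.del_triple_mem hw h
  obtain ⟨hab, hbc, hcd⟩ := Tuple.lt_quad h
  have hac := hab.trans hbc
  have hbd := hbc.trans hcd
  have had := hac.trans hcd
  have uniq : ∀ p : Fin 4 × Fin 4, p.1 < p.2 →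
      (∀ q : Fin 4 × Fin 4, q.1 < q.2 → q ≠ p → w.symm (t.1 q.2) < w.symm (t.1 q.1)) →
      ∀ q : Fin 4 × Fin 4, (q.1 < q.2 ∧ ¬ w.symm (t.1 q.2) < w.symm (t.1 q.1)) → q = p :=
    fun p _ h' q h => by
      by_contra hne
      exact h.2 (h' q h.1 hne)
  refine ⟨fun n1 i1 i2 i3 => ?_, fun n1 i1 i2 i3 i4 => ?_, fun n1 i1 i2 i3 => ?_⟩
  · refine ⟨AffSet.mk t, ⟨t, rfl, (0, 1), ?_, uniq _ (by decide) ?_⟩, 0, ?_,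
      .inr ⟨by decide, rfl, rfl⟩⟩
    · rw [invd_iff_of_lt hab] at n1
      simpa [h] using n1
    · have j1 := i1.2
      have j2 := i2.2
      have j3 := i3.2
      have j4 := (i1.trans i3).2
      have j5 := (i2.trans i3).2
      rintro ⟨i, j⟩ e1 e2
      rw [h]
      fin_cases i <;> fin_cases j <;> first | exact absurd e1 (by decide) | assumption |
        exact absurd rfl e2
    · rw [packet_inter_eq_pair]
      intro l
      fin_cases l
      · simp [AffSet.del_mk, m0, i2, i3]
      · simp [AffSet.del_mk, m1, i1, i3]
      · simp [AffSet.del_mk, m2, n1]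
      · simp [AffSet.del_mk, m3, n1]
  · refine ⟨AffSet.mk t, ⟨t, rfl, (1, 2), ?_, uniq _ (by decide) ?_⟩, 1, ?_,
      .inl ⟨by decide, rfl, rfl⟩⟩
    · rw [invd_iff_of_lt hbc] at n1
      simpa [h] using n1
    · have j1 := i1.2
      have j2 := i2.2
      have j3 := i3.2
      have j4 := i4.2
      have j5 := (i1.trans i3).2
      rintro ⟨i, j⟩ e1 e2
      rw [h]
      fin_cases i <;> fin_cases j <;> first | exact absurd e1 (by decide) | assumption |
        exact absurd rfl e2
    · rw [packet_inter_eq_pair]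
      intro l
      fin_cases l
      · simp [AffSet.del_mk, m0, n1]
      · simp [AffSet.del_mk, m1, i2, i4]
      · simp [AffSet.del_mk, m2, i1, i3]
      · simp [AffSet.del_mk, m3, n1]
  · refine ⟨AffSet.mk t, ⟨t, rfl, (2, 3), ?_, uniq _ (by decide) ?_⟩, 2, ?_,
      .inr ⟨by decide, rfl, rfl⟩⟩
    · rw [invd_iff_of_lt hcd] at n1
      simpa [h] using n1
    · have j1 := i1.2
      have j2 := i2.2
      have j3 := i3.2
      have j4 := (i1.trans i3).2
      have j5 := (i1.trans i2).2
      rintro ⟨i, j⟩ e1 e2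
      rw [h]
      fin_cases i <;> fin_cases j <;> first | exact absurd e1 (by decide) | assumption |
        exact absurd rfl e2
    · rw [packet_inter_eq_pair]
      intro l
      fin_cases l
      · simp [AffSet.del_mk, m0, n1]
      · simp [AffSet.del_mk, m1, n1]
      · simp [AffSet.del_mk, m2, i1, i3]
      · simp [AffSet.del_mk, m3, i1, i2]

theorem Tuple.shift_pair {t : Tuple n 2} {a b : ℤ} (h : t.1 = ![a, b]) :
    (t.shift 0).1 = ![a + n, b + n] ∧ (t.shift 1).1 = ![a, b + n] := by
  refine ⟨?_, ?_⟩ <;> (funext j; simp only [Tuple.shift, h]; fin_cases j <;> simp)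

theorem Tuple.shift_triple {t : Tuple n 3} {a b c : ℤ} (h : t.1 = ![a, b, c]) :
    (t.shift 0).1 = ![a + n, b + n, c + n] ∧ (t.shift 1).1 = ![a, b + n, c + n] ∧
      (t.shift 2).1 = ![a, b, c + n] := by
  refine ⟨?_, ?_, ?_⟩ <;> (funext j; simp only [Tuple.shift, h]; fin_cases j <;> simp)

end

end AffineBruhat

/-! ### Consistency as biconvexity of pairs and as `TripleCons` -/

namespace AffineBruhat

section

variable {n : ℕ} {k : ℕ} {w : Equiv.Perm ℤ}

/-- The shift with no zero entries is a simultaneous translation, so the corresponding congruence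
relation is trivial. -/
theorem AffSet.shift_zero (A : AffSet n (k + 1)) : A.shift 0 = A := by
  obtain ⟨t, rfl⟩ := A.exists_mk
  rw [AffSet.shift_mk, AffSet.mk_eq_mk]
  exact ⟨1, fun i => by simp [Tuple.shift]⟩

theorem pairRel_del_mk {R : Set (AffSet n 2)} {t : Tuple n 3} {a b c : ℤ} (h : t.1 = ![a, b, c]) :
    ((AffSet.mk t).del 0 ∈ R ↔ PairRel R b c) ∧ ((AffSet.mk t).del 1 ∈ R ↔ PairRel R a c) ∧
      ((AffSet.mk t).del 2 ∈ R ↔ PairRel R a b) := by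
  obtain ⟨h0, h1, h2⟩ := Tuple.del_triple h
  exact ⟨pairRel_mk h0, pairRel_mk h1, pairRel_mk h2⟩

theorem tripleRel_del_mk {R : Set (AffSet n 3)} {t : Tuple n 4} {a b c d : ℤ}
    (h : t.1 = ![a, b, c, d]) :
    ((AffSet.mk t).del 0 ∈ R ↔ TripleRel R b c d) ∧ ((AffSet.mk t).del 1 ∈ R ↔ TripleRel R a c d) ∧
      ((AffSet.mk t).del 2 ∈ R ↔ TripleRel R a b d) ∧
      ((AffSet.mk t).del 3 ∈ R ↔ TripleRel R a b c) := by
  obtain ⟨h0, h1, h2, h3⟩ := Tuple.del_quad h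
  exact ⟨tripleRel_mk h0, tripleRel_mk h1, tripleRel_mk h2, tripleRel_mk h3⟩

/-- Biconvexity of a set of inversions. -/
structure PairCons (w : Equiv.Perm ℤ) (R : ℤ → ℤ → Prop) : Prop where
  subset : ∀ {x y}, R x y → Invd w x y
  split : ∀ {x y z}, x < y → y < z → R x z → R x y ∨ R y z
  trans : ∀ {x y z}, R x y → R y z → R x z

/-- Biconvexity is stated without any congruence restriction. Triples with incongruent entries give
the packet and quasi-inversion conditions, and a triple ending in `y`, `y + n` gives the congruence
relation. -/
theorem PairCons.isConsistent (hn : 0 < n) (hw : Periodic n w) {R : Set (AffSet n 2)}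
    (h : PairCons w (PairRel R)) : IsConsistent n w R := by
  rw [isConsistent_iff]
  have hsub : R ⊆ InvSet n w 2 := by
    rw [subset_iff_pairRel]
    exact fun x y hx => (pairRel_invSet hw).mpr (h.subset hx)
  refine ⟨hsub, ?_, ?_⟩
  · rintro A B hA hB (⟨X, -, i, hX, hAB⟩ | ⟨i, hAB⟩)
    · obtain ⟨t, rfl⟩ := X.exists_mk
      rw [packet_inter_eq_pair] at hX
      obtain ⟨r0, r1, r2⟩ := pairRel_del_mk (R := R) t.eq_triple
      obtain ⟨s0, s1, s2⟩ := pairRel_del_mk (R := InvSet n w 2) t.eq_triple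
      obtain ⟨hab, hbc⟩ := Tuple.lt_triple t.eq_triple
      rw [pairRel_invSet hw] at s0 s1 s2
      fin_cases i
      · obtain ⟨-, rfl, rfl⟩ := hAB.resolve_right fun h => absurd h.1 (by decide)
        have n2 : ¬ Invd w (t.1 0) (t.1 1) := fun h' =>
          absurd ((hX 2).mp (s2.mpr h')) (by decide)
        exact r0.mpr ((h.split hab hbc (r1.mp hB)).resolve_left fun h' => n2 (h.subset h'))
      · obtain ⟨-, rfl, rfl⟩ := hAB.resolve_left fun h => absurd h.1 (by decide)
        have n2 : ¬ Invd w (t.1 1) (t.1 2) := fun h' =>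
          absurd ((hX 0).mp (s0.mpr h')) (by decide)
        exact r2.mpr ((h.split hab hbc (r1.mp hB)).resolve_right fun h' => n2 (h.subset h'))
    · fin_cases i
      · obtain ⟨-, rfl⟩ := hAB.resolve_left fun h => absurd h.1 (by decide)
        exact (AffSet.shift_zero B).symm ▸ hB
      · obtain ⟨-, rfl⟩ := hAB.resolve_right fun h => absurd h.1 (by decide)
        obtain ⟨t, rfl⟩ := A.exists_mk
        change AffSet.mk (t.shift 1) ∈ R at hB
        rw [pairRel_mk (Tuple.shift_pair t.eq_pair).2] at hB
        rw [pairRel_mk t.eq_pair] at hA ⊢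
        rw [pairRel_invSet hw] at hA
        have hB' := (h.subset hB).1
        have := hw.symm_apply (t.1 1) 1
        rw [one_mul] at this
        -- Splitting at `y` between `x` and `y + n` leaves only `x y`, since `y` and `y + n` are not
        -- inverted.
        refine (h.split hA.1 (by omega) hB).resolve_right fun h' => ?_
        have := (h.subset h').2
        omega
  · intro X hX
    obtain ⟨t, rfl⟩ := X.exists_mk
    obtain ⟨r0, r1, r2⟩ := pairRel_del_mk (R := R) t.eq_triple
    obtain ⟨hab, hbc⟩ := Tuple.lt_triple t.eq_triple
    have h1 := h.split hab hbc
    have h2 := h.trans (x := t.1 0) (y := t.1 1) (z := t.1 2)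
    simp only [Fin.forall_fin_two]
    change ((AffSet.mk t).del 0 ∈ R → (AffSet.mk t).del 1 ∈ R) ∧
      ((AffSet.mk t).del 1 ∈ R → (AffSet.mk t).del 2 ∈ R) ∨
      ((AffSet.mk t).del 1 ∈ R → (AffSet.mk t).del 0 ∈ R) ∧
      ((AffSet.mk t).del 2 ∈ R → (AffSet.mk t).del 1 ∈ R)
    rw [r0, r1, r2]
    tauto

theorem exists_eq_add_mul (hn : 0 < n) {x y : ℤ} (h : x ≡ y [ZMOD n]) (hlt : x < y) :
    ∃ m : ℕ, y = x + m * n := by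
  obtain ⟨m, hm⟩ := Int.modEq_iff_dvd.mp h
  have : 0 ≤ m := by
    by_contra hc
    have : (n : ℤ) * m < 0 := mul_neg_of_pos_of_neg (by omega) (by omega)
    omega
  exact ⟨m.toNat, by rw [Int.toNat_of_nonneg this]; linarith⟩

/-- Incongruent triples are covered by packets or quasi-inversions. When the middle entry is
congruent to an outer one, the congruence relation is applied repeatedly, lowering the last entry by
`n` each time. -/
theorem IsConsistent.pairCons (hn : 0 < n) (hw : Periodic n w) {R : Set (AffSet n 2)}
    (h : IsConsistent n w R) : PairCons w (PairRel R) := by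
  obtain ⟨hsub, hideal, hpack⟩ := isConsistent_iff.mp h
  have hinv : ∀ {x y}, PairRel R x y → Invd w x y := fun h' =>
    (pairRel_invSet hw).mp (h'.mono hsub)
  have hstep : ∀ {x y : ℤ}, PairRel R x (y + n) → Invd w x y → PairRel R x y := by
    intro x y h1 h2
    obtain ⟨t, ht⟩ := Tuple.exists_pair h2.1 (h2.not_modEq hw)
    rw [← pairRel_mk ht]
    refine hideal _ (AffSet.mk (t.shift 1)) ?_ ?_ (.inr ⟨1, .inl ⟨by decide, rfl⟩⟩)
    · rwa [pairRel_mk ht, pairRel_invSet hw]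
    · rwa [pairRel_mk (Tuple.shift_pair ht).2]
  have hstep' : ∀ (m : ℕ) {x y : ℤ}, PairRel R x (y + m * n) → x < y → PairRel R x y := by
    intro m
    induction m with
    | zero => intro x y h1 _; simpa using h1
    | succ m ih =>
      intro x y h1 hxy
      refine ih (hstep (by convert h1 using 1; push_cast; ring) ?_) hxy
      have h2 := (hinv h1).2
      rw [hw.symm_apply] at h2
      have h3 : (0 : ℤ) ≤ m * n := by positivity
      refine ⟨by omega, ?_⟩
      rw [hw.symm_apply]
      push_cast at h2
      have : ((m : ℤ) + 1) * n = m * n + n := by ring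
      omega
  refine ⟨hinv, ?_, ?_⟩
  · intro x y z hxy hyz hxz
    have ixz := hinv hxz
    by_cases c1 : x ≡ y [ZMOD n]
    · obtain ⟨m, rfl⟩ := exists_eq_add_mul hn c1 hxy
      right
      -- With `y = x + m * n`, lowering `z` by `m * n` and then translating the pair by the same
      -- amount leads from `x z` to `y z`.
      have h2 := hstep' m (y := z - m * n) (by simpa using hxz) (by omega)
      simpa using h2.translate m
    by_cases c2 : y ≡ z [ZMOD n]
    · obtain ⟨m, rfl⟩ := exists_eq_add_mul hn c2 hyz
      exact .inl (hstep' m hxz hxy)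
    obtain ⟨t, ht⟩ := Tuple.exists_triple hxy hyz c1 (ixz.not_modEq hw) c2
    obtain ⟨r0, r1, r2⟩ := pairRel_del_mk (R := R) ht
    obtain ⟨s0, s1, s2⟩ := pairRel_del_mk (R := InvSet n w 2) ht
    rw [pairRel_invSet hw] at s0 s1 s2
    obtain ⟨q1, q2⟩ := Tuple.quasiRel_pair hw ht
    by_cases d1 : Invd w x y
    · by_cases d2 : Invd w y z
      · have hX : AffSet.mk t ∈ InvSet n w 3 := by
          rw [tripleRel_mk ht, tripleRel_invSet hw]
          exact ⟨d1, d2⟩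
        have := hpack _ hX
        simp only [Fin.forall_fin_two] at this
        change ((AffSet.mk t).del 0 ∈ R → (AffSet.mk t).del 1 ∈ R) ∧
          ((AffSet.mk t).del 1 ∈ R → (AffSet.mk t).del 2 ∈ R) ∨
          ((AffSet.mk t).del 1 ∈ R → (AffSet.mk t).del 0 ∈ R) ∧
          ((AffSet.mk t).del 2 ∈ R → (AffSet.mk t).del 1 ∈ R) at this
        rw [r0, r1, r2] at this
        exact this.imp (fun u => u.2 hxz) (fun u => u.1 hxz)
      · exact .inl (r2.mp (hideal _ _ (s2.mpr d1) (r1.mpr hxz) (.inl (q2 d2 d1 ixz))))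
    · have d2 := (ixz.split hxy hyz).resolve_left d1
      exact .inr (r0.mp (hideal _ _ (s0.mpr d2) (r1.mpr hxz) (.inl (q1 d1 ixz d2))))
  · intro x y z hxy hyz
    have d1 := hinv hxy
    have d2 := hinv hyz
    obtain ⟨t, ht⟩ := Tuple.exists_triple d1.1 d2.1 (d1.not_modEq hw)
      ((d1.trans d2).not_modEq hw) (d2.not_modEq hw)
    obtain ⟨r0, r1, r2⟩ := pairRel_del_mk (R := R) ht
    have hX : AffSet.mk t ∈ InvSet n w 3 := by
      rw [tripleRel_mk ht, tripleRel_invSet hw]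
      exact ⟨d1, d2⟩
    have := hpack _ hX
    simp only [Fin.forall_fin_two] at this
    change ((AffSet.mk t).del 0 ∈ R → (AffSet.mk t).del 1 ∈ R) ∧
      ((AffSet.mk t).del 1 ∈ R → (AffSet.mk t).del 2 ∈ R) ∨
      ((AffSet.mk t).del 1 ∈ R → (AffSet.mk t).del 0 ∈ R) ∧
      ((AffSet.mk t).del 2 ∈ R → (AffSet.mk t).del 1 ∈ R) at this
    rw [r0, r1, r2] at this
    exact this.elim (fun u => u.1 hyz) (fun u => u.2 hxy)

theorem isConsistent_two_iff (hn : 0 < n) (hw : Periodic n w) {R : Set (AffSet n 2)} :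
    IsConsistent n w R ↔ PairCons w (PairRel R) :=
  ⟨fun h => h.pairCons hn hw, fun h => h.isConsistent hn hw⟩

/-- Besides packets and quasi-inversions there are two nontrivial congruence relations; they are
`first` and `last` for two entries that differ by `n`. -/
theorem TripleCons.isConsistent (hn : 0 < n) (hw : Periodic n w) {R : Set (AffSet n 3)}
    (h : TripleCons n w (TripleRel R)) : IsConsistent n w R := by
  rw [isConsistent_iff]
  have hsub : R ⊆ InvSet n w 3 := by
    rw [subset_iff_tripleRel]
    exact fun x y z hx => (tripleRel_invSet hw).mpr (h.subset hx)
  refine ⟨hsub, ?_, ?_⟩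
  · rintro A B hA hB (⟨X, -, i, hX, hAB⟩ | ⟨i, hAB⟩)
    · obtain ⟨t, rfl⟩ := X.exists_mk
      rw [packet_inter_eq_pair] at hX
      obtain ⟨r0, r1, r2, r3⟩ := tripleRel_del_mk (R := R) t.eq_quad
      obtain ⟨s0, s1, s2, s3⟩ := tripleRel_del_mk (R := InvSet n w 3) t.eq_quad
      obtain ⟨hab, hbc, hcd⟩ := Tuple.lt_quad t.eq_quad
      rw [tripleRel_invSet hw] at s0 s1 s2 s3
      have e0 := hX 0
      have e1 := hX 1
      have e2 := hX 2
      have e3 := hX 3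
      rw [s0] at e0
      rw [s1] at e1
      rw [s2] at e2
      rw [s3] at e3
      fin_cases i
      · obtain ⟨-, rfl, rfl⟩ := hAB.resolve_left fun h => absurd h.1 (by decide)
        have f0 := e0.mpr (by decide)
        have f1 := e1.mpr (by decide)
        have f3 := mt e3.mp (by decide)
        exact r1.mpr (h.first hab (fun h' => f3 ⟨h', f0.1⟩) f1.1 f0.1 f0.2 (r0.mp hB))
      · obtain ⟨-, rfl, rfl⟩ := hAB.resolve_right fun h => absurd h.1 (by decide)
        have f0 := mt e0.mp (by decide)
        have f1 := e1.mpr (by decide)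
        have f2 := e2.mpr (by decide)
        exact r1.mpr (h.middle hbc (fun h' => f0 ⟨h', f1.2⟩) f2.1 f1.1 f2.2 f1.2 (r2.mp hB))
      · obtain ⟨-, rfl, rfl⟩ := hAB.resolve_left fun h => absurd h.1 (by decide)
        have f0 := mt e0.mp (by decide)
        have f2 := e2.mpr (by decide)
        have f3 := e3.mpr (by decide)
        exact r3.mpr (h.last hcd (fun h' => f0 ⟨f3.2, h'⟩) f2.1 f3.2 f2.2 (r2.mp hB))
    · fin_cases i
      · obtain ⟨-, rfl⟩ := hAB.resolve_right fun h => absurd h.1 (by decide)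
        exact AffSet.shift_zero A ▸ hB
      · obtain ⟨-, rfl⟩ := hAB.resolve_left fun h => absurd h.1 (by decide)
        obtain ⟨t, rfl⟩ := B.exists_mk
        change AffSet.mk (t.shift 1) ∈ _ at hA
        change AffSet.mk (t.shift 1) ∈ _
        rw [tripleRel_mk (Tuple.shift_triple t.eq_triple).2.1] at hA ⊢
        rw [tripleRel_mk t.eq_triple] at hB
        have hB' := h.subset hB
        rw [tripleRel_invSet hw] at hA
        have i1 := (invd_translate hw (t.1 0 - n) (t.1 1) 1).mp (by simpa using hA.1)
        -- Raising the last two entries by `n` is, up to translation, lowering the first one, so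
        -- this is `first` applied to the entries `b - n` and `b`.
        have key := (h.first (a := t.1 0 - n) (b := t.1 0) (by omega) (fun h' =>
          not_invd_add hw (t.1 0 - n) 1 (by simpa using h')) i1 hB'.1 hB'.2 hB).translate 1
        simpa using key
      · obtain ⟨-, rfl⟩ := hAB.resolve_right fun h => absurd h.1 (by decide)
        obtain ⟨t, rfl⟩ := A.exists_mk
        change AffSet.mk (t.shift 2) ∈ R at hB
        rw [tripleRel_mk (Tuple.shift_triple t.eq_triple).2.2] at hB
        rw [tripleRel_mk t.eq_triple] at hA ⊢
        rw [tripleRel_invSet hw] at hA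
        have hB' := h.subset hB
        exact h.last (by omega) (fun h' => not_invd_add hw (t.1 2) 1 (by simpa using h'))
          hA.1 hA.2 hB'.2 hB
  · intro X hX
    obtain ⟨t, rfl⟩ := X.exists_mk
    obtain ⟨r0, r1, r2, r3⟩ := tripleRel_del_mk (R := R) t.eq_quad
    rw [mk_mem_invSet hw] at hX
    have h1 := h.full ⟨t.2.1 (show (0 : Fin 4) < 1 by decide), hX (show (0 : Fin 4) < 1 by decide)⟩
      ⟨t.2.1 (show (1 : Fin 4) < 2 by decide), hX (show (1 : Fin 4) < 2 by decide)⟩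
      ⟨t.2.1 (show (2 : Fin 4) < 3 by decide), hX (show (2 : Fin 4) < 3 by decide)⟩
    rw [← r0, ← r1, ← r2, ← r3] at h1
    refine h1.imp (fun h i => ?_) (fun h i => ?_) <;> fin_cases i
    exacts [h.1, h.2.1, h.2.2, h.2.2, h.2.1, h.1]

/-- The conditions of `TripleCons` with a congruent pair come from iterating the congruence
relations; the triples in between consist of inversions because their positions are monotone in the
shift. The other conditions come from packets and quasi-inversions. -/
theorem IsConsistent.tripleCons (hn : 0 < n) (hw : Periodic n w) {R : Set (AffSet n 3)}
    (h : IsConsistent n w R) : TripleCons n w (TripleRel R) := by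
  obtain ⟨hsub, hideal, hpack⟩ := isConsistent_iff.mp h
  have hinv : ∀ {x y z}, TripleRel R x y z → Invd w x y ∧ Invd w y z := fun h' =>
    (tripleRel_invSet hw).mp (subset_iff_tripleRel.mp hsub _ _ _ h')
  have hnm : ∀ {x y}, Invd w x y → ¬ x ≡ y [ZMOD n] := fun h' => h'.not_modEq hw
  have hfirst : ∀ {x y z : ℤ}, TripleRel R x y z → Invd w (x - n) y → TripleRel R (x - n) y z := by
    intro x y z h1 h2
    have h4 := (hinv h1).2
    obtain ⟨t, ht, h1'⟩ := h1
    have h3 : ∀ S : Set (AffSet n 3), AffSet.mk (t.shift 1) ∈ S ↔ TripleRel S (x - n) y z := by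
      intro S
      rw [tripleRel_mk (Tuple.shift_triple ht).2.1]
      constructor
      · intro h; simpa [sub_eq_add_neg] using h.translate (-1)
      · intro h; simpa using h.translate 1
    rw [← h3]
    refine hideal _ _ ?_ h1' (.inr ⟨1, .inr ⟨by decide, rfl⟩⟩)
    rw [h3, tripleRel_invSet hw]
    exact ⟨h2, h4⟩
  have hlast : ∀ {x y z : ℤ}, TripleRel R x y (z + n) → Invd w y z → TripleRel R x y z := by
    intro x y z h1 h2
    have h3 := (hinv h1).1
    obtain ⟨t, ht⟩ := Tuple.exists_triple h3.1 h2.1 (hnm h3) (hnm (h3.trans h2)) (hnm h2)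
    rw [← tripleRel_mk ht]
    refine hideal _ (AffSet.mk (t.shift 2)) ?_ ?_ (.inr ⟨2, .inl ⟨by decide, rfl⟩⟩)
    · rw [tripleRel_mk ht, tripleRel_invSet hw]
      exact ⟨h3, h2⟩
    · rwa [tripleRel_mk (Tuple.shift_triple ht).2.2]
  have hsucc : ∀ m : ℕ, ((m + 1 : ℕ) : ℤ) * n = m * n + n := fun m => by push_cast; ring
  have hfirst' : ∀ (m : ℕ) {x y z : ℤ}, TripleRel R x y z → Invd w (x - m * n) y →
      TripleRel R (x - m * n) y z := by
    intro m
    induction m with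
    | zero => intro x y z h1 _; simpa using h1
    | succ m ih =>
      intro x y z h1 h2
      have e1 := hw.symm_apply x (-(m + 1 : ℕ))
      have e2 := hw.symm_apply x (-m)
      rw [neg_mul, ← sub_eq_add_neg, ← sub_eq_add_neg] at e1 e2
      have e3 := (hinv h1).1
      rw [hsucc] at e1 h2 ⊢
      have h3 : (0 : ℤ) ≤ m * n := by positivity
      have h4 : x - (m * n + n) = x - m * n - n := by ring
      rw [h4] at h2 e1 ⊢
      refine hfirst (ih h1 ⟨?_, ?_⟩) h2
      · have := e3.1
        omega
      · have := h2.2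
        omega
  have hlast' : ∀ (m : ℕ) {x y z : ℤ}, TripleRel R x y (z + m * n) → y < z →
      TripleRel R x y z := by
    intro m
    induction m with
    | zero => intro x y z h1 _; simpa using h1
    | succ m ih =>
      intro x y z h1 h2
      have e1 := (hinv h1).2.2
      rw [hw.symm_apply] at e1
      rw [hsucc] at h1 e1
      have h3 : (0 : ℤ) ≤ m * n := by positivity
      rw [← add_assoc] at h1
      refine ih (hlast h1 ⟨by omega, ?_⟩) h2
      rw [hw.symm_apply]
      omega
  refine ⟨hinv, fun m h => h.translate m, ?_, ?_, ?_, ?_⟩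
  · intro a b c d i1 i2 i3
    obtain ⟨t, ht⟩ := Tuple.exists_quad i1.1 i2.1 i3.1 (hnm i1) (hnm (i1.trans i2))
      (hnm ((i1.trans i2).trans i3)) (hnm i2) (hnm (i2.trans i3)) (hnm i3)
    obtain ⟨r0, r1, r2, r3⟩ := tripleRel_del_mk (R := R) ht
    rw [← r0, ← r1, ← r2, ← r3]
    refine (hpack (AffSet.mk t) ?_).imp (fun h => ⟨h 0, h 1, h 2⟩) fun h => ⟨h 2, h 1, h 0⟩
    rw [mk_mem_invSet hw, ht]
    have := i1.2
    have := i2.2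
    have := i3.2
    have := (i1.trans i2).2
    have := (i2.trans i3).2
    have := ((i1.trans i2).trans i3).2
    intro i j hij
    fin_cases i <;> fin_cases j <;> first | assumption | exact absurd hij (by decide)
  · intro a b c d hab n1 i1 i2 i3 hR
    by_cases c1 : a ≡ b [ZMOD n]
    · obtain ⟨m, rfl⟩ := exists_eq_add_mul hn c1 hab
      have := hfirst' m hR (by simpa using i1)
      simpa using this
    obtain ⟨t, ht⟩ := Tuple.exists_quad hab i2.1 i3.1 c1 (hnm i1)
      (hnm (i1.trans i3)) (hnm i2) (hnm (i2.trans i3)) (hnm i3)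
    obtain ⟨r0, r1, r2, r3⟩ := tripleRel_del_mk (R := R) ht
    exact r1.mp (hideal _ _ ((Tuple.del_triple_mem hw ht).2.1.mpr ⟨i1, i3⟩) (r0.mpr hR)
      (.inl ((Tuple.quasiRel_triple hw ht).1 n1 i1 i2 i3)))
  · intro a b c d hbc n1 i1 i2 i3 i4 hR
    by_cases c1 : b ≡ c [ZMOD n]
    · obtain ⟨m, rfl⟩ := exists_eq_add_mul hn c1 hbc
      -- With `c = b + m * n`: lower the first entry of `a b d` by `m * n`, translate back by `m *
      -- n` to get `a c (d + m * n)`, and then lower the last entry.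
      have j1 : Invd w (a - m * n) b :=
        (invd_translate hw (a - m * n) b m).mp (by simpa using i2)
      have j2 := (hfirst' m hR j1).translate m
      rw [sub_add_cancel] at j2
      exact hlast' m j2 i4.1
    obtain ⟨t, ht⟩ := Tuple.exists_quad i1.1 hbc i4.1 (hnm i1) (hnm i2)
      (hnm (i2.trans i4)) c1 (hnm i3) (hnm i4)
    obtain ⟨r0, r1, r2, r3⟩ := tripleRel_del_mk (R := R) ht
    exact r1.mp (hideal _ _ ((Tuple.del_triple_mem hw ht).2.1.mpr ⟨i2, i4⟩) (r2.mpr hR)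
      (.inl ((Tuple.quasiRel_triple hw ht).2.1 n1 i1 i2 i3 i4)))
  · intro a b c d hcd n1 i1 i2 i3 hR
    by_cases c1 : c ≡ d [ZMOD n]
    · obtain ⟨m, rfl⟩ := exists_eq_add_mul hn c1 hcd
      exact hlast' m hR i2.1
    obtain ⟨t, ht⟩ := Tuple.exists_quad i1.1 i2.1 hcd (hnm i1) (hnm (i1.trans i2))
      (hnm (i1.trans i3)) (hnm i2) (hnm i3) c1
    obtain ⟨r0, r1, r2, r3⟩ := tripleRel_del_mk (R := R) ht
    exact r3.mp (hideal _ _ ((Tuple.del_triple_mem hw ht).2.2.2.mpr ⟨i1, i2⟩) (r2.mpr hR)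
      (.inl ((Tuple.quasiRel_triple hw ht).2.2 n1 i1 i2 i3)))

theorem isConsistent_three_iff (hn : 0 < n) (hw : Periodic n w) {R : Set (AffSet n 3)} :
    IsConsistent n w R ↔ TripleCons n w (TripleRel R) :=
  ⟨fun h => h.tripleCons hn hw, fun h => h.isConsistent hn hw⟩

end

end AffineBruhat

namespace AffineBruhat

section

variable {n : ℕ} {k : ℕ} {w : Equiv.Perm ℤ}

/-! ### Inversion sets as consistent sets -/

theorem symm_lt_of_not_invd {u : Equiv.Perm ℤ} {x y : ℤ} (h : x < y) (h' : ¬ Invd u x y) :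
    u.symm x < u.symm y := by
  rcases lt_trichotomy (u.symm x) (u.symm y) with h1 | h1 | h1
  · exact h1
  · exact absurd (u.symm.injective h1) h.ne
  · exact absurd ⟨h, h1⟩ h'

/-- If the inversions of `u` and the translates of one further pair form a biconvex set, then the
pair is at adjacent positions. -/
theorem symm_eq_add_one_of_pairCons {u : Equiv.Perm ℤ} {x y : ℤ} (hxy : x < y)
    (hni : ¬ Invd u x y) {R : ℤ → ℤ → Prop} (hc : PairCons w R)
    (hR : ∀ a b, R a b ↔ Invd u a b ∨ ∃ m : ℤ, a = x + m * n ∧ b = y + m * n) :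
    u.symm y = u.symm x + 1 := by
  have hlt := symm_lt_of_not_invd hxy hni
  by_contra hne
  -- Biconvexity at the entry right after `x` produces a pair of `R` that `u` does not invert and
  -- that has exactly one entry in common with `x y`. By `key` it would be a translate of `x y`,
  -- which is impossible.
  obtain ⟨z, hz⟩ := u.symm.surjective (u.symm x + 1)
  have hxz : z ≠ x := by
    rintro rfl
    omega
  have hzy : z ≠ y := by
    rintro rfl
    omega
  have hRxy : R x y := (hR x y).mpr (.inr ⟨0, by simp, by simp⟩)
  have key : ∀ {a b : ℤ}, R a b → u.symm a < u.symm b → ∃ m : ℤ, a = x + m * n ∧ b = y + m * n :=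
    fun h h' => ((hR _ _).mp h).resolve_left fun h'' => by
      have := h''.2
      omega
  rcases lt_or_gt_of_ne hxz with h1 | h1
  · obtain ⟨m, h2, h3⟩ := key (hc.trans ((hR z x).mpr (.inl ⟨h1, by omega⟩)) hRxy) (by omega)
    omega
  · rcases lt_or_gt_of_ne hzy with h2 | h2
    · rcases hc.split h1 h2 hRxy with h3 | h3
      · obtain ⟨m, h4, h5⟩ := key h3 (by omega)
        omega
      · obtain ⟨m, h4, h5⟩ := key h3 (by omega)
        omega
    · obtain ⟨m, h3, h4⟩ := key (hc.trans hRxy ((hR y z).mpr (.inl ⟨h2, by omega⟩))) (by omega)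
      omega

/-- A biconvex set that strictly contains the inversions of `u` contains a pair that can be
inverted next. -/
theorem PairCons.exists_ascent {R : ℤ → ℤ → Prop} (hR : PairCons w R) {u : Equiv.Perm ℤ}
    (hsub : ∀ x y, Invd u x y → R x y) (hne : ∃ x y, R x y ∧ ¬ Invd u x y) :
    ∃ a, u a < u (a + 1) ∧ R (u a) (u (a + 1)) := by
  -- Take a pair still to be inverted whose positions are closest. If they were not adjacent,
  -- biconvexity at the entry right after `x` would give a closer one.
  obtain ⟨⟨x, y⟩, ⟨h1, h2⟩, hmin⟩ := (measure fun t : ℤ × ℤ =>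
    (u.symm t.2 - u.symm t.1).toNat).wf.has_min
    {t | R t.1 t.2 ∧ ¬ Invd u t.1 t.2} (let ⟨a, b, h⟩ := hne; ⟨(a, b), h⟩)
  have h1 : R x y := h1
  have h2 : ¬ Invd u x y := h2
  have hxy := (hR.subset h1).1
  have hlt := symm_lt_of_not_invd hxy h2
  have hmin' : ∀ a b, R a b → u.symm a < u.symm b →
      u.symm y - u.symm x ≤ u.symm b - u.symm a := by
    intro a b h3 h4
    have h5 : ¬ (u.symm b - u.symm a).toNat < (u.symm y - u.symm x).toNat :=
      hmin (a, b) ⟨h3, fun h' => lt_asymm h4 h'.2⟩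
    omega
  by_cases hadj : u.symm y = u.symm x + 1
  · refine ⟨u.symm x, ?_⟩
    rw [← hadj]
    simpa using ⟨hxy, h1⟩
  exfalso
  obtain ⟨z, hz⟩ := u.symm.surjective (u.symm x + 1)
  have hxz : z ≠ x := by
    rintro rfl
    omega
  have hzy : z ≠ y := by
    rintro rfl
    omega
  rcases lt_or_gt_of_ne hxz with h3 | h3
  · have := hmin' z y (hR.trans (hsub z x ⟨h3, by omega⟩) h1) (by omega)
    omega
  · rcases lt_or_gt_of_ne hzy with h4 | h4
    · rcases hR.split h3 h4 h1 with h5 | h5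
      · have := hmin' x z h5 (by omega)
        omega
      · have := hmin' z y h5 (by omega)
        omega
    · have := hmin' x z (hR.trans h1 (hsub y z ⟨h4, by omega⟩)) (by omega)
      omega

theorem invSet_mul_simple (hn : n ≠ 1) {u : Equiv.Perm ℤ} (hu : Periodic n u) {i : ZMod n}
    {a : ℤ} (ha : (a : ZMod n) = i) (h : u a < u (a + 1)) :
    ∃ t : Tuple n 2, t.1 = ![u a, u (a + 1)] ∧ AffSet.mk t ∉ InvSet n u 2 ∧
      InvSet n (u * simpleTransposition n i) 2 = insert (AffSet.mk t) (InvSet n u 2) := by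
  have hu' := hu.mul (simple_periodic n i)
  have hinv := invd_mul_simple hn hu ha h
  have hnew : Invd (u * simpleTransposition n i) (u a) (u (a + 1)) :=
    (hinv _ _).mpr (.inr ⟨0, by simp, by simp⟩)
  obtain ⟨t, ht⟩ := Tuple.exists_pair h (hnew.not_modEq hu')
  refine ⟨t, ht, ?_, ?_⟩
  · rw [pairRel_mk ht, pairRel_invSet hu]
    intro h'
    have := h'.2
    simp only [Equiv.symm_apply_apply] at this
    omega
  · rw [eq_iff_pairRel]
    intro x y
    rw [pairRel_invSet hu', hinv]
    constructor
    · rintro (h1 | ⟨m, rfl, rfl⟩)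
      · exact ((pairRel_invSet hu).mpr h1).mono (Set.subset_insert _ _)
      · exact PairRel.translate ⟨t, ht, Set.mem_insert _ _⟩ m
    · rintro ⟨s, hs, h1⟩
      refine h1.symm.imp (fun h1 => ?_) fun h1 => (mk_pair_eq hs ht).mp h1
      rwa [pairRel_mk hs, pairRel_invSet hu] at h1

theorem pairCons_invd {u : Equiv.Perm ℤ} (h : ∀ x y, Invd u x y → Invd w x y) :
    PairCons w (Invd u) :=
  ⟨fun h' => h _ _ h', fun h1 h2 h3 => h3.split h1 h2, fun h1 h2 => h1.trans h2⟩

theorem pairRel_invSet_eq (hw : Periodic n w) : PairRel (InvSet n w 2) = Invd w := by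
  funext x y
  exact propext (pairRel_invSet hw)

theorem invSet_subset_iff {u : Equiv.Perm ℤ} (hu : Periodic n u) (hw : Periodic n w) :
    InvSet n u 2 ⊆ InvSet n w 2 ↔ ∀ x y, Invd u x y → Invd w x y := by
  rw [subset_iff_pairRel, pairRel_invSet_eq hu, pairRel_invSet_eq hw]

theorem invSet_injective (hn : 0 < n) {u : Equiv.Perm ℤ} (hu : IsAffinePerm n u)
    (hw : IsAffinePerm n w) (h : InvSet n u 2 = InvSet n w 2) : u = w :=
  perm_eq_of_invd_iff hn hu hw fun x y => by
    rw [← pairRel_invSet hu.per, h, pairRel_invSet hw.per]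

theorem isConsistent_invSet (hn : 0 < n) {u : Equiv.Perm ℤ} (hu : Periodic n u)
    (hw : Periodic n w) (h : InvSet n u 2 ⊆ InvSet n w 2) : IsConsistent n w (InvSet n u 2) := by
  rw [isConsistent_two_iff hn hw, pairRel_invSet_eq hu]
  exact pairCons_invd ((invSet_subset_iff hu hw).mp h)

theorem finite_invSet_two (hn : 0 < n) (hw : Periodic n w) : (InvSet n w 2).Finite := by
  refine ((Periodic.finite_windowInv hn hw).biUnion
    (t := fun q => {X | ∃ t : Tuple n 2, t.1 = ![q.1, q.2] ∧ AffSet.mk t = X})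
    fun q _ => Set.Subsingleton.finite ?_).subset ?_
  · rintro _ ⟨s, hs, rfl⟩ _ ⟨t, ht, rfl⟩
    exact congrArg _ (Subtype.ext (hs.trans ht.symm))
  · intro X hX
    obtain ⟨t, rfl⟩ := X.exists_mk
    rw [pairRel_mk t.eq_pair] at hX
    have hX' := hX.translate (-(t.1 0 / n))
    obtain ⟨s, hs, h⟩ := hX'
    have h1 := Int.emod_nonneg (t.1 0) (b := (n : ℤ)) (by omega)
    have h2 := Int.emod_lt_of_pos (t.1 0) (b := (n : ℤ)) (by omega)
    have h3 : t.1 0 + -(t.1 0 / n) * n = t.1 0 % n := by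
      have := Int.emod_add_mul_ediv (t.1 0) n
      linarith
    simp only [Set.mem_iUnion]
    refine ⟨(t.1 0 + -(t.1 0 / n) * n, t.1 1 + -(t.1 0 / n) * n), ⟨⟨?_, ?_⟩, ?_⟩, s, hs, ?_⟩
    · rw [h3]
      exact h1
    · rw [h3]
      exact h2
    · rwa [pairRel_mk hs, pairRel_invSet hw] at h
    · rw [mk_pair_eq hs t.eq_pair]
      exact ⟨_, rfl, rfl⟩

/-- A triple is determined by its two pairs that contain the first entry, because this common entry
fixes their relative translation. -/
theorem finite_invSet_three (hn : 0 < n) (hw : Periodic n w) : (InvSet n w 3).Finite := by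
  refine Set.Finite.of_injOn (f := fun X => (X.del 2, X.del 1)) (t := InvSet n w 2 ×ˢ InvSet n w 2)
    ?_ ?_ ((finite_invSet_two hn hw).prod (finite_invSet_two hn hw))
  · intro X hX
    obtain ⟨t, rfl⟩ := X.exists_mk
    rw [tripleRel_mk t.eq_triple, tripleRel_invSet hw] at hX
    obtain ⟨-, h1, h2⟩ := Tuple.del_pair_mem hw t.eq_triple
    exact ⟨h2.mpr hX.1, h1.mpr (hX.1.trans hX.2)⟩
  · intro X _ Y _ h
    obtain ⟨s, rfl⟩ := X.exists_mk
    obtain ⟨t, rfl⟩ := Y.exists_mk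
    obtain ⟨h1, h2⟩ := Prod.ext_iff.mp h
    obtain ⟨-, s1, s2⟩ := Tuple.del_triple s.eq_triple
    obtain ⟨-, t1, t2⟩ := Tuple.del_triple t.eq_triple
    obtain ⟨m, e1, e2⟩ := (mk_pair_eq s2 t2).mp h1
    obtain ⟨m', e3, e4⟩ := (mk_pair_eq s1 t1).mp h2
    rw [mk_triple_eq s.eq_triple t.eq_triple]
    have : m * n = m' * n := by omega
    exact ⟨m, e1, e2, by omega⟩

/-! ### Reduced words -/

theorem Asc.ncard_invSet (hn : 0 < n) {l : List (ZMod n)} (h : Asc n 1 l) :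
    (InvSet n (wordProd n l) 2).ncard = l.length := by
  induction l using List.reverseRecOn with
  | nil =>
    have : InvSet n (wordProd n []) 2 = ∅ := by
      rw [Set.eq_empty_iff_forall_notMem]
      intro X hX
      obtain ⟨t, rfl⟩ := X.exists_mk
      rw [pairRel_mk t.eq_pair, pairRel_invSet (wordProd_periodic n [])] at hX
      exact not_invd_one _ _ hX
    simp [this]
  | append_singleton l j ih =>
    obtain ⟨h1, h2⟩ := asc_append.mp h
    rw [one_mul, asc_singleton] at h2
    obtain ⟨t, -, h3, h4⟩ := invSet_mul_simple h2.1 (wordProd_periodic n l) (intCast_cast' j) h2.2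
    rw [wordProd_append, wordProd_singleton, h4,
      Set.ncard_insert_of_notMem h3 (finite_invSet_two hn (wordProd_periodic n l)), ih h1,
      List.length_append, List.length_singleton]

/-- For `n ≠ 1` a letter changes the number of inversion classes by one, upwards at an ascent and
downwards at a descent; for `n = 1` it has no effect. The length is therefore an upper bound, and
equality forces an ascent at every letter. -/
theorem ncard_invSet_le (hn : 0 < n) (l : List (ZMod n)) :
    (InvSet n (wordProd n l) 2).ncard ≤ l.length ∧
      ((InvSet n (wordProd n l) 2).ncard = l.length → Asc n 1 l ) := by
  induction l using List.reverseRecOn with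
  | nil => exact ⟨(Asc.ncard_invSet hn (l := []) trivial).le, fun _ => trivial⟩
  | append_singleton l j ih =>
    have hfin := finite_invSet_two hn (wordProd_periodic n l)
    rw [wordProd_append, wordProd_singleton, List.length_append, List.length_singleton]
    by_cases h1 : n = 1
    · have : simpleTransposition n j = 1 := by
        ext x
        simp [simple_apply, simpleFun, h1]
      rw [this, mul_one]
      exact ⟨ih.1.trans (Nat.le_succ _), fun h => by omega⟩
    by_cases h2 : wordProd n l (j.cast : ℤ) < wordProd n l ((j.cast : ℤ) + 1)
    · obtain ⟨t, -, h3, h4⟩ := invSet_mul_simple h1 (wordProd_periodic n l) (intCast_cast' j) h2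
      rw [h4, Set.ncard_insert_of_notMem h3 hfin]
      refine ⟨by omega, fun h => ?_⟩
      rw [asc_append, one_mul, asc_singleton]
      exact ⟨ih.2 (by omega), h1, h2⟩
    · have hper := (wordProd_periodic n l).mul (simple_periodic n j)
      have h5 := simple_of_eq h1 (intCast_cast' j)
      have h6 : simpleTransposition n j ((j.cast : ℤ) + 1) = j.cast := by
        rw [← h5, simple_simple]
      have h7 : wordProd n l (j.cast : ℤ) ≠ wordProd n l ((j.cast : ℤ) + 1) := fun h => by
        have := (wordProd n l).injective h
        omega
      -- A descent of the prefix is an ascent of the product after the letter, and the same letter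
      -- leads back.
      obtain ⟨t, -, h3, h4⟩ := invSet_mul_simple h1 hper (intCast_cast' j) (by
        rw [Equiv.Perm.mul_apply, Equiv.Perm.mul_apply, h5, h6]
        omega)
      rw [mul_assoc, simple_mul_self, mul_one] at h4
      rw [h4, Set.ncard_insert_of_notMem h3 (finite_invSet_two hn hper)] at ih
      exact ⟨by omega, fun h => by omega⟩

theorem exists_asc_word (hn : 0 < n) (hw : IsAffinePerm n w) :
    ∃ l, Asc n 1 l ∧ wordProd n l = w := by
  -- The empty set of triples is consistent, so some word realises it.
  obtain ⟨l, h1, h2, -⟩ := TripleCons.exists_word hn hw (R := fun _ _ _ => False)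
    ⟨False.elim, fun _ => False.elim, fun _ _ _ => by simp, by simp, by simp, by simp⟩
  exact ⟨l, h1, h2⟩

/-- The length of a word is at least the number of inversion classes, with equality exactly for
ascending words, and every element has an ascending word. -/
theorem isReducedWord_iff (hn : 0 < n) (hw : IsAffinePerm n w) {l : List (ZMod n)} :
    IsReducedWord n w l ↔ Asc n 1 l ∧ wordProd n l = w := by
  constructor
  · rintro ⟨rfl, h⟩
    obtain ⟨l', h1, h2⟩ := exists_asc_word hn hw
    refine ⟨(ncard_invSet_le hn l).2 (le_antisymm (ncard_invSet_le hn l).1 ?_), rfl⟩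
    rw [← h2, h1.ncard_invSet hn]
    exact h l' h2
  · rintro ⟨h, rfl⟩
    refine ⟨rfl, fun l' h' => ?_⟩
    rw [← h.ncard_invSet hn, ← h']
    exact (ncard_invSet_le hn l').1

end

end AffineBruhat

namespace AffineBruhat

section

variable {n : ℕ} {k : ℕ} {w : Equiv.Perm ℤ}

/-! ### Sublists -/

/-- Sublists are expressed by increasing indices, so that for reflection orders they turn into
inequalities between times. -/
theorem ofFn_sublist_iff {α : Type*} {m : ℕ} {g : Fin m → α} {ρ : List α} :
    List.Sublist (List.ofFn g) ρ ↔
      ∃ f : Fin m → ℕ, StrictMono f ∧ ∀ i, ρ[f i]? = some (g i) := by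
  rw [List.sublist_iff_exists_fin_orderEmbedding_get_eq]
  have hlen : (List.ofFn g).length = m := List.length_ofFn
  constructor
  · rintro ⟨f, hf⟩
    refine ⟨fun i => f (i.cast hlen.symm), fun i j hij => f.strictMono hij, fun i => ?_⟩
    have := hf (i.cast hlen.symm)
    rw [List.getElem?_eq_getElem (f (i.cast hlen.symm)).2]
    simpa using this.symm
  · rintro ⟨f, hf, h⟩
    have hlt : ∀ i, f i < ρ.length := fun i => (List.getElem?_eq_some_iff.mp (h i)).1
    refine ⟨OrderEmbedding.ofStrictMono (fun i => ⟨f (i.cast hlen), hlt _⟩)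
      fun i j hij => hf hij, fun i => ?_⟩
    rw [List.get_eq_getElem, List.getElem_ofFn]
    exact (List.getElem?_eq_some_iff.mp (h (i.cast hlen))).2.symm

theorem pair_eq_ofFn {α : Type*} (X Y : α) : [X, Y] = List.ofFn ![X, Y] := by simp

theorem lexPacket_eq (X : AffSet n (k + 1)) : lexPacket X = List.ofFn fun i => X.del i.rev := by
  refine List.ext_getElem (by simp [lexPacket, antilexPacket]) fun i h1 h2 => ?_
  simp only [lexPacket, antilexPacket, List.getElem_reverse, List.getElem_ofFn, List.length_ofFn]
  congr 1
  ext
  simp only [Fin.val_rev]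
  omega

theorem mem_take_of_sublist {α : Type*} {ρ : List α} (hρ : ρ.Nodup) {A B : α} {j : ℕ}
    (h : List.Sublist [A, B] ρ) (hB : B ∈ ρ.take j) : A ∈ ρ.take j := by
  rw [pair_eq_ofFn, ofFn_sublist_iff] at h
  obtain ⟨f, hf, h⟩ := h
  have h0 := h 0
  have h1 := h 1
  have h2 := hf (show (0 : Fin 2) < 1 by decide)
  obtain ⟨e0, e0'⟩ := List.getElem?_eq_some_iff.mp h0
  obtain ⟨e1, e1'⟩ := List.getElem?_eq_some_iff.mp h1
  obtain ⟨i, hi, hi'⟩ := List.mem_take_iff_getElem.mp hB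
  have : f 1 = i := (hρ.getElem_inj_iff (hi := e1) (hj := by omega)).mp (e1'.trans hi'.symm)
  rw [List.mem_take_iff_getElem]
  exact ⟨f 0, by omega, e0'⟩

/-! ### Reflection orders -/

theorem reflPairs_length (n : ℕ) (u : Equiv.Perm ℤ) (l : List (ZMod n)) :
    (reflPairs n u l).length = l.length := by
  induction l generalizing u with
  | nil => rfl
  | cons i l ih => simp [reflPairs, ih]

theorem reflPairs_getElem (u : Equiv.Perm ℤ) (l : List (ZMod n)) {j : ℕ} (hj : j < l.length) :
    (reflPairs n u l)[j]'(by rwa [reflPairs_length]) =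
      ((u * prefixProd n l j) (l[j].cast : ℤ), (u * prefixProd n l j) ((l[j].cast : ℤ) + 1)) := by
  induction l generalizing u j with
  | nil => simp at hj
  | cons i l ih =>
    cases j with
    | zero => simp [reflPairs, prefixProd_zero]
    | succ j =>
      simp only [reflPairs, List.getElem_cons_succ]
      rw [ih _ (by simpa using hj)]
      simp [prefixProd, wordProd_cons, mul_assoc]

theorem isReflOrderOf_iff {l : List (ZMod n)} {ρ : List (AffSet n 2)} :
    IsReflOrderOf n l ρ ↔ ρ.length = l.length ∧ ∀ j (hj : j < l.length),
      ∃ t : Tuple n 2, ρ[j]? = some (AffSet.mk t) ∧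
        t.1 = ![prefixProd n l j (l[j].cast : ℤ), prefixProd n l j ((l[j].cast : ℤ) + 1)] := by
  rw [IsReflOrderOf, List.forall₂_iff_get]
  refine ⟨fun ⟨hlen, h⟩ => ⟨by rw [hlen, reflPairs_length], fun j hj => ?_⟩,
    fun ⟨hlen, h⟩ => ⟨by rw [hlen, reflPairs_length], fun j h1 h2 => ?_⟩⟩
  · rw [reflPairs_length] at hlen
    obtain ⟨t, h1, h2, h3⟩ := h j (by omega) (by rwa [reflPairs_length])
    refine ⟨t, ?_, ?_⟩
    · rw [List.getElem?_eq_some_iff]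
      exact ⟨by omega, by rw [h1]; rfl⟩
    · rw [List.get_eq_getElem, reflPairs_getElem _ _ hj, one_mul] at h2 h3
      rw [t.eq_pair, h2, h3]
  · obtain ⟨t, h3, h4⟩ := h j (by omega)
    refine ⟨t, ?_, ?_, ?_⟩
    · exact (List.getElem?_eq_some_iff.mp h3).2.symm
    · rw [List.get_eq_getElem, reflPairs_getElem _ _ (hlen ▸ h1), one_mul, h4]
      rfl
    · rw [List.get_eq_getElem, reflPairs_getElem _ _ (hlen ▸ h1), one_mul, h4]
      rfl

theorem Asc.exists_reflOrder {l : List (ZMod n)} (h : Asc n 1 l) :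
    ∃ ρ, IsReflOrderOf n l ρ := by
  have : ∀ j : Fin l.length, ∃ t : Tuple n 2,
      t.1 = ![prefixProd n l j (l[j].cast : ℤ), prefixProd n l j ((l[j].cast : ℤ) + 1)] := by
    intro j
    refine Tuple.exists_pair (h.step j.2).2 (Invd.not_modEq (prefixProd_periodic n l (j + 1)) ?_)
    rw [h.invd_succ j.2]
    exact .inr ⟨0, by simp, by simp⟩
  choose t ht using this
  refine ⟨List.ofFn fun j => AffSet.mk (t j), ?_⟩
  rw [isReflOrderOf_iff]
  exact ⟨by simp, fun j hj => ⟨t ⟨j, hj⟩, by simp [hj], ht ⟨j, hj⟩⟩⟩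

theorem IsReflOrderOf.unique {l : List (ZMod n)} {ρ σ : List (AffSet n 2)}
    (h : IsReflOrderOf n l ρ) (h' : IsReflOrderOf n l σ) : ρ = σ := by
  obtain ⟨h1, h2⟩ := isReflOrderOf_iff.mp h
  obtain ⟨h3, h4⟩ := isReflOrderOf_iff.mp h'
  apply List.ext_getElem? fun j => ?_
  by_cases hj : j < l.length
  · obtain ⟨s, e1, e2⟩ := h2 j hj
    obtain ⟨t, e3, e4⟩ := h4 j hj
    rw [e1, e3, show s = t from Subtype.ext (e2.trans e4.symm)]
  · rw [List.getElem?_eq_none (by omega), List.getElem?_eq_none (by omega)]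

section

variable {l : List (ZMod n)} {ρ : List (AffSet n 2)}

/-- The index of a class in the reflection order is the time of its pair. Statements about the order
of the list are thereby statements about times. -/
theorem Asc.getElem?_reflOrder (h : Asc n 1 l) (hρ : IsReflOrderOf n l ρ) {t : Tuple n 2}
    {x y : ℤ} (ht : t.1 = ![x, y]) (j : ℕ) :
    ρ[j]? = some (AffSet.mk t) ↔ time n l x y = j ∧ j < l.length := by
  obtain ⟨h1, h2⟩ := isReflOrderOf_iff.mp hρ
  by_cases hj : j < l.length
  · obtain ⟨s, e1, e2⟩ := h2 j hj
    rw [e1, h.time_eq_iff hj, Option.some.injEq, eq_comm, mk_pair_eq ht e2]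
    simp [hj]
  · rw [List.getElem?_eq_none (by omega)]
    simp [hj]

theorem Asc.mem_take_reflOrder (h : Asc n 1 l) (hρ : IsReflOrderOf n l ρ) {j : ℕ}
    (hj : j ≤ l.length) : {X | X ∈ ρ.take j} = InvSet n (prefixProd n l j) 2 := by
  ext X
  obtain ⟨t, rfl⟩ := X.exists_mk
  rw [pairRel_mk (R := InvSet n _ 2) t.eq_pair, pairRel_invSet (prefixProd_periodic n l j),
    ← h.time_lt_iff hj]
  have hlen := (isReflOrderOf_iff.mp hρ).1
  have key := h.getElem?_reflOrder hρ t.eq_pair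
  constructor
  · intro h1
    obtain ⟨i, h2, h3⟩ := List.mem_take_iff_getElem.mp h1
    have := (key i).mp (List.getElem?_eq_some_iff.mpr ⟨by omega, h3⟩)
    omega
  · intro h1
    obtain ⟨h2, h3⟩ := List.getElem?_eq_some_iff.mp ((key _).mpr ⟨rfl, by omega⟩)
    exact List.mem_take_iff_getElem.mpr ⟨_, by omega, h3⟩

theorem Asc.mem_reflOrder (h : Asc n 1 l) (hρ : IsReflOrderOf n l ρ) (X : AffSet n 2) :
    X ∈ ρ ↔ X ∈ InvSet n (wordProd n l) 2 := by
  have h1 := Set.ext_iff.mp (h.mem_take_reflOrder hρ le_rfl) X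
  rw [prefixProd_length] at h1
  rw [← h1, ← (isReflOrderOf_iff.mp hρ).1, List.take_length]
  rfl

theorem Asc.nodup_reflOrder (h : Asc n 1 l) (hρ : IsReflOrderOf n l ρ) : ρ.Nodup := by
  rw [List.nodup_iff_getElem?_ne_getElem?]
  intro i j hij hj h1
  obtain ⟨t, ht⟩ := (ρ[j]).exists_mk
  have key := h.getElem?_reflOrder hρ t.eq_pair
  have h2 : ρ[j]? = some (AffSet.mk t) := by rw [ht, List.getElem?_eq_getElem hj]
  have h3 := (key j).mp h2
  have h4 := (key i).mp (h1.trans h2)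
  omega

theorem Asc.ofFn_sublist_reflOrder (h : Asc n 1 l) (hρ : IsReflOrderOf n l ρ) {m : ℕ}
    {s : Fin m → Tuple n 2} {x y : Fin m → ℤ} (hs : ∀ i, (s i).1 = ![x i, y i]) :
    List.Sublist (List.ofFn fun i => AffSet.mk (s i)) ρ ↔
      (StrictMono fun i => time n l (x i) (y i)) ∧ ∀ i, time n l (x i) (y i) < l.length := by
  rw [ofFn_sublist_iff]
  simp only [h.getElem?_reflOrder hρ (hs _)]
  constructor
  · rintro ⟨f, hf, h1⟩
    refine ⟨fun i j hij => ?_, fun i => ?_⟩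
    · dsimp only
      rw [(h1 i).1, (h1 j).1]
      exact hf hij
    · rw [(h1 i).1]
      exact (h1 i).2
  · rintro ⟨h1, h2⟩
    exact ⟨_, h1, fun i => ⟨rfl, h2 i⟩⟩

theorem Asc.pair_sublist_reflOrder (h : Asc n 1 l) (hρ : IsReflOrderOf n l ρ) {s t : Tuple n 2}
    {x y x' y' : ℤ} (hs : s.1 = ![x, y]) (ht : t.1 = ![x', y']) :
    List.Sublist [AffSet.mk s, AffSet.mk t] ρ ↔
      time n l x y < time n l x' y' ∧ time n l x' y' < l.length := by
  have := h.ofFn_sublist_reflOrder hρ (m := 2) (s := ![s, t]) (x := ![x, x']) (y := ![y, y'])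
    (by simp [Fin.forall_fin_two, hs, ht])
  simp only [List.ofFn_succ, List.ofFn_zero, Fin.forall_fin_two, Fin.strictMono_iff_lt_succ,
    Fin.forall_fin_one] at this
  refine this.trans ?_
  change time n l x y < time n l x' y' ∧ time n l x y < l.length ∧ time n l x' y' < l.length ↔ _
  omega

theorem Asc.antilex_sublist (h : Asc n 1 l) (hρ : IsReflOrderOf n l ρ) {t : Tuple n 3}
    {a b c : ℤ} (ht : t.1 = ![a, b, c]) :
    List.Sublist (antilexPacket (AffSet.mk t)) ρ ↔ time n l b c < time n l a c ∧
      time n l a c < time n l a b ∧ time n l a b < l.length := by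
  obtain ⟨h0, h1, h2⟩ := Tuple.del_triple ht
  have := h.ofFn_sublist_reflOrder hρ (m := 3) (s := fun i => t.del i) (x := ![b, a, a])
    (y := ![c, c, b]) (by intro i; fin_cases i <;> assumption)
  refine this.trans ?_
  rw [Fin.strictMono_iff_lt_succ, Fin.forall_fin_two, Fin.forall_fin_succ, Fin.forall_fin_two]
  change (time n l b c < time n l a c ∧ time n l a c < time n l a b) ∧
    time n l b c < l.length ∧ time n l a c < l.length ∧ time n l a b < l.length ↔ _
  omega

theorem Asc.lex_sublist (h : Asc n 1 l) (hρ : IsReflOrderOf n l ρ) {t : Tuple n 3}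
    {a b c : ℤ} (ht : t.1 = ![a, b, c]) :
    List.Sublist (lexPacket (AffSet.mk t)) ρ ↔ time n l a b < time n l a c ∧
      time n l a c < time n l b c ∧ time n l b c < l.length := by
  obtain ⟨h0, h1, h2⟩ := Tuple.del_triple ht
  rw [lexPacket_eq]
  have := h.ofFn_sublist_reflOrder hρ (m := 3) (s := fun i => t.del i.rev) (x := ![a, a, b])
    (y := ![b, c, c]) (by intro i; fin_cases i <;> assumption)
  refine this.trans ?_
  rw [Fin.strictMono_iff_lt_succ, Fin.forall_fin_two, Fin.forall_fin_succ, Fin.forall_fin_two]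
  change (time n l a b < time n l a c ∧ time n l a c < time n l b c) ∧
    time n l a b < l.length ∧ time n l a c < l.length ∧ time n l b c < l.length ↔ _
  omega

/-- Reflection orders are admissible. -/
theorem Asc.isAdmissible (hn : 0 < n) (h : Asc n 1 l) (hρ : IsReflOrderOf n l ρ) :
    IsAdmissible n (wordProd n l) ρ := by
  have hw := wordProd_periodic n l
  refine ⟨h.nodup_reflOrder hρ, h.mem_reflOrder hρ, fun X Y hne hle => ?_, fun X hX => ?_⟩
  · have hX : X ∈ InvSet n (wordProd n l) 2 := by
      rcases hle.cases_head with e | ⟨_, h1, -⟩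
      exacts [absurd e hne, h1.1]
    have hY : Y ∈ InvSet n (wordProd n l) 2 := by
      rcases hle.cases_tail with e | ⟨_, -, h1⟩
      exacts [absurd e.symm hne, h1.2.1]
    obtain ⟨s, rfl⟩ := X.exists_mk
    obtain ⟨t, rfl⟩ := Y.exists_mk
    rw [pairRel_mk s.eq_pair, pairRel_invSet hw, ← h.time_lt_length] at hX
    rw [pairRel_mk t.eq_pair, pairRel_invSet hw, ← h.time_lt_length] at hY
    rw [h.pair_sublist_reflOrder hρ s.eq_pair t.eq_pair]
    refine ⟨?_, hY⟩
    -- The prefix that ends with `Y` has an inversion set that is consistent for `w`, hence an ideal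
    -- of the permanent poset. It therefore contains `X`.
    have hc : IsConsistent n (wordProd n l)
        (InvSet n (prefixProd n l (time n l (t.1 0) (t.1 1) + 1)) 2) := by
      refine isConsistent_invSet hn (prefixProd_periodic n l _) hw ?_
      rw [invSet_subset_iff (prefixProd_periodic n l _) hw]
      intro x y hxy
      rw [← prefixProd_length]
      exact h.invd_mono hY le_rfl hxy
    have h1 := hc.ideal _ _ (by
      rw [pairRel_mk t.eq_pair, pairRel_invSet (prefixProd_periodic n l _), ← h.time_lt_iff hY]
      omega) hle
    rw [pairRel_mk s.eq_pair, pairRel_invSet (prefixProd_periodic n l _), ← h.time_lt_iff hY] at h1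
    refine lt_of_le_of_ne (Nat.lt_succ_iff.mp h1) fun h2 => hne ?_
    have e1 := (h.getElem?_reflOrder hρ s.eq_pair _).mpr ⟨rfl, hX⟩
    have e2 := (h.getElem?_reflOrder hρ t.eq_pair _).mpr ⟨rfl, hY⟩
    rw [h2] at e1
    exact Option.some.inj (e1.symm.trans e2)
  · obtain ⟨t, rfl⟩ := X.exists_mk
    rw [tripleRel_mk t.eq_triple, tripleRel_invSet hw, ← h.time_lt_length,
      ← h.time_lt_length] at hX
    rw [h.lex_sublist hρ t.eq_triple, h.antilex_sublist hρ t.eq_triple]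
    obtain ⟨h1, h2⟩ := Tuple.lt_triple t.eq_triple
    have h3 := h.time_between h1 h2
    have h4 := h.time_ne h1 h2
    omega

end

/-- The sets of first elements of an admissible order are consistent. -/
theorem IsAdmissible.isConsistent_take {ρ : List (AffSet n k)} (h : IsAdmissible n w ρ) (j : ℕ) :
    IsConsistent n w {X | X ∈ ρ.take j} := by
  rw [isConsistent_iff]
  refine ⟨fun X hX => (h.mem_iff X).mp (List.mem_of_mem_take hX), fun A B hA hB hAB => ?_,
    fun X hX => ?_⟩
  · by_cases hne : A = B
    · rwa [hne]
    · have hB' := (h.mem_iff B).mp (List.mem_of_mem_take hB)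
      exact mem_take_of_sublist h.nodup (h.linear_extension A B hne (.single ⟨hA, hB', hAB⟩)) hB
  · have key : ∀ g : Fin (k + 1) → AffSet n k, List.Sublist (List.ofFn g) ρ → ∀ i j, i < j →
        List.Sublist [g i, g j] ρ := by
      intro g hg i j hij
      rw [ofFn_sublist_iff] at hg
      obtain ⟨f, hf, hg⟩ := hg
      rw [pair_eq_ofFn, ofFn_sublist_iff]
      refine ⟨![f i, f j], ?_, ?_⟩
      · rw [Fin.strictMono_iff_lt_succ]
        simpa using hf hij
      · simp [Fin.forall_fin_two, hg]
    refine (h.packets X hX).imp (fun hs i => ?_) fun hs i => ?_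
    · rw [lexPacket_eq] at hs
      refine mem_take_of_sublist h.nodup ?_
      simpa using key _ hs i.succ.rev i.castSucc.rev (by simp)
    · exact mem_take_of_sublist h.nodup (key _ hs i.castSucc i.succ (by simp))

/-- Admissible orders are reflection orders. -/
theorem IsAdmissible.exists_word (hn : 0 < n) (hw : IsAffinePerm n w) {ρ : List (AffSet n 2)}
    (h : IsAdmissible n w ρ) :
    ∃ l, Asc n 1 l ∧ wordProd n l = w ∧ IsReflOrderOf n l ρ := by
  have key : ∀ j ≤ ρ.length, ∃ l, Asc n 1 l ∧ IsReflOrderOf n l (ρ.take j) := by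
    intro j
    induction j with
    | zero => exact fun _ => ⟨[], trivial, by simp [isReflOrderOf_iff]⟩
    | succ j ih =>
      intro hj
      obtain ⟨l, h1, h2⟩ := ih (by omega)
      have hper := wordProd_periodic n l
      have hlen := (isReflOrderOf_iff.mp h2).1
      rw [List.length_take, min_eq_left (by omega)] at hlen
      obtain ⟨t, ht⟩ := (ρ[j]).exists_mk
      have hmem := h1.mem_reflOrder h2
      have hnot : ¬ Invd (wordProd n l) (t.1 0) (t.1 1) := by
        rw [← pairRel_invSet hper, ← pairRel_mk t.eq_pair, ht, ← hmem]
        intro h3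
        obtain ⟨i, h4, h5⟩ := List.mem_take_iff_getElem.mp h3
        have := (h.nodup.getElem_inj_iff).mp h5
        omega
      have hlt := t.2.1 (show (0 : Fin 2) < 1 by decide)
      -- The next initial segment of the admissible order is again biconvex, so the new pair stands
      -- at adjacent positions and is inverted by one further letter.
      have hadj := symm_eq_add_one_of_pairCons (n := n) hlt hnot
        ((h.isConsistent_take (j + 1)).pairCons hn hw.per) (fun a b => by
          constructor
          · rintro ⟨s, hs, h3⟩
            have h3 : AffSet.mk s ∈ ρ.take (j + 1) := h3
            rw [List.take_succ_eq_append_getElem (by omega), List.mem_append, hmem,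
              List.mem_singleton, pairRel_mk hs, pairRel_invSet hper, ← ht,
              mk_pair_eq hs t.eq_pair] at h3
            exact h3
          · intro h3
            have hsub : InvSet n (wordProd n l) 2 ⊆ {X | X ∈ ρ.take (j + 1)} := by
              intro X hX
              rw [← hmem] at hX
              exact (List.take_sublist_take_left (by omega)).subset hX
            rcases h3 with h3 | ⟨m, rfl, rfl⟩
            · exact ((pairRel_invSet hper).mpr h3).mono hsub
            · refine PairRel.translate ⟨t, t.eq_pair, ?_⟩ m
              change AffSet.mk t ∈ ρ.take (j + 1)
              rw [ht, List.mem_take_iff_getElem]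
              exact ⟨j, by omega, rfl⟩)
      have hn1 : n ≠ 1 := by
        rintro rfl
        exact t.2.2 0 1 (by decide) (Int.modEq_iff_dvd.mpr ⟨t.1 1 - t.1 0, by simp⟩)
      set p := (wordProd n l).symm (t.1 0) with hp
      set i : ZMod n := (p : ZMod n) with hi
      have e0 : wordProd n l p = t.1 0 := by simp [hp]
      have e1 : wordProd n l (p + 1) = t.1 1 := by rw [← hadj]; simp
      obtain ⟨m, hm⟩ : ∃ m : ℤ, (i.cast : ℤ) = p + m * n := by
        have h3 : (((i.cast : ℤ) : ℤ) : ZMod n) = (p : ZMod n) := by rw [intCast_cast']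
        rw [ZMod.intCast_eq_intCast_iff] at h3
        obtain ⟨m, hm⟩ := Int.modEq_iff_dvd.mp h3
        exact ⟨-m, by linarith⟩
      have f0 : wordProd n l (i.cast : ℤ) = t.1 0 + m * n := by rw [hm, hper.apply, e0]
      have f1 : wordProd n l ((i.cast : ℤ) + 1) = t.1 1 + m * n := by
        rw [hm, add_right_comm, hper.apply, e1]
      refine ⟨l ++ [i], ?_, ?_⟩
      · rw [asc_append, one_mul, asc_singleton]
        exact ⟨h1, hn1, by rw [f0, f1]; omega⟩
      · rw [isReflOrderOf_iff]
        refine ⟨by simp; omega, fun j' hj' => ?_⟩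
        rw [List.length_append, List.length_singleton] at hj'
        by_cases hc : j' < l.length
        · obtain ⟨s, g1, g2⟩ := (isReflOrderOf_iff.mp h2).2 j' hc
          refine ⟨s, ?_, ?_⟩
          · rw [List.getElem?_take_of_lt (by omega)] at g1 ⊢
            exact g1
          · rw [g2, prefixProd_append_left hc.le, List.getElem_append_left hc]
        · obtain rfl : j' = l.length := by omega
          obtain ⟨s, hs⟩ := Tuple.exists_pair (n := n) (x := t.1 0 + m * n) (y := t.1 1 + m * n)
            (by omega) (by rw [modEq_translate]; exact t.2.2 0 1 (by decide))
          refine ⟨s, ?_, ?_⟩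
          · rw [List.getElem?_take_of_lt (by omega), (mk_pair_eq hs t.eq_pair).mpr ⟨m, rfl, rfl⟩,
              ht, ← hlen, List.getElem?_eq_getElem (by omega)]
          · rw [prefixProd_append_left le_rfl, prefixProd_length, List.getElem_concat_length rfl,
              f0, f1, hs]
  obtain ⟨l, h1, h2⟩ := key ρ.length le_rfl
  rw [List.take_length] at h2
  -- The product of the word has the same inversion set as `w`, which determines it.
  refine ⟨l, h1, invSet_injective hn (isAffinePerm_wordProd n l) hw ?_, h2⟩
  ext X
  rw [← h.mem_iff, h1.mem_reflOrder h2]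

end

end AffineBruhat

namespace AffineBruhat

section

variable {n : ℕ} {k : ℕ} {w : Equiv.Perm ℤ}

/-! ### Commutations and flips of reflection orders -/

/-- Times of words describe the exchange of two entries by a permutation of the indices. This lemma
and the next ones return from that description to concatenations of lists. -/
theorem list_take_eq_take_of_swap {α : Type*} {ρ σ : List α} {k m : ℕ}
    (h : ∀ j, σ[Equiv.swap k (k + m) j]? = ρ[j]?) : σ.take k = ρ.take k := by
  refine List.ext_getElem? fun j => ?_
  rw [List.getElem?_take, List.getElem?_take]
  split_ifs with hj
  · rw [← h j, Equiv.swap_apply_of_ne_of_ne (by omega) (by omega)]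
  · rfl

theorem list_drop_eq_drop_of_swap {α : Type*} {ρ σ : List α} {k m : ℕ}
    (h : ∀ j, σ[Equiv.swap k (k + m) j]? = ρ[j]?) :
    σ.drop (k + m + 1) = ρ.drop (k + m + 1) := by
  refine List.ext_getElem? fun j => ?_
  rw [List.getElem?_drop, List.getElem?_drop, ← h, Equiv.swap_apply_of_ne_of_ne] <;> omega

theorem list_exists_of_swap_one {α : Type*} {ρ σ : List α} {k : ℕ} (hk : k + 1 < ρ.length)
    (h : ∀ j, σ[Equiv.swap k (k + 1) j]? = ρ[j]?) :
    ∃ A B X Y, A.length = k ∧ ρ = A ++ [X, Y] ++ B ∧ σ = A ++ [Y, X] ++ B := by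
  have h0 := h k
  have h1 := h (k + 1)
  rw [Equiv.swap_apply_left, List.getElem?_eq_getElem (l := ρ) (by omega)] at h0
  rw [Equiv.swap_apply_right, List.getElem?_eq_getElem (l := ρ) hk] at h1
  obtain ⟨e0, f0⟩ := List.getElem?_eq_some_iff.mp h0
  obtain ⟨e1, f1⟩ := List.getElem?_eq_some_iff.mp h1
  refine ⟨ρ.take k, ρ.drop (k + 2), ρ[k], ρ[k + 1], by simp; omega, list_split_two hk, ?_⟩
  conv_lhs => rw [list_split_two e0, list_take_eq_take_of_swap h,
    show k + 2 = k + 1 + 1 from rfl, list_drop_eq_drop_of_swap h, f0, f1]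

theorem list_exists_of_swap_two {α : Type*} {ρ σ : List α} {k : ℕ} (hk : k + 2 < ρ.length)
    (h : ∀ j, σ[Equiv.swap k (k + 2) j]? = ρ[j]?) :
    ∃ A B X Y Z, A.length = k ∧ ρ = A ++ [X, Y, Z] ++ B ∧ σ = A ++ [Z, Y, X] ++ B := by
  have h0 := h k
  have h1 := h (k + 1)
  have h2 := h (k + 2)
  rw [Equiv.swap_apply_left, List.getElem?_eq_getElem (l := ρ) (by omega)] at h0
  rw [Equiv.swap_apply_of_ne_of_ne (by omega) (by omega), List.getElem?_eq_getElem (l := ρ) (by omega)] at h1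
  rw [Equiv.swap_apply_right, List.getElem?_eq_getElem (l := ρ) hk] at h2
  obtain ⟨e0, f0⟩ := List.getElem?_eq_some_iff.mp h0
  obtain ⟨e1, f1⟩ := List.getElem?_eq_some_iff.mp h1
  obtain ⟨e2, f2⟩ := List.getElem?_eq_some_iff.mp h2
  refine ⟨ρ.take k, ρ.drop (k + 3), ρ[k], ρ[k + 1], ρ[k + 2], by simp; omega,
    list_split_three hk, ?_⟩
  conv_lhs => rw [list_split_three e0, list_take_eq_take_of_swap h,
    show k + 3 = k + 2 + 1 from rfl, list_drop_eq_drop_of_swap h, f0, f1, f2]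

theorem list_swap_one_getElem? {α : Type*} (A B : List α) (X Y : α) (j : ℕ) :
    (A ++ [Y, X] ++ B)[Equiv.swap A.length (A.length + 1) j]? = (A ++ [X, Y] ++ B)[j]? := by
  rw [List.append_assoc, List.append_assoc, Equiv.swap_apply_def]
  split_ifs with h1 h2
  · subst h1
    simp
  · subst h2
    simp
  · by_cases h3 : j < A.length
    · rw [List.getElem?_append_left h3, List.getElem?_append_left h3]
    · obtain ⟨d, rfl⟩ : ∃ d, j = A.length + (d + 2) := ⟨j - A.length - 2, by omega⟩
      rw [List.getElem?_append_right (l₁ := A) (by omega),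
        List.getElem?_append_right (l₁ := A) (by omega),
        Nat.add_sub_cancel_left]
      rfl

theorem list_swap_two_getElem? {α : Type*} (A B : List α) (X Y Z : α) (j : ℕ) :
    (A ++ [Z, Y, X] ++ B)[Equiv.swap A.length (A.length + 2) j]? =
      (A ++ [X, Y, Z] ++ B)[j]? := by
  rw [List.append_assoc, List.append_assoc, Equiv.swap_apply_def]
  split_ifs with h1 h2
  · subst h1
    simp
  · subst h2
    simp
  · by_cases h3 : j < A.length
    · rw [List.getElem?_append_left h3, List.getElem?_append_left h3]
    · by_cases h4 : j = A.length + 1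
      · subst h4
        simp
      obtain ⟨d, rfl⟩ : ∃ d, j = A.length + (d + 3) := ⟨j - A.length - 3, by omega⟩
      rw [List.getElem?_append_right (l₁ := A) (by omega),
        List.getElem?_append_right (l₁ := A) (by omega),
        Nat.add_sub_cancel_left]
      rfl

section

variable {l l' : List (ZMod n)} {ρ σ : List (AffSet n 2)}

theorem Asc.length_eq (hn : 0 < n) (h : Asc n 1 l) (h' : Asc n 1 l')
    (hprod : wordProd n l' = wordProd n l) : l'.length = l.length := by
  rw [← h.ncard_invSet hn, ← h'.ncard_invSet hn, hprod]

/-- The times give the inversions of every prefix, hence the prefix products, hence the letters. -/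
theorem Asc.eq_of_time (hn : 0 < n) (h : Asc n 1 l) (h' : Asc n 1 l')
    (hlen : l'.length = l.length) (ht : ∀ x y, time n l' x y = time n l x y) : l' = l := by
  have key : ∀ j ≤ l.length, prefixProd n l' j = prefixProd n l j := by
    intro j hj
    refine perm_eq_of_invd_iff hn (isAffinePerm_wordProd n _) (isAffinePerm_wordProd n _)
      fun x y => ?_
    have h1 := h.time_lt_iff hj x y
    have h2 := h'.time_lt_iff (hlen ▸ hj) x y
    rw [ht] at h2
    exact h2.symm.trans h1
  refine List.ext_getElem hlen fun j h1 h2 => ?_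
  have h3 := key (j + 1) h2
  rw [prefixProd_succ h1, prefixProd_succ h2, key j h2.le] at h3
  exact simple_injective (h.step h2).1 (mul_left_cancel h3)

/-- Exchanging two entries of a reflection order is the same as exchanging two times. This links
moves on words and moves on orders in both directions. -/
theorem Asc.swap_reflOrder_iff (hn : 0 < n) (h : Asc n 1 l) (h' : Asc n 1 l')
    (hprod : wordProd n l' = wordProd n l) (hρ : IsReflOrderOf n l ρ) (hσ : IsReflOrderOf n l' σ)
    {a b : ℕ} (ha : a < l.length) (hb : b < l.length) :
    (∀ j, σ[Equiv.swap a b j]? = ρ[j]?) ↔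
      ∀ x y, time n l' x y = Equiv.swap a b (time n l x y) := by
  have hlen := h.length_eq hn h' hprod
  have hlt : ∀ j, Equiv.swap a b j < l.length ↔ j < l.length := by
    intro j
    rw [Equiv.swap_apply_def]
    split_ifs <;> omega
  constructor
  · intro hj x y
    by_cases hxy : Invd (wordProd n l) x y
    · obtain ⟨t, ht⟩ := Tuple.exists_pair hxy.1 (hxy.not_modEq (wordProd_periodic n l))
      have h1 := (h.getElem?_reflOrder hρ ht _).mpr ⟨rfl, (h.time_lt_length x y).mpr hxy⟩
      rw [← hj] at h1
      exact ((h'.getElem?_reflOrder hσ ht _).mp h1).1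
    · have h1 := mt (h.time_lt_length x y).mp hxy
      have h2 := mt (h'.time_lt_length x y).mp (hprod ▸ hxy)
      have h3 := time_le n l x y
      have h4 := time_le n l' x y
      rw [Equiv.swap_apply_of_ne_of_ne] <;> omega
  · intro ht j
    ext X
    obtain ⟨t, rfl⟩ := X.exists_mk
    rw [h.getElem?_reflOrder hρ t.eq_pair, h'.getElem?_reflOrder hσ t.eq_pair, ht, hlen, hlt,
      Equiv.apply_eq_iff_eq]

theorem Asc.time_braid (hn : 3 ≤ n) {l₁ l₂ : List (ZMod n)} {i : ZMod n}
    (h : Asc n 1 (l₁ ++ [i, i + 1, i] ++ l₂)) (h' : Asc n 1 (l₁ ++ [i + 1, i, i + 1] ++ l₂))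
    (a b : ℤ) : time n (l₁ ++ [i + 1, i, i + 1] ++ l₂) a b =
      Equiv.swap l₁.length (l₁.length + 2) (time n (l₁ ++ [i, i + 1, i] ++ l₂) a b) := by
  obtain ⟨x, y, z, t1, t2, t3, t4, t5, t6⟩ := h.braid_times hn h'
  have hw := h.time_window h' (by simp) (simple_braid hn i) a b
  have hw' := h'.time_window h (by simp) (simple_braid hn i).symm a b
  simp only [List.length_cons, List.length_nil] at hw hw'
  have hlt : ∀ j, j < 3 → l₁.length + j < (l₁ ++ [i, i + 1, i] ++ l₂).length := by
    intro j hj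
    simp
    omega
  have hcase : ∀ {c d : ℤ}, time n (l₁ ++ [i, i + 1, i] ++ l₂) a b =
      time n (l₁ ++ [i, i + 1, i] ++ l₂) c d →
      time n (l₁ ++ [i, i + 1, i] ++ l₂) a b < (l₁ ++ [i, i + 1, i] ++ l₂).length →
      time n (l₁ ++ [i + 1, i, i + 1] ++ l₂) a b =
        time n (l₁ ++ [i + 1, i, i + 1] ++ l₂) c d := by
    intro c d h1 h2
    obtain ⟨m, rfl, rfl⟩ := h.exists_translate h1 h2
    rw [time_translate]
  have l0 := hlt 0 (by omega)
  have l1 := hlt 1 (by omega)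
  have l2 := hlt 2 (by omega)
  by_cases c0 : time n (l₁ ++ [i, i + 1, i] ++ l₂) a b = l₁.length
  · rw [c0, Equiv.swap_apply_left, hcase (c0.trans t1.symm) (by omega), t6]
  by_cases c1 : time n (l₁ ++ [i, i + 1, i] ++ l₂) a b = l₁.length + 1
  · rw [c1, Equiv.swap_apply_of_ne_of_ne (by omega) (by omega),
      hcase (c1.trans t2.symm) (by omega), t5]
  by_cases c2 : time n (l₁ ++ [i, i + 1, i] ++ l₂) a b = l₁.length + 2
  · rw [c2, Equiv.swap_apply_right, hcase (c2.trans t3.symm) (by omega), t4]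
  rw [Equiv.swap_apply_of_ne_of_ne c0 c2]
  omega

/-- The definition of a braid step does not exclude `n = 2`, but there the two factors have
different products. -/
theorem three_le_of_braid (hn : 0 < n) {l₁ l₂ : List (ZMod n)} {i : ZMod n}
    (h : Asc n 1 (l₁ ++ [i, i + 1, i] ++ l₂))
    (hprod : wordProd n (l₁ ++ [i + 1, i, i + 1] ++ l₂) = wordProd n (l₁ ++ [i, i + 1, i] ++ l₂)) :
    3 ≤ n := by
  have hn1 := h.ne_one (by simp)
  by_contra hn3
  obtain rfl : n = 2 := by omega
  rw [wordProd_append, wordProd_append, wordProd_append, wordProd_append] at hprod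
  have h1 := mul_left_cancel (mul_right_cancel hprod)
  obtain ⟨p, rfl⟩ := ZMod.intCast_surjective i
  have h2 : ((p : ZMod 2) + 1 + 1) = p := by
    generalize (p : ZMod 2) = q
    revert q
    decide
  -- For `n = 2` one factor sends `p` to `p + 3` and the other sends it to `p - 3`.
  have h3 := congrArg (fun u : Equiv.Perm ℤ => u p) h1
  simp only [wordProd_cons, wordProd_nil, mul_one, Equiv.Perm.mul_apply] at h3
  have a0 : ((p : ℤ) : ZMod 2) = p := rfl
  have a1 : ((p + 1 : ℤ) : ZMod 2) = (p : ZMod 2) + 1 := by push_cast; rfl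
  have a2 : ((p + 1 + 1 : ℤ) : ZMod 2) = p := by push_cast; exact h2
  have b1 : ((p - 1 : ℤ) : ZMod 2) = (p : ZMod 2) + 1 := by
    push_cast
    rw [sub_eq_iff_eq_add, h2]
  have b2 : ((p - 1 - 1 : ℤ) : ZMod 2) = p := by
    push_cast at b1 ⊢
    rw [b1, add_sub_cancel_right]
  rw [simple_of_eq_add_one hn1 (i := (p : ZMod 2) + 1) (x := p) h2.symm,
    simple_of_eq_add_one hn1 (i := (p : ZMod 2)) b1,
    simple_of_eq_add_one hn1 (i := (p : ZMod 2) + 1) (x := p - 1 - 1) (b2.trans h2.symm),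
    simple_of_eq hn1 (i := (p : ZMod 2)) (x := p) rfl,
    simple_of_eq hn1 (i := (p : ZMod 2) + 1) a1,
    simple_of_eq hn1 (i := (p : ZMod 2)) a2] at h3
  omega

/-- Both reflection orders are linear extensions of the permanent poset and they list the two
exchanged elements in opposite orders, so these elements are incomparable. -/
theorem Asc.commStep_of_wordCommStep (hn : 0 < n) (h : Asc n 1 l) (h' : Asc n 1 l')
    (hρ : IsReflOrderOf n l ρ) (hσ : IsReflOrderOf n l' σ) (hs : WordCommStep n l l') :
    CommStep n (wordProd n l) ρ σ := by
  have hprod := (h.of_commStep hs).2.1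
  obtain ⟨l₁, l₂, i, j, h1, h2, h3, rfl, rfl⟩ := hs
  have hk : l₁.length + 1 < (l₁ ++ [i, j] ++ l₂).length := by simp
  have ht : ∀ x y, time n (l₁ ++ [j, i] ++ l₂) x y =
      Equiv.swap l₁.length (l₁.length + 1) (time n (l₁ ++ [i, j] ++ l₂) x y) := fun x y => by
    rw [(h.comm h1 h2 h3).2.2, Equiv.swap_apply_def]
  generalize l₁ ++ [i, j] ++ l₂ = l at *
  generalize l₁ ++ [j, i] ++ l₂ = l' at *
  have hlen := h.length_eq hn h' hprod
  have hadm := h.isAdmissible hn hρ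
  have hadm' := h'.isAdmissible hn hσ
  rw [hprod] at hadm'
  obtain ⟨A, B, X, Y, hA, e1, e2⟩ := list_exists_of_swap_one
    (by rwa [(isReflOrderOf_iff.mp hρ).1])
    ((h.swap_reflOrder_iff hn h' hprod hρ hσ (by omega) hk).mpr ht)
  refine ⟨A, B, X, Y, ⟨?_, ?_, ?_⟩, e1, e2⟩
  all_goals
    have x0 : ρ[l₁.length]? = some X := by simp [e1, ← hA]
    have x1 : ρ[l₁.length + 1]? = some Y := by simp [e1, ← hA]
  · intro hle
    obtain ⟨s, rfl⟩ := X.exists_mk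
    obtain ⟨t, rfl⟩ := Y.exists_mk
    have y0 := (h.getElem?_reflOrder hρ s.eq_pair _).mp x0
    have y1 := (h.getElem?_reflOrder hρ t.eq_pair _).mp x1
    have hne : AffSet.mk s ≠ AffSet.mk t := by
      intro e
      rw [e, h.getElem?_reflOrder hρ t.eq_pair] at x0
      omega
    have h4 := hadm'.linear_extension _ _ hne hle
    rw [h'.pair_sublist_reflOrder hσ s.eq_pair t.eq_pair, ht, ht, y0.1, y1.1,
      Equiv.swap_apply_left, Equiv.swap_apply_right] at h4
    omega
  · intro hle
    obtain ⟨s, rfl⟩ := X.exists_mk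
    obtain ⟨t, rfl⟩ := Y.exists_mk
    have y0 := (h.getElem?_reflOrder hρ s.eq_pair _).mp x0
    have y1 := (h.getElem?_reflOrder hρ t.eq_pair _).mp x1
    have hne : AffSet.mk t ≠ AffSet.mk s := by
      intro e
      rw [← e, h.getElem?_reflOrder hρ t.eq_pair] at x0
      omega
    have h4 := hadm.linear_extension _ _ hne hle
    rw [h.pair_sublist_reflOrder hρ t.eq_pair s.eq_pair, y0.1, y1.1] at h4
    omega
  -- For two crossings of one triangle, the exchange of neighbouring times would contradict
  -- `time_between` in one of the two words.
  · rintro ⟨Z, ⟨p, rfl⟩, ⟨q, rfl⟩⟩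
    obtain ⟨t, rfl⟩ := Z.exists_mk
    obtain ⟨d0, d1, d2⟩ := Tuple.del_triple t.eq_triple
    have hT : ∀ r : Fin 3, ∀ m, ρ[m]? = some ((AffSet.mk t).del r) →
        time n l (![t.1 1, t.1 0, t.1 0] r) (![t.1 2, t.1 2, t.1 1] r) = m := by
      intro r m hm
      fin_cases r
      · exact ((h.getElem?_reflOrder hρ d0 m).mp hm).1
      · exact ((h.getElem?_reflOrder hρ d1 m).mp hm).1
      · exact ((h.getElem?_reflOrder hρ d2 m).mp hm).1
    have y0 := hT p _ x0
    have y1 := hT q _ x1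
    obtain ⟨g1, g2⟩ := Tuple.lt_triple t.eq_triple
    have b1 := h.time_between g1 g2
    have b2 := h'.time_between g1 g2
    have b3 := h.time_ne g1 g2
    rw [ht, ht, ht] at b2
    simp only [Equiv.swap_apply_def] at b2
    fin_cases p <;> fin_cases q <;> simp at y0 y1 <;> simp only [y0, y1] at b1 b2 b3 <;>
      simp at b2 <;> split_ifs at b2 <;> omega

end

end

end AffineBruhat

namespace AffineBruhat

section

variable {n : ℕ} {w : Equiv.Perm ℤ} {l l' : List (ZMod n)} {ρ σ : List (AffSet n 2)}

theorem Asc.not_invd_of_modEq (h : Asc n 1 l) {x y : ℤ} (hxy : x ≡ y [ZMOD n]) :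
    time n l x y = l.length := by
  have h1 := time_le n l x y
  have h2 := mt (h.time_lt_length x y).mp fun h' => h'.not_modEq (wordProd_periodic n l) hxy
  omega

/-- The exchanged pairs have no line in common, even up to translation; hence `exists_swap` provides
a commutation, and the resulting word is `l'` because its times are the same. -/
theorem Asc.wordCommStep_of_commStep (hn : 0 < n) (h : Asc n 1 l) (h' : Asc n 1 l')
    (hprod : wordProd n l' = wordProd n l) (hρ : IsReflOrderOf n l ρ) (hσ : IsReflOrderOf n l' σ)
    (hs : CommStep n w ρ σ) : WordCommStep n l l' := by
  obtain ⟨A, B, X, Y, ⟨-, -, hpk⟩, e1, e2⟩ := hs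
  have hlen := h.length_eq hn h' hprod
  have hk : A.length + 1 < l.length := by
    rw [← (isReflOrderOf_iff.mp hρ).1, e1]
    simp
  have ht := (h.swap_reflOrder_iff hn h' hprod hρ hσ (a := A.length) (b := A.length + 1)
    (by omega) hk).mp fun j => by rw [e1, e2, list_swap_one_getElem?]
  have x0 : ρ[A.length]? = some X := by simp [e1]
  have x1 : ρ[A.length + 1]? = some Y := by simp [e1]
  have hper := wordProd_periodic n l
  have claim : ∀ a b c : ℤ, a < b → b < c →
      ¬ ((time n l a b = A.length ∧ time n l a c = A.length + 1) ∨
        (time n l a c = A.length ∧ time n l a b = A.length + 1) ∨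
        (time n l a c = A.length ∧ time n l b c = A.length + 1) ∨
        (time n l b c = A.length ∧ time n l a c = A.length + 1) ∨
        (time n l a b = A.length ∧ time n l b c = A.length + 1) ∨
        (time n l b c = A.length ∧ time n l a b = A.length + 1)) := by
    intro a b c hab hbc hcase
    have b1 := h.time_between hab hbc
    have b2 := h'.time_between hab hbc
    rw [ht, ht, ht] at b2
    have hne : ∀ x y : ℤ, x ≡ y [ZMOD n] → time n l x y = l.length := fun x y hxy =>
      h.not_invd_of_modEq hxy
    -- Congruent entries form no packet, so this case is not covered by the hypothesis. But then one
    -- of the three crossings never happens, and `time_between` fails in one of the two words.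
    have n1 : ¬ a ≡ b [ZMOD n] := fun hc => by
      rw [hne _ _ hc] at hcase b1 b2
      simp only [Equiv.swap_apply_def] at b2
      split_ifs at b2 <;> omega
    have n2 : ¬ a ≡ c [ZMOD n] := fun hc => by
      rw [hne _ _ hc] at hcase b1
      omega
    have n3 : ¬ b ≡ c [ZMOD n] := fun hc => by
      rw [hne _ _ hc] at hcase b1 b2
      simp only [Equiv.swap_apply_def] at b2
      split_ifs at b2 <;> omega
    obtain ⟨t, htt⟩ := Tuple.exists_triple hab hbc n1 n2 n3
    obtain ⟨d0, d1, d2⟩ := Tuple.del_triple htt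
    have key : ∀ {r : Fin 3} {x y : ℤ} {m : ℕ}, (t.del r).1 = ![x, y] → m < l.length →
        time n l x y = m → ∀ W, ρ[m]? = some W → W ∈ packet (AffSet.mk t) := by
      intro r x y m hd hm hxy W hW
      have := (h.getElem?_reflOrder hρ hd m).mpr ⟨hxy, hm⟩
      rw [hW] at this
      exact ⟨r, (Option.some.inj this).symm⟩
    have hk' : A.length < l.length := by omega
    refine hpk ⟨AffSet.mk t, ?_⟩
    rcases hcase with ⟨f, g⟩ | ⟨f, g⟩ | ⟨f, g⟩ | ⟨f, g⟩ | ⟨f, g⟩ | ⟨f, g⟩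
    · exact ⟨key d2 hk' f X x0, key d1 hk g Y x1⟩
    · exact ⟨key d1 hk' f X x0, key d2 hk g Y x1⟩
    · exact ⟨key d1 hk' f X x0, key d0 hk g Y x1⟩
    · exact ⟨key d0 hk' f X x0, key d1 hk g Y x1⟩
    · exact ⟨key d2 hk' f X x0, key d0 hk g Y x1⟩
    · exact ⟨key d0 hk' f X x0, key d2 hk g Y x1⟩
  obtain ⟨t, rfl⟩ := X.exists_mk
  obtain ⟨hxy, -⟩ := (h.getElem?_reflOrder hρ t.eq_pair _).mp x0
  have hlt := t.2.1 (show (0 : Fin 2) < 1 by decide)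
  obtain ⟨l'', s1, s2, s3, s4, s5⟩ := h.exists_swap hk hxy (by
    intro z
    have lt : ∀ {x y : ℤ}, time n l x y = A.length + 1 → x < y := fun h' =>
      h.lt_of_time (by omega)
    refine ⟨fun h1 => ?_, fun h1 => ?_, fun h1 => ?_, fun h1 => ?_⟩
    · have h2 := lt h1
      rcases lt_trichotomy z (t.1 1) with h3 | rfl | h3
      · exact claim _ _ _ h2 h3 (by tauto)
      · omega
      · exact claim _ _ _ hlt h3 (by tauto)
    · exact claim _ _ _ (lt h1) hlt (by tauto)
    · exact claim _ _ _ hlt (lt h1) (by tauto)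
    · have h2 := lt h1
      rcases lt_trichotomy z (t.1 0) with h3 | rfl | h3
      · exact claim _ _ _ h3 hlt (by tauto)
      · omega
      · exact claim _ _ _ h3 h2 (by tauto))
  have : l' = l'' := s2.eq_of_time hn h' (by omega) fun x y => by
    rw [ht, s5, Equiv.swap_apply_def]
  exact this ▸ s1

theorem Asc.flipStep_of_braidStep (hn : 0 < n) (h : Asc n 1 l) (h' : Asc n 1 l')
    (hprod : wordProd n l' = wordProd n l) (hρ : IsReflOrderOf n l ρ) (hσ : IsReflOrderOf n l' σ)
    (hs : BraidStep n l l') : FlipStep n (wordProd n l) ρ σ := by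
  obtain ⟨l₁, l₂, i, rfl, rfl⟩ := hs
  have hn3 := three_le_of_braid hn h hprod
  have ht := h.time_braid hn3 h'
  obtain ⟨x, y, z, t1, t2, t3, -⟩ := h.braid_times hn3 h'
  have hk : l₁.length + 2 < (l₁ ++ [i, i + 1, i] ++ l₂).length := by simp
  generalize l₁ ++ [i, i + 1, i] ++ l₂ = l at *
  generalize l₁ ++ [i + 1, i, i + 1] ++ l₂ = l' at *
  obtain ⟨A, B, X, Y, Z, hA, e1, e2⟩ := list_exists_of_swap_two
    (by rwa [(isReflOrderOf_iff.mp hρ).1])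
    ((h.swap_reflOrder_iff hn h' hprod hρ hσ (by omega) hk).mpr ht)
  have hper := wordProd_periodic n l
  have i1 := (h.time_lt_length x y).mp (by omega)
  have i2 := (h.time_lt_length y z).mp (by omega)
  obtain ⟨t, htt⟩ := Tuple.exists_triple i1.1 i2.1 (i1.not_modEq hper)
    ((i1.trans i2).not_modEq hper) (i2.not_modEq hper)
  obtain ⟨d0, d1, d2⟩ := Tuple.del_triple htt
  have x0 : ρ[l₁.length]? = some X := by simp [e1, ← hA]
  have x1 : ρ[l₁.length + 1]? = some Y := by simp [e1, ← hA]
  have x2 : ρ[l₁.length + 2]? = some Z := by simp [e1, ← hA]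
  rw [(h.getElem?_reflOrder hρ d2 _).mpr ⟨t1, by omega⟩] at x0
  rw [(h.getElem?_reflOrder hρ d1 _).mpr ⟨t2, by omega⟩] at x1
  rw [(h.getElem?_reflOrder hρ d0 _).mpr ⟨t3, by omega⟩] at x2
  have hanti : antilexPacket (AffSet.mk t) = [Z, Y, X] := by
    rw [← Option.some.inj x0, ← Option.some.inj x1, ← Option.some.inj x2]
    rfl
  refine ⟨A, B, AffSet.mk t, ?_, ?_, ?_⟩
  · rw [tripleRel_mk htt, tripleRel_invSet hper]
    exact ⟨i1, i2⟩
  · rw [e1, lexPacket, hanti]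
    rfl
  · rw [e2, hanti]

/-- Nothing is assumed about the flipped list. It is recognised as the reflection order of the word
after the braid move, and this is how admissibility passes through flips. -/
theorem Asc.exists_braidStep_of_flipStep (hn : 0 < n) (h : Asc n 1 l) (hρ : IsReflOrderOf n l ρ)
    (hs : FlipStep n w ρ σ) : ∃ l', Asc n 1 l' ∧ wordProd n l' = wordProd n l ∧
      IsReflOrderOf n l' σ ∧ BraidStep n l l' := by
  obtain ⟨A, B, X, -, e1, e2⟩ := hs
  obtain ⟨t, rfl⟩ := X.exists_mk
  obtain ⟨d0, d1, d2⟩ := Tuple.del_triple t.eq_triple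
  have hanti : antilexPacket (AffSet.mk t) =
      [AffSet.mk (t.del 0), AffSet.mk (t.del 1), AffSet.mk (t.del 2)] := rfl
  have hlex : lexPacket (AffSet.mk t) =
      [AffSet.mk (t.del 2), AffSet.mk (t.del 1), AffSet.mk (t.del 0)] := rfl
  rw [hlex] at e1
  rw [hanti] at e2
  have hk : A.length + 2 < l.length := by
    rw [← (isReflOrderOf_iff.mp hρ).1, e1]
    simp
  have t1 := ((h.getElem?_reflOrder hρ d2 A.length).mp (by simp [e1])).1
  have t2 := ((h.getElem?_reflOrder hρ d1 (A.length + 1)).mp (by simp [e1])).1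
  have t3 := ((h.getElem?_reflOrder hρ d0 (A.length + 2)).mp (by simp [e1])).1
  obtain ⟨hn3, i, hsplit⟩ := h.braid_of_lex hn hk t1 t2 t3
  have hm : (l.take A.length).length = A.length := by
    rw [List.length_take]
    omega
  generalize l.take A.length = m₁ at hsplit hm
  generalize l.drop (A.length + 3) = m₂ at hsplit
  subst hsplit
  have g1' := h
  rw [asc_append, asc_append] at g1'
  have hper : Periodic n (1 * wordProd n m₁) := by
    rw [one_mul]
    exact wordProd_periodic n m₁
  obtain ⟨p, hp⟩ := ZMod.intCast_surjective i
  have hiff := asc_braid_iff hn3 hper hp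
  have hl₂ : Asc n 1 (m₁ ++ [i + 1, i, i + 1] ++ m₂) := by
    rw [asc_append, asc_append]
    refine ⟨⟨g1'.1.1, hiff.2.mpr (hiff.1.mp g1'.1.2)⟩, ?_⟩
    rw [wordProd_append, ← simple_braid hn3, ← wordProd_append]
    exact g1'.2
  have hprod : wordProd n (m₁ ++ [i + 1, i, i + 1] ++ m₂) =
      wordProd n (m₁ ++ [i, i + 1, i] ++ m₂) := by
    simp only [wordProd_append, simple_braid hn3]
  obtain ⟨σ', hσ'⟩ := hl₂.exists_reflOrder
  have ht := (h.swap_reflOrder_iff hn hl₂ hprod hρ hσ' (a := A.length) (b := A.length + 2)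
    (by omega) hk).mpr fun x y => by rw [h.time_braid hn3 hl₂, hm]
  have he : σ' = σ := by
    refine List.ext_getElem? fun j => ?_
    obtain ⟨j, rfl⟩ := (Equiv.swap A.length (A.length + 2)).surjective j
    rw [ht, e1, e2, list_swap_two_getElem?]
  exact ⟨_, hl₂, hprod, he ▸ hσ', m₁, m₂, i, rfl, rfl⟩

/-! ### Reversal sets of words -/

/-- The classes of the triples that are reversed in a word. -/
def reversal (n : ℕ) (l : List (ZMod n)) : Set (AffSet n 3) :=
  {X | ∃ t : Tuple n 3, AffSet.mk t = X ∧ RevP n l (t.1 0) (t.1 1) (t.1 2)}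

theorem Asc.tripleRel_reversal (h : Asc n 1 l) (a b c : ℤ) :
    TripleRel (reversal n l) a b c ↔ RevP n l a b c := by
  have hper := wordProd_periodic n l
  constructor
  · rintro ⟨t, ht, s, hs, h1⟩
    obtain ⟨m, rfl, rfl, rfl⟩ := (mk_triple_eq ht s.eq_triple).mp hs.symm
    exact h.tripleCons.translate m h1
  · intro h1
    obtain ⟨i1, i2⟩ := h.tripleCons.subset h1
    obtain ⟨t, ht⟩ := Tuple.exists_triple i1.1 i2.1 (i1.not_modEq hper)
      ((i1.trans i2).not_modEq hper) (i2.not_modEq hper)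
    refine ⟨t, ht, t, rfl, ?_⟩
    rwa [ht]

theorem Asc.tripleRel_reversal_eq (h : Asc n 1 l) : TripleRel (reversal n l) = RevP n l := by
  funext a b c
  exact propext (h.tripleRel_reversal a b c)

theorem Asc.isConsistent_reversal (hn : 0 < n) (h : Asc n 1 l) :
    IsConsistent n (wordProd n l) (reversal n l) := by
  rw [isConsistent_three_iff hn (wordProd_periodic n l), h.tripleRel_reversal_eq]
  exact h.tripleCons

theorem Asc.reversal_eq_iff (h : Asc n 1 l) (h' : Asc n 1 l') :
    reversal n l' = reversal n l ↔ ∀ a b c, RevP n l' a b c ↔ RevP n l a b c := by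
  rw [eq_iff_tripleRel, h.tripleRel_reversal_eq, h'.tripleRel_reversal_eq]

theorem Asc.rev_eq (h : Asc n 1 l) (hρ : IsReflOrderOf n l ρ) :
    Rev n (wordProd n l) ρ = reversal n l := by
  have hper := wordProd_periodic n l
  rw [eq_iff_tripleRel, h.tripleRel_reversal_eq]
  intro a b c
  constructor
  · rintro ⟨t, ht, h1, h2⟩
    rw [h.antilex_sublist hρ ht] at h2
    obtain ⟨h3, h4⟩ := Tuple.lt_triple ht
    exact ⟨h3, h4, by omega, h2.2.2⟩
  · rintro ⟨h1, h2, h3, h4⟩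
    have i1 := (h.time_lt_length a b).mp h4
    have i2 := (h.time_lt_length b c).mp (by omega)
    obtain ⟨t, ht⟩ := Tuple.exists_triple h1 h2 (i1.not_modEq hper)
      ((i1.trans i2).not_modEq hper) (i2.not_modEq hper)
    refine ⟨t, ht, ?_, ?_⟩
    · rw [tripleRel_mk ht, tripleRel_invSet hper]
      exact ⟨i1, i2⟩
    · rw [h.antilex_sublist hρ ht]
      have := h.time_between h1 h2
      have := h.time_ne h1 h2
      omega

theorem Asc.reversal_braidStep (hn : 0 < n) (h : Asc n 1 l) (h' : Asc n 1 l')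
    (hprod : wordProd n l' = wordProd n l) (hs : BraidStep n l l') :
    ∃ X ∉ reversal n l, reversal n l' = insert X (reversal n l) := by
  obtain ⟨l₁, l₂, i, rfl, rfl⟩ := hs
  have hn3 := three_le_of_braid hn h hprod
  obtain ⟨x, y, z, t1, t2, t3, hrev⟩ := h.revP_braid hn3 h'
  have hk : l₁.length + 2 < (l₁ ++ [i, i + 1, i] ++ l₂).length := by simp
  have hper := wordProd_periodic n (l₁ ++ [i, i + 1, i] ++ l₂)
  have i1 := (h.time_lt_length x y).mp (by omega)
  have i2 := (h.time_lt_length y z).mp (by omega)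
  obtain ⟨t, ht⟩ := Tuple.exists_triple i1.1 i2.1 (i1.not_modEq hper)
    ((i1.trans i2).not_modEq hper) (i2.not_modEq hper)
  refine ⟨AffSet.mk t, ?_, ?_⟩
  · rw [tripleRel_mk ht, h.tripleRel_reversal]
    rintro ⟨-, -, h3, -⟩
    omega
  · rw [eq_iff_tripleRel]
    intro a b c
    rw [h'.tripleRel_reversal, hrev, ← h.tripleRel_reversal]
    constructor
    · rintro (⟨s, hs, h1⟩ | ⟨m, rfl, rfl, rfl⟩)
      · exact ⟨s, hs, .inr h1⟩
      · exact TripleRel.translate ⟨t, ht, Set.mem_insert _ _⟩ m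
    · rintro ⟨s, hs, h1 | h1⟩
      · exact .inr ((mk_triple_eq hs ht).mp h1)
      · exact .inl ⟨s, hs, h1⟩

end

end AffineBruhat

namespace AffineBruhat

section

variable {n : ℕ} {w : Equiv.Perm ℤ}

/-! ### Maximal chains of consistent sets of pairs -/

theorem IsConsistent.finite (hn : 0 < n) (hw : Periodic n w) {R : Set (AffSet n 2)}
    (h : IsConsistent n w R) : R.Finite :=
  (finite_invSet_two hn hw).subset h.subset

theorem Asc.invSet_append_singleton {l : List (ZMod n)} {i : ZMod n} (h : Asc n 1 (l ++ [i])) :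
    ∃ X ∉ InvSet n (wordProd n l) 2,
      InvSet n (wordProd n (l ++ [i])) 2 = insert X (InvSet n (wordProd n l) 2) := by
  have h2 := (asc_append.mp h).2
  rw [one_mul, asc_singleton] at h2
  obtain ⟨t, -, h3, h4⟩ := invSet_mul_simple h2.1 (wordProd_periodic n l) (intCast_cast' i) h2.2
  exact ⟨_, h3, by rw [wordProd_append, wordProd_singleton, h4]⟩

/-- A word whose inversions lie in a consistent set can be extended to a word with this inversion
set, and this gives a chain of consistent sets. -/
theorem Asc.exists_extension (hn : 0 < n) (hw : Periodic n w) (R : Consistent n w 2) (d : ℕ)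
    {l : List (ZMod n)} (h : Asc n 1 l) (hd : R.1.ncard - l.length = d)
    (hsub : InvSet n (wordProd n l) 2 ⊆ R.1) :
    (∃ m, Asc n 1 (l ++ m) ∧ InvSet n (wordProd n (l ++ m)) 2 = R.1) ∧
      ∀ Q : Consistent n w 2, Q.1 = InvSet n (wordProd n l) 2 → Q ≤ R := by
  induction d using Nat.strong_induction_on generalizing l with
  | _ d ih =>
  have hper := wordProd_periodic n l
  by_cases heq : InvSet n (wordProd n l) 2 = R.1
  · exact ⟨⟨[], by simpa using h, by simpa using heq⟩, fun Q hQ => by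
      have he : Q = R := Subtype.ext (hQ.trans heq)
      exact he.le⟩
  have hRfin := R.2.finite hn hw
  have hcard : l.length < R.1.ncard := by
    rw [← h.ncard_invSet hn]
    exact Set.ncard_lt_ncard (hsub.ssubset_of_ne heq) hRfin
  have hRc := R.2.pairCons hn hw
  -- As long as `R` contains further pairs, one of them stands at adjacent positions and can be
  -- inverted by the next letter.
  obtain ⟨a, ha, hRa⟩ := hRc.exists_ascent (u := wordProd n l)
    (fun x y hxy => ((pairRel_invSet hper).mpr hxy).mono hsub) (by
      by_contra hc
      push Not at hc
      refine heq (hsub.antisymm ?_)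
      rw [subset_iff_pairRel]
      exact fun x y hxy => (pairRel_invSet hper).mpr (hc x y hxy))
  have hn1 : n ≠ 1 := by
    rintro rfl
    exact hRa.lt.2 (Int.modEq_iff_dvd.mpr ⟨_, (one_mul _).symm⟩)
  have hasc : Asc n 1 (l ++ [(a : ZMod n)]) := by
    rw [asc_append, one_mul, asc_singleton]
    exact ⟨h, hn1, (lt_of_intCast_eq hper (intCast_cast' _).symm).mp ha⟩
  have hsub' : InvSet n (wordProd n (l ++ [(a : ZMod n)])) 2 ⊆ R.1 := by
    obtain ⟨t, ht, -, h4⟩ := invSet_mul_simple hn1 hper (rfl : (a : ZMod n) = a) ha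
    rw [wordProd_append, wordProd_singleton, h4, Set.insert_subset_iff]
    exact ⟨(pairRel_mk ht).mpr hRa, hsub⟩
  have hlen : (l ++ [(a : ZMod n)]).length = l.length + 1 := by simp
  obtain ⟨⟨m, h1, h2⟩, h3⟩ := ih _ (by rw [hlen]; omega) hasc rfl hsub'
  refine ⟨⟨(a : ZMod n) :: m, by simpa using h1, by simpa using h2⟩, fun Q hQ => ?_⟩
  obtain ⟨X, hX, hX'⟩ := hasc.invSet_append_singleton
  refine .head ⟨X, by rwa [hQ], ?_⟩ (h3 ⟨_, isConsistent_invSet hn (wordProd_periodic n _) hw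
    (hsub'.trans R.2.subset)⟩ rfl)
  rw [hQ]
  exact hX'

theorem invSet_nil (n : ℕ) : InvSet n (wordProd n []) 2 = ∅ := by
  rw [Set.eq_empty_iff_forall_notMem]
  intro X hX
  obtain ⟨t, rfl⟩ := X.exists_mk
  rw [pairRel_mk t.eq_pair, pairRel_invSet (wordProd_periodic n [])] at hX
  exact not_invd_one _ _ hX

theorem Consistent.exists_asc (hn : 0 < n) (hw : Periodic n w) (R : Consistent n w 2) :
    ∃ l, Asc n 1 l ∧ InvSet n (wordProd n l) 2 = R.1 := by
  obtain ⟨⟨m, h1, h2⟩, -⟩ := Asc.exists_extension hn hw R _ (l := []) trivial rfl (by simp [invSet_nil])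
  exact ⟨m, h1, h2⟩

/-- For pairs, the order generated by single insertions is plain inclusion: a word for the smaller
set extends letter by letter to a word for the larger one. -/
theorem Consistent.le_iff_subset (hn : 0 < n) (hw : Periodic n w) {R S : Consistent n w 2} :
    R ≤ S ↔ R.1 ⊆ S.1 := by
  refine ⟨subset_of_steps, fun h => ?_⟩
  obtain ⟨l, h1, h2⟩ := R.exists_asc hn hw
  exact (Asc.exists_extension hn hw S _ h1 rfl (h2.trans_subset h)).2 R h2.symm

theorem Consistent.le_of_ncard (hn : 0 < n) (hw : Periodic n w) {R S : Consistent n w 2}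
    (h : R ≤ S ∨ S ≤ R) (hcard : R.1.ncard ≤ S.1.ncard) : R ≤ S := by
  refine h.elim id fun h => ?_
  rw [Consistent.le_iff_subset hn hw] at h ⊢
  exact (Set.eq_of_subset_of_ncard_le h hcard (R.2.finite hn hw)).symm.subset

variable {l : List (ZMod n)} {ρ : List (AffSet n 2)}

theorem Asc.take_reflOrder (h : Asc n 1 l) (hρ : IsReflOrderOf n l ρ) (j : ℕ) :
    {X | X ∈ ρ.take j} = InvSet n (prefixProd n l (min j l.length)) 2 := by
  rw [← h.mem_take_reflOrder hρ (min_le_right _ _)]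
  rcases le_total j l.length with hj | hj
  · rw [min_eq_left hj]
  · rw [min_eq_right hj, List.take_of_length_le, List.take_of_length_le] <;>
      rw [(isReflOrderOf_iff.mp hρ).1]
    exact hj

theorem Asc.take {l : List (ZMod n)} (h : Asc n 1 l) (j : ℕ) : Asc n 1 (l.take j) := by
  rw [← List.take_append_drop j l, asc_append] at h
  exact h.1

theorem Asc.invSet_prefixProd_subset (h : Asc n 1 l) (hl : wordProd n l = w) {j : ℕ}
    (hj : j ≤ l.length) : InvSet n (prefixProd n l j) 2 ⊆ InvSet n w 2 := by
  subst hl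
  rw [invSet_subset_iff (prefixProd_periodic n l _) (wordProd_periodic n l), ← prefixProd_length]
  exact fun x y hxy => h.invd_mono hj le_rfl hxy

/-- The maximal chain of consistent sets that belongs to a reflection order. -/
def Asc.flag (hn : 0 < n) (hw : Periodic n w) (h : Asc n 1 l) (hl : wordProd n l = w)
    (hρ : IsReflOrderOf n l ρ) : Flag (Consistent n w 2) where
  carrier := {R | ∃ j : ℕ, R.1 = {X | X ∈ ρ.take j}}
  Chain' := by
    have key : ∀ {i j : ℕ}, i ≤ j → {X | X ∈ ρ.take i} ⊆ {X | X ∈ ρ.take j} := fun hij X hX =>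
      (List.take_sublist_take_left hij).subset hX
    rintro R ⟨i, hR⟩ S ⟨j, hS⟩ -
    change R ≤ S ∨ S ≤ R
    rw [Consistent.le_iff_subset hn hw, Consistent.le_iff_subset hn hw, hR, hS]
    exact (le_total i j).imp key key
  max_chain' := by
    intro s hs hsub
    -- A member of a larger chain is comparable with the initial segment of the same cardinality,
    -- and so it is equal to it.
    refine hsub.antisymm fun S hS => ⟨S.1.ncard, ?_⟩
    have hle : S.1.ncard ≤ l.length := by
      rw [← h.ncard_invSet hn, hl]
      exact Set.ncard_le_ncard S.2.subset (finite_invSet_two hn hw)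
    have e1 := h.mem_take_reflOrder hρ hle
    have e2 := h.invSet_prefixProd_subset hl hle
    have e3 : (InvSet n (prefixProd n l S.1.ncard) 2).ncard = S.1.ncard := by
      rw [prefixProd, (h.take _).ncard_invSet hn, List.length_take, min_eq_left hle]
    rw [e1]
    obtain ⟨T, hT⟩ : ∃ T : Consistent n w 2, T.1 = InvSet n (prefixProd n l S.1.ncard) 2 :=
      ⟨⟨_, isConsistent_invSet hn (prefixProd_periodic n l S.1.ncard) hw e2⟩, rfl⟩
    rw [← hT] at e1 e3 ⊢
    have hmem : T ∈ s := hsub ⟨_, e1.symm⟩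
    have hcmp : S ≤ T ∨ T ≤ S := hs.total hS hmem
    have he : S = T := le_antisymm (Consistent.le_of_ncard hn hw hcmp e3.ge)
      (Consistent.le_of_ncard hn hw hcmp.symm e3.le)
    exact congrArg Subtype.val he

/-- The members of the chain are determined by their cardinalities, so the chain determines the
inversions of every prefix and thus all times. -/
theorem Asc.eq_of_flag_eq (hn : 0 < n) (hw : Periodic n w) (h : Asc n 1 l)
    (hl : wordProd n l = w) (hρ : IsReflOrderOf n l ρ) {l' : List (ZMod n)}
    {σ : List (AffSet n 2)} (h' : Asc n 1 l') (hl' : wordProd n l' = w)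
    (hσ : IsReflOrderOf n l' σ) (he : h.flag hn hw hl hρ = h'.flag hn hw hl' hσ) : l' = l := by
  have hlen := h.length_eq hn h' (hl'.trans hl.symm)
  refine h.eq_of_time hn h' hlen fun x y => ?_
  have key : ∀ j ≤ l.length, time n l' x y < j ↔ time n l x y < j := by
    intro j hj
    rw [h.time_lt_iff hj, h'.time_lt_iff (hlen ▸ hj)]
    have e2 := h.invSet_prefixProd_subset hl hj
    have hmem : (⟨_, isConsistent_invSet hn (prefixProd_periodic n l j) hw e2⟩ :
        Consistent n w 2) ∈ h.flag hn hw hl hρ := ⟨j, (h.mem_take_reflOrder hρ hj).symm⟩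
    rw [he] at hmem
    obtain ⟨i, hi⟩ := hmem
    have hi : InvSet n (prefixProd n l j) 2 = _ := hi
    rw [h'.take_reflOrder hσ] at hi
    have hc := congrArg Set.ncard hi
    rw [prefixProd, prefixProd, (h.take _).ncard_invSet hn, (h'.take _).ncard_invSet hn,
      List.length_take, List.length_take, min_eq_left hj] at hc
    rw [show min i l'.length = j by omega] at hi
    rw [← pairRel_invSet (prefixProd_periodic n l j), ← pairRel_invSet (prefixProd_periodic n l' j),
      hi]
  have h1 := time_le n l x y
  have h2 := time_le n l' x y
  have h3 := key (time n l x y)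
  have h4 := key (time n l' x y)
  by_contra hne
  rcases lt_or_gt_of_ne hne with h5 | h5
  · have := key (time n l x y) h1
    omega
  · have := key (time n l' x y) (by omega)
    omega

/-- The empty set and the full inversion set are comparable to everything, so they belong to every
maximal chain. Between them the chain rises by one element at a time, and each element is realised
by a letter. -/
theorem Asc.exists_flag_eq (hn : 0 < n) (hw : IsAffinePerm n w) (c : Flag (Consistent n w 2)) :
    ∃ l, Asc n 1 l ∧ wordProd n l = w ∧ ∀ j ≤ l.length, ∃ R ∈ c,
      R.1 = InvSet n (prefixProd n l j) 2 := by
  have hper := hw.per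
  have htop : IsConsistent n w (InvSet n w 2) := isConsistent_invSet hn hper hper subset_rfl
  have htopmem : (⟨_, htop⟩ : Consistent n w 2) ∈ c := by
    refine Flag.mem_iff_forall_le_or_ge.mpr ?_
    exact fun S _ => .inr ((Consistent.le_iff_subset hn hper).mpr S.2.subset)
  have hbot : IsConsistent n w (InvSet n (wordProd n []) 2) :=
    isConsistent_invSet hn (wordProd_periodic n []) hper (by simp [invSet_nil])
  have key : ∀ j ≤ (InvSet n w 2).ncard, ∃ l, l.length = j ∧ Asc n 1 l ∧
      ∀ i ≤ l.length, ∃ R ∈ c, R.1 = InvSet n (prefixProd n l i) 2 := by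
    intro j
    induction j with
    | zero =>
      refine fun _ => ⟨[], rfl, trivial, fun i _ => ⟨⟨_, hbot⟩, ?_, by simp [prefixProd]⟩⟩
      refine Flag.mem_iff_forall_le_or_ge.mpr ?_
      exact fun S _ => .inl ((Consistent.le_iff_subset hn hper).mpr (by simp [invSet_nil]))
    | succ j ih =>
      intro hj
      obtain ⟨l, hlen, hasc, hl⟩ := ih (by omega)
      obtain ⟨R, hRc, hR⟩ := hl l.length le_rfl
      rw [prefixProd_length] at hR
      have hRcard : R.1.ncard = j := by rw [hR, hasc.ncard_invSet hn, hlen]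
      obtain ⟨S, ⟨hSc, hRS⟩, hmin⟩ := (measure fun S : Consistent n w 2 => S.1.ncard).wf.has_min
        {S | S ∈ c ∧ R < S} ⟨⟨_, htop⟩, htopmem, by
          refine lt_of_le_of_ne ((Consistent.le_iff_subset hn hper).mpr R.2.subset) fun he => ?_
          have := congrArg (fun S : Consistent n w 2 => S.1.ncard) he
          dsimp only at this
          omega⟩
      have hstep : ∃ R' : Consistent n w 2, (∃ X, X ∉ R.1 ∧ R'.1 = insert X R.1) ∧ R' ≤ S := by
        rcases Relation.ReflTransGen.cases_head (show Relation.ReflTransGen _ R S from hRS.le) with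
          h1 | ⟨R', h1, h2⟩
        · exact absurd h1 hRS.ne
        · exact ⟨R', h1, h2⟩
      obtain ⟨R', ⟨X, hX, hR'⟩, hR'S⟩ := hstep
      have hRR' : R ≤ R' := .single ⟨X, hX, hR'⟩
      -- The set `R'` has one element more than `R` and lies below the next member `S` of the chain,
      -- so it is comparable to every member. Maximality puts it into the chain.
      have hR'c : R' ∈ c := by
        rw [Flag.mem_iff_forall_le_or_ge]
        intro T hT
        by_cases hTR : T ≤ R
        · exact .inr (hTR.trans hRR')
        · have hRT : R < T := lt_of_le_not_ge ((c.le_or_le hT hRc).resolve_left hTR) hTR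
          exact .inl (hR'S.trans (Consistent.le_of_ncard hn hper (c.le_or_le hSc hT)
            (not_lt.mp (hmin T ⟨hT, hRT⟩))))
      have hsub : InvSet n (wordProd n l) 2 ⊆ R'.1 := by
        rw [← hR, hR']
        exact Set.subset_insert _ _
      obtain ⟨⟨m, h1, h2⟩, -⟩ := Asc.exists_extension hn hper R' _ hasc rfl hsub
      have hcard : (l ++ m).length = j + 1 := by
        rw [← h1.ncard_invSet hn, h2, hR', Set.ncard_insert_of_notMem hX (R.2.finite hn hper),
          hRcard]
      refine ⟨l ++ m, hcard, h1, fun i hi => ?_⟩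
      by_cases hil : i ≤ l.length
      · rw [prefixProd_append_left hil]
        exact hl i hil
      · have : i = (l ++ m).length := by omega
        rw [this, prefixProd_length, h2]
        exact ⟨R', hR'c, rfl⟩
  obtain ⟨l, h1, h2, h3⟩ := key _ le_rfl
  refine ⟨l, h2, ?_, h3⟩
  obtain ⟨R, -, hR⟩ := h3 l.length le_rfl
  rw [prefixProd_length] at hR
  refine invSet_injective hn (isAffinePerm_wordProd n l) hw
    (Set.eq_of_subset_of_ncard_le (hR ▸ R.2.subset) ?_ (finite_invSet_two hn hper))
  rw [h2.ncard_invSet hn, h1]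

end

end AffineBruhat

namespace AffineBruhat

section

variable {n : ℕ} {w : Equiv.Perm ℤ} {l : List (ZMod n)}

/-! ### Braid moves and consistent sets of triples -/

/-- On classes, the braid move adds or removes a single element. It lies in a triple of the
difference, so it is added when `R` contains it and removed otherwise. -/
theorem HasBraid.exists_insert (hn : 0 < n) (h : Asc n 1 l) {R : ℤ → ℤ → ℤ → Prop}
    (hb : HasBraid n l R) : ∃ (l₁ l₂ : List (ZMod n)) (t : Tuple n 3),
      Relation.EqvGen (WordCommStep n) l l₁ ∧ Asc n 1 l₂ ∧ wordProd n l₂ = wordProd n l ∧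
      ((BraidStep n l₁ l₂ ∧ R (t.1 0) (t.1 1) (t.1 2) ∧ AffSet.mk t ∉ reversal n l ∧
          reversal n l₂ = insert (AffSet.mk t) (reversal n l)) ∨
        (BraidStep n l₂ l₁ ∧ ¬ R (t.1 0) (t.1 1) (t.1 2) ∧ AffSet.mk t ∉ reversal n l₂ ∧
          reversal n l = insert (AffSet.mk t) (reversal n l₂))) := by
  obtain ⟨l₁, l₂, a, b, c, h1, h2, h3, -, h5, h6⟩ := hb
  obtain ⟨g1, g2, g3, g4⟩ := Asc.of_eqvGen h1 h
  have e1 : reversal n l₁ = reversal n l := (h.reversal_eq_iff g1).mpr g4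
  have hself : ∃ m : ℤ, a = a + m * n ∧ b = b + m * n ∧ c = c + m * n := ⟨0, by simp⟩
  rcases h6 with ⟨h6, h7⟩ | ⟨h6, h7⟩
  · obtain ⟨X, hX, hX'⟩ := g1.reversal_braidStep hn h2 (h3.trans g2.symm) h6
    rw [e1] at hX hX'
    have hnot : ¬ RevP n l a b c := by
      intro h8
      have : reversal n l₂ = reversal n l := by
        rw [h.reversal_eq_iff h2]
        intro a' b' c'
        rw [h7, or_iff_left_iff_imp]
        rintro ⟨m, rfl, rfl, rfl⟩
        exact h.tripleCons.translate m h8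
      exact hX (this ▸ hX' ▸ Set.mem_insert X _)
    obtain ⟨t, ht, h8⟩ := (h2.tripleRel_reversal a b c).mpr ((h7 a b c).mpr (.inr hself))
    have h9 : AffSet.mk t ∉ reversal n l := by
      rwa [tripleRel_mk ht, h.tripleRel_reversal]
    rw [hX'] at h8
    obtain rfl := h8.resolve_right h9
    have h10 := h5.2.2
    refine ⟨l₁, l₂, t, h1, h2, h3, .inl ⟨h6, ?_, h9, hX'⟩⟩
    rw [ht]
    change R a b c
    tauto
  · obtain ⟨X, hX, hX'⟩ := h2.reversal_braidStep hn g1 (g2.trans h3.symm) h6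
    rw [e1] at hX'
    have hnot : ¬ RevP n l₂ a b c := by
      intro h8
      have : reversal n l = reversal n l₂ := by
        rw [h2.reversal_eq_iff h]
        intro a' b' c'
        rw [h7, or_iff_left_iff_imp]
        rintro ⟨m, rfl, rfl, rfl⟩
        exact h2.tripleCons.translate m h8
      exact hX (this ▸ hX' ▸ Set.mem_insert X _)
    have hyes : RevP n l a b c := (h7 a b c).mpr (.inr hself)
    obtain ⟨t, ht, h8⟩ := (h.tripleRel_reversal a b c).mpr hyes
    have h9 : AffSet.mk t ∉ reversal n l₂ := by
      rwa [tripleRel_mk ht, h2.tripleRel_reversal]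
    rw [hX'] at h8
    obtain rfl := h8.resolve_right h9
    have h10 := h5.2.2
    refine ⟨l₁, l₂, t, h1, h2, h3, .inr ⟨h6, ?_, h9, hX'⟩⟩
    rw [ht]
    change ¬ R a b c
    tauto

/-- Adding one element to the reversal set is realized by a braid move. -/
theorem Asc.exists_braidStep_of_insert (hn : 0 < n) (h : Asc n 1 l) {S : Set (AffSet n 3)}
    (hS : IsConsistent n (wordProd n l) S) {X : AffSet n 3} (hX : X ∉ reversal n l)
    (hSX : S = insert X (reversal n l)) :
    ∃ l₁ l₂, Relation.EqvGen (WordCommStep n) l l₁ ∧ Asc n 1 l₂ ∧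
      wordProd n l₂ = wordProd n l ∧ BraidStep n l₁ l₂ ∧ reversal n l₂ = S := by
  obtain ⟨s, rfl⟩ := X.exists_mk
  have hper := wordProd_periodic n l
  have hsub : reversal n l ⊆ S := hSX ▸ Set.subset_insert _ _
  -- The difference is the single class `X`, so the first two entries of a representative serve as
  -- the fixed pair.
  obtain ⟨l₁, l₂, t, h1, h2, h3, h4⟩ := (h.exists_braid hn (hS.tripleCons hn hper)
    (q₁ := s.1 0) (q₂ := s.1 1) (by
      rintro a b c ⟨d1, d2, d3⟩
      have h5 : TripleRel S a b c ∧ ¬ RevP n l a b c := by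
        have : RevP n l a b c → TripleRel S a b c := fun h' =>
          subset_iff_tripleRel.mp hsub _ _ _ ((h.tripleRel_reversal a b c).mpr h')
        tauto
      obtain ⟨⟨t, ht, h6⟩, h7⟩ := h5
      rw [← h.tripleRel_reversal, ← tripleRel_mk ht] at h7
      rw [hSX] at h6
      obtain ⟨m, e1, e2, -⟩ := (mk_triple_eq ht s.eq_triple).mp (h6.resolve_right h7)
      exact .inl ⟨m, e1, e2⟩) (by
      rw [tripleRel_mk s.eq_triple, h.tripleRel_reversal] at hX
      have h5 : TripleRel S (s.1 0) (s.1 1) (s.1 2) :=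
        (tripleRel_mk s.eq_triple).mp (hSX ▸ Set.mem_insert _ _)
      have h6 := (hS.tripleCons hn hper).subset h5
      exact ⟨_, _, _, h6.1, h6.2, fun h7 => hX (h7.mp h5)⟩)).exists_insert hn h
  rcases h4 with ⟨h4, h5, h6, h7⟩ | ⟨h4, h5, h6, h7⟩
  · rw [← tripleRel_mk t.eq_triple] at h5
    rw [hSX] at h5
    rw [h5.resolve_right h6, ← hSX] at h7
    exact ⟨l₁, l₂, h1, h2, h3, h4, h7⟩
  -- A removing move would remove an element outside of `S`, but the reversal set is contained in
  -- `S`.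
  · rw [← tripleRel_mk t.eq_triple] at h5
    exact absurd (hsub (h7 ▸ Set.mem_insert _ _)) h5

/-- With all inverted triples as the target, the braid move cannot remove an element, so it adds
one. -/
theorem Asc.exists_insert (hn : 0 < n) (h : Asc n 1 l)
    (hne : reversal n l ≠ InvSet n (wordProd n l) 3) :
    ∃ l₂, Asc n 1 l₂ ∧ wordProd n l₂ = wordProd n l ∧
      ∃ X ∉ reversal n l, reversal n l₂ = insert X (reversal n l) := by
  have hper := wordProd_periodic n l
  have hsub := (h.isConsistent_reversal hn).subset
  obtain ⟨X, hX, hX'⟩ := Set.exists_of_ssubset (hsub.ssubset_of_ne hne)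
  obtain ⟨s, rfl⟩ := X.exists_mk
  rw [tripleRel_mk s.eq_triple, tripleRel_invSet hper] at hX
  rw [tripleRel_mk s.eq_triple, h.tripleRel_reversal] at hX'
  obtain ⟨l₁, l₂, t, h1, h2, h3, h4⟩ := (h.hasBraid_const hn True
    ⟨_, _, _, hX.1, hX.2, fun h7 => hX' (h7.mp ⟨trivial, hX⟩)⟩).exists_insert hn h
  rcases h4 with ⟨-, -, h6, h7⟩ | ⟨-, h5, -, h7⟩
  · exact ⟨l₂, h2, h3, _, h6, h7⟩
  · refine absurd ⟨trivial, ?_⟩ h5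
    rw [← tripleRel_invSet hper, ← tripleRel_mk t.eq_triple]
    exact hsub (h7 ▸ Set.mem_insert _ _)

/-- With no triple as the target, the braid move can only remove an element. -/
theorem Asc.exists_remove (hn : 0 < n) (h : Asc n 1 l) (hne : reversal n l ≠ ∅) :
    ∃ l₂, Asc n 1 l₂ ∧ wordProd n l₂ = wordProd n l ∧
      ∃ X ∉ reversal n l₂, reversal n l = insert X (reversal n l₂) := by
  obtain ⟨X, hX⟩ := Set.nonempty_iff_ne_empty.mpr hne
  obtain ⟨s, rfl⟩ := X.exists_mk
  rw [tripleRel_mk s.eq_triple, h.tripleRel_reversal] at hX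
  have hX' := h.tripleCons.subset hX
  obtain ⟨l₁, l₂, t, h1, h2, h3, h4⟩ := (h.hasBraid_const hn False
    ⟨_, _, _, hX'.1, hX'.2, fun h7 => (h7.mpr hX).1⟩).exists_insert hn h
  rcases h4 with ⟨-, h5, -⟩ | ⟨-, -, h6, h7⟩
  · exact h5.1.elim
  · exact ⟨l₂, h2, h3, _, h6, h7⟩

theorem IsConsistent.exists_word (hn : 0 < n) (hw : IsAffinePerm n w) {R : Set (AffSet n 3)}
    (h : IsConsistent n w R) : ∃ l, Asc n 1 l ∧ wordProd n l = w ∧ reversal n l = R := by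
  obtain ⟨l, h1, h2, h3⟩ := TripleCons.exists_word hn hw (h.tripleCons hn hw.per)
  exact ⟨l, h1, h2, eq_iff_tripleRel.mpr fun a b c => (h1.tripleRel_reversal a b c).trans (h3 a b c)⟩

theorem Consistent.le_top_aux (hn : 0 < n) (hw : IsAffinePerm n w) (d : ℕ)
    (R T : Consistent n w 3) (hT : T.1 = InvSet n w 3)
    (hd : (InvSet n w 3).ncard - R.1.ncard = d) : R ≤ T := by
  induction d using Nat.strong_induction_on generalizing R with
  | _ d ih =>
  obtain ⟨l, h1, rfl, h3⟩ := R.2.exists_word hn hw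
  by_cases hne : reversal n l = InvSet n (wordProd n l) 3
  · have : R = T := Subtype.ext (h3.symm.trans (hne.trans hT.symm))
    exact this.le
  obtain ⟨l₂, h4, h5, X, h6, h7⟩ := h1.exists_insert hn hne
  have hcons : IsConsistent n (wordProd n l) (reversal n l₂) := h5 ▸ h4.isConsistent_reversal hn
  have hfin := finite_invSet_three hn hw.per
  have hc1 : (reversal n l₂).ncard = (reversal n l).ncard + 1 := by
    rw [h7, Set.ncard_insert_of_notMem h6 (hfin.subset (h1.isConsistent_reversal hn).subset)]
  have hc2 := Set.ncard_le_ncard hcons.subset hfin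
  rw [h3] at hc1 h6 h7
  exact .head ⟨X, h6, h7⟩ (ih _ (by
    change _ - (reversal n l₂).ncard < d
    omega) ⟨_, hcons⟩ rfl)

theorem Consistent.bot_le_aux (hn : 0 < n) (hw : IsAffinePerm n w) (d : ℕ)
    (R B : Consistent n w 3) (hB : B.1 = ∅) (hd : R.1.ncard = d) : B ≤ R := by
  induction d using Nat.strong_induction_on generalizing R with
  | _ d ih =>
  obtain ⟨l, h1, rfl, h3⟩ := R.2.exists_word hn hw
  by_cases hne : reversal n l = ∅
  · have : B = R := Subtype.ext (hB.trans (hne.symm.trans h3))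
    exact this.le
  obtain ⟨l₂, h4, h5, X, h6, h7⟩ := h1.exists_remove hn hne
  have hcons : IsConsistent n (wordProd n l) (reversal n l₂) := h5 ▸ h4.isConsistent_reversal hn
  have hfin := finite_invSet_three hn hw.per
  have hc1 : (reversal n l).ncard = (reversal n l₂).ncard + 1 := by
    rw [h7, Set.ncard_insert_of_notMem h6 (hfin.subset hcons.subset)]
  rw [h3] at hc1 h7
  exact .tail (ih _ (by
    change (reversal n l₂).ncard < d
    omega) ⟨_, hcons⟩ rfl) ⟨X, h6, h7⟩

theorem isConsistent_invSet_self (hw : Periodic n w) (k : ℕ) :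
    IsConsistent n w (InvSet n w k) := by
  rw [isConsistent_iff]
  refine ⟨subset_rfl, fun A B hA _ _ => hA, fun X hX => ?_⟩
  obtain ⟨t, rfl⟩ := X.exists_mk
  rw [mk_mem_invSet hw] at hX
  refine .inl fun i _ => ?_
  rw [AffSet.del_mk, mk_mem_invSet hw]
  exact fun a b hab => hX (Fin.strictMono_succAbove _ hab)

theorem isConsistent_empty (n : ℕ) (w : Equiv.Perm ℤ) (k : ℕ) :
    IsConsistent n w (∅ : Set (AffSet n k)) := by
  rw [isConsistent_iff]
  exact ⟨Set.empty_subset _, fun A B _ hB => hB.elim, fun X _ => .inl fun i h => h.elim⟩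

/-! ### The order of the consistent sets -/

variable {k : ℕ}

theorem Consistent.le_of_insert {R S : Consistent n w k} {X : AffSet n k} (hX : X ∉ R.1)
    (h : S.1 = insert X R.1) : R ≤ S :=
  .single ⟨X, hX, h⟩

theorem Consistent.ncard_lt (hfin : (InvSet n w k).Finite) {R S : Consistent n w k} (h : R < S) :
    R.1.ncard < S.1.ncard :=
  Set.ncard_lt_ncard ((subset_of_steps h.le).ssubset_of_ne fun he => h.ne (Subtype.ext he))
    (hfin.subset S.2.subset)

/-- The order is generated by insertions, so a cover is a single insertion. Conversely nothing fits
strictly between, because cardinality is strictly increasing. -/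
theorem Consistent.covBy_iff (hfin : (InvSet n w k).Finite) {R S : Consistent n w k} :
    R ⋖ S ↔ ∃ X ∉ R.1, S.1 = insert X R.1 := by
  constructor
  · intro h
    rcases Relation.ReflTransGen.cases_head (show Relation.ReflTransGen _ R S from h.le) with
      h1 | ⟨T, ⟨X, h1, h2⟩, h3⟩
    · exact absurd h1 h.ne
    · have hlt : R < T := lt_of_le_of_ne (.single ⟨X, h1, h2⟩) fun he => h1 (by
        rw [he, h2]
        exact Set.mem_insert X _)
      have hTS : T = S := by
        by_contra hne
        exact h.2 hlt (lt_of_le_of_ne h3 hne)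
      exact ⟨X, h1, hTS ▸ h2⟩
  · rintro ⟨X, h1, h2⟩
    refine ⟨lt_of_le_of_ne (.single ⟨X, h1, h2⟩) fun he => h1 (by
        rw [he, h2]
        exact Set.mem_insert X _), fun T hRT hTS => ?_⟩
    have h3 := Consistent.ncard_lt hfin hRT
    have h4 := Consistent.ncard_lt hfin hTS
    rw [h2, Set.ncard_insert_of_notMem h1 (hfin.subset R.2.subset)] at h4
    omega

end

end AffineBruhat

namespace AffineBruhat

section

variable {n : ℕ} {k : ℕ} {w : Equiv.Perm ℤ}

/-! ### Commutation classes as consistent sets -/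

/-- A sublist that does not contain `X` before `Y` uses at most one of the two exchanged entries. -/
theorem list_sublist_swap {α : Type*} {L A B : List α} {X Y : α}
    (h : List.Sublist L (A ++ [X, Y] ++ B)) (hL : ¬ List.Sublist [X, Y] L) :
    List.Sublist L (A ++ [Y, X] ++ B) := by
  obtain ⟨L₁, L₃, rfl, h1, h3⟩ := List.sublist_append_iff.mp h
  obtain ⟨L₁, L₂, rfl, h1, h2⟩ := List.sublist_append_iff.mp h1
  refine (h1.append ?_).append h3
  have h4 : ¬ List.Sublist [X, Y] L₂ := fun h' =>
    hL ((h'.trans (List.sublist_append_right _ _)).trans (List.sublist_append_left _ _))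
  rw [List.sublist_cons_iff] at h2
  rcases h2 with h2 | ⟨L₄, rfl, h2⟩
  · exact h2.trans (List.sublist_append_left [Y] [X])
  · rw [List.sublist_cons_iff] at h2
    rcases h2 with h2 | ⟨L₅, rfl, h2⟩
    · rw [List.sublist_nil.mp h2]
      exact List.sublist_append_right [Y] [X]
    · exact absurd (((List.nil_sublist L₅).cons_cons Y).cons_cons X) h4

/-- The conditions of admissibility concern sublists that are relations of the permanent poset or
ordered packets. Commuting elements occur together in none of these, so all conditions survive the
exchange. -/
theorem CommStep.isAdmissible {ρ σ : List (AffSet n k)} (hs : CommStep n w ρ σ)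
    (h : IsAdmissible n w ρ) : IsAdmissible n w σ := by
  obtain ⟨A, B, X, Y, ⟨h1, h2, h3⟩, rfl, rfl⟩ := hs
  have hperm : List.Perm (A ++ [X, Y] ++ B) (A ++ [Y, X] ++ B) :=
    ((List.Perm.swap Y X []).append_left A).append_right B
  refine ⟨hperm.nodup_iff.mp h.nodup, fun Z => hperm.mem_iff.symm.trans (h.mem_iff Z),
    fun P Q hne hPQ => ?_, fun Z hZ => ?_⟩
  · refine list_sublist_swap (h.linear_extension P Q hne hPQ) fun hsub => ?_
    have he := hsub.eq_of_length rfl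
    simp only [List.cons.injEq, and_true] at he
    obtain ⟨rfl, rfl⟩ := he
    exact h1 hPQ
  · have key : ∀ L : List (AffSet n k), (∀ P ∈ L, P ∈ packet Z) → ¬ List.Sublist [X, Y] L :=
      fun L hL hsub => h3 ⟨Z, hL X (hsub.subset (by simp)), hL Y (hsub.subset (by simp))⟩
    have hanti : ∀ P ∈ antilexPacket Z, P ∈ packet Z := fun P hP => by
      exact (List.mem_ofFn' _ _).mp hP
    refine (h.packets Z hZ).imp (fun h4 => list_sublist_swap h4 (key _ fun P hP => ?_))
      fun h4 => list_sublist_swap h4 (key _ hanti)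
    exact hanti P (List.mem_reverse.mp hP)

theorem CommStep.rev_eq (hn : 0 < n) (hw : IsAffinePerm n w) {ρ σ : List (AffSet n 2)}
    (hs : CommStep n w ρ σ) (h : IsAdmissible n w ρ) : Rev n w ρ = Rev n w σ := by
  obtain ⟨l, h1, rfl, h3⟩ := h.exists_word hn hw
  obtain ⟨l', h4, h5, h6⟩ := (hs.isAdmissible h).exists_word hn hw
  have hs' := h1.wordCommStep_of_commStep hn h4 h5 h3 h6 hs
  rw [h1.rev_eq h3, ← h5, h4.rev_eq h6]
  exact ((h1.reversal_eq_iff h4).mpr (h1.of_commStep hs').2.2.2).symm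

theorem rev_eq_of_eqvGen (hn : 0 < n) (hw : IsAffinePerm n w) {ρ σ : List (AffSet n 2)}
    (hs : Relation.EqvGen (CommStep n w) ρ σ) :
    (IsAdmissible n w ρ ↔ IsAdmissible n w σ) ∧ (IsAdmissible n w ρ → Rev n w ρ = Rev n w σ) := by
  induction hs with
  | rel a b h => exact ⟨⟨h.isAdmissible, h.symm.isAdmissible⟩, h.rev_eq hn hw⟩
  | refl a => exact ⟨Iff.rfl, fun _ => rfl⟩
  | symm a b _ ih => exact ⟨ih.1.symm, fun h => (ih.2 (ih.1.mpr h)).symm⟩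
  | trans a b c _ _ ih₁ ih₂ =>
    exact ⟨ih₁.1.trans ih₂.1, fun h => (ih₁.2 h).trans (ih₂.2 (ih₁.1.mp h))⟩

theorem eqvGen_reflOrder (hn : 0 < n) {l l' : List (ZMod n)}
    (hs : Relation.EqvGen (WordCommStep n) l l') (h : Asc n 1 l) {ρ σ : List (AffSet n 2)}
    (hρ : IsReflOrderOf n l ρ) (hσ : IsReflOrderOf n l' σ) :
    Relation.EqvGen (CommStep n (wordProd n l)) ρ σ := by
  induction hs generalizing ρ σ with
  | rel a b hs => exact .rel _ _ (h.commStep_of_wordCommStep hn (h.of_commStep hs).1 hρ hσ hs)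
  | refl a =>
    rw [hρ.unique hσ]
    exact .refl _
  | symm a b hs ih =>
    obtain ⟨g1, g2, -⟩ := Asc.of_eqvGen (hs.symm _ _) h
    rw [← g2]
    exact (ih g1 hσ hρ).symm _ _
  | trans a b c hs₁ hs₂ ih₁ ih₂ =>
    obtain ⟨g1, g2, -⟩ := Asc.of_eqvGen hs₁ h
    obtain ⟨τ, hτ⟩ := g1.exists_reflOrder
    refine (ih₁ h hρ hτ).trans _ _ _ ?_
    rw [← g2]
    exact ih₂ g1 hτ hσ

theorem IsAdmissible.isConsistent_rev (hn : 0 < n) (hw : IsAffinePerm n w)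
    {ρ : List (AffSet n 2)} (h : IsAdmissible n w ρ) : IsConsistent n w (Rev n w ρ) := by
  obtain ⟨l, h1, rfl, h3⟩ := h.exists_word hn hw
  rw [h1.rev_eq h3]
  exact h1.isConsistent_reversal hn

theorem ReducedWord.isConsistent_reversal (hn : 0 < n) (hw : IsAffinePerm n w)
    (a : ReducedWord n w) : IsConsistent n w (reversal n a.1) := by
  obtain ⟨h1, h2⟩ := (isReducedWord_iff hn hw).mp a.2
  have := h1.isConsistent_reversal hn
  rwa [h2] at this

/-- Commutation classes of reduced words are consistent sets of triples. -/
noncomputable def wordClassEquiv (hn : 0 < n) (hw : IsAffinePerm n w) :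
    WordClass n w ≃ Consistent n w 3 :=
  Equiv.ofBijective
    (Quotient.lift (s := wordSetoid n w)
      (fun a : ReducedWord n w => (⟨reversal n a.1, a.isConsistent_reversal hn hw⟩ : Consistent n w 3))
      (by
        intro a b hab
        obtain ⟨h1, -⟩ := (isReducedWord_iff hn hw).mp a.2
        obtain ⟨h2, -, -, h3⟩ := Asc.of_eqvGen (show Relation.EqvGen (WordCommStep n) a.1 b.1 from hab) h1
        exact Subtype.ext ((h1.reversal_eq_iff h2).mpr h3).symm))
    (by
      constructor
      · intro c d hcd
        obtain ⟨a, rfl⟩ := Quotient.exists_rep c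
        obtain ⟨b, rfl⟩ := Quotient.exists_rep d
        have he : reversal n a.1 = reversal n b.1 := congrArg Subtype.val hcd
        obtain ⟨h1, h2⟩ := (isReducedWord_iff hn hw).mp a.2
        obtain ⟨h3, h4⟩ := (isReducedWord_iff hn hw).mp b.2
        exact Quotient.sound (s := wordSetoid n w) (h3.eqvGen_of_revP h1 (h2.trans h4.symm)
          (h3.length_eq hn h1 (h2.trans h4.symm)) ((h3.reversal_eq_iff h1).mp he))
      · intro R
        obtain ⟨l, h1, h2, h3⟩ := R.2.exists_word hn hw
        exact ⟨Quotient.mk _ ⟨l, (isReducedWord_iff hn hw).mpr ⟨h1, h2⟩⟩, Subtype.ext h3⟩)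

/-- Commutation classes of admissible orders are consistent sets of triples. -/
noncomputable def higherBruhatEquiv (hn : 0 < n) (hw : IsAffinePerm n w) :
    HigherBruhat n w 2 ≃ Consistent n w 3 :=
  Equiv.ofBijective
    (Quotient.lift (s := admSetoid n w 2)
      (fun ρ : Adm n w 2 => (⟨Rev n w ρ.1, ρ.2.isConsistent_rev hn hw⟩ : Consistent n w 3))
      (fun ρ σ h => Subtype.ext ((rev_eq_of_eqvGen hn hw
        (show Relation.EqvGen (CommStep n w) ρ.1 σ.1 from h)).2 ρ.2)))
    (by
      constructor
      · intro c d hcd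
        obtain ⟨ρ, rfl⟩ := Quotient.exists_rep c
        obtain ⟨σ, rfl⟩ := Quotient.exists_rep d
        have he : Rev n w ρ.1 = Rev n w σ.1 := congrArg Subtype.val hcd
        obtain ⟨l, h1, h2, h3⟩ := ρ.2.exists_word hn hw
        obtain ⟨l', h4, h5, h6⟩ := σ.2.exists_word hn hw
        have hprod : wordProd n l = wordProd n l' := h2.trans h5.symm
        have he' : reversal n l = reversal n l' := by
          rw [← h1.rev_eq h3, ← h4.rev_eq h6, h2, h5, he]
        have hs := h4.eqvGen_of_revP h1 hprod (h4.length_eq hn h1 hprod)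
          ((h4.reversal_eq_iff h1).mp he')
        have := eqvGen_reflOrder hn hs h1 h3 h6
        rw [h2] at this
        exact Quotient.sound (s := admSetoid n w 2) this
      · intro R
        obtain ⟨l, h1, h2, h3⟩ := R.2.exists_word hn hw
        obtain ⟨ρ, hρ⟩ := h1.exists_reflOrder
        refine ⟨Quotient.mk _ ⟨ρ, h2 ▸ h1.isAdmissible hn hρ⟩, Subtype.ext ?_⟩
        change Rev n w ρ = R.1
        rw [← h3, ← h1.rev_eq hρ, h2])

theorem higherBruhatEquiv_admClass (hn : 0 < n) (hw : IsAffinePerm n w) (ρ : Adm n w 2) :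
    (higherBruhatEquiv hn hw (admClass ρ)).1 = Rev n w ρ.1 := rfl

theorem exists_reducedWord_braidStep (hn : 0 < n) (hw : IsAffinePerm n w) {R S : Consistent n w 3}
    {X : AffSet n 3} (hX : X ∉ R.1) (hS : S.1 = insert X R.1) :
    ∃ l l', Asc n 1 l ∧ wordProd n l = w ∧ Asc n 1 l' ∧ wordProd n l' = w ∧ BraidStep n l l' ∧
      reversal n l = R.1 ∧ reversal n l' = S.1 := by
  obtain ⟨l, h1, rfl, h3⟩ := R.2.exists_word hn hw
  rw [← h3] at hX hS
  obtain ⟨l₁, l₂, g1, g2, g3, g4, g5⟩ := h1.exists_braidStep_of_insert hn S.2 hX hS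
  obtain ⟨f1, f2, -, f4⟩ := Asc.of_eqvGen g1 h1
  exact ⟨l₁, l₂, f1, f2, g2, g3, g4, ((h1.reversal_eq_iff f1).mpr f4).trans h3, g5⟩

/-- Once commutation classes are identified with consistent sets of triples, edges are insertions of
one element. This makes the braid graph a Hasse diagram. -/
theorem braidGraph_adj_iff (hn : 0 < n) (hw : IsAffinePerm n w) {c d : WordClass n w} :
    (braidGraph n w).Adj c d ↔ ∃ X ∉ (wordClassEquiv hn hw c).1,
      (wordClassEquiv hn hw d).1 = insert X (wordClassEquiv hn hw c).1 := by
  constructor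
  · rintro ⟨a, b, rfl, rfl, h⟩
    obtain ⟨h1, h2⟩ := (isReducedWord_iff hn hw).mp a.2
    obtain ⟨h3, h4⟩ := (isReducedWord_iff hn hw).mp b.2
    exact h1.reversal_braidStep hn h3 (h4.trans h2.symm) h
  · rintro ⟨X, hX, h⟩
    obtain ⟨l, l', h1, h2, h3, h4, h5, h6, h7⟩ := exists_reducedWord_braidStep hn hw hX h
    exact ⟨⟨l, (isReducedWord_iff hn hw).mpr ⟨h1, h2⟩⟩, ⟨l', (isReducedWord_iff hn hw).mpr ⟨h3, h4⟩⟩,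
      (wordClassEquiv hn hw).injective (Subtype.ext h6),
      (wordClassEquiv hn hw).injective (Subtype.ext h7), h5⟩

theorem FlipStep.exists_insert (hn : 0 < n) (hw : IsAffinePerm n w) {ρ σ : List (AffSet n 2)}
    (h : IsAdmissible n w ρ) (hs : FlipStep n w ρ σ) :
    IsAdmissible n w σ ∧ ∃ X ∉ Rev n w ρ, Rev n w σ = insert X (Rev n w ρ) := by
  obtain ⟨l, h1, rfl, h3⟩ := h.exists_word hn hw
  obtain ⟨l', h4, h5, h6, h7⟩ := h1.exists_braidStep_of_flipStep hn h3 hs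
  have h8 := h4.isAdmissible hn h6
  have h9 := h4.rev_eq h6
  rw [h5] at h8 h9
  refine ⟨h8, ?_⟩
  rw [h9, h1.rev_eq h3]
  exact h1.reversal_braidStep hn h4 h5 h7

/-- The reversal set map is an isomorphism of posets. -/
noncomputable def higherBruhatIso (hn : 0 < n) (hw : IsAffinePerm n w) :
    HigherBruhat n w 2 ≃o Consistent n w 3 where
  toEquiv := higherBruhatEquiv hn hw
  map_rel_iff' := by
    intro b c
    constructor
    · intro h
      have key : ∀ R S : Consistent n w 3, R ≤ S →
          (higherBruhatEquiv hn hw).symm R ≤ (higherBruhatEquiv hn hw).symm S := by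
        intro R S hRS
        change Relation.ReflTransGen _ R S at hRS
        induction hRS with
        | refl => exact le_rfl
        | tail _ h ih =>
          obtain ⟨X, h1, h2⟩ := h
          refine ih.trans ?_
          obtain ⟨l, l', g1, g2, g3, g4, g5, g6, g7⟩ :=
            exists_reducedWord_braidStep hn hw h1 h2
          obtain ⟨ρ, hρ⟩ := g1.exists_reflOrder
          obtain ⟨σ, hσ⟩ := g3.exists_reflOrder
          have f1 := g1.flipStep_of_braidStep hn g3 (g4.trans g2.symm) hρ hσ g5
          have f2 := g1.isAdmissible hn hρ
          have f3 := g3.isAdmissible hn hσ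
          have f4 := g1.rev_eq hρ
          have f5 := g3.rev_eq hσ
          rw [g2] at f1 f2 f4
          rw [g4] at f3 f5
          refine ⟨⟨ρ, f2⟩, ⟨σ, f3⟩, ?_, ?_, .single (.inr f1)⟩
          · rw [Equiv.eq_symm_apply]
            exact Subtype.ext (f4.trans g6)
          · rw [Equiv.eq_symm_apply]
            exact Subtype.ext (f5.trans g7)
      simpa using key _ _ h
    · rintro ⟨ρ, σ, rfl, rfl, h⟩
      -- The intermediate lists are not assumed to be admissible, so admissibility is carried along
      -- with the inequality.
      have key : ∀ τ : List (AffSet n 2), Relation.ReflTransGen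
          (fun a b => CommStep n w a b ∨ FlipStep n w a b) ρ.1 τ →
          ∃ hτ : IsAdmissible n w τ, higherBruhatEquiv hn hw (admClass ρ) ≤
            higherBruhatEquiv hn hw (admClass ⟨τ, hτ⟩) := by
        intro τ hτ
        induction hτ with
        | refl => exact ⟨ρ.2, le_rfl⟩
        | tail _ h ih =>
          obtain ⟨h1, h2⟩ := ih
          rcases h with h | h
          · refine ⟨h.isAdmissible h1, h2.trans (le_of_eq (Subtype.ext ?_))⟩
            exact h.rev_eq hn hw h1
          · obtain ⟨h3, X, h4, h5⟩ := h.exists_insert hn hw h1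
            exact ⟨h3, h2.trans (Consistent.le_of_insert h4 h5)⟩
      exact (key _ h).2

end

end AffineBruhat

namespace AffineBruhat

section

variable {n : ℕ} {k : ℕ} {w : Equiv.Perm ℤ}

/-! ### Reduced words, reflection orders, admissible orders and maximal chains -/

theorem ReducedWord.exists_reflOrder (hn : 0 < n) (hw : IsAffinePerm n w) (a : ReducedWord n w) :
    ∃ ρ, IsReflOrderOf n a.1 ρ :=
  ((isReducedWord_iff hn hw).mp a.2).1.exists_reflOrder

theorem ReducedWord.eq_of_isReflOrderOf (hn : 0 < n) (hw : IsAffinePerm n w)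
    {a b : ReducedWord n w} {ρ : List (AffSet n 2)} (ha : IsReflOrderOf n a.1 ρ)
    (hb : IsReflOrderOf n b.1 ρ) : a = b := by
  obtain ⟨h1, h2⟩ := (isReducedWord_iff hn hw).mp a.2
  obtain ⟨h3, h4⟩ := (isReducedWord_iff hn hw).mp b.2
  exact Subtype.ext (h3.eq_of_flag_eq hn hw.per h4 hb h1 h2 ha rfl)

/-- The bijection from reduced words to reflection orders. -/
noncomputable def reflOrderEquiv (hn : 0 < n) (hw : IsAffinePerm n w) :
    ReducedWord n w ≃ ReflOrder n w :=
  Equiv.ofBijective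
    (fun a => ⟨(a.exists_reflOrder hn hw).choose, a.1, a.2, (a.exists_reflOrder hn hw).choose_spec⟩)
    (by
      constructor
      · intro a b h
        have ha := (a.exists_reflOrder hn hw).choose_spec
        rw [show (a.exists_reflOrder hn hw).choose = (b.exists_reflOrder hn hw).choose from
          congrArg Subtype.val h] at ha
        exact ReducedWord.eq_of_isReflOrderOf hn hw ha (b.exists_reflOrder hn hw).choose_spec
      · rintro ⟨ρ, l, h1, h2⟩
        exact ⟨⟨l, h1⟩, Subtype.ext
          ((ReducedWord.exists_reflOrder hn hw ⟨l, h1⟩).choose_spec.unique h2)⟩)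

theorem isReflOrderOf_reflOrderEquiv (hn : 0 < n) (hw : IsAffinePerm n w) (a : ReducedWord n w) :
    IsReflOrderOf n a.1 (reflOrderEquiv hn hw a).1 :=
  (a.exists_reflOrder hn hw).choose_spec

theorem ReflOrder.isAdmissible (hn : 0 < n) (hw : IsAffinePerm n w) (ρ : ReflOrder n w) :
    IsAdmissible n w ρ.1 := by
  obtain ⟨ρ, l, h1, h2⟩ := ρ
  obtain ⟨h3, h4⟩ := (isReducedWord_iff hn hw).mp h1
  have := h3.isAdmissible hn h2
  rwa [h4] at this

/-- The reflection orders are the admissible orders. -/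
noncomputable def admEquiv (hn : 0 < n) (hw : IsAffinePerm n w) : ReflOrder n w ≃ Adm n w 2 where
  toFun ρ := ⟨ρ.1, ρ.isAdmissible hn hw⟩
  invFun ρ := ⟨ρ.1, by
    obtain ⟨l, h1, h2, h3⟩ := ρ.2.exists_word hn hw
    exact ⟨l, (isReducedWord_iff hn hw).mpr ⟨h1, h2⟩, h3⟩⟩
  left_inv _ := rfl
  right_inv _ := rfl

/-- The maximal chain of consistent sets that belongs to a reduced word. -/
noncomputable def ReducedWord.flag (hn : 0 < n) (hw : IsAffinePerm n w) (a : ReducedWord n w) :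
    Flag (Consistent n w 2) :=
  ((isReducedWord_iff hn hw).mp a.2).1.flag hn hw.per ((isReducedWord_iff hn hw).mp a.2).2
    (isReflOrderOf_reflOrderEquiv hn hw a)

theorem ReducedWord.mem_flag (hn : 0 < n) (hw : IsAffinePerm n w) (a : ReducedWord n w)
    {R : Consistent n w 2} : R ∈ a.flag hn hw ↔
      ∃ j : ℕ, R.1 = {X | X ∈ (reflOrderEquiv hn hw a).1.take j} := Iff.rfl

theorem ReducedWord.flag_bijective (hn : 0 < n) (hw : IsAffinePerm n w) :
    Function.Bijective (ReducedWord.flag hn hw : ReducedWord n w → Flag (Consistent n w 2)) := by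
  constructor
  · intro a b h
    obtain ⟨h1, h2⟩ := (isReducedWord_iff hn hw).mp a.2
    obtain ⟨h3, h4⟩ := (isReducedWord_iff hn hw).mp b.2
    exact Subtype.ext (h3.eq_of_flag_eq hn hw.per h4 (isReflOrderOf_reflOrderEquiv hn hw b) h1 h2
      (isReflOrderOf_reflOrderEquiv hn hw a) h.symm)
  · intro c
    obtain ⟨l, h1, h2, h3⟩ := Asc.exists_flag_eq hn hw c
    refine ⟨⟨l, (isReducedWord_iff hn hw).mpr ⟨h1, h2⟩⟩, ?_⟩
    have hρ := isReflOrderOf_reflOrderEquiv hn hw ⟨l, (isReducedWord_iff hn hw).mpr ⟨h1, h2⟩⟩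
    -- The chain of the word is contained in `c`, and maximality makes the two equal.
    refine Flag.ext ((ReducedWord.flag hn hw _).max_chain' c.chain_le fun R hR => ?_)
    obtain ⟨j, hj⟩ := (ReducedWord.mem_flag hn hw _).mp hR
    obtain ⟨S, hS, hS'⟩ := h3 _ (min_le_right j l.length)
    have : R = S := Subtype.ext (hj.trans ((h1.take_reflOrder hρ j).trans hS'.symm))
    exact this ▸ hS

/-! ### The order isomorphism and the grading -/

theorem higherBruhat_antisymm (hn : 0 < n) (hw : IsAffinePerm n w) {b c : HigherBruhat n w 2}
    (h : b ≤ c) (h' : c ≤ b) : b = c :=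
  (higherBruhatIso hn hw).injective (le_antisymm ((higherBruhatIso hn hw).monotone h)
    ((higherBruhatIso hn hw).monotone h'))

theorem Consistent.exists_isBot (hn : 0 < n) (hw : IsAffinePerm n w) :
    ∃ B : Consistent n w 3, B.1 = ∅ ∧ IsBot B :=
  ⟨⟨∅, isConsistent_empty n w 3⟩, rfl, fun R => Consistent.bot_le_aux hn hw _ R _ rfl rfl⟩

theorem Consistent.exists_isTop (hn : 0 < n) (hw : IsAffinePerm n w) :
    ∃ T : Consistent n w 3, T.1 = InvSet n w 3 ∧ IsTop T :=
  ⟨⟨_, isConsistent_invSet_self hw.per 3⟩, rfl, fun R => Consistent.le_top_aux hn hw _ R _ rfl rfl⟩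

/-- The consistent sets of triples are graded by their cardinality. -/
noncomputable abbrev consistentGradeMinOrder (hn : 0 < n) (hw : IsAffinePerm n w) :
    GradeMinOrder ℕ (Consistent n w 3) where
  grade R := R.1.ncard
  grade_strictMono _ _ h := Consistent.ncard_lt (finite_invSet_three hn hw.per) h
  covBy_grade R S h := by
    have hfin := finite_invSet_three hn hw.per
    obtain ⟨X, h1, h2⟩ := (Consistent.covBy_iff hfin).mp h
    rw [h2, Set.ncard_insert_of_notMem h1 (hfin.subset R.2.subset)]
    exact Nat.covBy_iff_add_one_eq.mpr rfl
  isMin_grade R h := by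
    obtain ⟨B, hB, hbot⟩ := Consistent.exists_isBot hn hw
    have : R = B := le_antisymm (h (hbot R)) (hbot R)
    rw [this, hB, Set.ncard_empty]
    exact isMin_bot

/-- The higher Bruhat order is graded by the cardinality of the reversal sets. -/
noncomputable abbrev higherBruhatGradeMinOrder (hn : 0 < n) (hw : IsAffinePerm n w) :
    GradeMinOrder ℕ (HigherBruhat n w 2) where
  grade b := (higherBruhatIso hn hw b).1.ncard
  grade_strictMono _ _ h :=
    (consistentGradeMinOrder hn hw).grade_strictMono ((higherBruhatIso hn hw).strictMono h)
  covBy_grade _ _ h :=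
    (consistentGradeMinOrder hn hw).covBy_grade (apply_covBy_apply_iff (higherBruhatIso hn hw) |>.mpr h)
  isMin_grade _ h :=
    (consistentGradeMinOrder hn hw).isMin_grade ((higherBruhatIso hn hw).isMin_apply.mpr h)

theorem higherBruhat_exists_isBot (hn : 0 < n) (hw : IsAffinePerm n w) :
    ∃ b : HigherBruhat n w 2, (higherBruhatIso hn hw b).1 = ∅ ∧ IsBot b ∧ ∀ x, IsMin x ↔ x = b := by
  obtain ⟨B, h1, h2⟩ := Consistent.exists_isBot hn hw
  have hbot : IsBot ((higherBruhatIso hn hw).symm B) := fun x =>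
    (higherBruhatIso hn hw).symm_apply_le.mpr (h2 _)
  refine ⟨(higherBruhatIso hn hw).symm B, ?_, hbot, fun x => ⟨fun hx => ?_, ?_⟩⟩
  · have := (higherBruhatIso hn hw).apply_symm_apply B
    exact (congrArg Subtype.val this).trans h1
  · exact higherBruhat_antisymm hn hw (hx (hbot x)) (hbot x)
  · rintro rfl
    exact hbot.isMin

theorem higherBruhat_exists_isTop (hn : 0 < n) (hw : IsAffinePerm n w) :
    ∃ t : HigherBruhat n w 2,
      (higherBruhatIso hn hw t).1 = InvSet n w 3 ∧ IsTop t ∧ ∀ x, IsMax x ↔ x = t := by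
  obtain ⟨T, h1, h2⟩ := Consistent.exists_isTop hn hw
  have htop : IsTop ((higherBruhatIso hn hw).symm T) := fun x =>
    (higherBruhatIso hn hw).le_symm_apply.mpr (h2 _)
  refine ⟨(higherBruhatIso hn hw).symm T, ?_, htop, fun x => ⟨fun hx => ?_, ?_⟩⟩
  · have := (higherBruhatIso hn hw).apply_symm_apply T
    exact (congrArg Subtype.val this).trans h1
  · exact higherBruhat_antisymm hn hw (htop x) (hx (htop x))
  · rintro rfl
    exact htop.isMax

/-! ### The directed braid graph -/

theorem higherBruhat_covBy_iff (hn : 0 < n) (hw : IsAffinePerm n w) {b c : HigherBruhat n w 2} :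
    b ⋖ c ↔ ∃ X ∉ (higherBruhatIso hn hw b).1,
      (higherBruhatIso hn hw c).1 = insert X (higherBruhatIso hn hw b).1 :=
  (apply_covBy_apply_iff (higherBruhatIso hn hw)).symm.trans
    (Consistent.covBy_iff (finite_invSet_three hn hw.per))

/-- The Hasse diagram of the higher Bruhat order is the directed braid graph. -/
noncomputable def hasseDigraphIso (hn : 0 < n) (hw : IsAffinePerm n w) :
    (hasseDigraph (HigherBruhat n w 2)).Adj ≃r (braidGraph n w).Adj where
  toEquiv := (higherBruhatEquiv hn hw).trans (wordClassEquiv hn hw).symm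
  map_rel_iff' := by
    intro b c
    refine (braidGraph_adj_iff hn hw).trans (Iff.trans ?_ (higherBruhat_covBy_iff hn hw).symm)
    simp only [Equiv.trans_apply, Equiv.apply_symm_apply]
    exact Iff.rfl

theorem hasseDigraphIso_admClass (hn : 0 < n) (hw : IsAffinePerm n w) (a : ReducedWord n w) :
    hasseDigraphIso hn hw (admClass (admEquiv hn hw (reflOrderEquiv hn hw a))) = wordClass a := by
  refine (Equiv.symm_apply_eq (wordClassEquiv hn hw)).mpr (Subtype.ext ?_)
  obtain ⟨h1, h2⟩ := (isReducedWord_iff hn hw).mp a.2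
  have := h1.rev_eq (isReflOrderOf_reflOrderEquiv hn hw a)
  rw [h2] at this
  exact this

theorem wordClassEquiv_adj (hn : 0 < n) (hw : IsAffinePerm n w) {c d : WordClass n w}
    (h : (braidGraph n w).toSimpleGraphInclusive.Adj c d) :
    (wordClassEquiv hn hw c).1.ncard ≤ (wordClassEquiv hn hw d).1.ncard + 1 := by
  have hfin := finite_invSet_three hn hw.per
  obtain ⟨-, h | h⟩ := h
  all_goals
    obtain ⟨X, h1, h2⟩ := (braidGraph_adj_iff hn hw).mp h
    rw [h2, Set.ncard_insert_of_notMem h1 (hfin.subset (wordClassEquiv hn hw _).2.subset)]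
    try omega

theorem ncard_le_of_walk (hn : 0 < n) (hw : IsAffinePerm n w) {c d : WordClass n w}
    (p : (braidGraph n w).toSimpleGraphInclusive.Walk c d) :
    (wordClassEquiv hn hw c).1.ncard ≤ (wordClassEquiv hn hw d).1.ncard + p.length := by
  induction p with
  | nil => exact le_rfl
  | cons h p ih =>
    have := wordClassEquiv_adj hn hw h
    rw [SimpleGraph.Walk.length_cons]
    omega

theorem exists_walk_of_le (hn : 0 < n) (hw : IsAffinePerm n w) {R S : Consistent n w 3}
    (h : R ≤ S) : ∃ p : (braidGraph n w).toSimpleGraphInclusive.Walk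
      ((wordClassEquiv hn hw).symm R) ((wordClassEquiv hn hw).symm S),
      p.length + R.1.ncard = S.1.ncard := by
  have hfin := finite_invSet_three hn hw.per
  change Relation.ReflTransGen _ R S at h
  induction h with
  | refl => exact ⟨.nil, by simp⟩
  | @tail S T _ h ih =>
    obtain ⟨X, h1, h2⟩ := h
    obtain ⟨p, hp⟩ := ih
    have hadj : (braidGraph n w).Adj ((wordClassEquiv hn hw).symm S)
        ((wordClassEquiv hn hw).symm T) := by
      rw [braidGraph_adj_iff hn hw]
      simp only [Equiv.apply_symm_apply]
      exact ⟨X, h1, h2⟩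
    have hne : (wordClassEquiv hn hw).symm S ≠ (wordClassEquiv hn hw).symm T := fun he => h1 (by
      rw [(wordClassEquiv hn hw).symm.injective he, h2]
      exact Set.mem_insert X _)
    have hadj' : (braidGraph n w).toSimpleGraphInclusive.Adj ((wordClassEquiv hn hw).symm S)
        ((wordClassEquiv hn hw).symm T) := ⟨hne, .inl hadj⟩
    refine ⟨p.concat hadj', ?_⟩
    rw [SimpleGraph.Walk.length_concat, h2,
      Set.ncard_insert_of_notMem h1 (hfin.subset S.2.subset)]
    omega

/-- Each edge changes the cardinality of the reversal set by one, so the minimum and the maximum are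
at least `|Inv_3(w)|` apart. Chains through one of these two elements join any two classes within
that distance. -/
theorem ediam_braidGraph (hn : 0 < n) (hw : IsAffinePerm n w) :
    (braidGraph n w).toSimpleGraphInclusive.ediam = (InvSet n w 3).encard := by
  have hfin := finite_invSet_three hn hw.per
  obtain ⟨B, hB, hbot⟩ := Consistent.exists_isBot hn hw
  obtain ⟨T, hT, htop⟩ := Consistent.exists_isTop hn hw
  rw [← hfin.cast_ncard_eq]
  apply le_antisymm
  · refine SimpleGraph.ediam_le_of_edist_le fun c d => ?_
    obtain ⟨R, rfl⟩ := (wordClassEquiv hn hw).symm.surjective c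
    obtain ⟨S, rfl⟩ := (wordClassEquiv hn hw).symm.surjective d
    obtain ⟨p₁, h1⟩ := exists_walk_of_le hn hw (hbot R)
    obtain ⟨p₂, h2⟩ := exists_walk_of_le hn hw (hbot S)
    obtain ⟨q₁, h3⟩ := exists_walk_of_le hn hw (htop R)
    obtain ⟨q₂, h4⟩ := exists_walk_of_le hn hw (htop S)
    rw [hB, Set.ncard_empty] at h1 h2
    rw [hT] at h3 h4
    -- The route through the minimum and the route through the maximum have total length twice the
    -- number of `3`-inversions, so the shorter one suffices.
    by_cases hle : R.1.ncard + S.1.ncard ≤ (InvSet n w 3).ncard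
    · refine (p₁.reverse.append p₂).edist_le.trans ?_
      rw [SimpleGraph.Walk.length_append, SimpleGraph.Walk.length_reverse]
      exact_mod_cast (by omega)
    · refine (q₁.append q₂.reverse).edist_le.trans ?_
      rw [SimpleGraph.Walk.length_append, SimpleGraph.Walk.length_reverse]
      exact_mod_cast (by omega)
  · refine le_trans ?_ (SimpleGraph.edist_le_ediam (u := (wordClassEquiv hn hw).symm T)
      (v := (wordClassEquiv hn hw).symm B))
    refine le_iInf fun p => ?_
    have := ncard_le_of_walk hn hw p
    simp only [Equiv.apply_symm_apply] at this
    rw [hT, hB, Set.ncard_empty] at this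
    exact_mod_cast (by omega)

end

end AffineBruhat

/-! ### Assembly of the three assertions -/

theorem mainTheorem1 (n : ℕ) (hn : 0 < n) (w : Equiv.Perm ℤ) (hw : IsAffinePerm n w) :
    -- the bijections between maximal chains, reduced words, reflection orders, admissible orders
    (∃ (α : Flag (Consistent n w 2) ≃ ReducedWord n w)
        (β : ReducedWord n w ≃ ReflOrder n w)
        (γ : ReflOrder n w ≃ Adm n w 2),
      (∀ a, IsReflOrderOf n a.1 (β a).1) ∧
      (∀ ρ, (γ ρ).1 = ρ.1) ∧
      (∀ (c : Flag (Consistent n w 2)) (R : Consistent n w 2),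
        R ∈ c ↔ ∃ j : ℕ, R.1 = {X | X ∈ (γ (β (α c))).1.take j}) ∧
      -- the Hasse diagram of the second higher Bruhat order is the directed braid graph
      ∃ Ψ : (hasseDigraph (HigherBruhat n w 2)).Adj ≃r (braidGraph n w).Adj,
        ∀ a : ReducedWord n w, Ψ (admClass (γ (β a))) = wordClass a) ∧
    -- `B_w(n,2)` is a poset, isomorphic to `C_w(n,3)` by the reversal set map
    (∀ b c : HigherBruhat n w 2, b ≤ c → c ≤ b → b = c) ∧
    (∃ Φ : HigherBruhat n w 2 ≃o Consistent n w 3,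
      (∀ ρ : Adm n w 2, (Φ (admClass ρ)).1 = Rev n w ρ.1) ∧
      -- it is ranked by the cardinality of the reversal set
      (∃ g : GradeMinOrder ℕ (HigherBruhat n w 2), ∀ b, g.grade b = (Φ b).1.ncard) ∧
      (∃ g : GradeMinOrder ℕ (Consistent n w 3), ∀ R, g.grade R = R.1.ncard) ∧
      -- with unique minimal element and unique maximal element
      (∃ b t : HigherBruhat n w 2,
        (Φ b).1 = ∅ ∧ IsBot b ∧ (∀ x, IsMin x ↔ x = b) ∧
        (Φ t).1 = InvSet n w 3 ∧ IsTop t ∧ (∀ x, IsMax x ↔ x = t))) ∧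
    -- the undirected diameter of the directed braid graph is the number of `3`-inversions
    (InvSet n w 3).Finite ∧
    (braidGraph n w).toSimpleGraphInclusive.ediam = (InvSet n w 3).encard := by
  refine ⟨⟨(Equiv.ofBijective _ (ReducedWord.flag_bijective hn hw)).symm, reflOrderEquiv hn hw,
      admEquiv hn hw, isReflOrderOf_reflOrderEquiv hn hw, fun _ => rfl, fun c R => ?_,
      hasseDigraphIso hn hw, hasseDigraphIso_admClass hn hw⟩,
    fun _ _ => higherBruhat_antisymm hn hw,
    ⟨higherBruhatIso hn hw, higherBruhatEquiv_admClass hn hw,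
      ⟨higherBruhatGradeMinOrder hn hw, fun _ => rfl⟩,
      ⟨consistentGradeMinOrder hn hw, fun _ => rfl⟩, ?_⟩,
    finite_invSet_three hn hw.per, ediam_braidGraph hn hw⟩
  · obtain ⟨a, rfl⟩ := (Equiv.ofBijective _ (ReducedWord.flag_bijective hn hw)).surjective c
    rw [Equiv.symm_apply_apply]
    exact a.mem_flag hn hw
  · obtain ⟨b, h1, h2, h3⟩ := higherBruhat_exists_isBot hn hw
    obtain ⟨t, h4, h5, h6⟩ := higherBruhat_exists_isTop hn hw
    exact ⟨b, t, h1, h2, h3, h4, h5, h6⟩
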